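/- Let $(M,g)$ be a complete, non-compact (connected, smooth) Riemannian manifold with Riemannian measure $\mu$, fix $x_0\in M$, and put $r(x)=\mathrm{dist}(x_0,x)$, $B_R=\{r<R\}$, $S=M\times(0,\infty)$. Let $p>1$, $m\ge 1$, $q>\max(p+m-2,1)$, let $f:[0,\infty)\to\mathbb R$ be Borel measurable with $0\le f\le K$ for some $K>0$, let $a\in\mathrm{Lip}_{\mathrm{loc}}(M)$ with $a>0$ a.e., and put $\mu_a=a\mu$. Let $V\in L^1_{\mathrm{loc}}(S)$. A function $u$ on $S$ is a *global nonnegative weak solution* of $$\partial_t u\ \ge\ \frac1{a}\,\mathrm{div}\Big(a\,u^{m-1}|\nabla u|^{p-2}f(|\nabla u|)\nabla u\Big)+V\,u^q\quad\text{in } M\times(0,\infty)\qquad(*)$$ if $u\ge0$ a.e., $u\in W^{1,1}_{\mathrm{loc}}(S)$ (that is, $u$ has weak derivatives $\nabla u$, $\partial_tu$, and $u,|\nabla u|,\partial_t u\in L^1_{\mathrm{loc}}(S;d\mu\,dt)$), $u\in L^q_{\mathrm{loc}}(S;V\,d\mu_a\,dt)$, $u^{p+m-1}$ and $u\,\partial_tu$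 belong to $L^1_{\mathrm{loc}}(S;d\mu_a\,dt)$, $|\nabla u|^pu^{m-1}\in L^1_{\mathrm{loc}}(S;d\mu\,dt)$, and for every nonnegative $\psi\in\mathrm{Lip}_{\mathrm{loc}}(S)$ with compact support in $S$ $$\int_0^\infty\!\!\int_M\psi\,u^qV\,d\mu_a\,dt\le\int_0^\infty\!\!\int_M\langle\nabla\psi,\nabla u\rangle u^{m-1}|\nabla u|^{p-2}f(|\nabla u|)\,d\mu_a\,dt-\int_0^\infty\!\!\int_M(\partial_t\psi)\,u\,d\mu_a\,dt .$$ (Where $a$ is positive, local integrability with respect to $d\mu\,dt$ and to $d\mu_a\,dt$ is the same.) Suppose that $V(x,t)\ge h(x)$ for a.e. $(x,t)\in S$, for some measurable $h:M\to\mathbb R$, and that there are constants $C>0$ and $\alpha,\sigma_1,\sigma_2\ge0$ such that $$C^{-1}(1+r(x))^{-\alpha}\le h(x)\le C(1+r(x))^{\alpha}\quad\text{for a.e. }x\in M$$ and, for all sufficiently large $R$, $$\int_{B_R}h^{-\frac1{q-1}}\,d\mu_a\le C R^{\sigma_1}(\log R)^{\frac1{q-1}},\qquad \int_{B_R}h^{-\frac{p+m-2}{q-p-m+2}}\,d\mu_a\le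 C R^{\sigma_2}(\log R)^{\frac{p+m-2}{q-p-m+2}} .$$ If $$0\le\sigma_2<\frac{pq}{q-p-m+2}\qquad\text{and}\qquad \sigma_1\le\frac1{q-1}\Big(\frac{pq}{q-p-m+2}-\sigma_2\Big),$$ then no global nonnegative, nontrivial weak solution of $(*)$ exists: every global nonnegative weak solution $u$ satisfies $u=0$ a.e. in $M\times(0,\infty)$. -/

import Mathlib

open MeasureTheory Set Filter Bundle
open scoped Manifold ContDiff ENNReal Topology

noncomputable section

namespace RiemParabolic

section Geometry

variable {n : ℕ} {M : Type*} [TopologicalSpace M] [ChartedSpace (EuclideanSpace ℝ (Fin n)) M]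

/-- The coordinate vector `∂/∂yᵢ` of the chart around `c`, at the point with coordinates `y`. -/
def coordVec (c : M) (i : Fin n) (y : EuclideanSpace ℝ (Fin n)) :
    TangentSpace (𝓡 n) ((extChartAt (𝓡 n) c).symm y) :=
  mfderiv 𝓘(ℝ, EuclideanSpace ℝ (Fin n)) (𝓡 n) (extChartAt (𝓡 n) c).symm y
    (EuclideanSpace.single i (1 : ℝ))

variable [RiemannianBundle (fun x : M ↦ TangentSpace (𝓡 n) x)]

/-- The density `√(det gᵢⱼ)` of the Riemannian measure in the coordinates around `c`. -/
def volDensity (c : M) (y : EuclideanSpace ℝ (Fin n)) : ℝ :=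
  Real.sqrt (Matrix.det (Matrix.of fun i j : Fin n ↦
    inner ℝ (coordVec (n := n) c i y) (coordVec (n := n) c j y)))

variable [MeasurableSpace M]

variable (n) in
/-- The Riemannian measure of the chart domain around `c`, extended by zero to `M`:
the image under the inverse chart of `√(det gᵢⱼ) dy`. -/
def chartVolume (c : M) : Measure M :=
  Measure.map (extChartAt (𝓡 n) c).symm
    ((volume.restrict (extChartAt (𝓡 n) c).target).withDensity
      fun y ↦ ENNReal.ofReal (volDensity c y))

variable (n M) in
/-- The Riemannian measure `μ` of `M`. The measures `chartVolume n c` agree on overlaps of chart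
domains; their supremum is the measure that restricts to each of them on its chart domain. -/
def riemVolume : Measure M := ⨆ c : M, chartVolume n c

variable (n) in
/-- The weighted measure `μ_a = a μ`. -/
def weightedVolume (a : M → ℝ) : Measure M :=
  (riemVolume n M).withDensity fun x ↦ ENNReal.ofReal (a x)

end Geometry

/-- The space-time domain `S = M × (0, ∞)`. -/
def spaceTime (M : Type*) : Set (M × ℝ) := univ ×ˢ Ioi (0 : ℝ)

section Solutions

variable {n : ℕ} {M : Type*} [MetricSpace M] [ChartedSpace (EuclideanSpace ℝ (Fin n)) M]
  [RiemannianBundle (fun x : M ↦ TangentSpace (𝓡 n) x)] [MeasurableSpace M]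

/-- `u ∈ W^{1,1}_loc(M × (0, ∞))` with spatial weak gradient `X` and weak time derivative `w`.
The weak derivatives are tested in charts: the coordinate function `u (φ⁻¹ y, t)` has the
distributional derivative `∂u/∂yᵢ = ⟨X, ∂/∂yᵢ⟩` in the direction `yᵢ` and `w` in the
direction `t`. -/
structure HasWeakDerivs (u : M × ℝ → ℝ) (X : ∀ x : M, ℝ → TangentSpace (𝓡 n) x)
    (w : M × ℝ → ℝ) : Prop where
  locInt : LocallyIntegrableOn u (spaceTime M) ((riemVolume n M).prod volume)
  locInt_time : LocallyIntegrableOn w (spaceTime M) ((riemVolume n M).prod volume)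
  locInt_grad : ∀ (c : M) (i : Fin n), LocallyIntegrableOn
    (fun z : EuclideanSpace ℝ (Fin n) × ℝ ↦
      inner ℝ (X ((extChartAt (𝓡 n) c).symm z.1) z.2) (coordVec c i z.1))
    ((extChartAt (𝓡 n) c).target ×ˢ Ioi (0 : ℝ)) volume
  grad : ∀ (c : M) (i : Fin n) (ζ : EuclideanSpace ℝ (Fin n) × ℝ → ℝ),
    ContDiff ℝ ∞ ζ → HasCompactSupport ζ →
    tsupport ζ ⊆ (extChartAt (𝓡 n) c).target ×ˢ Ioi (0 : ℝ) →
    ∫ z in (extChartAt (𝓡 n) c).target ×ˢ Ioi (0 : ℝ),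
        u ((extChartAt (𝓡 n) c).symm z.1, z.2)
          * fderiv ℝ ζ z (EuclideanSpace.single i (1 : ℝ), 0)
      = - ∫ z in (extChartAt (𝓡 n) c).target ×ˢ Ioi (0 : ℝ),
        inner ℝ (X ((extChartAt (𝓡 n) c).symm z.1) z.2) (coordVec c i z.1) * ζ z
  time : ∀ (c : M) (ζ : EuclideanSpace ℝ (Fin n) × ℝ → ℝ),
    ContDiff ℝ ∞ ζ → HasCompactSupport ζ →
    tsupport ζ ⊆ (extChartAt (𝓡 n) c).target ×ˢ Ioi (0 : ℝ) →
    ∫ z in (extChartAt (𝓡 n) c).target ×ˢ Ioi (0 : ℝ),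
        u ((extChartAt (𝓡 n) c).symm z.1, z.2) * fderiv ℝ ζ z (0, 1)
      = - ∫ z in (extChartAt (𝓡 n) c).target ×ˢ Ioi (0 : ℝ),
        w ((extChartAt (𝓡 n) c).symm z.1, z.2) * ζ z

/-- The derivative `dg_x(v)` of a real function `g` on `M`, that is `⟨∇g(x), v⟩`. -/
def dirDeriv (g : M → ℝ) (x : M) (v : TangentSpace (𝓡 n) x) : ℝ :=
  mfderiv (𝓡 n) 𝓘(ℝ, ℝ) g x v

/-- Test functions: nonnegative, locally Lipschitz, with compact support in `M × (0, ∞)`. -/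
structure IsTestFunction (ψ : M × ℝ → ℝ) : Prop where
  nonneg : ∀ z, 0 ≤ ψ z
  lip : LocallyLipschitz ψ
  compact : HasCompactSupport ψ
  supp : tsupport ψ ⊆ spaceTime M

variable (n) in
/-- Global nonnegative weak solutions of
`∂ₜ u ≥ (1/a) div (a u^(m-1) |∇u|^(p-2) f(|∇u|) ∇u) + V u^q` in `M × (0, ∞)`.
Here `X = ∇u` and `w = ∂ₜ u` are the (a.e. unique) weak derivatives of `u`. For a test function
`ψ`, which is differentiable almost everywhere, `⟨∇ψ, ∇u⟩` is the derivative of `ψ (·, t)`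
in the direction `∇u`. The energy `|∇u|^p u^(m-1)` is locally integrable for the Riemannian
measure itself; where `a` is positive this is the same as for `μ_a`. -/
def IsWeakSolution (p q m : ℝ) (f : ℝ → ℝ) (a : M → ℝ) (V u : M × ℝ → ℝ) : Prop :=
  (∀ᵐ z ∂(((riemVolume n M).prod volume).restrict (spaceTime M)), 0 ≤ u z) ∧
  ∃ (X : ∀ x : M, ℝ → TangentSpace (𝓡 n) x) (w : M × ℝ → ℝ),
    HasWeakDerivs u X w ∧
    LocallyIntegrableOn (fun z ↦ u z ^ q * V z) (spaceTime M)
      ((weightedVolume n a).prod volume) ∧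
    LocallyIntegrableOn (fun z ↦ u z ^ (p + m - 1)) (spaceTime M)
      ((weightedVolume n a).prod volume) ∧
    LocallyIntegrableOn (fun z ↦ ‖X z.1 z.2‖ ^ p * u z ^ (m - 1)) (spaceTime M)
      ((riemVolume n M).prod volume) ∧
    LocallyIntegrableOn (fun z ↦ u z * w z) (spaceTime M)
      ((weightedVolume n a).prod volume) ∧
    ∀ ψ : M × ℝ → ℝ, IsTestFunction ψ →
      ∫ z in spaceTime M, ψ z * u z ^ q * V z ∂((weightedVolume n a).prod volume)
        ≤ (∫ z in spaceTime M,
            dirDeriv (fun x ↦ ψ (x, z.2)) z.1 (X z.1 z.2)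
              * u z ^ (m - 1) * ‖X z.1 z.2‖ ^ (p - 2) * f ‖X z.1 z.2‖
            ∂((weightedVolume n a).prod volume))
          - ∫ z in spaceTime M, deriv (fun s ↦ ψ (z.1, s)) z.2 * u z
            ∂((weightedVolume n a).prod volume)

end Solutions

end RiemParabolic

end

/-! Write k = p + m - 2, let ζ be a cutoff, and put θ = pq/(q - k) - σ₂, which is positive by
assumption; the bound on σ₁ then reads σ₁ ≤ θ/(q - 1).

The inequality is tested with ζ (u + ε)^(-δ). The power is decreasing, so the term where the
gradient falls on it has the sign of -δ ζ u^(m-1) (u + ε)^(-δ-1) |∇u|^p, and by Young's inequality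
it absorbs the term with ∇ζ (`tested_gradient_le`). After ε → 0 this leaves, up to constants
(`lintegral_reaction_le`), ∫ ζ h u^(q-δ) ≤ δ^(1-p) ∫ |∇ζ|^p ζ^(1-p) u^(k-δ) + ∫ (-∂ₜζ)₊ u^(1-δ).
Hölder's inequality with weight h bounds each term on the right by a power less than one of ∫ ζ h
u^Q over the region where ζ is not constant, times an integral of the slopes of ζ against a power
close to h^(-k/(q-k)) or h^(-1/(q-1)).

The cutoff is a function of max(log r / j, log t / (θ j)). Its slopes have size 1/(jr) and 1/(θjt)
on the shells r ≈ e^i, t ≲ e^(θi) and t ≈ e^(θi), r ≲ e^i respectively, with j ≤ i ≤ 2j. By the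
choice of θ the volume growth cancels all exponentials, so about j shells contribute alike. What
remains is the factor j^(1-p) in the gradient term and a constant in the time term; the logarithms
allowed in the volume growth are exactly what this tolerates. With δ = 1/j the loss δ^(1-p) =
j^(p-1) is compensated. Shifting exponents by O(1/j) costs only a constant, because the slopes lie
above e^(-Nj) and h below e^(Nj) on the region concerned (`rpow_mul_rpow_neg_le`).

Hence Z_j = ∫ ζ_j h u^(q-1/j) satisfies Z_j ≤ D (W^Γ₁ + W^Γ₂), with D independent of j and W the
integral of ζ_j h u^Q over the outer region (`exists_lintegral_cutoff_le`). With Q = q - 1/j one has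
W ≤ Z_j, so Z_j is bounded and h u^q is integrable by Fatou. With Q = q the integral W is a tail of
a convergent integral, so Z_j → 0 and u = 0 (`ae_eq_zero_of_sublinear_bound`).

Testing with ζ F(u) needs justification, since only Lipschitz test functions are admitted and only
the degenerate energy |∇u|^p u^(m-1) is controlled. In a chart F(u) is mollified in space and then
in time, and the time scale is removed first. For the spatial scale, s^β |s - r| ≤ |s^(1+β) -
r^(1+β)| with β = (m-1)/p turns difference quotients of u^(1+β) into a uniform weighted L^p bound
for the mollified gradients (`exists_bound_spGrad`). Almost everywhere convergence and Vitali's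
theorem then give `test_comp`. A Lipschitz partition of unity carries the inequality to the manifold
(`testedInequality`). The geometry used is that closed balls are compact, that charts are locally
bi-Lipschitz for the Riemannian distance, and that the Riemannian measure has the expected density
in each chart. -/

set_option linter.unusedSectionVars false

noncomputable section

namespace RiemParabolic

/-! ### L¹ and almost everywhere convergence of mollifications. -/

section Mollification

open ContinuousLinearMap

variable {G : Type*} [NormedAddCommGroup G] [NormedSpace ℝ G] [FiniteDimensional ℝ G]

/-- A sequence of bump functions at the origin, scaled by `k + 1`. -/
def bumpSeq (G : Type*) [NormedAddCommGroup G] [NormedSpace ℝ G] [FiniteDimensional ℝ G] (k : ℕ) :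
    ContDiffBump (0 : G) where
  rIn := ((k : ℝ) + 1)⁻¹
  rOut := 2 * ((k : ℝ) + 1)⁻¹
  rIn_pos := by positivity
  rIn_lt_rOut := by
    have : 0 < ((k : ℝ) + 1)⁻¹ := by positivity
    linarith

theorem bumpSeq_rOut_tendsto : Tendsto (fun k ↦ (bumpSeq G k).rOut) atTop (𝓝 0) := by
  have h : Tendsto (fun k : ℕ ↦ 2 * ((k : ℝ) + 1)⁻¹) atTop (𝓝 (2 * 0)) :=
    (tendsto_inv_atTop_zero.comp
      (tendsto_atTop_add_const_right _ _ tendsto_natCast_atTop_atTop)).const_mul 2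
  simpa [bumpSeq] using h

theorem bumpSeq_apply (k : ℕ) (x : G) : bumpSeq G k x = bumpSeq G 0 (((k : ℝ) + 1) • x) := by
  have h1 : (2 : ℝ) * ((k : ℝ) + 1)⁻¹ / ((k : ℝ) + 1)⁻¹ = 2 := by field_simp
  simp [ContDiffBump.apply, bumpSeq, h1]

variable [MeasurableSpace G] [BorelSpace G] (μ : Measure G) [μ.IsAddHaarMeasure]

/-- This is Lebesgue differentiation; the fixed ratio 2 between the outer and inner radii of the
bumps keeps the kernels comparable with averages over balls. -/
theorem ae_tendsto_bumpSeq_convolution {f : G → ℝ} (hf : LocallyIntegrable f μ) :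
    ∀ᵐ x ∂μ, Tendsto (fun k ↦ (convolution ((bumpSeq G k).normed μ) f (lsmul ℝ ℝ) μ) x) atTop
      (𝓝 (f x)) :=
  ContDiffBump.ae_convolution_tendsto_right_of_locallyIntegrable (K := 2) bumpSeq_rOut_tendsto
    (Eventually.of_forall fun k ↦ by simp [bumpSeq]) hf

theorem integrable_bumpSeq_convolution {f : G → ℝ} (hf : Integrable f μ) (k : ℕ) :
    Integrable (convolution ((bumpSeq G k).normed μ) f (lsmul ℝ ℝ) μ) μ :=
  ((bumpSeq G k).integrable_normed).integrable_convolution _ hf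

/-- Scheffé's argument: mollification preserves the integral, so ∫ |c_k - f| = 2 ∫ (f - c_k)₊, and
(f - c_k)₊ ≤ f admits dominated convergence. -/
theorem tendsto_integral_abs_bumpSeq_sub_of_nonneg {f : G → ℝ} (hf : Integrable f μ)
    (h0 : ∀ x, 0 ≤ f x) :
    Tendsto (fun k ↦ ∫ x, |(convolution ((bumpSeq G k).normed μ) f (lsmul ℝ ℝ) μ) x - f x| ∂μ)
      atTop (𝓝 0) := by
  set c := fun k ↦ convolution ((bumpSeq G k).normed μ) f (lsmul ℝ ℝ) μ with hc
  have hci : ∀ k, Integrable (c k) μ := integrable_bumpSeq_convolution μ hf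
  have hc0 : ∀ k x, 0 ≤ c k x := fun k x ↦ by
    simp only [hc, convolution_def, lsmul_apply, smul_eq_mul]
    exact integral_nonneg fun y ↦ mul_nonneg ((bumpSeq G k).nonneg_normed y) (h0 _)
  have hint : ∀ k, ∫ x, c k x ∂μ = ∫ x, f x ∂μ := fun k ↦ by
    rw [hc]
    simp only
    rw [integral_convolution _ (bumpSeq G k).integrable_normed hf]
    simp [(bumpSeq G k).integral_normed]
  have hpos : Tendsto (fun k ↦ ∫ x, max (f x - c k x) 0 ∂μ) atTop (𝓝 (∫ x, (0 : ℝ) ∂μ)) := by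
    refine tendsto_integral_of_dominated_convergence f (fun k ↦ ?_) hf (fun k ↦ ?_) ?_
    · exact ((hf.sub (hci k)).pos_part).aestronglyMeasurable
    · refine Eventually.of_forall fun x ↦ ?_
      rw [Real.norm_of_nonneg (le_max_right _ _)]
      exact max_le (by linarith [hc0 k x]) (h0 x)
    · filter_upwards [ae_tendsto_bumpSeq_convolution μ hf.locallyIntegrable] with x hx
      have : Tendsto (fun k ↦ max (f x - c k x) 0) atTop (𝓝 (max (f x - f x) 0)) :=
        (tendsto_const_nhds.sub hx).max tendsto_const_nhds
      simpa using this
  have heq : ∀ k, ∫ x, |c k x - f x| ∂μ = 2 * ∫ x, max (f x - c k x) 0 ∂μ := fun k ↦ by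
    have : ∀ x, |c k x - f x| = 2 * max (f x - c k x) 0 + (c k x - f x) := fun x ↦ by
      rcases le_total (f x) (c k x) with h | h
      · rw [abs_of_nonneg (by linarith), max_eq_right (by linarith)]; ring
      · rw [abs_of_nonpos (by linarith), max_eq_left (by linarith)]; ring
    have i1 : Integrable (fun x ↦ 2 * max (f x - c k x) 0) μ :=
      ((hf.sub (hci k)).pos_part).const_mul 2
    have i2 : Integrable (fun x ↦ c k x - f x) μ := (hci k).sub hf
    simp_rw [this]
    rw [integral_add i1 i2, integral_sub (hci k) hf, hint, integral_const_mul]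
    ring
  have h2 := hpos.const_mul 2
  simp only [integral_zero, mul_zero] at h2
  exact h2.congr fun k ↦ (heq k).symm

theorem tendsto_integral_abs_bumpSeq_sub {f : G → ℝ} (hf : Integrable f μ) :
    Tendsto (fun k ↦ ∫ x, |(convolution ((bumpSeq G k).normed μ) f (lsmul ℝ ℝ) μ) x - f x| ∂μ)
      atTop (𝓝 0) := by
  have hp := tendsto_integral_abs_bumpSeq_sub_of_nonneg μ hf.pos_part (fun x ↦ le_max_right _ _)
  have hn := tendsto_integral_abs_bumpSeq_sub_of_nonneg μ hf.neg_part (fun x ↦ le_max_right _ _)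
  have hpn := hp.add hn
  rw [add_zero] at hpn
  refine squeeze_zero (fun k ↦ integral_nonneg fun x ↦ abs_nonneg _) (fun k ↦ ?_) hpn
  have hfe : f = fun x ↦ max (f x) 0 - max (-f x) 0 := by
    funext x
    rcases le_total 0 (f x) with h | h
    · rw [max_eq_left h, max_eq_right (by linarith)]; ring
    · rw [max_eq_right h, max_eq_left (by linarith)]; ring
  have hcs : ∀ g : G → ℝ, Integrable g μ → ∀ x, ConvolutionExistsAt ((bumpSeq G k).normed μ) g x
      (lsmul ℝ ℝ) μ := fun g hg x ↦
    (bumpSeq G k).hasCompactSupport_normed.convolutionExists_left _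
      ((bumpSeq G k).contDiff_normed (n := 0)).continuous hg.locallyIntegrable x
  have hconv : ∀ x, (convolution ((bumpSeq G k).normed μ) f (lsmul ℝ ℝ) μ) x =
      (convolution ((bumpSeq G k).normed μ) (fun x ↦ max (f x) 0) (lsmul ℝ ℝ) μ) x -
      (convolution ((bumpSeq G k).normed μ) (fun x ↦ max (-f x) 0) (lsmul ℝ ℝ) μ) x := fun x ↦ by
    conv_lhs => rw [hfe]
    simp only [convolution_def, map_sub]
    exact integral_sub (hcs _ hf.pos_part x) (hcs _ hf.neg_part x)
  have i1 := (integrable_bumpSeq_convolution μ hf.pos_part k).sub hf.pos_part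
  have i2 := (integrable_bumpSeq_convolution μ hf.neg_part k).sub hf.neg_part
  refine le_of_le_of_eq ?_ (integral_add i1.abs i2.abs)
  refine integral_mono ((integrable_bumpSeq_convolution μ hf k).sub hf).abs (i1.abs.add i2.abs)
    fun x ↦ ?_
  have h1 : f x = max (f x) 0 - max (-f x) 0 := congrFun hfe x
  have h2 : (convolution ((bumpSeq G k).normed μ) f (lsmul ℝ ℝ) μ) x - f x =
      ((convolution ((bumpSeq G k).normed μ) (fun x ↦ max (f x) 0) (lsmul ℝ ℝ) μ) x
      - max (f x) 0) - ((convolution ((bumpSeq G k).normed μ) (fun x ↦ max (-f x) 0)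
        (lsmul ℝ ℝ) μ) x - max (-f x) 0) := by rw [hconv x]; linarith
  exact (congrArg abs h2).trans_le (abs_sub _ _)

end Mollification

/-! ### Weak directional derivatives and the chain rule. -/

section WeakDerivative

open ContinuousLinearMap

variable {G : Type*} [NormedAddCommGroup G] [NormedSpace ℝ G] [FiniteDimensional ℝ G]
  [MeasurableSpace G] [BorelSpace G] (μ : Measure G) [μ.IsAddHaarMeasure]

/-- `U` has the weak derivative `Q` in the direction `e` on the set `O`. -/
structure HasWeakDirDeriv (O : Set G) (U Q : G → ℝ) (e : G) : Prop where
  locInt : LocallyIntegrableOn U O μ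
  locInt_deriv : LocallyIntegrableOn Q O μ
  integral_eq : ∀ ζ : G → ℝ, ContDiff ℝ ∞ ζ → HasCompactSupport ζ → tsupport ζ ⊆ O →
    ∫ z, U z * fderiv ℝ ζ z e ∂μ = -∫ z, Q z * ζ z ∂μ

variable {μ}

theorem integrable_mul_of_tsupport {O : Set G} {U g : G → ℝ} (hU : LocallyIntegrableOn U O μ)
    {B : ℝ} (hg : AEStronglyMeasurable g μ) (hgB : ∀ z, |g z| ≤ B) {K : Set G} (hK : IsCompact K)
    (hKO : K ⊆ O) (hgK : ∀ z ∉ K, g z = 0) : Integrable (fun z ↦ U z * g z) μ := by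
  have h1 : IntegrableOn U K μ := hU.integrableOn_compact_subset hKO hK
  have h2 : IntegrableOn (fun z ↦ U z * g z) K μ :=
    Integrable.mul_bdd (c := B) h1 hg.restrict (Eventually.of_forall hgB)
  refine (integrableOn_iff_integrable_of_support_subset ?_).1 h2
  intro z hz
  by_contra hzK
  exact hz (by simp [hgK z hzK])

theorem tendsto_integral_of_abs_sub_le {X : Type*} [MeasurableSpace X] {ν : Measure X}
    {a b : ℕ → X → ℝ} {a0 : X → ℝ}
    (ia : ∀ k, Integrable (a k) ν) (ia0 : Integrable a0 ν) (ib : ∀ k, Integrable (b k) ν)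
    (hb : Tendsto (fun k ↦ ∫ x, b k x ∂ν) atTop (𝓝 0)) (hab : ∀ k x, |a k x - a0 x| ≤ b k x) :
    Tendsto (fun k ↦ ∫ x, a k x ∂ν) atTop (𝓝 (∫ x, a0 x ∂ν)) := by
  rw [tendsto_iff_norm_sub_tendsto_zero]
  refine squeeze_zero (fun _ ↦ norm_nonneg _) (fun k ↦ ?_) hb
  rw [← integral_sub (ia k) ia0]
  exact norm_integral_le_of_norm_le (ib k) (Eventually.of_forall (hab k))

theorem exists_contDiff_one_on_compact {O K : Set G} (hO : IsOpen O) (hK : IsCompact K)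
    (hKO : K ⊆ O) : ∃ χ : G → ℝ, ContDiff ℝ ∞ χ ∧ HasCompactSupport χ ∧ tsupport χ ⊆ O ∧
      (∀ x ∈ K, χ =ᶠ[𝓝 x] 1) ∧ ∀ x, 0 ≤ χ x ∧ χ x ≤ 1 := by
  obtain ⟨L, hL, hKL, hLO⟩ := exists_compact_between hK hO hKO
  obtain ⟨f, hf, hf0, hf1⟩ := exists_contMDiffMap_one_nhds_of_subset_interior 𝓘(ℝ, G) (n := (⊤ : ℕ∞))
    hK.isClosed hKL
  have hts : tsupport f ⊆ L := closure_minimal (fun x hx ↦ by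
    by_contra h; exact hx (hf0 x h)) hL.isClosed
  exact ⟨f, f.contMDiff.contDiff, hL.of_isClosed_subset (isClosed_tsupport _) hts,
    hts.trans hLO, fun x hx ↦ (eventually_nhdsSet_iff_forall.1 hf) x hx, fun x ↦ hf1 x⟩

theorem tsupport_mul_subset_tsupport_left (f g : G → ℝ) :
    tsupport (fun x ↦ f x * g x) ⊆ tsupport f :=
  closure_mono fun _ hx ↦ left_ne_zero_of_mul hx

/-- The product rule for χU. The localised function and its derivative are globally integrable,
hence can be convolved, and `ζ` no longer needs compact support. -/
theorem HasWeakDirDeriv.integral_cutoff {O : Set G} {U Q : G → ℝ} {e : G}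
    (h : HasWeakDirDeriv μ O U Q e) {χ : G → ℝ} (hχ : ContDiff ℝ ∞ χ) (hχc : HasCompactSupport χ)
    (hχO : tsupport χ ⊆ O) {ζ : G → ℝ} (hζ : ContDiff ℝ ∞ ζ) :
    ∫ z, (χ z * U z) * fderiv ℝ ζ z e ∂μ
      = -∫ z, (χ z * Q z + fderiv ℝ χ z e * U z) * ζ z ∂μ := by
  have hts := tsupport_mul_subset_tsupport_left χ ζ
  have hd : ∀ z, fderiv ℝ (fun x ↦ χ x * ζ x) z e
      = χ z * fderiv ℝ ζ z e + ζ z * fderiv ℝ χ z e := fun z ↦ by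
    rw [fderiv_fun_mul (hχ.differentiable (by simp) z) (hζ.differentiable (by simp) z)]
    simp
  have hmain := h.integral_eq (fun x ↦ χ x * ζ x) (hχ.mul hζ)
    (hχc.of_isClosed_subset (isClosed_tsupport _) hts) (hts.trans hχO)
  simp_rw [hd] at hmain
  have hχ' : Continuous fun z ↦ fderiv ℝ χ z e :=
    (hχ.continuous_fderiv (by simp)).clm_apply continuous_const
  have hζ' : Continuous fun z ↦ fderiv ℝ ζ z e :=
    (hζ.continuous_fderiv (by simp)).clm_apply continuous_const
  have z1 : ∀ z ∉ tsupport χ, χ z = 0 := fun z hz ↦ image_eq_zero_of_notMem_tsupport hz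
  have z2 : ∀ z ∉ tsupport χ, fderiv ℝ χ z e = 0 := fun z hz ↦ by
    have : fderiv ℝ χ z = 0 := by
      by_contra h0; exact hz (tsupport_fderiv_subset ℝ (subset_closure h0))
    simp [this]
  have key : ∀ {V g : G → ℝ}, LocallyIntegrableOn V O μ → Continuous g →
      (∀ z ∉ tsupport χ, g z = 0) → Integrable (fun z ↦ V z * g z) μ := fun {V g} hV hg hz ↦ by
    obtain ⟨B, hB⟩ := (HasCompactSupport.intro hχc hz).exists_bound_of_continuous hg
    exact integrable_mul_of_tsupport hV hg.aestronglyMeasurable hB hχc hχO hz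
  have i1 : Integrable (fun z ↦ U z * (χ z * fderiv ℝ ζ z e)) μ :=
    key h.locInt (hχ.continuous.mul hζ') fun z hz ↦ by simp [z1 z hz]
  have i2 : Integrable (fun z ↦ U z * (ζ z * fderiv ℝ χ z e)) μ :=
    key h.locInt (hζ.continuous.mul hχ') fun z hz ↦ by simp [z2 z hz]
  have i3 : Integrable (fun z ↦ Q z * (χ z * ζ z)) μ :=
    key h.locInt_deriv (hχ.continuous.mul hζ.continuous) fun z hz ↦ by simp [z1 z hz]
  simp_rw [mul_add] at hmain
  rw [integral_add i1 i2] at hmain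
  calc ∫ z, (χ z * U z) * fderiv ℝ ζ z e ∂μ = ∫ z, U z * (χ z * fderiv ℝ ζ z e) ∂μ :=
        integral_congr_ae (Eventually.of_forall fun z ↦ by ring)
    _ = -(∫ z, Q z * (χ z * ζ z) ∂μ + ∫ z, U z * (ζ z * fderiv ℝ χ z e) ∂μ) := by linarith
    _ = _ := by
        rw [← integral_add i3 i2]
        exact congrArg _ (integral_congr_ae (Eventually.of_forall fun z ↦ by ring))

/-- Chain rule for weak derivatives, tested with Lipschitz functions. -/
theorem HasWeakDirDeriv.integral_comp_mul_lineDeriv {O : Set G} (hO : IsOpen O) {U Q : G → ℝ}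
    {e : G} (h : HasWeakDirDeriv μ O U Q e) {F F' : ℝ → ℝ} (hF : ∀ s, HasDerivAt F (F' s) s)
    (hF' : Continuous F') {B : ℝ} (hB : ∀ s, |F' s| ≤ B) {C : NNReal} {g : G → ℝ}
    (hg : LipschitzWith C g) (hgc : HasCompactSupport g) (hgO : tsupport g ⊆ O) :
    ∫ z, F (U z) * lineDeriv ℝ g z e ∂μ = -∫ z, F' (U z) * Q z * g z ∂μ := by
  obtain ⟨χ, hχ, hχc, hχO, hχ1, hχ01⟩ := exists_contDiff_one_on_compact hO hgc hgO
  set U1 : G → ℝ := fun z ↦ χ z * U z with hU1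
  set Q1 : G → ℝ := fun z ↦ χ z * Q z + fderiv ℝ χ z e * U z with hQ1
  have hχ' : Continuous fun z ↦ fderiv ℝ χ z e :=
    (hχ.continuous_fderiv (by simp)).clm_apply continuous_const
  have z1 : ∀ z ∉ tsupport χ, χ z = 0 := fun z hz ↦ image_eq_zero_of_notMem_tsupport hz
  have z2 : ∀ z ∉ tsupport χ, fderiv ℝ χ z e = 0 := fun z hz ↦ by
    have : fderiv ℝ χ z = 0 := by
      by_contra h0; exact hz (tsupport_fderiv_subset ℝ (subset_closure h0))
    simp [this]
  have key : ∀ {V g : G → ℝ}, LocallyIntegrableOn V O μ → Continuous g →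
      (∀ z ∉ tsupport χ, g z = 0) → Integrable (fun z ↦ g z * V z) μ := fun {V g} hV hg hz ↦ by
    obtain ⟨B, hB⟩ := (HasCompactSupport.intro hχc hz).exists_bound_of_continuous hg
    simpa only [mul_comm] using
      integrable_mul_of_tsupport hV hg.aestronglyMeasurable hB hχc hχO hz
  have iU1 : Integrable U1 μ := key h.locInt hχ.continuous z1
  have iQ1 : Integrable Q1 μ := (key h.locInt_deriv hχ.continuous z1).add (key h.locInt hχ' z2)
  have hmeas : Measurable F' := hF'.measurable
  have hFc : Continuous F := continuous_iff_continuousAt.2 fun s ↦ (hF s).continuousAt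
  have hB0 : 0 ≤ B := (abs_nonneg _).trans (hB 0)
  have hFL : LipschitzWith B.toNNReal F := lipschitzWith_of_nnnorm_deriv_le
    (fun s ↦ (hF s).differentiableAt) fun s ↦ by
      rw [(hF s).deriv, ← NNReal.coe_le_coe, coe_nnnorm, Real.coe_toNNReal _ hB0]; exact hB s
  have hFLd : ∀ s r, |F s - F r| ≤ B * |s - r| := fun s r ↦ by
    have := hFL.dist_le_mul s r
    rwa [Real.coe_toNNReal _ hB0, Real.dist_eq, Real.dist_eq] at this
  -- mollification
  set c : ℕ → G → ℝ := fun k ↦ convolution ((bumpSeq G k).normed μ) U1 (lsmul ℝ ℝ) μ with hc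
  set d : ℕ → G → ℝ := fun k ↦ convolution ((bumpSeq G k).normed μ) Q1 (lsmul ℝ ℝ) μ with hd
  have hcsm : ∀ k, ContDiff ℝ ∞ (c k) := fun k ↦
    (bumpSeq G k).hasCompactSupport_normed.contDiff_convolution_left _
      (bumpSeq G k).contDiff_normed iU1.locallyIntegrable
  have hccs : ∀ k, HasCompactSupport (c k) := fun k ↦
    (bumpSeq G k).hasCompactSupport_normed.convolution _
      (hχc.mul_right : HasCompactSupport U1)
  -- Mollification commutes with the weak derivative: the cutoff identity is applied to the
  -- reflected kernel y ↦ ρ(z - y), whose derivative carries the opposite sign.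
  have hcd : ∀ k z, fderiv ℝ (c k) z e = d k z := fun k z ↦ by
    have h1 := (bumpSeq G k).hasCompactSupport_normed.hasFDerivAt_convolution_left
      (lsmul ℝ ℝ) ((bumpSeq G k).contDiff_normed (μ := μ)) iU1.locallyIntegrable z
    rw [h1.fderiv]
    have hcf : HasCompactSupport (fderiv ℝ ((bumpSeq G k).normed μ)) :=
      (bumpSeq G k).hasCompactSupport_normed.fderiv ℝ
    have hcont : Continuous (fderiv ℝ ((bumpSeq G k).normed μ)) :=
      (bumpSeq G k).contDiff_normed.continuous_fderiv (n := ∞) (by simp)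
    rw [convolution_eq_swap, ContinuousLinearMap.integral_apply]
    · have := h.integral_cutoff hχ hχc hχO (ζ := fun y ↦ (bumpSeq G k).normed μ (z - y))
        ((bumpSeq G k).contDiff_normed.comp (contDiff_const.sub contDiff_id))
      have hfd : ∀ y, fderiv ℝ (fun y ↦ (bumpSeq G k).normed μ (z - y)) y e
          = -fderiv ℝ ((bumpSeq G k).normed μ) (z - y) e := fun y ↦ by
        have h2 : HasFDerivAt ((bumpSeq G k).normed μ)
            (fderiv ℝ ((bumpSeq G k).normed μ) (z - y)) (z - y) :=
          ((bumpSeq G k).contDiff_normed.differentiable (n := ∞) (by simp) _).hasFDerivAt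
        have h3 := h2.comp y ((hasFDerivAt_id y).const_sub z)
        have h4 : fderiv ℝ (fun y ↦ (bumpSeq G k).normed μ (z - y)) y = _ := h3.fderiv
        rw [h4]; simp
      simp_rw [hfd, mul_neg, integral_neg, neg_inj] at this
      simp only [hd, convolution_eq_swap, lsmul_apply, smul_eq_mul, precompL_apply]
      rw [← integral_congr_ae (Eventually.of_forall fun y ↦ mul_comm _ _),
        this]
      exact integral_congr_ae (Eventually.of_forall fun y ↦ mul_comm _ _)
    · exact (hcf.convolutionExists_left _ hcont iU1.locallyIntegrable z).integrable_swap
  -- For the smooth c_k the classical chain rule holds, and integration by parts against a compactly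
  -- supported Lipschitz function is available.
  have hk : ∀ k, ∫ z, F (c k z) * lineDeriv ℝ g z e ∂μ = -∫ z, F' (c k z) * d k z * g z ∂μ := by
    intro k
    obtain ⟨D, hD⟩ := (hcsm k).lipschitzWith_of_hasCompactSupport (hccs k) (by simp)
    have h1 := (hFL.comp hD).integral_lineDeriv_mul_eq (μ := μ) hg hgc e
    have h2 : ∀ z, lineDeriv ℝ (F ∘ c k) z e = F' (c k z) * d k z := fun z ↦ by
      have h3 := (hF (c k z)).hasFDerivAt.comp z
        ((hcsm k).differentiable (by simp) z).hasFDerivAt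
      rw [h3.differentiableAt.lineDeriv_eq_fderiv, h3.fderiv]
      simp [hcd, mul_comm]
    simp_rw [h2, lineDeriv_neg] at h1
    rw [h1]
    simp [integral_neg, mul_comm, Function.comp]
  have hld : Measurable fun z ↦ lineDeriv ℝ g z e := measurable_lineDeriv hg.continuous
  have hldB : ∀ z, |lineDeriv ℝ g z e| ≤ C * ‖e‖ := fun z ↦
    norm_lineDeriv_le_of_lipschitz ℝ hg
  have hldz : ∀ z ∉ tsupport g, lineDeriv ℝ g z e = 0 := fun z hz ↦ by
    have h0 : g =ᶠ[𝓝 z] fun _ ↦ 0 := notMem_tsupport_iff_eventuallyEq.1 hz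
    rw [h0.lineDeriv_eq]; simp [lineDeriv]
  have hgz : ∀ z ∉ tsupport g, g z = 0 := fun z hz ↦ image_eq_zero_of_notMem_tsupport hz
  obtain ⟨D, hD⟩ := hgc.exists_bound_of_continuous hg.continuous
  have hD0 : 0 ≤ D := (norm_nonneg _).trans (hD 0)
  have icint := fun k ↦ integrable_bumpSeq_convolution μ iU1 k
  have idint := fun k ↦ integrable_bumpSeq_convolution μ iQ1 k
  have hloc : ∀ {V : G → ℝ}, Integrable V μ →
      Integrable (fun z ↦ F (V z) * lineDeriv ℝ g z e) μ := fun {V} hV ↦ by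
    have h1 : LocallyIntegrableOn (fun z ↦ |F 0| + B * |V z|) univ μ :=
      ((locallyIntegrable_const _).add (hV.abs.const_mul B).locallyIntegrable).locallyIntegrableOn _
    refine (integrable_mul_of_tsupport h1 hld.aestronglyMeasurable hldB hgc (subset_univ _)
      hldz).mono ((hFc.comp_aestronglyMeasurable hV.aestronglyMeasurable).mul
        hld.aestronglyMeasurable) (Eventually.of_forall fun z ↦ ?_)
    rw [norm_mul, norm_mul]
    refine mul_le_mul_of_nonneg_right ?_ (norm_nonneg _)
    have h2 := hFLd (V z) 0
    rw [sub_zero] at h2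
    rw [Real.norm_eq_abs, Real.norm_eq_abs]
    calc |F (V z)| = |F 0 + (F (V z) - F 0)| := by ring_nf
      _ ≤ |F 0| + B * |V z| := (abs_add_le _ _).trans (by linarith)
      _ ≤ _ := le_abs_self _
  have hloc' : ∀ {V R : G → ℝ}, Integrable V μ → Integrable R μ →
      Integrable (fun z ↦ F' (V z) * R z * g z) μ := fun {V R} hV hR ↦ by
    have h1 : Integrable (fun z ↦ F' (V z) * R z) μ :=
      Integrable.bdd_mul (c := B) hR (hF'.comp_aestronglyMeasurable hV.aestronglyMeasurable)
        (Eventually.of_forall fun z ↦ hB _)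
    exact h1.mul_bdd (c := D) hg.continuous.aestronglyMeasurable (Eventually.of_forall hD)
  have L1 : Tendsto (fun k ↦ ∫ z, F (c k z) * lineDeriv ℝ g z e ∂μ) atTop
      (𝓝 (∫ z, F (U1 z) * lineDeriv ℝ g z e ∂μ)) := by
    refine tendsto_integral_of_abs_sub_le (b := fun k z ↦ (B * (C * ‖e‖)) * |c k z - U1 z|)
      (fun k ↦ hloc (icint k)) (hloc iU1) (fun k ↦ ((icint k).sub iU1).abs.const_mul _) ?_ ?_
    · simp_rw [integral_const_mul]
      simpa using (tendsto_integral_abs_bumpSeq_sub μ iU1).const_mul (B * (C * ‖e‖))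
    · intro k z
      rw [← sub_mul, abs_mul]
      calc _ ≤ (B * |c k z - U1 z|) * (C * ‖e‖) :=
            mul_le_mul (hFLd _ _) (hldB z) (abs_nonneg _) (by positivity)
        _ = _ := by ring
  -- The difference splits into F'(c)(d - Q₁), small because d → Q₁ in L¹ and F' is bounded, and
  -- (F'(c) - F'(U₁)) Q₁, small by dominated convergence because F' is continuous.
  have L2 : Tendsto (fun k ↦ ∫ z, F' (c k z) * d k z * g z ∂μ) atTop
      (𝓝 (∫ z, F' (U1 z) * Q1 z * g z ∂μ)) := by
    have iF : ∀ k, Integrable (fun z ↦ |F' (c k z) - F' (U1 z)| * |Q1 z|) μ := fun k ↦ by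
      refine Integrable.bdd_mul (c := B + B) iQ1.abs ?_ (Eventually.of_forall fun z ↦ ?_)
      · exact ((hF'.comp_aestronglyMeasurable (icint k).aestronglyMeasurable).sub
          (hF'.comp_aestronglyMeasurable iU1.aestronglyMeasurable)).norm
      · rw [Real.norm_eq_abs, abs_abs]
        exact (abs_sub _ _).trans (add_le_add (hB _) (hB _))
    have iD : ∀ k, Integrable (fun z ↦ |d k z - Q1 z|) μ := fun k ↦ ((idint k).sub iQ1).abs
    refine tendsto_integral_of_abs_sub_le
      (b := fun k z ↦ (B * D) * |d k z - Q1 z| + D * (|F' (c k z) - F' (U1 z)| * |Q1 z|))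
      (fun k ↦ hloc' (icint k) (idint k)) (hloc' iU1 iQ1)
      (fun k ↦ ((iD k).const_mul _).add ((iF k).const_mul _)) ?_ ?_
    · have : ∀ k, ∫ z, ((B * D) * |d k z - Q1 z|
          + D * (|F' (c k z) - F' (U1 z)| * |Q1 z|)) ∂μ = (B * D) * ∫ z, |d k z - Q1 z| ∂μ
          + D * ∫ z, |F' (c k z) - F' (U1 z)| * |Q1 z| ∂μ := fun k ↦ by
        rw [integral_add ((iD k).const_mul _) ((iF k).const_mul _), integral_const_mul,
          integral_const_mul]
      simp_rw [this]
      have t1 := (tendsto_integral_abs_bumpSeq_sub μ iQ1).const_mul (B * D)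
      have t2 : Tendsto (fun k ↦ ∫ z, |F' (c k z) - F' (U1 z)| * |Q1 z| ∂μ) atTop
          (𝓝 (∫ z, (0 : ℝ) ∂μ)) := by
        refine tendsto_integral_of_dominated_convergence (fun z ↦ (B + B) * |Q1 z|)
          (fun k ↦ (iF k).aestronglyMeasurable) (iQ1.abs.const_mul _)
          (fun k ↦ Eventually.of_forall fun z ↦ ?_) ?_
        · rw [norm_mul, Real.norm_eq_abs, Real.norm_eq_abs, abs_abs, abs_abs]
          exact mul_le_mul_of_nonneg_right ((abs_sub _ _).trans (add_le_add (hB _) (hB _)))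
            (abs_nonneg _)
        · filter_upwards [ae_tendsto_bumpSeq_convolution μ iU1.locallyIntegrable] with z hz
          have := (((hF'.tendsto _).comp hz).sub_const (F' (U1 z))).abs.mul_const |Q1 z|
          simpa using this
      rw [integral_zero] at t2
      simpa using t1.add (t2.const_mul D)
    · intro k z
      have : F' (c k z) * d k z * g z - F' (U1 z) * Q1 z * g z
          = F' (c k z) * (d k z - Q1 z) * g z + (F' (c k z) - F' (U1 z)) * Q1 z * g z := by ring
      rw [this]
      refine (abs_add_le _ _).trans (add_le_add ?_ ?_)
      · rw [abs_mul, abs_mul]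
        calc _ ≤ B * |d k z - Q1 z| * D := mul_le_mul (mul_le_mul_of_nonneg_right (hB _)
              (abs_nonneg _)) (hD z) (abs_nonneg _) (by positivity)
          _ = _ := by ring
      · rw [abs_mul, abs_mul, mul_comm D]
        exact mul_le_mul_of_nonneg_left (hD z) (by positivity)
  have hfin := tendsto_nhds_unique L1 (by simpa only [hk] using L2.neg)
  -- The cutoff is one near the support of g, so it disappears from both limits.
  have e1 : ∀ z, F (U z) * lineDeriv ℝ g z e = F (U1 z) * lineDeriv ℝ g z e := fun z ↦ by
    by_cases hz : z ∈ tsupport g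
    · simp [hU1, (hχ1 z hz).eq_of_nhds]
    · simp [hldz z hz]
  have e2 : ∀ z, F' (U z) * Q z * g z = F' (U1 z) * Q1 z * g z := fun z ↦ by
    by_cases hz : z ∈ tsupport g
    · have h0 : fderiv ℝ χ z = 0 := by
        rw [(hχ1 z hz).fderiv_eq]; exact fderiv_const_apply _
      simp [hU1, hQ1, (hχ1 z hz).eq_of_nhds, h0]
    · simp [hgz z hz]
  simp_rw [e1, e2]
  exact hfin

end WeakDerivative

/-! ### Increments of weakly differentiable functions along segments. -/

section Translation

variable {G : Type*} [NormedAddCommGroup G] [NormedSpace ℝ G] [FiniteDimensional ℝ G]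
  [MeasurableSpace G] [BorelSpace G] {μ : Measure G} [μ.IsAddHaarMeasure]

theorem abs_sub_le_of_hasDerivAt_bounded {F F' : ℝ → ℝ} (hF : ∀ s, HasDerivAt F (F' s) s)
    {B : ℝ} (hB : ∀ s, |F' s| ≤ B) (s r : ℝ) : |F s - F r| ≤ B * |s - r| :=
  Convex.norm_image_sub_le_of_norm_hasDerivWithin_le (fun x _ ↦ (hF x).hasDerivWithinAt)
    (fun x _ ↦ hB x) convex_univ (mem_univ r) (mem_univ s)

theorem _root_.MeasureTheory.LocallyIntegrableOn.bdd_mul_of_measurable {O : Set G} (hO : IsOpen O)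
    {Q : G → ℝ} (hQ : LocallyIntegrableOn Q O μ) {g : G → ℝ} (hg : Measurable g) {B : ℝ}
    (hB : ∀ z, |g z| ≤ B) : LocallyIntegrableOn (fun z ↦ g z * Q z) O μ := by
  rw [locallyIntegrableOn_iff hO.isLocallyClosed] at hQ ⊢
  exact fun K hK hKc ↦ Integrable.bdd_mul (c := B) (hQ K hK hKc) hg.aestronglyMeasurable
    (Eventually.of_forall hB)

theorem _root_.MeasureTheory.LocallyIntegrableOn.comp_of_hasDerivAt_bounded {O : Set G}
    {U : G → ℝ} (hU : LocallyIntegrableOn U O μ) (hUm : Measurable U)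
    {F F' : ℝ → ℝ} (hF : ∀ s, HasDerivAt F (F' s) s) {B : ℝ} (hB : ∀ s, |F' s| ≤ B) :
    LocallyIntegrableOn (fun z ↦ F (U z)) O μ := by
  have hFc : Continuous F := continuous_iff_continuousAt.2 fun s ↦ (hF s).continuousAt
  have h1 : LocallyIntegrableOn (fun z ↦ |F 0| + B * |U z|) O μ := by
    refine ((locallyIntegrable_const _).locallyIntegrableOn O).add ?_
    intro x hx
    obtain ⟨t, ht, hi⟩ := hU x hx
    exact ⟨t, ht, hi.abs.const_mul B⟩
  refine h1.mono (hFc.measurable.comp hUm).aestronglyMeasurable (Eventually.of_forall fun z ↦ ?_)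
  have h2 := abs_sub_le_of_hasDerivAt_bounded hF hB (U z) 0
  rw [sub_zero] at h2
  rw [Real.norm_eq_abs, Real.norm_eq_abs]
  calc |F (U z)| = |F 0 + (F (U z) - F 0)| := by ring_nf
    _ ≤ |F 0| + B * |U z| := (abs_add_le _ _).trans (by linarith)
    _ ≤ _ := le_abs_self _

theorem HasWeakDirDeriv.comp {O : Set G} (hO : IsOpen O) {U Q : G → ℝ}
    {e : G} (h : HasWeakDirDeriv μ O U Q e) (hUm : Measurable U)
    {F F' : ℝ → ℝ} (hF : ∀ s, HasDerivAt F (F' s) s)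
    (hF' : Continuous F') {B : ℝ} (hB : ∀ s, |F' s| ≤ B) :
    HasWeakDirDeriv μ O (fun z ↦ F (U z)) (fun z ↦ F' (U z) * Q z) e := by
  refine ⟨h.locInt.comp_of_hasDerivAt_bounded hUm hF hB,
    h.locInt_deriv.bdd_mul_of_measurable hO (hF'.measurable.comp hUm) fun z ↦ hB _, ?_⟩
  intro ζ hζ hζc hζO
  obtain ⟨C, hC⟩ := hζ.lipschitzWith_of_hasCompactSupport hζc (by simp)
  have := h.integral_comp_mul_lineDeriv hO hF hF' hB hC hζc hζO
  simpa only [(hζ.differentiable (by simp) _).lineDeriv_eq_fderiv] using this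

theorem HasWeakDirDeriv.sum {ι : Type*} [Fintype ι] {O : Set G} {U : G → ℝ} {Q : ι → G → ℝ}
    {e : ι → G} (hU : LocallyIntegrableOn U O μ) (h : ∀ i, HasWeakDirDeriv μ O U (Q i) (e i))
    (c : ι → ℝ) :
    HasWeakDirDeriv μ O U (fun z ↦ ∑ i, c i * Q i z) (∑ i, c i • e i) := by
  have hi : ∀ i, LocallyIntegrableOn (fun z ↦ c i * Q i z) O μ := fun i ↦
    (h i).locInt_deriv.smul (c i)
  refine ⟨hU, ?_, fun ζ hζ hζc hζO ↦ ?_⟩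
  · intro x hx
    choose t ht hti using fun i ↦ hi i x hx
    refine ⟨⋂ i, t i, (Filter.iInter_mem).2 ht, ?_⟩
    exact integrable_finsetSum _ fun i _ ↦ (hti i).mono_set (iInter_subset _ i)
  · have hz1 : ∀ z ∉ tsupport ζ, ζ z = 0 := fun z hz ↦ image_eq_zero_of_notMem_tsupport hz
    have hz2 : ∀ v : G, ∀ z ∉ tsupport ζ, fderiv ℝ ζ z v = 0 := fun v z hz ↦ by
      have : fderiv ℝ ζ z = 0 := by
        by_contra h0; exact hz (tsupport_fderiv_subset ℝ (subset_closure h0))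
      simp [this]
    have key : ∀ {V g : G → ℝ}, LocallyIntegrableOn V O μ → Continuous g →
        (∀ z ∉ tsupport ζ, g z = 0) → Integrable (fun z ↦ V z * g z) μ := fun {V g} hV hg hz ↦ by
      obtain ⟨B, hB⟩ := (HasCompactSupport.intro hζc hz).exists_bound_of_continuous hg
      exact integrable_mul_of_tsupport hV hg.aestronglyMeasurable hB hζc hζO hz
    have hc : ∀ v : G, Continuous fun z ↦ fderiv ℝ ζ z v := fun v ↦
      (hζ.continuous_fderiv (by simp)).clm_apply continuous_const
    simp only [map_sum, map_smul, smul_eq_mul, Finset.mul_sum, Finset.sum_mul]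
    rw [integral_finsetSum _ fun i _ ↦ ?_, integral_finsetSum _ fun i _ ↦ ?_,
      ← Finset.sum_neg_distrib]
    · refine Finset.sum_congr rfl fun i _ ↦ ?_
      have := (h i).integral_eq ζ hζ hζc hζO
      calc _ = c i * ∫ z, U z * fderiv ℝ ζ z (e i) ∂μ := by
            rw [← integral_const_mul]; congr 1; funext z; ring
        _ = _ := by rw [this, mul_neg, ← integral_const_mul]; congr 2; funext z; ring
    · exact key (hi i) hζ.continuous hz1
    · exact key hU ((hc (e i)).const_mul (c i)) fun z hz ↦ by simp [hz2 _ z hz]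

theorem integrable_prod_translate {Q : G → ℝ} (hQm : Measurable Q) (hQ : Integrable Q μ) (e : G) :
    Integrable (fun p : G × ℝ ↦ Q (p.1 + p.2 • e)) (μ.prod (volume.restrict (Icc (0 : ℝ) 1))) := by
  have hm : Measurable fun p : G × ℝ ↦ Q (p.1 + p.2 • e) := hQm.comp (by fun_prop)
  rw [integrable_prod_iff' hm.aestronglyMeasurable]
  refine ⟨Eventually.of_forall fun s ↦ hQ.comp_add_right (s • e), ?_⟩
  have : ∀ s : ℝ, ∫ x, ‖Q (x + s • e)‖ ∂μ = ∫ x, ‖Q x‖ ∂μ := fun s ↦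
    integral_add_right_eq_self (fun x ↦ ‖Q x‖) (s • e)
  simp only [this]
  exact integrable_const _

/-- The increment of a weakly differentiable function is the integral of its derivative
along almost every segment in a given direction. -/
theorem HasWeakDirDeriv.ae_sub_eq_integral {O O' : Set G} {V Q : G → ℝ} {e : G}
    (h : HasWeakDirDeriv μ O V Q e) (hQm : Measurable Q) (hVm : Measurable V)
    (hO' : IsOpen O') (hOO' : ∀ x ∈ O', ∀ s ∈ Icc (0 : ℝ) 1, x + s • e ∈ O) :
    ∀ᵐ x ∂μ, x ∈ O' → V (x + e) - V x = ∫ s in Icc (0 : ℝ) 1, Q (x + s • e) := by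
  -- compact sets swept by segments
  have hL : ∀ K : Set G, IsCompact K → K ⊆ O' → ∃ L : Set G, IsCompact L ∧ L ⊆ O ∧
      ∀ x ∈ K, ∀ s ∈ Icc (0 : ℝ) 1, x + s • e ∈ L := fun K hK hKO ↦ by
    refine ⟨(fun p : G × ℝ ↦ p.1 + p.2 • e) '' (K ×ˢ Icc 0 1),
      (hK.prod isCompact_Icc).image (by fun_prop), ?_, ?_⟩
    · rintro _ ⟨p, hp, rfl⟩; exact hOO' _ (hKO hp.1) _ hp.2
    · exact fun x hx s hs ↦ ⟨(x, s), ⟨hx, hs⟩, rfl⟩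
  have hloc : LocallyIntegrableOn
      (fun x ↦ V (x + e) - V x - ∫ s in Icc (0 : ℝ) 1, Q (x + s • e)) O' μ := by
    rw [locallyIntegrableOn_iff hO'.isLocallyClosed]
    intro K hKO hK
    obtain ⟨L, hLc, hLO, hKL⟩ := hL K hK hKO
    have hVL : Integrable (L.indicator V) μ :=
      (integrable_indicator_iff hLc.measurableSet).2 (h.locInt.integrableOn_compact_subset hLO hLc)
    have hQL : Integrable (L.indicator Q) μ :=
      (integrable_indicator_iff hLc.measurableSet).2
        (h.locInt_deriv.integrableOn_compact_subset hLO hLc)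
    have i3 := (integrable_prod_translate (hQm.indicator hLc.measurableSet) hQL e).integral_prod_left
    refine (((hVL.comp_add_right e).sub hVL).sub i3).integrableOn.congr_fun (fun x hx ↦ ?_)
      hK.measurableSet
    have h0 := hKL x hx 0 (by simp)
    have h1 := hKL x hx 1 (by simp)
    rw [zero_smul, add_zero] at h0
    rw [one_smul] at h1
    simp only [Pi.sub_apply, indicator_of_mem h0, indicator_of_mem h1]
    congr 1
    exact setIntegral_congr_fun measurableSet_Icc fun s hs ↦ indicator_of_mem (hKL x hx s hs) _
  -- Both sides are compared by pairing with smooth g. For each s the weak derivative is tested with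
  -- g translated by se; integrating in s turns ∂ₑg(x - se) into g(x) - g(x - e).
  have := hO'.ae_eq_zero_of_integral_contDiff_smul_eq_zero hloc fun g hg hgc hgO ↦ ?_
  · filter_upwards [this] with x hx hxO
    linarith [hx hxO]
  obtain ⟨L, hLc, hLO, hKL⟩ := hL _ hgc hgO
  have hVL : Integrable (L.indicator V) μ :=
    (integrable_indicator_iff hLc.measurableSet).2 (h.locInt.integrableOn_compact_subset hLO hLc)
  have hQL : Integrable (L.indicator Q) μ :=
    (integrable_indicator_iff hLc.measurableSet).2
      (h.locInt_deriv.integrableOn_compact_subset hLO hLc)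
  have hgz : ∀ x ∉ tsupport g, g x = 0 := fun x hx ↦ image_eq_zero_of_notMem_tsupport hx
  obtain ⟨B, hB⟩ := hgc.exists_bound_of_continuous hg.continuous
  have hg' : Continuous fun x ↦ fderiv ℝ g x e :=
    (hg.continuous_fderiv (by simp)).clm_apply continuous_const
  have hg'z : ∀ x ∉ tsupport g, fderiv ℝ g x e = 0 := fun z hz ↦ by
    have : fderiv ℝ g z = 0 := by
      by_contra h0; exact hz (tsupport_fderiv_subset ℝ (subset_closure h0))
    simp [this]
  obtain ⟨B', hB'⟩ := (HasCompactSupport.intro hgc hg'z).exists_bound_of_continuous hg'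
  have iQ := integrable_prod_translate (hQm.indicator hLc.measurableSet) hQL e
  have iQg : Integrable (fun p : G × ℝ ↦ L.indicator Q (p.1 + p.2 • e) * g p.1)
      (μ.prod (volume.restrict (Icc (0 : ℝ) 1))) :=
    iQ.mul_bdd (c := B) (hg.continuous.comp continuous_fst).aestronglyMeasurable
      (Eventually.of_forall fun p ↦ hB _)
  have iV := integrable_prod_translate (hVm.indicator hLc.measurableSet) hVL e
  have iVg : Integrable (fun p : G × ℝ ↦ L.indicator V (p.1 + p.2 • e) * fderiv ℝ g p.1 e)
      (μ.prod (volume.restrict (Icc (0 : ℝ) 1))) :=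
    iV.mul_bdd (c := B') (hg'.comp continuous_fst).aestronglyMeasurable
      (Eventually.of_forall fun p ↦ hB' _)
  have eV : ∀ s ∈ Icc (0 : ℝ) 1, ∫ x, L.indicator V (x + s • e) * fderiv ℝ g x e ∂μ
      = -∫ x, L.indicator Q (x + s • e) * g x ∂μ := fun s hs ↦ by
    have hts : tsupport (fun y ↦ g (y - s • e)) ⊆ (fun x ↦ x + s • e) '' tsupport g := by
      refine closure_minimal (fun y hy ↦ ⟨y - s • e, subset_closure hy, by simp⟩) ?_
      exact (hgc.image (by fun_prop)).isClosed
    have hs1 := h.integral_eq (fun y ↦ g (y - s • e)) (hg.comp (contDiff_id.sub contDiff_const))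
      ((hgc.image (by fun_prop : Continuous fun x ↦ x + s • e)).of_isClosed_subset
        (isClosed_tsupport _) hts) (hts.trans (by
          rintro _ ⟨x, hx, rfl⟩; exact hLO (hKL x hx s hs)))
    simp_rw [fderiv_comp_sub] at hs1
    rw [← integral_add_right_eq_self (μ := μ) _ (s • e),
      ← integral_add_right_eq_self (μ := μ) (fun z ↦ Q z * g (z - s • e)) (s • e)] at hs1
    simp only [add_sub_cancel_right] at hs1
    have c1 : ∀ x, L.indicator V (x + s • e) * fderiv ℝ g x e
        = V (x + s • e) * fderiv ℝ g x e := fun x ↦ by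
      by_cases hx : x ∈ tsupport g
      · rw [indicator_of_mem (hKL x hx s hs)]
      · simp [hg'z x hx]
    have c2 : ∀ x, L.indicator Q (x + s • e) * g x = Q (x + s • e) * g x := fun x ↦ by
      by_cases hx : x ∈ tsupport g
      · rw [indicator_of_mem (hKL x hx s hs)]
      · simp [hgz x hx]
    simp_rw [c1, c2]
    exact hs1
  have hT : ∫ x, g x * (∫ s in Icc (0 : ℝ) 1, L.indicator Q (x + s • e)) ∂μ
      = -∫ s in Icc (0 : ℝ) 1, ∫ x, L.indicator V (x + s • e) * fderiv ℝ g x e ∂μ := by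
    rw [setIntegral_congr_fun measurableSet_Icc eV, integral_neg, neg_neg]
    rw [← integral_prod_symm _ iQg, integral_prod _ iQg]
    refine integral_congr_ae (Eventually.of_forall fun x ↦ ?_)
    simp only [integral_mul_const]
    ring
  have hS : ∫ s in Icc (0 : ℝ) 1, ∫ x, L.indicator V (x + s • e) * fderiv ℝ g x e ∂μ
      = ∫ x, L.indicator V x * (g x - g (x - e)) ∂μ := by
    have e1 : ∀ s : ℝ, ∫ x, L.indicator V (x + s • e) * fderiv ℝ g x e ∂μ
        = ∫ x, L.indicator V x * fderiv ℝ g (x - s • e) e ∂μ := fun s ↦ by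
      rw [← integral_add_right_eq_self (fun x ↦ L.indicator V x * fderiv ℝ g (x - s • e) e) (s • e)]
      simp only [add_sub_cancel_right]
    simp_rw [e1]
    have iW : Integrable (fun p : G × ℝ ↦ L.indicator V p.1 * fderiv ℝ g (p.1 - p.2 • e) e)
        (μ.prod (volume.restrict (Icc (0 : ℝ) 1))) :=
      (hVL.comp_fst _).mul_bdd (c := B')
        (hg'.comp (by fun_prop : Continuous fun p : G × ℝ ↦ p.1 - p.2 • e)).aestronglyMeasurable
        (Eventually.of_forall fun p ↦ hB' _)
    rw [← integral_prod_symm _ iW, integral_prod _ iW]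
    refine integral_congr_ae (Eventually.of_forall fun x ↦ ?_)
    simp only [integral_const_mul]
    congr 1
    have hder : ∀ s : ℝ, HasDerivAt (fun s ↦ -g (x - s • e)) (fderiv ℝ g (x - s • e) e) s := by
      intro s
      have h1 : HasDerivAt (fun s : ℝ ↦ x - s • e) (-e) s := by
        simpa using ((hasDerivAt_id s).smul_const e).const_sub x
      have h2 := ((hg.differentiable (by simp) (x - s • e)).hasFDerivAt.comp_hasDerivAt s h1).neg
      have h3 : HasDerivAt (fun s ↦ -g (x - s • e)) (-(fderiv ℝ g (x - s • e) (-e))) s := h2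
      simpa using h3
    have hcont : Continuous fun s : ℝ ↦ fderiv ℝ g (x - s • e) e := hg'.comp (by fun_prop)
    rw [integral_Icc_eq_integral_Ioc, ← intervalIntegral.integral_of_le zero_le_one,
      intervalIntegral.integral_eq_sub_of_hasDerivAt (fun s _ ↦ hder s)
        (hcont.intervalIntegrable _ _)]
    simp
    ring
  have bg : ∀ {V : G → ℝ}, Integrable V μ → Integrable (fun x ↦ g x * V x) μ := fun hV ↦
    Integrable.bdd_mul (c := B) hV hg.continuous.aestronglyMeasurable (Eventually.of_forall hB)
  have i1 := bg (hVL.comp_add_right e)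
  have i2 := bg hVL
  have i3 : Integrable (fun x ↦ g x * ∫ s in Icc (0 : ℝ) 1, L.indicator Q (x + s • e)) μ :=
    bg iQ.integral_prod_left
  have hU : ∫ x, L.indicator V x * (g x - g (x - e)) ∂μ
      = ∫ x, g x * L.indicator V x ∂μ - ∫ x, g x * L.indicator V (x + e) ∂μ := by
    rw [← integral_sub_right_eq_self (fun x ↦ g x * L.indicator V (x + e)) e]
    simp only [sub_add_cancel]
    have i4 : Integrable (fun x ↦ g (x - e) * L.indicator V x) μ :=
      Integrable.bdd_mul (c := B) hVL
        (hg.continuous.comp (by fun_prop : Continuous fun x ↦ x - e)).aestronglyMeasurable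
        (Eventually.of_forall fun x ↦ hB _)
    rw [← integral_sub i2 i4]
    congr 1; funext x; ring
  have hcg : ∀ x, g x • (V (x + e) - V x - ∫ s in Icc (0 : ℝ) 1, Q (x + s • e))
      = g x * L.indicator V (x + e) - g x * L.indicator V x
        - g x * ∫ s in Icc (0 : ℝ) 1, L.indicator Q (x + s • e) := fun x ↦ by
    by_cases hx : x ∈ tsupport g
    · have h0 := hKL x hx 0 (by simp)
      have h1 := hKL x hx 1 (by simp)
      rw [zero_smul, add_zero] at h0
      rw [one_smul] at h1
      rw [indicator_of_mem h0, indicator_of_mem h1,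
        setIntegral_congr_fun measurableSet_Icc fun s hs ↦ indicator_of_mem (hKL x hx s hs) _,
        smul_eq_mul]
      ring
    · simp [hgz x hx]
  simp_rw [hcg]
  have i5 := integral_sub (i1.sub i2) i3
  simp only [Pi.sub_apply] at i5
  rw [i5, integral_sub i1 i2, hT, hS, hU]
  ring

theorem hasDerivAt_primitive {φ : ℝ → ℝ} (hφ : Continuous φ) (s : ℝ) :
    HasDerivAt (fun s ↦ ∫ r in (0 : ℝ)..s, φ r) (φ s) s :=
  intervalIntegral.integral_hasDerivAt_right (hφ.intervalIntegrable _ _)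
    (hφ.stronglyMeasurableAtFilter _ _) hφ.continuousAt

/-- Since s^(1+β) has unbounded slope for β > 0, the chain rule is applied to primitives of (1+β)
min(s⁺, N)^β, with one null set serving all N. -/
theorem HasWeakDirDeriv.ae_enorm_rpow_sub_le {O O' : Set G} {U Q : G → ℝ} {e : G}
    (hO : IsOpen O) (h : HasWeakDirDeriv μ O U Q e) (hQm : Measurable Q) (hUm : Measurable U)
    (hU0 : ∀ x, 0 ≤ U x)
    (hO' : IsOpen O') (hOO' : ∀ x ∈ O', ∀ s ∈ Icc (0 : ℝ) 1, x + s • e ∈ O) {β : ℝ} (hβ : 0 ≤ β) :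
    ∀ᵐ x ∂μ, x ∈ O' → ‖U (x + e) ^ (1 + β) - U x ^ (1 + β)‖ₑ
      ≤ ∫⁻ s in Icc (0 : ℝ) 1,
        ENNReal.ofReal ((1 + β) * U (x + s • e) ^ β * |Q (x + s • e)|) := by
  set φ : ℕ → ℝ → ℝ := fun N r ↦ (1 + β) * (min (max r 0) N) ^ β with hφ
  have hφc : ∀ N, Continuous (φ N) := fun N ↦
    continuous_const.mul (((continuous_id.max continuous_const).min continuous_const).rpow_const
      fun _ ↦ Or.inr hβ)
  have hmin0 : ∀ (N : ℕ) (r : ℝ), 0 ≤ min (max r 0) (N : ℝ) := fun N r ↦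
    le_min (le_max_right _ _) (Nat.cast_nonneg N)
  have hφ0 : ∀ N r, 0 ≤ φ N r := fun N r ↦ mul_nonneg (by linarith) (Real.rpow_nonneg (hmin0 N r) _)
  have hφB : ∀ N r, |φ N r| ≤ (1 + β) * (N : ℝ) ^ β := fun N r ↦ by
    rw [abs_of_nonneg (hφ0 N r)]
    exact mul_le_mul_of_nonneg_left
      (Real.rpow_le_rpow (hmin0 N r) (min_le_right _ _) hβ) (by linarith)
  have hprim : ∀ (N : ℕ) (s : ℝ), 0 ≤ s → s ≤ N → ∫ r in (0 : ℝ)..s, φ N r = s ^ (1 + β) := by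
    intro N s hs hsN
    have : ∀ r ∈ uIcc 0 s, φ N r = (1 + β) * r ^ β := fun r hr ↦ by
      rw [uIcc_of_le hs] at hr
      simp only [hφ]
      rw [max_eq_left hr.1, min_eq_left (hr.2.trans hsN)]
    rw [intervalIntegral.integral_congr this, intervalIntegral.integral_const_mul,
      integral_rpow (Or.inl (by linarith)), Real.zero_rpow (by linarith)]
    rw [add_comm β 1]
    field_simp
    ring
  have hall : ∀ᵐ x ∂μ, ∀ N : ℕ, x ∈ O' →
      (∫ r in (0 : ℝ)..U (x + e), φ N r) - (∫ r in (0 : ℝ)..U x, φ N r)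
        = ∫ s in Icc (0 : ℝ) 1, φ N (U (x + s • e)) * Q (x + s • e) := by
    rw [ae_all_iff]
    intro N
    have h1 := h.comp hO hUm (hasDerivAt_primitive (hφc N)) (hφc N) (hφB N)
    refine h1.ae_sub_eq_integral (((hφc N).measurable.comp hUm).mul hQm) ?_ hO' hOO'
    exact (continuous_iff_continuousAt.2 fun s ↦
      (hasDerivAt_primitive (hφc N) s).continuousAt).measurable.comp hUm
  filter_upwards [hall] with x hx hxO
  -- The truncation must be inactive only at the two endpoints; along the segment it merely lowers
  -- the integrand.
  obtain ⟨N, hN⟩ := exists_nat_ge (max (U (x + e)) (U x))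
  have h1 := hx N hxO
  rw [hprim N _ (hU0 _) ((le_max_left _ _).trans hN),
    hprim N _ (hU0 _) ((le_max_right _ _).trans hN)] at h1
  rw [h1]
  refine (enorm_integral_le_lintegral_enorm _).trans (lintegral_mono fun s ↦ ?_)
  rw [← ofReal_norm, Real.norm_eq_abs, abs_mul, abs_of_nonneg (hφ0 _ _)]
  refine ENNReal.ofReal_le_ofReal (mul_le_mul_of_nonneg_right ?_ (abs_nonneg _))
  refine mul_le_mul_of_nonneg_left (Real.rpow_le_rpow (hmin0 _ _) ?_ hβ) (by linarith)
  rw [max_eq_left (hU0 _)]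
  exact min_le_left _ _

theorem lintegral_rpow_le_measure_univ_rpow_mul {X : Type*} [MeasurableSpace X] {ν : Measure X}
    {g : X → ℝ≥0∞} (hg : AEMeasurable g ν) {p : ℝ} (hp : 1 < p) :
    (∫⁻ x, g x ∂ν) ^ p ≤ ν univ ^ (p - 1) * ∫⁻ x, g x ^ p ∂ν := by
  have hpq := Real.HolderConjugate.conjExponent hp
  have h := ENNReal.lintegral_mul_le_Lp_mul_Lq ν hpq hg (g := fun _ ↦ 1) aemeasurable_const
  simp only [Pi.mul_apply, mul_one, ENNReal.one_rpow, lintegral_one] at h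
  calc (∫⁻ x, g x ∂ν) ^ p
      ≤ ((∫⁻ x, g x ^ p ∂ν) ^ (1 / p) * ν univ ^ (1 / p.conjExponent)) ^ p :=
        ENNReal.rpow_le_rpow h (by linarith)
    _ = _ := by
        rw [ENNReal.mul_rpow_of_nonneg _ _ (by linarith), ← ENNReal.rpow_mul, ← ENNReal.rpow_mul,
          one_div_mul_cancel (by linarith), ENNReal.rpow_one, mul_comm]
        congr 2
        rw [Real.conjExponent]
        field_simp

/-- Jensen's inequality on the unit parameter interval, then Tonelli; for each s the translation by
se carries K into L and preserves the measure. -/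
theorem HasWeakDirDeriv.lintegral_rpow_sub_le {O O' K L : Set G} {U Q : G → ℝ} {e : G}
    (hO : IsOpen O) (h : HasWeakDirDeriv μ O U Q e) (hQm : Measurable Q) (hUm : Measurable U)
    (hU0 : ∀ x, 0 ≤ U x)
    (hO' : IsOpen O') (hOO' : ∀ x ∈ O', ∀ s ∈ Icc (0 : ℝ) 1, x + s • e ∈ O) {β : ℝ} (hβ : 0 ≤ β)
    {p : ℝ} (hp : 1 < p) (hK : MeasurableSet K) (hKO' : K ⊆ O') (hL : MeasurableSet L)
    (hKL : ∀ x ∈ K, ∀ s ∈ Icc (0 : ℝ) 1, x + s • e ∈ L) :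
    ∫⁻ x in K, ‖U (x + e) ^ (1 + β) - U x ^ (1 + β)‖ₑ ^ p ∂μ
      ≤ ∫⁻ x in L, ENNReal.ofReal ((1 + β) * U x ^ β * |Q x|) ^ p ∂μ := by
  set N : G → ℝ≥0∞ := fun x ↦ ENNReal.ofReal ((1 + β) * U x ^ β * |Q x|) with hN
  have hNm : Measurable N := by fun_prop
  calc ∫⁻ x in K, ‖U (x + e) ^ (1 + β) - U x ^ (1 + β)‖ₑ ^ p ∂μ
      ≤ ∫⁻ x in K, ∫⁻ s in Icc (0 : ℝ) 1, N (x + s • e) ^ p ∂volume ∂μ := by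
        refine lintegral_mono_ae ?_
        filter_upwards [ae_restrict_of_ae
          (h.ae_enorm_rpow_sub_le hO hQm hUm hU0 hO' hOO' hβ), ae_restrict_mem hK] with x hx hxK
        refine (ENNReal.rpow_le_rpow (hx (hKO' hxK)) (by linarith)).trans ?_
        have hm : Measurable fun s : ℝ ↦ N (x + s • e) := hNm.comp (by fun_prop)
        have := lintegral_rpow_le_measure_univ_rpow_mul (ν := volume.restrict (Icc (0 : ℝ) 1))
          hm.aemeasurable hp
        simpa using this
    _ = ∫⁻ s in Icc (0 : ℝ) 1, ∫⁻ x in K, N (x + s • e) ^ p ∂μ := by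
        refine lintegral_lintegral_swap ?_
        have : Measurable fun q : G × ℝ ↦ N (q.1 + q.2 • e) ^ p :=
          (hNm.comp (by fun_prop)).pow_const p
        exact this.aemeasurable
    _ ≤ ∫⁻ s in Icc (0 : ℝ) 1, ∫⁻ x in L, N x ^ p ∂μ := by
        refine setLIntegral_mono measurable_const fun s hs ↦ ?_
        rw [← lintegral_indicator hK, ← lintegral_indicator hL,
          ← lintegral_add_right_eq_self (μ := μ) (L.indicator fun x ↦ N x ^ p) (s • e)]
        refine lintegral_mono fun x ↦ ?_
        by_cases hx : x ∈ K
        · rw [indicator_of_mem hx, indicator_of_mem (hKL x hx s hs)]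
        · rw [indicator_of_notMem hx]; exact zero_le
    _ = _ := by simp [hN]

end Translation

/-! ### Mollification in the space variable and the weighted gradient bound. -/

section SpatialMollification

variable {n : ℕ}

instance isAddHaarMeasure_spaceTime :
    (volume : Measure (EuclideanSpace ℝ (Fin n) × ℝ)).IsAddHaarMeasure :=
  inferInstanceAs ((volume : Measure (EuclideanSpace ℝ (Fin n))).prod
    (volume : Measure ℝ)).IsAddHaarMeasure

/-- The standard mollifier at scale `1 / (k + 1)`. -/
def mollifier (n k : ℕ) : EuclideanSpace ℝ (Fin n) → ℝ :=
  (bumpSeq (EuclideanSpace ℝ (Fin n)) k).normed volume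

theorem mollifier_contDiff (k : ℕ) {m : ℕ∞} : ContDiff ℝ m (mollifier n k) :=
  (bumpSeq (EuclideanSpace ℝ (Fin n)) k).contDiff_normed

theorem mollifier_nonneg (k : ℕ) (x) : 0 ≤ mollifier n k x :=
  (bumpSeq (EuclideanSpace ℝ (Fin n)) k).nonneg_normed x

theorem mollifier_integral (k : ℕ) : ∫ x, mollifier n k x = 1 :=
  (bumpSeq (EuclideanSpace ℝ (Fin n)) k).integral_normed

theorem mollifier_hasCompactSupport (k : ℕ) : HasCompactSupport (mollifier n k) :=
  (bumpSeq (EuclideanSpace ℝ (Fin n)) k).hasCompactSupport_normed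

theorem mollifier_integrable (k : ℕ) : Integrable (mollifier n k) :=
  (bumpSeq (EuclideanSpace ℝ (Fin n)) k).integrable_normed

/-- The support radius of the mollifier. -/
def mollRadius (k : ℕ) : ℝ := 2 * ((k : ℝ) + 1)⁻¹

theorem mollRadius_pos (k : ℕ) : 0 < mollRadius k := by unfold mollRadius; positivity

theorem mollRadius_tendsto : Tendsto mollRadius atTop (𝓝 0) :=
  bumpSeq_rOut_tendsto (G := ℝ)

theorem mollifier_tsupport (k : ℕ) :
    tsupport (mollifier n k) = Metric.closedBall 0 (mollRadius k) :=
  (bumpSeq (EuclideanSpace ℝ (Fin n)) k).tsupport_normed_eq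

theorem mollifier_eq_zero {k : ℕ} {x : EuclideanSpace ℝ (Fin n)} (hx : mollRadius k < ‖x‖) :
    mollifier n k x = 0 := by
  refine image_eq_zero_of_notMem_tsupport ?_
  rw [mollifier_tsupport]
  simpa using hx

theorem fderiv_mollifier_eq_zero {k : ℕ} {x : EuclideanSpace ℝ (Fin n)}
    (hx : mollRadius k < ‖x‖) : fderiv ℝ (mollifier n k) x = 0 := by
  by_contra h0
  have := tsupport_fderiv_subset ℝ (f := mollifier n k) (subset_closure h0)
  rw [mollifier_tsupport] at this
  simp at this
  linarith

theorem continuous_fderiv_mollifier (k : ℕ) (e : EuclideanSpace ℝ (Fin n)) :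
    Continuous fun x ↦ fderiv ℝ (mollifier n k) x e :=
  ((mollifier_contDiff (m := 1) k).continuous_fderiv (by simp)).clm_apply continuous_const

theorem mollifier_neg (k : ℕ) (x) : mollifier n k (-x) = mollifier n k x :=
  (bumpSeq (EuclideanSpace ℝ (Fin n)) k).normed_neg x

theorem mollifier_scaling (k : ℕ) (x : EuclideanSpace ℝ (Fin n)) :
    mollifier n k x = ((k : ℝ) + 1) ^ n * mollifier n 0 (((k : ℝ) + 1) • x) := by
  have hk : (0 : ℝ) < (k : ℝ) + 1 := by positivity
  have h0 : ∀ x, mollifier n k x = bumpSeq (EuclideanSpace ℝ (Fin n)) k x / ∫ y, bumpSeq (EuclideanSpace ℝ (Fin n)) k y :=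
    fun x ↦ rfl
  have h1 : ∀ x, mollifier n 0 x = bumpSeq (EuclideanSpace ℝ (Fin n)) 0 x / ∫ y, bumpSeq (EuclideanSpace ℝ (Fin n)) 0 y :=
    fun x ↦ rfl
  have h2 : ∫ y, bumpSeq (EuclideanSpace ℝ (Fin n)) k y
      = (((k : ℝ) + 1) ^ n)⁻¹ * ∫ y, bumpSeq (EuclideanSpace ℝ (Fin n)) 0 y := by
    simp_rw [bumpSeq_apply k]
    rw [Measure.integral_comp_smul_of_nonneg (μ := volume) (hR := hk.le)]
    simp
  rw [h0, h1, h2, bumpSeq_apply k]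
  field_simp

/-- By scaling. The growth (k+1)^(n+1) is the inverse, up to constants, of the radius times the
volume of the support, which is what makes the bound in `exists_bound_spGrad` independent of k. -/
theorem exists_fderiv_mollifier_bound (n : ℕ) : ∃ D : ℝ, 0 ≤ D ∧
    ∀ (k : ℕ) (x e : EuclideanSpace ℝ (Fin n)),
      |fderiv ℝ (mollifier n k) x e| ≤ D * ((k : ℝ) + 1) ^ (n + 1) * ‖e‖ := by
  obtain ⟨D, hD⟩ := ((mollifier_hasCompactSupport (n := n) 0).fderiv ℝ).exists_bound_of_continuous
    ((mollifier_contDiff (m := 1) 0).continuous_fderiv (by simp))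
  refine ⟨D, (norm_nonneg _).trans (hD 0), fun k x e ↦ ?_⟩
  have hk : (0 : ℝ) < (k : ℝ) + 1 := by positivity
  have h1 : HasFDerivAt (mollifier n k) ((((k : ℝ) + 1) ^ n) •
      ((fderiv ℝ (mollifier n 0) (((k : ℝ) + 1) • x)).comp
        (((k : ℝ) + 1) • ContinuousLinearMap.id ℝ _))) x := by
    have h2 : mollifier n k = fun x ↦ ((k : ℝ) + 1) ^ n * mollifier n 0 (((k : ℝ) + 1) • x) :=
      funext (mollifier_scaling k)
    rw [h2]
    have h3 := ((mollifier_contDiff (n := n) (m := 1) 0).differentiable (by simp)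
      (((k : ℝ) + 1) • x)).hasFDerivAt
    exact (h3.comp x ((hasFDerivAt_id x).const_smul ((k : ℝ) + 1))).const_mul _
  rw [h1.fderiv]
  simp only [smul_apply, ContinuousLinearMap.comp_apply,
    ContinuousLinearMap.id_apply, map_smul, smul_eq_mul, abs_mul]
  rw [abs_of_pos (pow_pos hk n), abs_of_pos hk, pow_succ]
  have h4 : |fderiv ℝ (mollifier n 0) (((k : ℝ) + 1) • x) e| ≤ D * ‖e‖ :=
    ((fderiv ℝ (mollifier n 0) (((k : ℝ) + 1) • x)).le_opNorm e).trans
      (mul_le_mul_of_nonneg_right (hD _) (norm_nonneg _))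
  calc _ ≤ ((k : ℝ) + 1) ^ n * (((k : ℝ) + 1) * (D * ‖e‖)) := by gcongr
    _ = _ := by ring

/-- Mollification in the space variable. -/
def spMoll (k : ℕ) (G : EuclideanSpace ℝ (Fin n) × ℝ → ℝ) (z : EuclideanSpace ℝ (Fin n) × ℝ) : ℝ :=
  ∫ w, mollifier n k (z.1 - w) * G (w, z.2)

/-- The derivative in the direction `e` of the mollification in the space variable. -/
def spGrad (k : ℕ) (e : EuclideanSpace ℝ (Fin n)) (G : EuclideanSpace ℝ (Fin n) × ℝ → ℝ)
    (z : EuclideanSpace ℝ (Fin n) × ℝ) : ℝ :=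
  ∫ w, fderiv ℝ (mollifier n k) (z.1 - w) e * G (w, z.2)

variable {G : EuclideanSpace ℝ (Fin n) × ℝ → ℝ}

theorem measurable_kernel_integral {κ : EuclideanSpace ℝ (Fin n) → ℝ} (hκ : Measurable κ)
    (hG : Measurable G) : Measurable fun z : EuclideanSpace ℝ (Fin n) × ℝ ↦
      ∫ w, κ (z.1 - w) * G (w, z.2) := by
  have h : Measurable fun q : (EuclideanSpace ℝ (Fin n) × ℝ) × EuclideanSpace ℝ (Fin n) ↦
      κ (q.1.1 - q.2) * G (q.2, q.1.2) :=
    (hκ.comp (by fun_prop)).mul (hG.comp (by fun_prop))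
  exact (h.stronglyMeasurable.integral_prod_right' (ν := volume)).measurable

theorem measurable_spMoll (k : ℕ) (hG : Measurable G) : Measurable (spMoll k G) :=
  measurable_kernel_integral (mollifier_contDiff (m := 0) k).continuous.measurable hG

theorem measurable_spGrad (k : ℕ) (e : EuclideanSpace ℝ (Fin n)) (hG : Measurable G) :
    Measurable (spGrad k e G) :=
  measurable_kernel_integral (continuous_fderiv_mollifier k e).measurable hG

theorem abs_kernel_integral_le {κ : EuclideanSpace ℝ (Fin n) → ℝ} (hκ : Integrable κ) {B : ℝ}
    (hB : ∀ z, |G z| ≤ B) (z : EuclideanSpace ℝ (Fin n) × ℝ) :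
    |∫ w, κ (z.1 - w) * G (w, z.2)| ≤ (∫ w, |κ w|) * B := by
  have h1 : ∫ w, |κ (z.1 - w)| = ∫ w, |κ w| := integral_sub_left_eq_self (fun w ↦ |κ w|) volume z.1
  rw [← h1, ← integral_mul_const]
  have h2 : Integrable (fun w ↦ |κ (z.1 - w)| * B) := (hκ.comp_sub_left z.1).abs.mul_const B
  rw [← Real.norm_eq_abs]
  refine norm_integral_le_of_norm_le h2
    (Eventually.of_forall fun w ↦ ?_)
  rw [norm_mul]
  exact mul_le_mul_of_nonneg_left (hB _) (norm_nonneg _)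

theorem abs_spMoll_le (k : ℕ) {B : ℝ} (hB : ∀ z, |G z| ≤ B) (z) : |spMoll k G z| ≤ B := by
  have := abs_kernel_integral_le (mollifier_integrable (n := n) k) hB z
  simp_rw [abs_of_nonneg (mollifier_nonneg k _), mollifier_integral, one_mul] at this
  exact this

theorem spMoll_nonneg (k : ℕ) (hG : ∀ z, 0 ≤ G z) (z) : 0 ≤ spMoll k G z :=
  integral_nonneg fun _ ↦ mul_nonneg (mollifier_nonneg k _) (hG _)

theorem integrable_fderiv_mollifier (k : ℕ) (e : EuclideanSpace ℝ (Fin n)) :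
    Integrable fun x ↦ fderiv ℝ (mollifier n k) x e := by
  refine (continuous_fderiv_mollifier k e).integrable_of_hasCompactSupport ?_
  refine HasCompactSupport.intro (isCompact_closedBall (0 : EuclideanSpace ℝ (Fin n))
    (mollRadius k)) fun x hx ↦ ?_
  have h0 : fderiv ℝ (mollifier n k) x = 0 := fderiv_mollifier_eq_zero (by simpa using hx)
  simp [h0]

theorem abs_spGrad_le (k : ℕ) (e : EuclideanSpace ℝ (Fin n)) {B : ℝ} (hB : ∀ z, |G z| ≤ B) (z) :
    |spGrad k e G z| ≤ (∫ w, |fderiv ℝ (mollifier n k) w e|) * B :=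
  abs_kernel_integral_le (integrable_fderiv_mollifier k e) hB z

/-- The mollifier is even, so its derivative is odd. This mean-zero property allows increments to
replace values in `spGrad_eq_sub`. -/
theorem integral_fderiv_mollifier (k : ℕ) (e : EuclideanSpace ℝ (Fin n)) :
    ∫ x, fderiv ℝ (mollifier n k) x e = 0 := by
  have h1 : ∀ x, fderiv ℝ (mollifier n k) (-x) e = -fderiv ℝ (mollifier n k) x e := fun x ↦ by
    have h2 : (fun x ↦ mollifier n k (-x)) = mollifier n k := funext fun x ↦ mollifier_neg k x
    have h3 : HasFDerivAt (fun x ↦ mollifier n k (-x)) _ x :=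
      ((mollifier_contDiff (n := n) (m := 1) k).differentiable (by simp)
        (-x)).hasFDerivAt.comp x (hasFDerivAt_id x).neg
    rw [h2] at h3
    rw [h3.fderiv]
    simp
  have h3 := integral_neg_eq_self (fun x ↦ fderiv ℝ (mollifier n k) x e) volume
  simp_rw [h1, integral_neg] at h3
  linarith

/-- Mollifying the weak derivative gives the derivative of the mollification. -/
theorem HasWeakDirDeriv.spGrad_eq {Ω : Set (EuclideanSpace ℝ (Fin n))}
    {V Q : EuclideanSpace ℝ (Fin n) × ℝ → ℝ} {e : EuclideanSpace ℝ (Fin n)}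
    (h : HasWeakDirDeriv volume (Ω ×ˢ Ioi (0 : ℝ)) V Q (e, 0))
    (k : ℕ) {y : EuclideanSpace ℝ (Fin n)} (hy : Metric.closedBall y (mollRadius k) ⊆ Ω) :
    ∀ᵐ τ : ℝ, τ ∈ Ioi (0 : ℝ) → spGrad k e V (y, τ) = spMoll k Q (y, τ) := by
  set Bk := Metric.closedBall y (mollRadius k) with hBk
  have hBc : IsCompact Bk := isCompact_closedBall _ _
  have hz1 : ∀ w ∉ Bk, mollifier n k (y - w) = 0 := fun w hw ↦ mollifier_eq_zero (by
    rw [hBk, Metric.mem_closedBall, not_le, dist_comm, dist_eq_norm] at hw; exact hw)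
  have hz2 : ∀ w ∉ Bk, fderiv ℝ (mollifier n k) (y - w) e = 0 := fun w hw ↦ by
    rw [fderiv_mollifier_eq_zero (by
      rw [hBk, Metric.mem_closedBall, not_le, dist_comm, dist_eq_norm] at hw; exact hw)]
    rfl
  have c1 : Continuous fun w ↦ mollifier n k (y - w) :=
    (mollifier_contDiff (m := 0) k).continuous.comp (by fun_prop)
  have c2 : Continuous fun w ↦ fderiv ℝ (mollifier n k) (y - w) e :=
    (continuous_fderiv_mollifier k e).comp (by fun_prop)
  have key : ∀ {W : EuclideanSpace ℝ (Fin n) × ℝ → ℝ} {κ : EuclideanSpace ℝ (Fin n) → ℝ}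
      {J : Set ℝ}, LocallyIntegrableOn W (Ω ×ˢ Ioi (0 : ℝ)) volume → Continuous κ →
      (∀ w ∉ Bk, κ w = 0) → IsCompact J → J ⊆ Ioi 0 →
      Integrable (fun q : EuclideanSpace ℝ (Fin n) × ℝ ↦ κ q.1 * W q)
        (volume.prod (volume.restrict J)) := fun {W κ J} hW hκ hκz hJ hJ0 ↦ by
    obtain ⟨B, hB⟩ := (HasCompactSupport.intro hBc hκz).exists_bound_of_continuous hκ
    have h1 : IntegrableOn W (Bk ×ˢ J) volume :=
      hW.integrableOn_compact_subset (prod_mono hy hJ0) (hBc.prod hJ)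
    have h2 : IntegrableOn (fun q ↦ κ q.1 * W q) (Bk ×ˢ J) volume :=
      Integrable.bdd_mul (c := B) h1 (hκ.comp continuous_fst).aestronglyMeasurable
        (Eventually.of_forall fun q ↦ hB _)
    have h3 : IntegrableOn (fun q ↦ κ q.1 * W q) (univ ×ˢ J) volume := by
      refine h2.of_forall_sdiff_eq_zero (MeasurableSet.univ.prod hJ.measurableSet) fun q hq ↦ ?_
      rw [hκz q.1 fun h ↦ hq.2 ⟨h, hq.1.2⟩, zero_mul]
    rwa [IntegrableOn, Measure.volume_eq_prod, ← Measure.prod_restrict,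
      Measure.restrict_univ] at h3
  have hloc : LocallyIntegrableOn (fun τ ↦ spGrad k e V (y, τ) - spMoll k Q (y, τ)) (Ioi (0 : ℝ))
      volume := by
    rw [locallyIntegrableOn_iff isOpen_Ioi.isLocallyClosed]
    intro J hJ0 hJ
    exact (key h.locInt c2 hz2 hJ hJ0).integral_prod_right.sub
      (key h.locInt_deriv c1 hz1 hJ hJ0).integral_prod_right
  -- With y fixed, the two functions of time are compared by pairing with smooth θ; the product ρ(y
  -- - ·) θ is then an admissible space-time test function.
  have := isOpen_Ioi.ae_eq_zero_of_integral_contDiff_smul_eq_zero hloc fun θ hθ hθc hθ0 ↦ ?_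
  · filter_upwards [this] with τ hτ hτ0
    linarith [hτ hτ0]
  set J := tsupport θ with hJ
  have hθz : ∀ τ ∉ J, θ τ = 0 := fun τ hτ ↦ image_eq_zero_of_notMem_tsupport hτ
  obtain ⟨B, hB⟩ := hθc.exists_bound_of_continuous hθ.continuous
  have hgz : ∀ q : EuclideanSpace ℝ (Fin n) × ℝ, q ∉ Bk ×ˢ J →
      mollifier n k (y - q.1) * θ q.2 = 0 := fun q hq ↦ by
    by_cases h1 : q.1 ∈ Bk
    · rw [hθz q.2 fun h2 ↦ hq ⟨h1, h2⟩, mul_zero]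
    · rw [hz1 _ h1, zero_mul]
  have hgs : tsupport (fun q : EuclideanSpace ℝ (Fin n) × ℝ ↦ mollifier n k (y - q.1) * θ q.2)
      ⊆ Bk ×ˢ J := closure_minimal (fun q hq ↦ by
    by_contra h1; exact hq (hgz q h1)) (hBc.isClosed.prod (isClosed_tsupport _))
  have hmain := h.integral_eq (fun q ↦ mollifier n k (y - q.1) * θ q.2)
    (((mollifier_contDiff (m := ⊤) k).comp (contDiff_const.sub contDiff_fst)).mul
      (hθ.comp contDiff_snd)) (HasCompactSupport.intro (hBc.prod hθc) hgz)
    (hgs.trans (prod_mono hy hθ0))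
  have hfd : ∀ q : EuclideanSpace ℝ (Fin n) × ℝ,
      fderiv ℝ (fun q : EuclideanSpace ℝ (Fin n) × ℝ ↦ mollifier n k (y - q.1) * θ q.2) q (e, 0)
        = -(fderiv ℝ (mollifier n k) (y - q.1) e * θ q.2) := fun q ↦ by
    have h1 : HasFDerivAt (fun q : EuclideanSpace ℝ (Fin n) × ℝ ↦ y - q.1)
        (-ContinuousLinearMap.fst ℝ _ _) q := hasFDerivAt_fst.const_sub y
    have h2 : HasFDerivAt (fun q : EuclideanSpace ℝ (Fin n) × ℝ ↦ mollifier n k (y - q.1)) _ q :=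
      ((mollifier_contDiff (n := n) (m := 1) k).differentiable (by simp)
        (y - q.1)).hasFDerivAt.comp q h1
    have h3 : HasFDerivAt (fun q : EuclideanSpace ℝ (Fin n) × ℝ ↦ θ q.2) _ q :=
      (hθ.differentiable (by simp) q.2).hasFDerivAt.comp q hasFDerivAt_snd
    have h4 : HasFDerivAt (fun q : EuclideanSpace ℝ (Fin n) × ℝ ↦
        mollifier n k (y - q.1) * θ q.2) _ q := h2.mul h3
    rw [h4.fderiv]
    simp [mul_comm]
  simp_rw [hfd] at hmain
  have tr : ∀ {W : EuclideanSpace ℝ (Fin n) × ℝ → ℝ} {κ : EuclideanSpace ℝ (Fin n) → ℝ},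
      LocallyIntegrableOn W (Ω ×ˢ Ioi (0 : ℝ)) volume → Continuous κ →
      (∀ w ∉ Bk, κ w = 0) → ∫ q, θ q.2 * (κ q.1 * W q) = ∫ τ, θ τ * ∫ w, κ w * W (w, τ) ∧
      Integrable (fun τ ↦ θ τ * ∫ w, κ w * W (w, τ)) := fun {W κ} hW hκ hκz ↦ by
    have h1 := key hW hκ hκz hθc hθ0
    have h2 : Integrable (fun q : EuclideanSpace ℝ (Fin n) × ℝ ↦ θ q.2 * (κ q.1 * W q))
        (volume.prod (volume.restrict J)) :=
      Integrable.bdd_mul (c := B) h1 (hθ.continuous.comp continuous_snd).aestronglyMeasurable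
        (Eventually.of_forall fun q ↦ hB _)
    have h3 : (volume : Measure (EuclideanSpace ℝ (Fin n))).prod (volume.restrict J)
        = (volume : Measure (EuclideanSpace ℝ (Fin n) × ℝ)).restrict (univ ×ˢ J) := by
      rw [Measure.volume_eq_prod, ← Measure.prod_restrict, Measure.restrict_univ]
    have h4 : Integrable (fun q : EuclideanSpace ℝ (Fin n) × ℝ ↦ θ q.2 * (κ q.1 * W q)) volume := by
      rw [h3] at h2
      have hsupp : Function.support (fun q : EuclideanSpace ℝ (Fin n) × ℝ ↦
          θ q.2 * (κ q.1 * W q)) ⊆ univ ×ˢ J := fun q hq ↦ by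
        refine ⟨mem_univ _, ?_⟩
        by_contra h5
        exact hq (by simp [hθz q.2 h5])
      exact (integrableOn_iff_integrable_of_support_subset hsupp).1 h2
    refine ⟨?_, ?_⟩
    · rw [Measure.volume_eq_prod] at h4 ⊢
      rw [integral_prod_symm _ h4]
      simp only [integral_const_mul]
    · rw [Measure.volume_eq_prod] at h4
      simpa only [integral_const_mul] using h4.integral_prod_right
  obtain ⟨t1, j1⟩ := tr h.locInt c2 hz2
  obtain ⟨t2, j2⟩ := tr h.locInt_deriv c1 hz1
  simp only [smul_eq_mul, mul_sub]
  have j3 := integral_sub j1 j2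
  refine j3.trans ?_
  rw [← t1, ← t2, sub_eq_zero]
  have e1 : ∫ q, V q * -(fderiv ℝ (mollifier n k) (y - q.1) e * θ q.2)
      = -∫ q, θ q.2 * (fderiv ℝ (mollifier n k) (y - q.1) e * V q) := by
    rw [← integral_neg]; congr 1; funext q; ring
  have e2 : ∫ q, Q q * (mollifier n k (y - q.1) * θ q.2)
      = ∫ q, θ q.2 * (mollifier n k (y - q.1) * Q q) := by
    congr 1; funext q; ring
  rw [e1, e2, neg_inj] at hmain
  exact hmain

/-- Lebesgue differentiation on almost every time slice, assembled by Fubini since the convergence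
set is measurable. -/
theorem spMoll_ae_tendsto_of_integrable {Q : EuclideanSpace ℝ (Fin n) × ℝ → ℝ}
    (hQm : Measurable Q) (hQ : Integrable Q) :
    ∀ᵐ z : EuclideanSpace ℝ (Fin n) × ℝ, Tendsto (fun k ↦ spMoll k Q z) atTop (𝓝 (Q z)) := by
  have hms : MeasurableSet {z | Tendsto (fun k ↦ spMoll k Q z) atTop (𝓝 (Q z))} := by
    have h1 : {z | Tendsto (fun k ↦ spMoll k Q z) atTop (𝓝 (Q z))}
        = {z | Tendsto (fun k ↦ spMoll k Q z - Q z) atTop (𝓝 0)} := by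
      ext z; exact tendsto_sub_nhds_zero_iff.symm
    rw [h1]
    exact measurableSet_tendsto _ fun k ↦ (measurable_spMoll k hQm).sub hQm
  have hsl : ∀ᵐ τ : ℝ, ∀ᵐ y : EuclideanSpace ℝ (Fin n),
      Tendsto (fun k ↦ spMoll k Q (y, τ)) atTop (𝓝 (Q (y, τ))) := by
    rw [Measure.volume_eq_prod] at hQ
    filter_upwards [hQ.prod_left_ae] with τ hτ
    filter_upwards [ae_tendsto_bumpSeq_convolution volume hτ.locallyIntegrable] with y hy
    refine hy.congr fun k ↦ ?_
    rw [convolution_eq_swap]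
    rfl
  rw [Measure.volume_eq_prod]
  have hsw : ∀ᵐ z : ℝ × EuclideanSpace ℝ (Fin n) ∂(volume.prod volume),
      Tendsto (fun k ↦ spMoll k Q z.swap) atTop (𝓝 (Q z.swap)) := by
    rw [Measure.ae_prod_iff_ae_ae (p := fun z : ℝ × EuclideanSpace ℝ (Fin n) ↦
      Tendsto (fun k ↦ spMoll k Q z.swap) atTop (𝓝 (Q z.swap))) (measurable_swap hms)]
    exact hsl
  have := (Measure.measurePreserving_swap (μ := (volume : Measure (EuclideanSpace ℝ (Fin n))))
    (ν := (volume : Measure ℝ))).quasiMeasurePreserving.ae hsw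
  simpa using this

theorem spMoll_congr {k : ℕ} {Q Q' : EuclideanSpace ℝ (Fin n) × ℝ → ℝ}
    {z : EuclideanSpace ℝ (Fin n) × ℝ}
    (h : ∀ w ∈ Metric.closedBall z.1 (mollRadius k), Q (w, z.2) = Q' (w, z.2)) :
    spMoll k Q z = spMoll k Q' z := by
  refine integral_congr_ae (Eventually.of_forall fun w ↦ ?_)
  by_cases hw : w ∈ Metric.closedBall z.1 (mollRadius k)
  · simp only [h w hw]
  · have : mollifier n k (z.1 - w) = 0 := mollifier_eq_zero (by
      rw [Metric.mem_closedBall, not_le, dist_comm, dist_eq_norm] at hw; exact hw)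
    simp [this]

/-- For large k the mollification at points of K × J sees only a compact thickening inside Ω × J, on
which Q is integrable. -/
theorem spMoll_ae_tendsto {Ω : Set (EuclideanSpace ℝ (Fin n))} (hΩ : IsOpen Ω)
    {Q : EuclideanSpace ℝ (Fin n) × ℝ → ℝ} (hQm : Measurable Q)
    (hQ : LocallyIntegrableOn Q (Ω ×ˢ Ioi (0 : ℝ)) volume)
    {K : Set (EuclideanSpace ℝ (Fin n))} (hK : IsCompact K) (hKΩ : K ⊆ Ω) {J : Set ℝ}
    (hJ : IsCompact J) (hJ0 : J ⊆ Ioi 0) :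
    ∀ᵐ z : EuclideanSpace ℝ (Fin n) × ℝ, z ∈ K ×ˢ J →
      Tendsto (fun k ↦ spMoll k Q z) atTop (𝓝 (Q z)) := by
  obtain ⟨δ, hδ, hδΩ⟩ := hK.exists_cthickening_subset_open hΩ hKΩ
  have hL : IsCompact (Metric.cthickening δ K ×ˢ J) := hK.cthickening.prod hJ
  have hQ1 : Integrable ((Metric.cthickening δ K ×ˢ J).indicator Q) :=
    (integrable_indicator_iff hL.measurableSet).2
      (hQ.integrableOn_compact_subset (prod_mono hδΩ hJ0) hL)
  filter_upwards [spMoll_ae_tendsto_of_integrable (hQm.indicator hL.measurableSet) hQ1]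
    with z hz hzK
  have hzL : z ∈ Metric.cthickening δ K ×ˢ J :=
    mk_mem_prod (Metric.self_subset_cthickening _ hzK.1) hzK.2
  rw [indicator_of_mem hzL] at hz
  refine hz.congr' ?_
  filter_upwards [mollRadius_tendsto.eventually (gt_mem_nhds hδ)] with k hk
  refine spMoll_congr fun w hw ↦ indicator_of_mem (mk_mem_prod ?_ hzK.2) Q
  exact Metric.mem_cthickening_of_dist_le _ _ _ _ hzK.1 (hw.trans hk.le)

/-- In s^(1+β) - r^(1+β) = s^β (s - r) + r (s^β - r^β) both summands have the same sign. Thus a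
weight taken at s alone is controlled by an increment of the power, whichever of s and r is larger;
this handles the degeneracy in the gradient bound. -/
theorem rpow_mul_abs_sub_le {s r β : ℝ} (hs : 0 ≤ s) (hr : 0 ≤ r) (hβ : 0 ≤ β) :
    s ^ β * |s - r| ≤ |s ^ (1 + β) - r ^ (1 + β)| := by
  have h1 : ∀ x : ℝ, 0 ≤ x → x ^ (1 + β) = x * x ^ β := fun x hx ↦ by
    rcases hx.eq_or_lt with rfl | hx
    · rw [Real.zero_rpow (by linarith), zero_mul]
    · rw [Real.rpow_add hx, Real.rpow_one]
  rw [h1 s hs, h1 r hr]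
  rcases le_total r s with h | h
  · have h2 := mul_le_mul_of_nonneg_left (Real.rpow_le_rpow hr h hβ) hr
    rw [abs_of_nonneg (sub_nonneg.2 h)]
    refine le_trans ?_ (le_abs_self _)
    linarith [mul_sub (s ^ β) s r, mul_comm s (s ^ β), mul_comm r (s ^ β)]
  · have h2 := mul_le_mul_of_nonneg_left (Real.rpow_le_rpow hs h hβ) hr
    rw [abs_of_nonpos (sub_nonpos.2 h)]
    refine le_trans ?_ (neg_le_abs _)
    linarith [mul_sub (s ^ β) s r, mul_comm s (s ^ β), mul_comm r (s ^ β),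
      mul_neg (s ^ β) (s - r)]

/-- The kernel derivative has mean zero, so the value at the centre may be subtracted. -/
theorem spGrad_eq_sub {k : ℕ} {e : EuclideanSpace ℝ (Fin n)} {B : ℝ} (hG : Measurable G)
    (hB : ∀ z, |G z| ≤ B) (z : EuclideanSpace ℝ (Fin n) × ℝ) :
    spGrad k e G z = ∫ x, fderiv ℝ (mollifier n k) (-x) e * (G (z.1 + x, z.2) - G z) := by
  have h0 : Integrable fun x ↦ fderiv ℝ (mollifier n k) (-x) e :=
    (integrable_fderiv_mollifier k e).comp_neg
  have h1 : Integrable fun x ↦ fderiv ℝ (mollifier n k) (-x) e * G (z.1 + x, z.2) :=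
    h0.mul_bdd (c := B) (hG.comp (by fun_prop)).aestronglyMeasurable
      (Eventually.of_forall fun x ↦ hB _)
  simp_rw [mul_sub]
  rw [integral_sub h1 (h0.mul_const _), integral_mul_const,
    integral_neg_eq_self (fun x ↦ fderiv ℝ (mollifier n k) x e), integral_fderiv_mollifier,
    zero_mul, sub_zero, spGrad,
    ← integral_add_left_eq_self (fun w ↦ fderiv ℝ (mollifier n k) (z.1 - w) e * G (w, z.2)) z.1]
  simp

/-- Weighted `L^p` bound for the mollified gradient of a Lipschitz function of `U`. -/
theorem exists_bound_spGrad {Ω : Set (EuclideanSpace ℝ (Fin n))} (hΩ : IsOpen Ω)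
    {U : EuclideanSpace ℝ (Fin n) × ℝ → ℝ} {P : Fin n → EuclideanSpace ℝ (Fin n) × ℝ → ℝ}
    (hP : ∀ i, HasWeakDirDeriv volume (Ω ×ˢ Ioi (0 : ℝ)) U (P i) (EuclideanSpace.single i 1, 0))
    (hU : LocallyIntegrableOn U (Ω ×ˢ Ioi (0 : ℝ)) volume)
    (hPm : ∀ i, Measurable (P i)) (hUm : Measurable U) (hU0 : ∀ z, 0 ≤ U z)
    {β p : ℝ} (hβ : 0 ≤ β) (hp : 1 < p)
    (hI : ∀ L ⊆ Ω ×ˢ Ioi (0 : ℝ), IsCompact L →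
      ∫⁻ z in L, ENNReal.ofReal (U z ^ β * ∑ i, |P i z|) ^ p < ⊤)
    {F : ℝ → ℝ} {B B' : ℝ} (hFm : Measurable F) (hFB' : ∀ z, |F (U z)| ≤ B')
    (hFB : ∀ s r, |F s - F r| ≤ B * |s - r|)
    {K : Set (EuclideanSpace ℝ (Fin n))} (hK : IsCompact K) (hKΩ : K ⊆ Ω) {J : Set ℝ}
    (hJ : IsCompact J) (hJ0 : J ⊆ Ioi 0) (e : EuclideanSpace ℝ (Fin n)) :
    ∃ C : ℝ≥0∞, C < ⊤ ∧ ∀ᶠ k in atTop,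
      ∫⁻ z in K ×ˢ J, ENNReal.ofReal (U z ^ β * |spGrad k e (fun z ↦ F (U z)) z|) ^ p ≤ C := by
  have hB0 : 0 ≤ B := by have := hFB 1 0; simp at this; exact (abs_nonneg _).trans this
  obtain ⟨D, hD0, hD⟩ := exists_fderiv_mollifier_bound n
  obtain ⟨δ, hδ, hδΩ⟩ := hK.exists_cthickening_subset_open hΩ hKΩ
  set L := Metric.cthickening δ K ×ˢ J with hL
  have hLc : IsCompact L := hK.cthickening.prod hJ
  have hLO : L ⊆ Ω ×ˢ Ioi (0 : ℝ) := prod_mono hδΩ hJ0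
  have hp0 : 0 ≤ p := by linarith
  set v : EuclideanSpace ℝ (Fin n) × ℝ → ℝ := fun z ↦ U z ^ (1 + β) with hv
  have hvm : Measurable v := hUm.pow_const _
  set I : ℝ≥0∞ := ∫⁻ z in L, ENNReal.ofReal (U z ^ β * ∑ i, |P i z|) ^ p with hIdef
  have hIfin : I < ⊤ := hI L hLO hLc
  -- differences in direction `x`
  have hdiff : ∀ x : EuclideanSpace ℝ (Fin n), ‖x‖ < δ →
      ∫⁻ z in K ×ˢ J, ‖v (z + (x, 0)) - v z‖ₑ ^ p
        ≤ ENNReal.ofReal ((1 + β) * ‖x‖) ^ p * I := fun x hx ↦ by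
    have hx1 : ∑ i, x i • ((EuclideanSpace.single i 1, 0) : EuclideanSpace ℝ (Fin n) × ℝ)
        = (x, 0) := by
      have h1 : ∑ i, x i • (EuclideanSpace.single i 1 : EuclideanSpace ℝ (Fin n)) = x := by
        simpa using (EuclideanSpace.basisFun (Fin n) ℝ).sum_repr x
      refine Prod.ext ?_ ?_
      · rw [Prod.fst_sum]; simpa using h1
      · rw [Prod.snd_sum]; simp
    have hw := HasWeakDirDeriv.sum hU hP x
    rw [hx1] at hw
    have hseg : ∀ z ∈ Metric.thickening (δ - ‖x‖) K ×ˢ Ioi (0 : ℝ), ∀ s ∈ Icc (0 : ℝ) 1,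
        z + s • (x, (0 : ℝ)) ∈ Ω ×ˢ Ioi (0 : ℝ) := fun z hz s hs ↦ by
      refine ⟨hδΩ ?_, by simpa using hz.2⟩
      obtain ⟨y, hy, hzy⟩ := Metric.mem_thickening_iff.1 hz.1
      refine Metric.mem_cthickening_of_dist_le _ y _ _ hy ?_
      have h1 : dist (z.1 + s • x) z.1 ≤ ‖x‖ := by
        simp only [dist_self_add_left, norm_smul, Real.norm_eq_abs, abs_of_nonneg hs.1]
        exact mul_le_of_le_one_left (norm_nonneg _) hs.2
      have h2 : (z + s • (x, (0 : ℝ))).1 = z.1 + s • x := rfl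
      rw [h2]
      linarith [dist_triangle (z.1 + s • x) z.1 y]
    have hKL : ∀ z ∈ K ×ˢ J, ∀ s ∈ Icc (0 : ℝ) 1, z + s • (x, (0 : ℝ)) ∈ L := fun z hz s hs ↦ by
      refine ⟨Metric.mem_cthickening_of_dist_le _ z.1 _ _ hz.1 ?_, by simpa using hz.2⟩
      have h2 : (z + s • (x, (0 : ℝ))).1 = z.1 + s • x := rfl
      rw [h2]
      simp only [dist_self_add_left, norm_smul, Real.norm_eq_abs, abs_of_nonneg hs.1]
      exact (mul_le_of_le_one_left (norm_nonneg _) hs.2).trans hx.le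
    have hKO' : K ×ˢ J ⊆ Metric.thickening (δ - ‖x‖) K ×ˢ Ioi (0 : ℝ) :=
      prod_mono (Metric.self_subset_thickening (by linarith) _) hJ0
    have hΩO : IsOpen (Ω ×ˢ Ioi (0 : ℝ)) := hΩ.prod isOpen_Ioi
    have := hw.lintegral_rpow_sub_le hΩO (by fun_prop) hUm hU0
      (Metric.isOpen_thickening.prod isOpen_Ioi) hseg hβ hp (hK.prod hJ).measurableSet hKO'
      hLc.measurableSet hKL
    refine this.trans ?_
    rw [hIdef, ← lintegral_const_mul _ (by fun_prop)]
    refine lintegral_mono fun z ↦ ?_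
    simp only
    rw [← ENNReal.mul_rpow_of_nonneg _ _ hp0, ← ENNReal.ofReal_mul (by positivity)]
    refine ENNReal.rpow_le_rpow (ENNReal.ofReal_le_ofReal ?_) hp0
    have h3 : |∑ i, x i * P i z| ≤ ‖x‖ * ∑ i, |P i z| := by
      rw [Finset.mul_sum]
      refine (Finset.abs_sum_le_sum_abs _ _).trans (Finset.sum_le_sum fun i _ ↦ ?_)
      rw [abs_mul]
      exact mul_le_mul_of_nonneg_right (PiLp.norm_apply_le x i) (abs_nonneg _)
    calc (1 + β) * U z ^ β * |∑ i, x i * P i z|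
        ≤ (1 + β) * U z ^ β * (‖x‖ * ∑ i, |P i z|) :=
          mul_le_mul_of_nonneg_left h3 (mul_nonneg (by linarith) (Real.rpow_nonneg (hU0 z) _))
      _ = _ := by ring
  set vb : ℝ≥0∞ := volume (Metric.ball (0 : EuclideanSpace ℝ (Fin n)) 1) with hvb
  have hvbfin : vb ≠ ⊤ := measure_ball_lt_top.ne
  -- The constant collects kernel slope (k+1)^(n+1), increment size r and ball volume r^n; since
  -- r(k+1) = 2 these combine to 2^(n+1) and k drops out.
  set A : ℝ≥0∞ := ENNReal.ofReal (2 ^ (n + 1) * D * ‖e‖ * B * (1 + β)) * vb with hA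
  refine ⟨A ^ p * I, ENNReal.mul_lt_top (ENNReal.rpow_lt_top_of_nonneg hp0
    (ENNReal.mul_ne_top ENNReal.ofReal_ne_top hvbfin)) hIfin, ?_⟩
  filter_upwards [mollRadius_tendsto.eventually (gt_mem_nhds hδ)] with k hk
  set r := mollRadius k with hr
  have hr0 : 0 < r := mollRadius_pos k
  set c : ℝ := D * ((k : ℝ) + 1) ^ (n + 1) * ‖e‖ * B with hc
  have hc0 : 0 ≤ c := by positivity
  set Br := Metric.closedBall (0 : EuclideanSpace ℝ (Fin n)) r with hBr
  have hvol : volume Br = ENNReal.ofReal (r ^ n) * vb := by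
    rw [hBr, Measure.addHaar_closedBall _ _ hr0.le]; simp [hvb]
  set N : EuclideanSpace ℝ (Fin n) → EuclideanSpace ℝ (Fin n) × ℝ → ℝ≥0∞ :=
    fun x z ↦ ENNReal.ofReal c * ‖v (z + (x, 0)) - v z‖ₑ with hN
  have hNm : Measurable (Function.uncurry N) := by
    have : Measurable fun q : EuclideanSpace ℝ (Fin n) × (EuclideanSpace ℝ (Fin n) × ℝ) ↦
        v (q.2 + (q.1, 0)) - v q.2 := (hvm.comp (by fun_prop)).sub (hvm.comp measurable_snd)
    exact this.enorm.const_mul _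
  -- The weight U(z)^β moves inside the integral and is absorbed into an increment of v = U^(1+β),
  -- the Lipschitz constant of F being part of c.
  have hpt : ∀ z, ENNReal.ofReal (U z ^ β * |spGrad k e (fun z ↦ F (U z)) z|)
      ≤ ∫⁻ x in Br, N x z := fun z ↦ by
    have hUβ : 0 ≤ U z ^ β := Real.rpow_nonneg (hU0 z) _
    rw [spGrad_eq_sub (G := fun z ↦ F (U z)) (hFm.comp hUm) hFB']
    have h1 : U z ^ β * |∫ x, fderiv ℝ (mollifier n k) (-x) e * (F (U (z.1 + x, z.2)) - F (U z))|
        = ‖∫ x, U z ^ β * (fderiv ℝ (mollifier n k) (-x) e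
          * (F (U (z.1 + x, z.2)) - F (U z)))‖ := by
      rw [integral_const_mul, norm_mul, Real.norm_of_nonneg hUβ, Real.norm_eq_abs]
    rw [h1, ofReal_norm]
    refine (enorm_integral_le_lintegral_enorm _).trans ?_
    rw [← lintegral_indicator measurableSet_closedBall]
    refine lintegral_mono fun x ↦ ?_
    by_cases hx : x ∈ Br
    · rw [indicator_of_mem hx]
      simp only [hN]
      rw [← ofReal_norm, ← ofReal_norm, ← ENNReal.ofReal_mul hc0]
      refine ENNReal.ofReal_le_ofReal ?_
      have h2 : z + (x, 0) = (z.1 + x, z.2) := by ext1 <;> simp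
      rw [h2, norm_mul, norm_mul, Real.norm_of_nonneg hUβ, Real.norm_eq_abs, Real.norm_eq_abs,
        Real.norm_eq_abs]
      have h3 := hD k (-x) e
      have h4 := hFB (U (z.1 + x, z.2)) (U z)
      have h5 := rpow_mul_abs_sub_le (hU0 z) (hU0 (z.1 + x, z.2)) hβ
      rw [abs_sub_comm, abs_sub_comm (U z ^ (1 + β))] at h5
      calc _ ≤ U z ^ β * ((D * ((k : ℝ) + 1) ^ (n + 1) * ‖e‖)
            * (B * |U (z.1 + x, z.2) - U z|)) := by gcongr
        _ = c * (U z ^ β * |U (z.1 + x, z.2) - U z|) := by rw [hc]; ring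
        _ ≤ _ := mul_le_mul_of_nonneg_left h5 hc0
    · rw [indicator_of_notMem hx]
      have h2 : fderiv ℝ (mollifier n k) (-x) = 0 := fderiv_mollifier_eq_zero (by
        simpa [hBr] using hx)
      simp [h2]
  calc ∫⁻ z in K ×ˢ J, ENNReal.ofReal (U z ^ β * |spGrad k e (fun z ↦ F (U z)) z|) ^ p
      ≤ ∫⁻ z in K ×ˢ J, volume Br ^ (p - 1) * ∫⁻ x in Br, N x z ^ p := by
        refine lintegral_mono fun z ↦ (ENNReal.rpow_le_rpow (hpt z) hp0).trans ?_
        have hm : Measurable fun x ↦ N x z := hNm.of_uncurry_right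
        have := lintegral_rpow_le_measure_univ_rpow_mul (ν := volume.restrict Br)
          hm.aemeasurable hp
        rwa [Measure.restrict_apply_univ] at this
    _ = volume Br ^ (p - 1) * ∫⁻ x in Br, ∫⁻ z in K ×ˢ J, N x z ^ p := by
        rw [lintegral_const_mul _ (Measurable.lintegral_prod_left (hNm.pow_const p)),
          lintegral_lintegral_swap]
        exact ((hNm.comp measurable_swap).pow_const p).aemeasurable
    _ ≤ volume Br ^ (p - 1) * ∫⁻ x in Br,
          ENNReal.ofReal c ^ p * (ENNReal.ofReal ((1 + β) * r) ^ p * I) := by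
        refine mul_le_mul_right (setLIntegral_mono measurable_const fun x hx ↦ ?_) _
        have hxr : ‖x‖ ≤ r := by simpa [hBr] using hx
        simp only [hN, ENNReal.mul_rpow_of_nonneg _ _ hp0]
        have hm : Measurable fun z ↦ ‖v (z + (x, 0)) - v z‖ₑ ^ p :=
          (((hvm.comp (by fun_prop)).sub hvm).enorm).pow_const p
        rw [lintegral_const_mul _ hm]
        gcongr
        refine (hdiff x (hxr.trans_lt hk)).trans ?_
        gcongr
    _ = (volume Br * ENNReal.ofReal (c * ((1 + β) * r))) ^ p * I := by
        rw [lintegral_const, Measure.restrict_apply_univ, ENNReal.ofReal_mul hc0,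
          ENNReal.mul_rpow_of_nonneg _ _ hp0, ENNReal.mul_rpow_of_nonneg _ _ hp0]
        have h1 : volume Br ^ p = volume Br ^ (p - 1) * volume Br := by
          conv_lhs => rw [show p = (p - 1) + 1 by ring]
          rw [ENNReal.rpow_add_of_nonneg _ _ (by linarith) zero_le_one, ENNReal.rpow_one]
        rw [h1]
        ring
    _ = A ^ p * I := by
        congr 2
        rw [hvol, hA, mul_right_comm, ← ENNReal.ofReal_mul (by positivity)]
        congr 2
        have h1 : r * ((k : ℝ) + 1) = 2 := by
          rw [hr, mollRadius]; field_simp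
        rw [hc, ← h1, mul_pow]
        ring

end SpatialMollification

/-! ### Locally Lipschitz functions with compact support. -/

section Lipschitz

theorem LocallyLipschitz.mul_real {X : Type*} [PseudoEMetricSpace X] {f g : X → ℝ}
    (hf : LocallyLipschitz f) (hg : LocallyLipschitz g) :
    LocallyLipschitz fun x ↦ f x * g x := by
  have h : LocallyLipschitz fun q : ℝ × ℝ ↦ q.1 * q.2 :=
    (contDiff_fst.mul contDiff_snd : ContDiff ℝ 1 fun q : ℝ × ℝ ↦ q.1 * q.2).locallyLipschitz
  exact h.comp (hf.prodMk hg)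

/-- Within distance one of the support the function is Lipschitz on a compact set; points farther
away have distance at least one from the support, so boundedness suffices there. -/
theorem exists_lipschitzWith_of_hasCompactSupport {X : Type*} [PseudoMetricSpace X] [ProperSpace X]
    {f : X → ℝ} (hf : LocallyLipschitz f) (hc : HasCompactSupport f) :
    ∃ C, LipschitzWith C f := by
  have hL : IsCompact (Metric.cthickening 1 (tsupport f)) := hc.cthickening
  obtain ⟨C, hC⟩ := (hf.locallyLipschitzOn (s := Metric.cthickening 1 (tsupport f))
    ).exists_lipschitzOnWith_of_compact hL
  obtain ⟨M, hM⟩ := hc.exists_bound_of_continuous hf.continuous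
  have hz : ∀ x ∉ tsupport f, f x = 0 := fun x hx ↦ image_eq_zero_of_notMem_tsupport hx
  have key : ∀ x y, x ∈ tsupport f → dist (f x) (f y) ≤ (max C M.toNNReal : NNReal) * dist x y := by
    intro x y hx
    by_cases hy : y ∈ Metric.cthickening 1 (tsupport f)
    · refine (hC.dist_le_mul x (Metric.self_subset_cthickening _ hx) y hy).trans ?_
      gcongr
      exact le_max_left _ _
    · have hy0 : f y = 0 := hz y fun h ↦ hy (Metric.self_subset_cthickening _ h)
      have hd : 1 ≤ dist x y := by
        by_contra h
        exact hy (Metric.mem_cthickening_of_dist_le y x _ _ hx (by rw [dist_comm]; linarith))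
      rw [hy0, dist_zero_right]
      calc ‖f x‖ ≤ M := hM x
        _ ≤ (M.toNNReal : ℝ) := Real.le_coe_toNNReal M
        _ ≤ (max C M.toNNReal : NNReal) := by exact_mod_cast le_max_right _ _
        _ ≤ _ := le_mul_of_one_le_right (NNReal.coe_nonneg _) hd
  refine ⟨max C M.toNNReal, LipschitzWith.of_dist_le_mul fun x y ↦ ?_⟩
  by_cases hx : x ∈ tsupport f
  · exact key x y hx
  by_cases hy : y ∈ tsupport f
  · rw [dist_comm, dist_comm x]; exact key y x hy
  · rw [hz x hx, hz y hy, dist_self]; positivity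

end Lipschitz

/-! ### Passage to the limit in products under a weighted L^p bound. -/

section Vitali

variable {X : Type*} [MeasurableSpace X] {μ : Measure X}

theorem lintegral_mul_enorm_le_of_bound {A S w H : X → ℝ} {p q : ℝ} (hpq : p.HolderConjugate q)
    (hS : AEMeasurable S μ) (hw : AEMeasurable w μ) (hH : AEMeasurable H μ)
    (hw0 : ∀ x, 0 ≤ w x) (hA : ∀ᵐ x ∂μ, |A x| ≤ S x * w x) :
    ∫⁻ x, ‖A x * H x‖ₑ ∂μ ≤ (∫⁻ x, ENNReal.ofReal (S x) ^ q ∂μ) ^ (1 / q)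
      * (∫⁻ x, ENNReal.ofReal (w x * |H x|) ^ p ∂μ) ^ (1 / p) := by
  refine le_trans (lintegral_mono_ae ?_) (ENNReal.lintegral_mul_le_Lp_mul_Lq μ hpq.symm
    hS.ennreal_ofReal (hw.mul hH.abs).ennreal_ofReal)
  filter_upwards [hA] with x hx
  simp only [Pi.mul_apply]
  rw [← ofReal_norm, norm_mul, Real.norm_eq_abs, Real.norm_eq_abs,
    ← ENNReal.ofReal_mul' (mul_nonneg (hw0 x) (abs_nonneg _)), ← mul_assoc]
  exact ENNReal.ofReal_le_ofReal (mul_le_mul_of_nonneg_right hx (abs_nonneg _))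

/-- Vitali's theorem. On any set s, Hölder bounds ∫ₛ |A H_k| by the L^q norm of S over s times a
constant, so absolute continuity of ∫ S^q gives uniform integrability; norm convergence of H_k is
never needed. Fatou gives integrability of the limit. -/
theorem tendsto_integral_mul_of_ae_tendsto_of_bound [IsFiniteMeasure μ]
    {A S w : X → ℝ} {H : ℕ → X → ℝ} {H' : X → ℝ} {p q : ℝ} (hpq : p.HolderConjugate q)
    (hAm : AEStronglyMeasurable A μ)
    (hS : AEMeasurable S μ) (hw : AEMeasurable w μ) (hH : ∀ k, AEMeasurable (H k) μ)
    (hw0 : ∀ x, 0 ≤ w x) (hA : ∀ᵐ x ∂μ, |A x| ≤ S x * w x)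
    (hSq : ∫⁻ x, ENNReal.ofReal (S x) ^ q ∂μ < ⊤) {C : ℝ≥0∞} (hC : C < ⊤)
    (hHC : ∀ᶠ k in atTop, ∫⁻ x, ENNReal.ofReal (w x * |H k x|) ^ p ∂μ ≤ C)
    (hlim : ∀ᵐ x ∂μ, Tendsto (fun k ↦ H k x) atTop (𝓝 (H' x))) :
    Integrable (fun x ↦ A x * H' x) μ ∧
      Tendsto (fun k ↦ ∫ x, A x * H k x ∂μ) atTop (𝓝 (∫ x, A x * H' x ∂μ)) := by
  obtain ⟨k0, hk0⟩ := eventually_atTop.1 hHC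
  have hp0 : 0 < p := hpq.pos
  have hq0 : 0 < q := hpq.symm.pos
  have hC1 : C ^ (1 / p) ≠ ⊤ := ENNReal.rpow_ne_top_of_nonneg (by positivity) hC.ne
  set f : ℕ → X → ℝ := fun k x ↦ A x * H (k + k0) x with hf
  have hfm : ∀ k, AEStronglyMeasurable (f k) μ := fun k ↦ hAm.mul (hH _).aestronglyMeasurable
  have hflim : ∀ᵐ x ∂μ, Tendsto (fun k ↦ f k x) atTop (𝓝 (A x * H' x)) := by
    filter_upwards [hlim] with x hx
    exact ((tendsto_add_atTop_iff_nat k0).2 hx).const_mul _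
  have hbd : ∀ (s : Set X), MeasurableSet s → ∀ k, ∫⁻ x in s, ‖f k x‖ₑ ∂μ
      ≤ (∫⁻ x in s, ENNReal.ofReal (S x) ^ q ∂μ) ^ (1 / q) * C ^ (1 / p) := fun s hs k ↦ by
    refine (lintegral_mul_enorm_le_of_bound hpq hS.restrict hw.restrict (hH _).restrict hw0
      (ae_restrict_of_ae hA)).trans ?_
    gcongr
    exact (setLIntegral_le_lintegral _ _).trans (hk0 _ (Nat.le_add_left _ _))
  have hg : MemLp (fun x ↦ A x * H' x) 1 μ := by
    refine ⟨aestronglyMeasurable_of_tendsto_ae atTop hfm hflim, ?_⟩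
    rw [eLpNorm_one_eq_lintegral_enorm]
    have h1 : ∫⁻ x, ‖A x * H' x‖ₑ ∂μ ≤ liminf (fun k ↦ ∫⁻ x, ‖f k x‖ₑ ∂μ) atTop := by
      refine le_trans (lintegral_mono_ae ?_) (lintegral_liminf_le' fun k ↦ (hfm k).enorm)
      filter_upwards [hflim] with x hx
      exact (hx.enorm.liminf_eq).ge
    have h2 : liminf (fun k ↦ ∫⁻ x, ‖f k x‖ₑ ∂μ) atTop
        ≤ (∫⁻ x, ENNReal.ofReal (S x) ^ q ∂μ) ^ (1 / q) * C ^ (1 / p) :=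
      liminf_le_of_frequently_le' (Frequently.of_forall fun k ↦ by
        simpa using hbd univ MeasurableSet.univ k)
    exact (h1.trans h2).trans_lt
      (ENNReal.mul_lt_top (ENNReal.rpow_lt_top_of_nonneg (by positivity) hSq.ne) hC1.lt_top)
  have hui : UnifIntegrable f 1 μ := by
    intro ε hε
    set D : ℝ≥0∞ := C ^ (1 / p) + 1 with hD
    have hD0 : D ≠ 0 := by simp [hD]
    have hDt : D ≠ ⊤ := ENNReal.add_ne_top.2 ⟨hC1, ENNReal.one_ne_top⟩
    -- Chosen so that η^(1/q) D = ε; the summand 1 in D excludes division by zero.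
    set η : ℝ≥0∞ := (ENNReal.ofReal ε / D) ^ q with hη
    have hη0 : η ≠ 0 := by
      have : 0 < ENNReal.ofReal ε / D := ENNReal.div_pos (by simpa using hε) hDt
      exact (ENNReal.rpow_pos this (ENNReal.div_lt_top ENNReal.ofReal_ne_top hD0).ne).ne'
    obtain ⟨δ, hδ, hδs⟩ := exists_pos_setLIntegral_lt_of_measure_lt hSq.ne hη0
    obtain ⟨δ', hδ', hδ'δ⟩ : ∃ δ' : ℝ, 0 < δ' ∧ ENNReal.ofReal δ' < δ := by
      obtain ⟨r, hr0, hr⟩ := ENNReal.lt_iff_exists_nnreal_btwn.1 hδ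
      exact ⟨r, by exact_mod_cast hr0, by simpa using hr⟩
    refine ⟨δ', hδ', fun k s hs hμs ↦ ?_⟩
    rw [eLpNorm_one_eq_lintegral_enorm]
    simp_rw [enorm_indicator_eq_indicator_enorm]
    rw [lintegral_indicator hs]
    have h1 := (hδs s (hμs.trans_lt hδ'δ)).le
    calc _ ≤ (∫⁻ x in s, ENNReal.ofReal (S x) ^ q ∂μ) ^ (1 / q) * C ^ (1 / p) := hbd s hs k
      _ ≤ η ^ (1 / q) * D := by
        gcongr
        exact le_self_add
      _ = ENNReal.ofReal ε := by
        rw [hη, ← ENNReal.rpow_mul, mul_one_div_cancel hq0.ne', ENNReal.rpow_one,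
          ENNReal.div_mul_cancel hD0 hDt]
  have hL := tendsto_Lp_finite_of_tendsto_ae le_rfl ENNReal.one_ne_top hfm hg hui hflim
  refine ⟨memLp_one_iff_integrable.1 hg, ?_⟩
  have hfi : ∀ k, Integrable (f k) μ := fun k ↦ by
    refine ⟨hfm k, ?_⟩
    have h1 := hbd univ MeasurableSet.univ k
    simp only [Measure.restrict_univ] at h1
    exact h1.trans_lt
      (ENNReal.mul_lt_top (ENNReal.rpow_lt_top_of_nonneg (by positivity) hSq.ne) hC1.lt_top)
  rw [← tendsto_add_atTop_iff_nat k0]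
  refine tendsto_integral_of_L1 _ hg.1 (Eventually.of_forall hfi) ?_
  refine hL.congr fun k ↦ ?_
  rw [eLpNorm_one_eq_lintegral_enorm]
  rfl

end Vitali

/-! ### Mollification in time, which makes the test functions Lipschitz. -/

section TimeMollification

variable {n : ℕ} {G : EuclideanSpace ℝ (Fin n) × ℝ → ℝ}

/-- The mollifier in the time variable. -/
def timeMollifier (j : ℕ) : ℝ → ℝ := (bumpSeq ℝ j).normed volume

/-- Mollification in the time variable. -/
def tmMoll (j : ℕ) (G : EuclideanSpace ℝ (Fin n) × ℝ → ℝ) (z : EuclideanSpace ℝ (Fin n) × ℝ) : ℝ :=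
  ∫ τ, timeMollifier j (z.2 - τ) * G (z.1, τ)

theorem timeMollifier_contDiff (j : ℕ) {m : ℕ∞} : ContDiff ℝ m (timeMollifier j) :=
  (bumpSeq ℝ j).contDiff_normed

theorem timeMollifier_nonneg (j : ℕ) (x) : 0 ≤ timeMollifier j x :=
  (bumpSeq ℝ j).nonneg_normed x

theorem timeMollifier_integral (j : ℕ) : ∫ x, timeMollifier j x = 1 :=
  (bumpSeq ℝ j).integral_normed

theorem timeMollifier_integrable (j : ℕ) : Integrable (timeMollifier j) :=
  (bumpSeq ℝ j).integrable_normed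

theorem timeMollifier_hasCompactSupport (j : ℕ) : HasCompactSupport (timeMollifier j) :=
  (bumpSeq ℝ j).hasCompactSupport_normed

theorem measurable_tmMoll (j : ℕ) (hG : Measurable G) : Measurable (tmMoll j G) := by
  have h : Measurable fun q : (EuclideanSpace ℝ (Fin n) × ℝ) × ℝ ↦
      timeMollifier j (q.1.2 - q.2) * G (q.1.1, q.2) :=
    ((timeMollifier_contDiff (m := 0) j).continuous.measurable.comp (by fun_prop)).mul
      (hG.comp (by fun_prop))
  exact (h.stronglyMeasurable.integral_prod_right' (ν := volume)).measurable

theorem abs_tmMoll_le (j : ℕ) {B : ℝ} (hB : ∀ z, |G z| ≤ B) (z) : |tmMoll j G z| ≤ B := by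
  have h1 : ∫ τ, |timeMollifier j (z.2 - τ)| = 1 := by
    simp_rw [abs_of_nonneg (timeMollifier_nonneg j _)]
    rw [integral_sub_left_eq_self (fun τ ↦ timeMollifier j τ), timeMollifier_integral]
  have h2 : Integrable (fun τ ↦ |timeMollifier j (z.2 - τ)| * B) :=
    ((timeMollifier_integrable j).comp_sub_left z.2).abs.mul_const B
  rw [← one_mul B, ← h1, ← integral_mul_const, ← Real.norm_eq_abs]
  refine norm_integral_le_of_norm_le h2 (Eventually.of_forall fun w ↦ ?_)
  rw [norm_mul (timeMollifier j (z.2 - w))]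
  exact mul_le_mul_of_nonneg_left (hB _) (norm_nonneg _)

theorem tmMoll_nonneg (j : ℕ) (hG : ∀ z, 0 ≤ G z) (z) : 0 ≤ tmMoll j G z :=
  integral_nonneg fun _ ↦ mul_nonneg (timeMollifier_nonneg j _) (hG _)

theorem tmMoll_ae_tendsto (hG : Measurable G) {B : ℝ} (hB : ∀ z, |G z| ≤ B) :
    ∀ᵐ z : EuclideanSpace ℝ (Fin n) × ℝ, Tendsto (fun j ↦ tmMoll j G z) atTop (𝓝 (G z)) := by
  have hms : MeasurableSet {z | Tendsto (fun j ↦ tmMoll j G z) atTop (𝓝 (G z))} := by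
    have h1 : {z | Tendsto (fun j ↦ tmMoll j G z) atTop (𝓝 (G z))}
        = {z | Tendsto (fun j ↦ tmMoll j G z - G z) atTop (𝓝 0)} := by
      ext z; exact tendsto_sub_nhds_zero_iff.symm
    rw [h1]
    exact measurableSet_tendsto _ fun j ↦ (measurable_tmMoll j hG).sub hG
  rw [Measure.volume_eq_prod, Measure.ae_prod_iff_ae_ae
    (p := fun z ↦ Tendsto (fun j ↦ tmMoll j G z) atTop (𝓝 (G z))) hms]
  refine Eventually.of_forall fun y ↦ ?_
  have hloc : LocallyIntegrable (fun τ ↦ G (y, τ)) volume :=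
    (locallyIntegrable_const B).mono (hG.comp (by fun_prop)).aestronglyMeasurable
      (Eventually.of_forall fun τ ↦ (hB _).trans (le_abs_self B))
  filter_upwards [ae_tendsto_bumpSeq_convolution volume hloc] with t ht
  refine ht.congr fun k ↦ ?_
  rw [convolution_eq_swap]
  rfl

/-- The space-time mollification is Lipschitz, with explicit spatial derivatives. -/
theorem tmMoll_spMoll_lipschitz (k j : ℕ) (hG : Measurable G) {B : ℝ} (hB : ∀ z, |G z| ≤ B) :
    LocallyLipschitz (tmMoll j (spMoll k G)) ∧
    ∀ z : EuclideanSpace ℝ (Fin n) × ℝ,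
      DifferentiableAt ℝ (fun y ↦ tmMoll j (spMoll k G) (y, z.2)) z.1 ∧
      ∀ e, fderiv ℝ (fun y ↦ tmMoll j (spMoll k G) (y, z.2)) z.1 e
        = tmMoll j (spGrad k e G) z := by
  -- The iterated mollification is one convolution with a smooth, compactly supported product
  -- kernel, so smoothness and derivatives can be read off from the kernel.
  set κ : EuclideanSpace ℝ (Fin n) × ℝ → ℝ := fun z ↦ mollifier n k z.1 * timeMollifier j z.2
    with hκ
  have hκs : ContDiff ℝ 1 κ :=
    ((mollifier_contDiff (m := 1) k).comp contDiff_fst).mul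
      ((timeMollifier_contDiff (m := 1) j).comp contDiff_snd)
  have hκc : HasCompactSupport κ :=
    HasCompactSupport.intro ((mollifier_hasCompactSupport k).prod
      (timeMollifier_hasCompactSupport j)) fun z hz ↦ by
      by_cases h1 : z.1 ∈ tsupport (mollifier n k)
      · have h2 : z.2 ∉ tsupport (timeMollifier j) := fun h ↦ hz ⟨h1, h⟩
        simp [hκ, image_eq_zero_of_notMem_tsupport h2]
      · simp [hκ, image_eq_zero_of_notMem_tsupport h1]
  have hloc : LocallyIntegrable G volume :=
    (locallyIntegrable_const B).mono hG.aestronglyMeasurable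
      (Eventually.of_forall fun τ ↦ (hB _).trans (le_abs_self B))
  set g := convolution κ G (ContinuousLinearMap.lsmul ℝ ℝ) volume with hg
  have hgs : ContDiff ℝ 1 g := hκc.contDiff_convolution_left (n := 1) _ hκs hloc
  -- a product kernel acts by successive integrations
  have hprod : ∀ {κ1 : EuclideanSpace ℝ (Fin n) → ℝ}, Continuous κ1 → Integrable κ1 →
      ∀ z : EuclideanSpace ℝ (Fin n) × ℝ,
      ∫ q : EuclideanSpace ℝ (Fin n) × ℝ, (κ1 (z.1 - q.1) * timeMollifier j (z.2 - q.2)) * G q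
        = ∫ τ, timeMollifier j (z.2 - τ) * ∫ w, κ1 (z.1 - w) * G (w, τ) := fun {κ1} hc hi z ↦ by
    have h1 : Integrable (fun q : EuclideanSpace ℝ (Fin n) × ℝ ↦
        (κ1 (z.1 - q.1) * timeMollifier j (z.2 - q.2)) * G q) :=
      ((hi.comp_sub_left z.1).mul_prod ((timeMollifier_integrable j).comp_sub_left z.2)).mul_bdd
        (c := B) hG.aestronglyMeasurable (Eventually.of_forall hB)
    rw [Measure.volume_eq_prod] at h1 ⊢
    rw [integral_prod_symm _ h1]
    refine integral_congr_ae (Eventually.of_forall fun τ ↦ ?_)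
    simp only
    rw [← integral_const_mul]
    refine integral_congr_ae (Eventually.of_forall fun w ↦ ?_)
    simp only
    ring
  have hgeq : g = tmMoll j (spMoll k G) := by
    funext z
    rw [hg, convolution_eq_swap]
    exact hprod (mollifier_contDiff (m := 0) k).continuous (mollifier_integrable k) z
  rw [← hgeq]
  refine ⟨hgs.locallyLipschitz, fun z ↦ ?_⟩
  have h1 := hκc.hasFDerivAt_convolution_left (ContinuousLinearMap.lsmul ℝ ℝ) hκs hloc z
  have h2 : HasFDerivAt (fun y ↦ g (y, z.2)) _ z.1 :=
    HasFDerivAt.comp (g := g) z.1 h1 (hasFDerivAt_prodMk_left z.1 z.2)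
  refine ⟨h2.differentiableAt, fun e ↦ ?_⟩
  rw [h2.fderiv]
  simp only [ContinuousLinearMap.comp_apply, ContinuousLinearMap.inl_apply]
  have hcf : HasCompactSupport (fderiv ℝ κ) := hκc.fderiv ℝ
  rw [convolution_eq_swap, ContinuousLinearMap.integral_apply]
  · have h3 : ∀ q, fderiv ℝ κ q (e, 0)
        = fderiv ℝ (mollifier n k) q.1 e * timeMollifier j q.2 := fun q ↦ by
      have h4 : HasFDerivAt (fun q : EuclideanSpace ℝ (Fin n) × ℝ ↦ mollifier n k q.1) _ q :=
        ((mollifier_contDiff (n := n) (m := 1) k).differentiable (by simp)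
          q.1).hasFDerivAt.comp q hasFDerivAt_fst
      have h5 : HasFDerivAt (fun q : EuclideanSpace ℝ (Fin n) × ℝ ↦ timeMollifier j q.2) _ q :=
        ((timeMollifier_contDiff (m := 1) j).differentiable (by simp)
          q.2).hasFDerivAt.comp q hasFDerivAt_snd
      have h6 : HasFDerivAt κ _ q := h4.mul h5
      rw [h6.fderiv]
      simp [mul_comm]
    simp only [ContinuousLinearMap.precompL_apply, h3]
    exact hprod (continuous_fderiv_mollifier k e) (integrable_fderiv_mollifier k e) z
  · exact (hcf.convolutionExists_left _ (hκs.continuous_fderiv (by simp)) hloc z).integrable_swap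

end TimeMollification

/-! ### Partial derivatives of Lipschitz functions on space-time. -/

section SliceDerivatives

variable {n : ℕ} {ψ : EuclideanSpace ℝ (Fin n) × ℝ → ℝ}

/-- The `i`-th spatial partial derivative. -/
def spDeriv (i : Fin n) (ψ : EuclideanSpace ℝ (Fin n) × ℝ → ℝ)
    (z : EuclideanSpace ℝ (Fin n) × ℝ) : ℝ :=
  fderiv ℝ (fun y ↦ ψ (y, z.2)) z.1 (EuclideanSpace.single i 1)

/-- The partial derivative in time. -/
def tmDeriv (ψ : EuclideanSpace ℝ (Fin n) × ℝ → ℝ) (z : EuclideanSpace ℝ (Fin n) × ℝ) : ℝ :=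
  deriv (fun s ↦ ψ (z.1, s)) z.2

theorem measurable_spDeriv (hψ : Continuous ψ) (i : Fin n) : Measurable (spDeriv i ψ) := by
  have h := measurable_fderiv_apply_const_with_param ℝ
    (f := fun (t : ℝ) (y : EuclideanSpace ℝ (Fin n)) ↦ ψ (y, t)) (by fun_prop)
    (EuclideanSpace.single i 1)
  exact h.comp measurable_swap

theorem measurable_tmDeriv (hψ : Continuous ψ) : Measurable (tmDeriv ψ) :=
  measurable_deriv_with_param (f := fun (y : EuclideanSpace ℝ (Fin n)) (t : ℝ) ↦ ψ (y, t))
    (by fun_prop)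

theorem abs_spDeriv_le {C : NNReal} (hψ : LipschitzWith C ψ) (i : Fin n) (z) :
    |spDeriv i ψ z| ≤ C := by
  have h : LipschitzWith C fun y ↦ ψ (y, z.2) := by
    simpa [Function.comp_def] using hψ.comp (LipschitzWith.prodMk_right z.2)
  refine ((fderiv ℝ (fun y ↦ ψ (y, z.2)) z.1).le_opNorm _).trans ?_
  rw [PiLp.norm_single, norm_one, mul_one]
  exact norm_fderiv_le_of_lipschitz ℝ h

theorem abs_tmDeriv_le {C : NNReal} (hψ : LipschitzWith C ψ) (z) : |tmDeriv ψ z| ≤ C := by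
  have h : LipschitzWith C fun s ↦ ψ (z.1, s) := by
    simpa [Function.comp_def] using hψ.comp (LipschitzWith.prodMk_left z.1)
  exact norm_deriv_le_of_lipschitz h

theorem spDeriv_eq_zero {i : Fin n} {z} (hz : z ∉ tsupport ψ) : spDeriv i ψ z = 0 := by
  have h : (fun y ↦ ψ (y, z.2)) =ᶠ[𝓝 z.1] fun _ ↦ 0 := by
    have h1 := notMem_tsupport_iff_eventuallyEq.1 hz
    exact (Continuous.tendsto (by fun_prop : Continuous fun y : EuclideanSpace ℝ (Fin n) ↦
      (y, z.2)) z.1).eventually h1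
  rw [spDeriv, h.fderiv_eq]
  simp

theorem tmDeriv_eq_zero {z} (hz : z ∉ tsupport ψ) : tmDeriv ψ z = 0 := by
  have h : (fun s ↦ ψ (z.1, s)) =ᶠ[𝓝 z.2] fun _ ↦ 0 := by
    have h1 := notMem_tsupport_iff_eventuallyEq.1 hz
    exact (Continuous.tendsto (by fun_prop : Continuous fun s : ℝ ↦ (z.1, s)) z.2).eventually h1
  rw [tmDeriv, h.deriv_eq]
  simp

theorem lineDeriv_mul_comp_fst (b : EuclideanSpace ℝ (Fin n) → ℝ) (z) :
    lineDeriv ℝ (fun z ↦ ψ z * b z.1) z (0, 1) = tmDeriv ψ z * b z.1 := by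
  have h1 : ∀ t : ℝ, (fun z ↦ ψ z * b z.1) (z + t • ((0 : EuclideanSpace ℝ (Fin n)), (1 : ℝ)))
      = ψ (z.1, z.2 + t) * b z.1 := fun t ↦ by
    have : z + t • ((0 : EuclideanSpace ℝ (Fin n)), (1 : ℝ)) = (z.1, z.2 + t) := by
      ext <;> simp
    simp only [this]
  rw [lineDeriv]
  simp_rw [h1]
  rw [deriv_mul_const_field, deriv_comp_const_add (fun s ↦ ψ (z.1, s)), add_zero]
  rfl

/-- The weight is controlled only on Ω, but off the support of ψ the product vanishes locally. -/
theorem locallyLipschitz_mul_comp_fst {Ω : Set (EuclideanSpace ℝ (Fin n))} (hΩ : IsOpen Ω)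
    {b : EuclideanSpace ℝ (Fin n) → ℝ} (hb : LocallyLipschitzOn Ω b) (hψ : LocallyLipschitz ψ)
    (hs : tsupport ψ ⊆ Ω ×ˢ Ioi (0 : ℝ)) : LocallyLipschitz fun z ↦ ψ z * b z.1 := by
  intro z
  by_cases hz : z ∈ tsupport ψ
  · have hO : IsOpen (Ω ×ˢ (univ : Set ℝ)) := hΩ.prod isOpen_univ
    have hzO : z ∈ Ω ×ˢ (univ : Set ℝ) := ⟨(hs hz).1, mem_univ _⟩
    have h1 : LocallyLipschitz fun w : (Ω ×ˢ (univ : Set ℝ) : Set _) ↦ b w.1.1 := by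
      have h2 : LocallyLipschitz (Ω.domRestrict b) := locallyLipschitzOn_iff_restrict.1 hb
      have h3 : LocallyLipschitz fun w : (Ω ×ˢ (univ : Set ℝ) : Set _) ↦
          (⟨w.1.1, w.2.1⟩ : Ω) :=
        (LipschitzWith.of_edist_le fun x y ↦ le_max_left _ _).locallyLipschitz
      exact h2.comp h3
    have h2 : LocallyLipschitz fun w : (Ω ×ˢ (univ : Set ℝ) : Set _) ↦ ψ w.1 * b w.1.1 :=
      LocallyLipschitz.mul_real (hψ.comp (LipschitzWith.subtype_val _).locallyLipschitz) h1
    have h3 : LocallyLipschitzOn (Ω ×ˢ (univ : Set ℝ)) fun z ↦ ψ z * b z.1 :=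
      locallyLipschitzOn_iff_restrict.2 h2
    obtain ⟨K, t, ht, hK⟩ := h3 hzO
    exact ⟨K, t, by rwa [hO.nhdsWithin_eq hzO] at ht, hK⟩
  · have h1 := notMem_tsupport_iff_eventuallyEq.1 hz
    refine ⟨0, _, h1, fun x hx y hy ↦ ?_⟩
    have hx' : ψ x = 0 := hx
    have hy' : ψ y = 0 := hy
    simp [hx', hy']

theorem ae_differentiableAt_slice {C : NNReal} (hψ : LipschitzWith C ψ) :
    ∀ᵐ z : EuclideanSpace ℝ (Fin n) × ℝ, DifferentiableAt ℝ (fun y ↦ ψ (y, z.2)) z.1 := by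
  filter_upwards [hψ.ae_differentiableAt (μ := volume)] with z hz
  exact DifferentiableAt.comp (g := ψ) z.1 hz
    (hasFDerivAt_prodMk_left z.1 z.2).differentiableAt

end SliceDerivatives

theorem tendsto_integral_mul_of_bounded {X : Type*} [MeasurableSpace X] {μ : Measure X}
    {c : X → ℝ} (hc : Integrable c μ) {H : ℕ → X → ℝ} {H' : X → ℝ} {B : ℝ}
    (hH : ∀ j, AEStronglyMeasurable (H j) μ) (hB : ∀ j x, |H j x| ≤ B)
    (hlim : ∀ᵐ x ∂μ, c x ≠ 0 → Tendsto (fun j ↦ H j x) atTop (𝓝 (H' x))) :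
    Tendsto (fun j ↦ ∫ x, c x * H j x ∂μ) atTop (𝓝 (∫ x, c x * H' x ∂μ)) := by
  refine tendsto_integral_of_dominated_convergence (fun x ↦ |c x| * B)
    (fun j ↦ hc.1.mul (hH j)) (hc.abs.mul_const B)
    (fun j ↦ Eventually.of_forall fun x ↦ ?_) ?_
  · rw [norm_mul]
    exact mul_le_mul_of_nonneg_left (hB j x) (norm_nonneg _)
  · filter_upwards [hlim] with x hx
    by_cases h : c x = 0
    · simp [h]
    · exact (hx h).const_mul _

/-! ### Testing Euclidean supersolutions with functions of the solution. -/

section Euclidean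

variable {n : ℕ}

/-- Weak supersolutions `b ∂ₜU ≥ div A + R` on `Ω × (0, ∞)`, with the integrability of the flux
`A` and of the gradient `P` that is needed in order to test with functions of `U`. -/
structure IsEuclideanSupersolution (Ω : Set (EuclideanSpace ℝ (Fin n)))
    (b : EuclideanSpace ℝ (Fin n) → ℝ) (β p q : ℝ) (U W : EuclideanSpace ℝ (Fin n) × ℝ → ℝ)
    (P A : Fin n → EuclideanSpace ℝ (Fin n) × ℝ → ℝ)
    (S R : EuclideanSpace ℝ (Fin n) × ℝ → ℝ) : Prop where
  isOpen : IsOpen Ω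
  weight : LocallyLipschitzOn Ω b
  conj : p.HolderConjugate q
  exponent : 0 ≤ β
  meas : Measurable U
  nonneg : ∀ z, 0 ≤ U z
  meas_grad : ∀ i, Measurable (P i)
  grad : ∀ i, HasWeakDirDeriv volume (Ω ×ˢ Ioi (0 : ℝ)) U (P i) (EuclideanSpace.single i 1, 0)
  time : HasWeakDirDeriv volume (Ω ×ˢ Ioi (0 : ℝ)) U W (0, 1)
  grad_int : ∀ L ⊆ Ω ×ˢ Ioi (0 : ℝ), IsCompact L →
    ∫⁻ z in L, ENNReal.ofReal (U z ^ β * ∑ i, |P i z|) ^ p < ⊤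
  reaction_locInt : LocallyIntegrableOn R (Ω ×ˢ Ioi (0 : ℝ)) volume
  flux_locInt : ∀ i, LocallyIntegrableOn (A i) (Ω ×ˢ Ioi (0 : ℝ)) volume
  flux_le : ∀ i, ∀ᵐ z ∂(volume.restrict (Ω ×ˢ Ioi (0 : ℝ))), |A i z| ≤ S z * U z ^ β
  flux_meas : AEMeasurable S (volume.restrict (Ω ×ˢ Ioi (0 : ℝ)))
  flux_int : ∀ L ⊆ Ω ×ˢ Ioi (0 : ℝ), IsCompact L → ∫⁻ z in L, ENNReal.ofReal (S z) ^ q < ⊤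
  test : ∀ ψ : EuclideanSpace ℝ (Fin n) × ℝ → ℝ, (∀ z, 0 ≤ ψ z) → LocallyLipschitz ψ →
    HasCompactSupport ψ → tsupport ψ ⊆ Ω ×ˢ Ioi (0 : ℝ) →
    ∫ z, ψ z * R z ≤ (∫ z, ∑ i, spDeriv i ψ z * A i z) - ∫ z, tmDeriv ψ z * (U z * b z.1)

namespace IsEuclideanSupersolution

variable {Ω : Set (EuclideanSpace ℝ (Fin n))}
    {b : EuclideanSpace ℝ (Fin n) → ℝ} {β p q : ℝ} {U W : EuclideanSpace ℝ (Fin n) × ℝ → ℝ}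
    {P A : Fin n → EuclideanSpace ℝ (Fin n) × ℝ → ℝ}
    {S R : EuclideanSpace ℝ (Fin n) × ℝ → ℝ}
    (h : IsEuclideanSupersolution Ω b β p q U W P A S R)
    {ψ : EuclideanSpace ℝ (Fin n) × ℝ → ℝ}
include h

theorem isOpen_prod : IsOpen (Ω ×ˢ Ioi (0 : ℝ)) := h.isOpen.prod isOpen_Ioi

/-- The weak chain rule in time is tested with ψb, whose time derivative is b ∂ₜψ because b is
independent of t. The Lipschitz property of the weight makes ψb admissible. -/
theorem integral_comp_mul_tmDeriv {F F' : ℝ → ℝ} (hF : ∀ s, HasDerivAt F (F' s) s)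
    (hF' : Continuous F') {B : ℝ} (hB : ∀ s, |F' s| ≤ B) (hψ : LocallyLipschitz ψ)
    (hc : HasCompactSupport ψ) (hs : tsupport ψ ⊆ Ω ×ˢ Ioi (0 : ℝ)) :
    ∫ z, F (U z) * (tmDeriv ψ z * b z.1) = -∫ z, F' (U z) * W z * (ψ z * b z.1) := by
  have hg := locallyLipschitz_mul_comp_fst h.isOpen h.weight hψ hs
  have hgc : HasCompactSupport fun z ↦ ψ z * b z.1 := hc.mul_right
  obtain ⟨C, hC⟩ := exists_lipschitzWith_of_hasCompactSupport hg hgc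
  have := h.time.integral_comp_mul_lineDeriv h.isOpen_prod hF hF' hB hC hgc
    ((tsupport_mul_subset_left (f := ψ) (g := fun z ↦ b z.1)).trans hs)
  simpa only [lineDeriv_mul_comp_fst] using this

theorem integrable_spDeriv_mul_flux (hψ : LocallyLipschitz ψ)
    (hc : HasCompactSupport ψ) (hs : tsupport ψ ⊆ Ω ×ˢ Ioi (0 : ℝ)) (i : Fin n) :
    Integrable fun z ↦ spDeriv i ψ z * A i z := by
  obtain ⟨C, hC⟩ := exists_lipschitzWith_of_hasCompactSupport hψ hc
  refine (integrable_mul_of_tsupport (h.flux_locInt i)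
    (measurable_spDeriv hψ.continuous i).aestronglyMeasurable (fun z ↦ abs_spDeriv_le hC i z)
    hc hs (fun z hz ↦ spDeriv_eq_zero hz)).congr (Eventually.of_forall fun z ↦ mul_comm _ _)

theorem integrable_mul (hψ : Continuous ψ) (hc : HasCompactSupport ψ)
    (hs : tsupport ψ ⊆ Ω ×ˢ Ioi (0 : ℝ)) {Q : EuclideanSpace ℝ (Fin n) × ℝ → ℝ}
    (hQ : LocallyIntegrableOn Q (Ω ×ˢ Ioi (0 : ℝ)) volume) : Integrable fun z ↦ ψ z * Q z := by
  obtain ⟨C, hC⟩ := hc.exists_bound_of_continuous hψ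
  exact (integrable_mul_of_tsupport hQ hψ.aestronglyMeasurable hC hc hs
    fun z hz ↦ image_eq_zero_of_notMem_tsupport hz).congr
      (Eventually.of_forall fun z ↦ mul_comm _ _)

theorem continuous_mul_weight (hψ : LocallyLipschitz ψ) (hs : tsupport ψ ⊆ Ω ×ˢ Ioi (0 : ℝ)) :
    Continuous fun z ↦ ψ z * b z.1 :=
  (locallyLipschitz_mul_comp_fst h.isOpen h.weight hψ hs).continuous

/-- The test inequality with the time derivative on the solution. -/
theorem test_time (hψ0 : ∀ z, 0 ≤ ψ z) (hψ : LocallyLipschitz ψ)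
    (hc : HasCompactSupport ψ) (hs : tsupport ψ ⊆ Ω ×ˢ Ioi (0 : ℝ)) :
    ∫ z, ψ z * R z ≤ (∑ i, ∫ z, spDeriv i ψ z * A i z) + ∫ z, (ψ z * b z.1) * W z := by
  have h1 := h.test ψ hψ0 hψ hc hs
  rw [integral_finsetSum _ fun i _ ↦ h.integrable_spDeriv_mul_flux hψ hc hs i] at h1
  have h2 := h.integral_comp_mul_tmDeriv (F := id) (F' := fun _ ↦ 1) (fun s ↦ hasDerivAt_id s)
    continuous_const (B := 1) (by simp) hψ hc hs
  simp only [id, one_mul] at h2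
  have h3 : ∫ z, tmDeriv ψ z * (U z * b z.1) = ∫ z, U z * (tmDeriv ψ z * b z.1) :=
    integral_congr_ae (Eventually.of_forall fun z ↦ by simp only; ring)
  have h4 : ∫ z, (ψ z * b z.1) * W z = ∫ z, W z * (ψ z * b z.1) :=
    integral_congr_ae (Eventually.of_forall fun z ↦ by simp only; ring)
  rw [h3, h2] at h1
  rw [h4]
  linarith

variable {F F' : ℝ → ℝ} (hF : ∀ s, HasDerivAt F (F' s) s)
    (hF' : Continuous F') {B B' : ℝ} (hB : ∀ s, |F' s| ≤ B) (hF0 : ∀ s, 0 ≤ F s)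
    (hFB : ∀ s, F s ≤ B')
include hF hF' hB hF0 hFB

/-- The test inequality with the test function `ψ` times the spatially mollified `F (U)`. -/
theorem test_spMoll (k : ℕ) (hψ0 : ∀ z, 0 ≤ ψ z) (hψ : LocallyLipschitz ψ)
    (hc : HasCompactSupport ψ) (hs : tsupport ψ ⊆ Ω ×ˢ Ioi (0 : ℝ)) :
    ∫ z, (ψ z * R z) * spMoll k (fun z ↦ F (U z)) z
      ≤ (∑ i, ((∫ z, (spDeriv i ψ z * A i z) * spMoll k (fun z ↦ F (U z)) z)
          + ∫ z, (ψ z * A i z) * spGrad k (EuclideanSpace.single i 1) (fun z ↦ F (U z)) z))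
        + ∫ z, ((ψ z * b z.1) * W z) * spMoll k (fun z ↦ F (U z)) z := by
  have hFc : Continuous F := continuous_iff_continuousAt.2 fun s ↦ (hF s).continuousAt
  set G : EuclideanSpace ℝ (Fin n) × ℝ → ℝ := fun z ↦ F (U z) with hG
  have hGm : Measurable G := hFc.measurable.comp h.meas
  have hGB : ∀ z, |G z| ≤ B' := fun z ↦ by rw [abs_of_nonneg (hF0 _)]; exact hFB _
  have hMm : Measurable (spMoll k G) := measurable_spMoll k hGm
  have hMB : ∀ z, |spMoll k G z| ≤ B' := abs_spMoll_le k hGB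
  have hDm : ∀ e, Measurable (spGrad k e G) := fun e ↦ measurable_spGrad k e hGm
  have hDB := fun e ↦ abs_spGrad_le k e hGB
  set g : ℕ → EuclideanSpace ℝ (Fin n) × ℝ → ℝ := fun j ↦ tmMoll j (spMoll k G) with hg
  have hgl : ∀ j, LocallyLipschitz (g j) := fun j ↦ (tmMoll_spMoll_lipschitz k j hGm hGB).1
  have hgB : ∀ j z, |g j z| ≤ B' := fun j ↦ abs_tmMoll_le j hMB
  obtain ⟨C, hC⟩ := exists_lipschitzWith_of_hasCompactSupport hψ hc
  have hiA := h.integrable_spDeriv_mul_flux hψ hc hs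
  have hiB : ∀ i, Integrable fun z ↦ ψ z * A i z := fun i ↦
    h.integrable_mul hψ.continuous hc hs (h.flux_locInt i)
  have hiR := h.integrable_mul hψ.continuous hc hs h.reaction_locInt
  have hiW : Integrable fun z ↦ (ψ z * b z.1) * W z :=
    h.integrable_mul (h.continuous_mul_weight hψ hs) hc.mul_right
      ((tsupport_mul_subset_left (f := ψ) (g := fun z ↦ b z.1)).trans hs) h.time.locInt_deriv
  -- The function ψ times the space-time mollification of F(U) is Lipschitz, hence admissible; the
  -- product rule for its slices holds wherever ψ is differentiable, that is almost everywhere.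
  have hj : ∀ j, ∫ z, (ψ z * R z) * g j z
      ≤ (∑ i, ((∫ z, (spDeriv i ψ z * A i z) * g j z)
          + ∫ z, (ψ z * A i z) * tmMoll j (spGrad k (EuclideanSpace.single i 1) G) z))
        + ∫ z, ((ψ z * b z.1) * W z) * g j z := fun j ↦ by
    have h1 := h.test_time (ψ := fun z ↦ ψ z * g j z)
      (fun z ↦ mul_nonneg (hψ0 z) (tmMoll_nonneg j (spMoll_nonneg k fun z ↦ hF0 _) z))
      (LocallyLipschitz.mul_real hψ (hgl j)) hc.mul_right
      ((tsupport_mul_subset_left (f := ψ) (g := g j)).trans hs)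
    have h2 : ∀ i, ∫ z, spDeriv i (fun z ↦ ψ z * g j z) z * A i z
        = (∫ z, (spDeriv i ψ z * A i z) * g j z)
          + ∫ z, (ψ z * A i z) * tmMoll j (spGrad k (EuclideanSpace.single i 1) G) z := fun i ↦ by
      rw [← integral_add ((hiA i).mul_bdd (c := B') (hgl j).continuous.aestronglyMeasurable
          (Eventually.of_forall (hgB j)))
        ((hiB i).mul_bdd (measurable_tmMoll j (hDm _)).aestronglyMeasurable
          (Eventually.of_forall (abs_tmMoll_le j (hDB _))))]
      refine integral_congr_ae ?_
      filter_upwards [ae_differentiableAt_slice hC] with z hz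
      obtain ⟨hd, he⟩ := (tmMoll_spMoll_lipschitz k j hGm hGB).2 z
      have h3 : HasFDerivAt (fun y ↦ ψ (y, z.2) * g j (y, z.2)) _ z.1 :=
        hz.hasFDerivAt.mul hd.hasFDerivAt
      simp only [spDeriv] at *
      rw [h3.fderiv]
      simp only [add_apply, smul_apply, smul_eq_mul, he]
      ring
    simp only [h2] at h1
    convert h1 using 1
    · exact integral_congr_ae (Eventually.of_forall fun z ↦ by simp only; ring)
    · congr 1
      exact integral_congr_ae (Eventually.of_forall fun z ↦ by simp only; ring)
  -- The time scale tends to zero with k fixed. All mollified factors are then bounded by constants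
  -- depending on k alone, and dominated convergence suffices.
  have hgt := tmMoll_ae_tendsto hMm hMB
  have hgm : ∀ j, AEStronglyMeasurable (g j) volume := fun j ↦
    (hgl j).continuous.aestronglyMeasurable
  have key : ∀ {c : EuclideanSpace ℝ (Fin n) × ℝ → ℝ}, Integrable c →
      Tendsto (fun j ↦ ∫ z, c z * g j z) atTop (𝓝 (∫ z, c z * spMoll k G z)) := fun hc ↦
    tendsto_integral_mul_of_bounded hc hgm hgB (hgt.mono fun _ hz _ ↦ hz)
  refine le_of_tendsto_of_tendsto' (key hiR) ?_ hj
  refine Tendsto.add (tendsto_finsetSum _ fun i _ ↦ (key (hiA i)).add ?_) (key hiW)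
  exact tendsto_integral_mul_of_bounded (hiB i)
    (fun j ↦ (measurable_tmMoll j (hDm _)).aestronglyMeasurable)
    (fun j ↦ abs_tmMoll_le j (hDB _)) ((tmMoll_ae_tendsto (hDm _) (hDB _)).mono fun _ hz _ ↦ hz)

/-- Where the mollification ball fits into Ω, the gradient of the mollification is the mollification
of F'(U)P, to which Lebesgue differentiation applies. The exceptional times depend on the point and
are assembled by Fubini. -/
theorem spGrad_ae_tendsto {K : Set (EuclideanSpace ℝ (Fin n))} (hK : IsCompact K) (hKΩ : K ⊆ Ω)
    {J : Set ℝ} (hJ : IsCompact J) (hJ0 : J ⊆ Ioi 0) (i : Fin n) :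
    ∀ᵐ z : EuclideanSpace ℝ (Fin n) × ℝ, z ∈ K ×ˢ J →
      Tendsto (fun k ↦ spGrad k (EuclideanSpace.single i 1) (fun z ↦ F (U z)) z) atTop
        (𝓝 (F' (U z) * P i z)) := by
  have hFc : Continuous F := continuous_iff_continuousAt.2 fun s ↦ (hF s).continuousAt
  have hw := (h.grad i).comp h.isOpen_prod h.meas hF hF' hB
  have hQm : Measurable fun z ↦ F' (U z) * P i z :=
    (hF'.measurable.comp h.meas).mul (h.meas_grad i)
  have hGm : Measurable fun z ↦ F (U z) := hFc.measurable.comp h.meas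
  obtain ⟨δ, hδ, hδΩ⟩ := hK.exists_cthickening_subset_open h.isOpen hKΩ
  obtain ⟨k0, hk0⟩ := eventually_atTop.1 (mollRadius_tendsto.eventually (gt_mem_nhds hδ))
  have heq : ∀ᵐ z : EuclideanSpace ℝ (Fin n) × ℝ, ∀ k, k0 ≤ k → z ∈ K ×ˢ J →
      spGrad k (EuclideanSpace.single i 1) (fun z ↦ F (U z)) z
        = spMoll k (fun z ↦ F' (U z) * P i z) z := by
    refine ae_all_iff.2 fun k ↦ ?_
    by_cases hk : k0 ≤ k
    swap
    · exact Eventually.of_forall fun z h ↦ absurd h hk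
    have hms : MeasurableSet {z : EuclideanSpace ℝ (Fin n) × ℝ | k0 ≤ k → z ∈ K ×ˢ J →
        spGrad k (EuclideanSpace.single i 1) (fun z ↦ F (U z)) z
          = spMoll k (fun z ↦ F' (U z) * P i z) z} := by
      have h1 := measurableSet_eq_fun (measurable_spGrad k (EuclideanSpace.single i 1) hGm)
        (measurable_spMoll k hQm)
      have h2 : MeasurableSet (K ×ˢ J) := hK.measurableSet.prod hJ.measurableSet
      have h3 : {z : EuclideanSpace ℝ (Fin n) × ℝ | k0 ≤ k → z ∈ K ×ˢ J →
          spGrad k (EuclideanSpace.single i 1) (fun z ↦ F (U z)) z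
          = spMoll k (fun z ↦ F' (U z) * P i z) z} = (K ×ˢ J)ᶜ ∪ {z |
          spGrad k (EuclideanSpace.single i 1) (fun z ↦ F (U z)) z
          = spMoll k (fun z ↦ F' (U z) * P i z) z} := by
        ext z
        simp only [hk, forall_const, mem_ofPred_eq, mem_union, mem_compl_iff, imp_iff_not_or]
      rw [h3]
      exact h2.compl.union h1
    rw [Measure.volume_eq_prod]
    rw [Measure.ae_prod_iff_ae_ae hms]
    refine Eventually.of_forall fun y ↦ ?_
    by_cases hy : y ∈ K
    · have hyΩ : Metric.closedBall y (mollRadius k) ⊆ Ω :=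
        ((Metric.closedBall_subset_closedBall (hk0 k hk).le).trans
          (Metric.closedBall_subset_cthickening hy δ)).trans hδΩ
      filter_upwards [hw.spGrad_eq k hyΩ] with τ hτ _ hz
      exact hτ (hJ0 hz.2)
    · exact Eventually.of_forall fun τ _ hz ↦ absurd hz.1 hy
  filter_upwards [heq, spMoll_ae_tendsto h.isOpen hQm hw.locInt_deriv hK hKΩ hJ hJ0]
    with z hz1 hz2 hz
  refine (hz2 hz).congr' ?_
  filter_upwards [eventually_ge_atTop k0] with k hk
  exact (hz1 k hk hz).symm

/-- Testing a supersolution with functions of the solution itself. -/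
theorem test_comp {Φ : ℝ → ℝ} (hΦ : ∀ s, HasDerivAt Φ (F s) s)
    (hψ0 : ∀ z, 0 ≤ ψ z) (hψ : LocallyLipschitz ψ)
    (hc : HasCompactSupport ψ) (hs : tsupport ψ ⊆ Ω ×ˢ Ioi (0 : ℝ)) :
    (∀ i, Integrable fun z ↦ (ψ z * A i z) * (F' (U z) * P i z)) ∧
    ∫ z, (ψ z * R z) * F (U z)
      ≤ (∑ i, ((∫ z, (spDeriv i ψ z * A i z) * F (U z))
          + ∫ z, (ψ z * A i z) * (F' (U z) * P i z)))
        - ∫ z, Φ (U z) * (tmDeriv ψ z * b z.1) := by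
  have hFc : Continuous F := continuous_iff_continuousAt.2 fun s ↦ (hF s).continuousAt
  have hFabs : ∀ s, |F s| ≤ B' := fun s ↦ by rw [abs_of_nonneg (hF0 s)]; exact hFB s
  have hGm : Measurable fun z ↦ F (U z) := hFc.measurable.comp h.meas
  have hGB : ∀ z, |F (U z)| ≤ B' := fun z ↦ hFabs _
  set K := Prod.fst '' tsupport ψ with hKdef
  set J := Prod.snd '' tsupport ψ with hJdef
  have hK : IsCompact K := hc.isCompact.image continuous_fst
  have hJ : IsCompact J := hc.isCompact.image continuous_snd
  have hKΩ : K ⊆ Ω := by rintro _ ⟨z, hz, rfl⟩; exact (hs hz).1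
  have hJ0 : J ⊆ Ioi 0 := by rintro _ ⟨z, hz, rfl⟩; exact (hs hz).2
  have hL : IsCompact (K ×ˢ J) := hK.prod hJ
  have hLO : K ×ˢ J ⊆ Ω ×ˢ Ioi (0 : ℝ) := prod_mono hKΩ hJ0
  have hzL : ∀ z ∉ K ×ˢ J, ψ z = 0 := fun z hz ↦ image_eq_zero_of_notMem_tsupport fun h' ↦
    hz (mk_mem_prod (mem_image_of_mem _ h') (mem_image_of_mem _ h'))
  have hzD : ∀ i, ∀ z ∉ K ×ˢ J, spDeriv i ψ z = 0 := fun i z hz ↦ spDeriv_eq_zero fun h' ↦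
    hz (mk_mem_prod (mem_image_of_mem _ h') (mem_image_of_mem _ h'))
  have hGl : LocallyIntegrable (fun z ↦ F (U z)) volume :=
    (locallyIntegrable_const B').mono hGm.aestronglyMeasurable
      (Eventually.of_forall fun τ ↦ (hGB _).trans (le_abs_self B'))
  have hGt := spMoll_ae_tendsto h.isOpen hGm (hGl.locallyIntegrableOn _) hK hKΩ hJ hJ0
  have hiA := h.integrable_spDeriv_mul_flux hψ hc hs
  have hiB : ∀ i, Integrable fun z ↦ ψ z * A i z := fun i ↦
    h.integrable_mul hψ.continuous hc hs (h.flux_locInt i)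
  have hiR := h.integrable_mul hψ.continuous hc hs h.reaction_locInt
  have hiW : Integrable fun z ↦ (ψ z * b z.1) * W z :=
    h.integrable_mul (h.continuous_mul_weight hψ hs) hc.mul_right
      ((tsupport_mul_subset_left (f := ψ) (g := fun z ↦ b z.1)).trans hs) h.time.locInt_deriv
  have key : ∀ {c : EuclideanSpace ℝ (Fin n) × ℝ → ℝ}, Integrable c → (∀ z ∉ K ×ˢ J, c z = 0) →
      Tendsto (fun k ↦ ∫ z, c z * spMoll k (fun z ↦ F (U z)) z) atTop
        (𝓝 (∫ z, c z * F (U z))) := fun hc hcz ↦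
    tendsto_integral_mul_of_bounded hc (fun k ↦ (measurable_spMoll k hGm).aestronglyMeasurable)
      (fun k ↦ abs_spMoll_le k hGB) (hGt.mono fun z hz hcne ↦ hz (by
        by_contra hn
        exact hcne (hcz z hn)))
  obtain ⟨Cψ, hCψ⟩ := hc.exists_bound_of_continuous hψ.continuous
  have : IsFiniteMeasure (volume.restrict (K ×ˢ J)) := ⟨by
    rw [Measure.restrict_apply_univ]; exact hL.measure_lt_top⟩
  have hrle : volume.restrict (K ×ˢ J) ≤ volume.restrict (Ω ×ˢ Ioi (0 : ℝ)) :=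
    Measure.restrict_mono hLO le_rfl
  have hq0 : 0 < q := h.conj.symm.pos
  have hCψ0 : 0 ≤ Cψ := (norm_nonneg _).trans (hCψ 0)
  -- The delicate limit. The flux is at most S U^β with S in L^q, while U^β times the mollified
  -- gradient is bounded in L^p uniformly in k, so Vitali's theorem applies with almost everywhere
  -- convergence.
  have hvit : ∀ i, Integrable (fun z ↦ (ψ z * A i z) * (F' (U z) * P i z))
      (volume.restrict (K ×ˢ J)) ∧
      Tendsto (fun k ↦ ∫ z in K ×ˢ J, (ψ z * A i z)
          * spGrad k (EuclideanSpace.single i 1) (fun z ↦ F (U z)) z) atTop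
        (𝓝 (∫ z in K ×ˢ J, (ψ z * A i z) * (F' (U z) * P i z))) := fun i ↦ by
    obtain ⟨D, hD, hDk⟩ := exists_bound_spGrad h.isOpen h.grad (h.grad i).locInt h.meas_grad h.meas
      h.nonneg h.exponent h.conj.lt h.grad_int hFc.measurable hGB
      (abs_sub_le_of_hasDerivAt_bounded hF hB) hK hKΩ hJ hJ0 (EuclideanSpace.single i 1)
    refine tendsto_integral_mul_of_ae_tendsto_of_bound h.conj (hiB i).1.restrict
      (S := fun z ↦ Cψ * S z) (w := fun z ↦ U z ^ β)
      ((h.flux_meas.mono_measure hrle).const_mul _) (h.meas.pow_const _).aemeasurable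
      (fun k ↦ (measurable_spGrad k _ hGm).aemeasurable)
      (fun z ↦ Real.rpow_nonneg (h.nonneg z) _) ?_ ?_ hD hDk ?_
    · filter_upwards [ae_mono hrle (h.flux_le i)] with z hz
      rw [abs_mul, mul_assoc]
      exact mul_le_mul (hCψ z) hz (abs_nonneg _) hCψ0
    · have h1 : ∀ z, ENNReal.ofReal (Cψ * S z) ^ q
          = ENNReal.ofReal Cψ ^ q * ENNReal.ofReal (S z) ^ q := fun z ↦ by
        rw [ENNReal.ofReal_mul hCψ0, ENNReal.mul_rpow_of_nonneg _ _ hq0.le]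
      simp_rw [h1]
      rw [lintegral_const_mul' _ _ (ENNReal.rpow_ne_top_of_nonneg hq0.le ENNReal.ofReal_ne_top)]
      exact ENNReal.mul_lt_top
        (ENNReal.rpow_lt_top_of_nonneg hq0.le ENNReal.ofReal_ne_top) (h.flux_int _ hLO hL)
    · exact (ae_restrict_iff' hL.measurableSet).2
        (h.spGrad_ae_tendsto hF hF' hB hF0 hFB hK hKΩ hJ hJ0 i)
  have hres : ∀ (i) (H : EuclideanSpace ℝ (Fin n) × ℝ → ℝ),
      ∫ z in K ×ˢ J, (ψ z * A i z) * H z = ∫ z, (ψ z * A i z) * H z := fun i H ↦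
    setIntegral_eq_integral_of_forall_compl_eq_zero fun z hz ↦ by simp [hzL z hz]
  simp only [hres] at hvit
  refine ⟨fun i ↦ (integrableOn_iff_integrable_of_support_subset fun z hz ↦ ?_).1 (hvit i).1, ?_⟩
  · by_contra hn
    exact hz (by simp [hzL z hn])
  -- The time term has the bounded limit factor F(U); the chain rule with primitive Φ then returns
  -- the derivative to ψ.
  have hW : -∫ z, Φ (U z) * (tmDeriv ψ z * b z.1) = ∫ z, ((ψ z * b z.1) * W z) * F (U z) := by
    rw [h.integral_comp_mul_tmDeriv hΦ hFc hFabs hψ hc hs, neg_neg]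
    exact integral_congr_ae (Eventually.of_forall fun z ↦ by simp only; ring)
  rw [sub_eq_add_neg, hW]
  refine le_of_tendsto_of_tendsto' (key hiR fun z hz ↦ by simp [hzL z hz]) ?_
    (fun k ↦ h.test_spMoll hF hF' hB hF0 hFB k hψ0 hψ hc hs)
  refine Tendsto.add (tendsto_finsetSum _ fun i _ ↦ (key (hiA i) fun z hz ↦ by
    simp [hzD i z hz]).add (hvit i).2) (key hiW fun z hz ↦ by simp [hzL z hz])

end IsEuclideanSupersolution

end Euclidean

/-! ### Length structure and the Hopf-Rinow theorem. -/

section LengthSpace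

/-- The Riemannian distance is a length distance: there are almost midpoints. -/
theorem exists_dist_le_dist_le (n : ℕ) {M : Type*} [MetricSpace M]
    [ChartedSpace (EuclideanSpace ℝ (Fin n)) M] [IsManifold (𝓡 n) ∞ M]
    [RiemannianBundle (fun x : M ↦ TangentSpace (𝓡 n) x)]
    [IsRiemannianManifold (𝓡 n) M]
    {x y : M} {r s : ℝ} (hr : 0 ≤ r) (hs : 0 ≤ s)
    (hrs : dist x y < r + s) : ∃ z, dist x z ≤ r ∧ dist z y ≤ s := by
  rcases le_or_gt (dist x y) r with h | h
  · exact ⟨y, h, by simpa using hs⟩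
  have h1 : Manifold.riemannianEDist (𝓡 n) x y < ENNReal.ofReal (r + s) := by
    rw [← IsRiemannianManifold.out (I := 𝓡 n) x y, edist_dist]
    exact (ENNReal.ofReal_lt_ofReal_iff (dist_nonneg.trans_lt hrs)).2 hrs
  obtain ⟨γ, h0, hγ1, hγ, hl⟩ := Manifold.exists_lt_of_riemannianEDist_lt h1
  have hc : ContinuousOn (fun t ↦ dist x (γ t)) (Icc 0 1) :=
    (continuous_const.dist continuous_id).comp_continuousOn hγ.continuousOn
  -- The intermediate point lies at distance exactly r on a curve of length less than r + s; the arc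
  -- up to it has length at least r, so less than s remains.
  obtain ⟨t, ht, htr⟩ := intermediate_value_Icc zero_le_one hc
    (show r ∈ Icc (dist x (γ 0)) (dist x (γ 1)) by rw [h0, hγ1, dist_self]; exact ⟨hr, h.le⟩)
  refine ⟨γ t, htr.le, ?_⟩
  have e1 : edist x (γ t) ≤ Manifold.pathELength (𝓡 n) γ 0 t := by
    rw [IsRiemannianManifold.out (I := 𝓡 n)]
    exact Manifold.riemannianEDist_le_pathELength
      (hγ.mono (Icc_subset_Icc_right ht.2)) h0 rfl ht.1
  have e2 : edist (γ t) y ≤ Manifold.pathELength (𝓡 n) γ t 1 := by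
    rw [IsRiemannianManifold.out (I := 𝓡 n)]
    exact Manifold.riemannianEDist_le_pathELength
      (hγ.mono (Icc_subset_Icc_left ht.1)) rfl hγ1 ht.2
  have e3 := Manifold.pathELength_add (I := 𝓡 n) (γ := γ) ht.1 ht.2
  have e4 : ENNReal.ofReal r + edist (γ t) y < ENNReal.ofReal r + ENNReal.ofReal s := by
    rw [← ENNReal.ofReal_add hr hs]
    refine lt_of_le_of_lt ?_ hl
    rw [← e3]
    refine add_le_add (le_trans ?_ e1) e2
    rw [edist_dist]
    simp only at htr
    rw [htr]
  have e5 := lt_of_add_lt_add_left e4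
  rw [edist_dist] at e5
  exact (ENNReal.ofReal_lt_ofReal_iff'.1 e5).1.le

/-- Hopf-Rinow: in a complete Riemannian manifold closed balls are compact. -/
theorem properSpace_of_completeSpace (n : ℕ) (M : Type*) [MetricSpace M]
    [ChartedSpace (EuclideanSpace ℝ (Fin n)) M] [IsManifold (𝓡 n) ∞ M]
    [RiemannianBundle (fun x : M ↦ TangentSpace (𝓡 n) x)]
    [IsRiemannianManifold (𝓡 n) M]
    [CompleteSpace M] : ProperSpace M := by
  have : LocallyCompactSpace M := Manifold.locallyCompact_of_finiteDimensional (𝓡 n)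
  refine ⟨fun x ↦ ?_⟩
  set A : Set ℝ := {r | IsCompact (Metric.closedBall x r)} with hA
  have hmono : ∀ {r s}, r ∈ A → s ≤ r → s ∈ A := fun {r s} hr hs ↦
    IsCompact.of_isClosed_subset hr Metric.isClosed_closedBall (Metric.closedBall_subset_closedBall hs)
  have h0 : (0 : ℝ) ∈ A := by simp [hA]
  -- the supremum is attained
  have hsup : ∀ R : ℝ, 0 < R → (∀ r < R, r ∈ A) → R ∈ A := fun R hR hr ↦ by
    refine isCompact_iff_totallyBounded_isComplete.2
      ⟨?_, Metric.isClosed_closedBall.isComplete⟩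
    refine Metric.totallyBounded_iff.2 fun ε hε ↦ ?_
    -- Every point of the R-ball lies within 2δ ≤ ε/2 of the compact (R - δ)-ball, so an ε/2-net of
    -- the latter is an ε-net of the former.
    set δ := min (ε / 4) R with hδ
    have hδ0 : 0 < δ := lt_min (by linarith) hR
    obtain ⟨t, ht, htc⟩ := Metric.totallyBounded_iff.1
      (hr (R - δ) (by linarith)).totallyBounded (ε / 2) (by linarith)
    refine ⟨t, ht, fun y hy ↦ ?_⟩
    obtain ⟨z, hz1, hz2⟩ := exists_dist_le_dist_le n (x := x) (y := y) (r := R - δ) (s := 2 * δ)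
      (by linarith [min_le_right (ε / 4) R]) (by linarith)
      (by rw [Metric.mem_closedBall, dist_comm] at hy; linarith)
    obtain ⟨w, hw, hzw⟩ := mem_iUnion₂.1 (htc (by rwa [Metric.mem_closedBall, dist_comm]))
    refine mem_iUnion₂.2 ⟨w, hw, ?_⟩
    rw [Metric.mem_ball] at hzw ⊢
    have := dist_triangle_left y w z
    linarith [min_le_left (ε / 4) R]
  -- A compact ball has a compact neighbourhood containing a δ-thickening of it, and by the length
  -- property a slightly larger ball lies in that thickening.
  have hopen : ∀ R ∈ A, 0 ≤ R → ∃ R' > R, R' ∈ A := fun R hR hR0 ↦ by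
    obtain ⟨K, hK, hRK⟩ := exists_compact_superset hR
    obtain ⟨δ, hδ, hδK⟩ := IsCompact.exists_thickening_subset_open hR isOpen_interior hRK
    refine ⟨R + δ / 4, by linarith, IsCompact.of_isClosed_subset hK Metric.isClosed_closedBall
      fun y hy ↦ interior_subset (hδK ?_)⟩
    obtain ⟨z, hz1, hz2⟩ := exists_dist_le_dist_le n (x := x) (y := y) (r := R) (s := δ / 2)
      hR0 (by linarith) (by rw [Metric.mem_closedBall, dist_comm] at hy; linarith)
    refine Metric.mem_thickening_iff.2 ⟨z, by rwa [Metric.mem_closedBall, dist_comm], ?_⟩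
    rw [dist_comm]; linarith
  by_contra hne
  push Not at hne
  obtain ⟨r, hr⟩ := hne
  have hr0 : ∀ s ∈ A, s < r := fun s hs ↦ lt_of_not_ge fun h ↦ hr (hmono hs h)
  have hbdd : BddAbove A := ⟨r, fun s hs ↦ (hr0 s hs).le⟩
  have hS0 : 0 ≤ sSup A := le_csSup hbdd h0
  have hSA : sSup A ∈ A := by
    rcases hS0.eq_or_lt with h | h
    · rw [← h]; exact h0
    · refine hsup _ h fun s hs ↦ ?_
      obtain ⟨s', hs', hss'⟩ := exists_lt_of_lt_csSup ⟨0, h0⟩ hs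
      exact hmono hs' hss'.le
  obtain ⟨R', hR', hR'A⟩ := hopen _ hSA hS0
  exact absurd (le_csSup hbdd hR'A) (not_le.2 hR')

end LengthSpace

/-! ### Tangent vectors, metric and derivatives in chart coordinates. -/

section ChartCalculus

variable {n : ℕ} {M : Type*} [MetricSpace M]
    [ChartedSpace (EuclideanSpace ℝ (Fin n)) M] [IsManifold (𝓡 n) ∞ M]

theorem isOpen_chart_target (c : M) : IsOpen (extChartAt (𝓡 n) c).target :=
  isOpen_extChartAt_target c

theorem contMDiffOn_chart_symm (c : M) :
    ContMDiffOn 𝓘(ℝ, EuclideanSpace ℝ (Fin n)) (𝓡 n) ∞ (extChartAt (𝓡 n) c).symm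
      (extChartAt (𝓡 n) c).target :=
  contMDiffOn_extChartAt_symm c

theorem mdifferentiableAt_chart_symm {c : M} {y : EuclideanSpace ℝ (Fin n)}
    (hy : y ∈ (extChartAt (𝓡 n) c).target) :
    MDifferentiableAt 𝓘(ℝ, EuclideanSpace ℝ (Fin n)) (𝓡 n) (extChartAt (𝓡 n) c).symm y :=
  ((contMDiffOn_chart_symm c).contMDiffAt ((isOpen_chart_target c).mem_nhds hy)).mdifferentiableAt
    (by simp)

theorem mdifferentiableAt_chart {c x : M} (hx : x ∈ (extChartAt (𝓡 n) c).source) :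
    MDifferentiableAt (𝓡 n) 𝓘(ℝ, EuclideanSpace ℝ (Fin n)) (extChartAt (𝓡 n) c) x :=
  mdifferentiableAt_extChartAt (by rwa [← extChartAt_source (I := 𝓡 n)])

/-- The coordinates of a tangent vector in the chart around `c`. -/
def chartCoord (c x : M) (v : TangentSpace (𝓡 n) x) : EuclideanSpace ℝ (Fin n) :=
  mfderiv (𝓡 n) 𝓘(ℝ, EuclideanSpace ℝ (Fin n)) (extChartAt (𝓡 n) c) x v

theorem chartCoord_zero (c x : M) : chartCoord (n := n) c x 0 = 0 :=
  ContinuousLinearMap.map_zero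
    (mfderiv (𝓡 n) 𝓘(ℝ, EuclideanSpace ℝ (Fin n)) (extChartAt (𝓡 n) c) x)

theorem mfderiv_chart_symm_apply (c : M) (y w : EuclideanSpace ℝ (Fin n)) :
    mfderiv 𝓘(ℝ, EuclideanSpace ℝ (Fin n)) (𝓡 n) (extChartAt (𝓡 n) c).symm y w
      = ∑ i, w i • coordVec c i y := by
  have h : w = ∑ i, w i • EuclideanSpace.single i (1 : ℝ) := by
    ext j
    simp [Finset.sum_apply, Pi.single_apply]
  conv_lhs => rw [h]
  exact (map_sum _ _ _).trans (Finset.sum_congr rfl fun i _ ↦ map_smul _ _ _)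

theorem sum_chartCoord_smul_coordVec {c : M} {y : EuclideanSpace ℝ (Fin n)}
    (hy : y ∈ (extChartAt (𝓡 n) c).target)
    (v : TangentSpace (𝓡 n) ((extChartAt (𝓡 n) c).symm y)) :
    ∑ i, chartCoord c _ v i • coordVec c i y = v := by
  rw [← mfderiv_chart_symm_apply]
  have h := mfderivWithin_extChartAt_symm_comp_mfderiv_extChartAt (I := 𝓡 n) hy
  rw [ModelWithCorners.range_eq_univ, mfderivWithin_univ] at h
  exact DFunLike.congr_fun h v

theorem chartCoord_mfderiv_symm {c : M} {y : EuclideanSpace ℝ (Fin n)}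
    (hy : y ∈ (extChartAt (𝓡 n) c).target) (w : EuclideanSpace ℝ (Fin n)) :
    chartCoord c _ (mfderiv 𝓘(ℝ, EuclideanSpace ℝ (Fin n)) (𝓡 n) (extChartAt (𝓡 n) c).symm y w)
      = w := by
  have h := mfderiv_extChartAt_comp_mfderivWithin_extChartAt_symm (I := 𝓡 n) hy
  rw [ModelWithCorners.range_eq_univ, mfderivWithin_univ] at h
  exact DFunLike.congr_fun h w

theorem linearIndependent_coordVec {c : M} {y : EuclideanSpace ℝ (Fin n)}
    (hy : y ∈ (extChartAt (𝓡 n) c).target) :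
    LinearIndependent ℝ fun i : Fin n ↦ coordVec c i y := by
  rw [Fintype.linearIndependent_iff]
  intro g hg i
  have h1 : ∑ i, g i • coordVec c i y = ∑ i, (WithLp.toLp 2 g : EuclideanSpace ℝ (Fin n)) i
    • coordVec c i y := rfl
  rw [h1, ← mfderiv_chart_symm_apply] at hg
  have h2 := chartCoord_mfderiv_symm hy (WithLp.toLp 2 g)
  rw [hg] at h2
  rw [chartCoord_zero] at h2
  have := congrArg (fun w : EuclideanSpace ℝ (Fin n) ↦ w i) h2
  simpa using this.symm

/-- The derivative of a function in the coordinates of a chart. -/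
theorem dirDeriv_eq_fderiv {c : M} {y : EuclideanSpace ℝ (Fin n)}
    (hy : y ∈ (extChartAt (𝓡 n) c).target) (g : M → ℝ)
    (v : TangentSpace (𝓡 n) ((extChartAt (𝓡 n) c).symm y)) :
    dirDeriv g _ v = fderiv ℝ (fun y ↦ g ((extChartAt (𝓡 n) c).symm y)) y (chartCoord c _ v) := by
  set x := (extChartAt (𝓡 n) c).symm y with hx
  have hxs : x ∈ (extChartAt (𝓡 n) c).source := (extChartAt (𝓡 n) c).map_target hy
  have hxy : extChartAt (𝓡 n) c x = y := (extChartAt (𝓡 n) c).right_inv hy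
  have hev : g =ᶠ[𝓝 x] (fun y ↦ g ((extChartAt (𝓡 n) c).symm y)) ∘ extChartAt (𝓡 n) c := by
    filter_upwards [(isOpen_extChartAt_source (I := 𝓡 n) c).mem_nhds hxs] with x' hx'
    rw [Function.comp_apply, (extChartAt (𝓡 n) c).left_inv hx']
  by_cases hd : DifferentiableAt ℝ (fun y ↦ g ((extChartAt (𝓡 n) c).symm y)) y
  · rw [← hxy] at hd
    have h1 : mfderiv (𝓡 n) 𝓘(ℝ, ℝ) g x = (mfderiv 𝓘(ℝ, EuclideanSpace ℝ (Fin n)) 𝓘(ℝ, ℝ)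
        (fun y ↦ g ((extChartAt (𝓡 n) c).symm y)) (extChartAt (𝓡 n) c x)).comp
        (mfderiv (𝓡 n) 𝓘(ℝ, EuclideanSpace ℝ (Fin n)) (extChartAt (𝓡 n) c) x) := by
      rw [hev.mfderiv_eq]
      exact mfderiv_comp x hd.mdifferentiableAt (mdifferentiableAt_chart hxs)
    rw [dirDeriv, h1, mfderiv_eq_fderiv, hxy]
    rfl
  -- Differentiability in the chart and on the manifold are equivalent, so otherwise both
  -- derivatives take the default value zero.
  · rw [fderiv_zero_of_not_differentiableAt hd]
    have h1 : ¬ MDifferentiableAt (𝓡 n) 𝓘(ℝ, ℝ) g x := fun h ↦ hd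
      (MDifferentiableAt.comp y h (mdifferentiableAt_chart_symm hy)).differentiableAt
    rw [dirDeriv, mfderiv_zero_of_not_mdifferentiableAt h1]
    rfl

section Metric

variable [RiemannianBundle (fun x : M ↦ TangentSpace (𝓡 n) x)]

/-- The components `gᵢⱼ` of the metric in the coordinates around `c`. -/
def metricCoeff (c : M) (i j : Fin n) (y : EuclideanSpace ℝ (Fin n)) : ℝ :=
  inner ℝ (coordVec c i y) (coordVec c j y)

/-- The matrix of the metric in the coordinates around `c`. -/
def metricMatrix (c : M) (y : EuclideanSpace ℝ (Fin n)) : Matrix (Fin n) (Fin n) ℝ :=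
  Matrix.of fun i j ↦ metricCoeff c i j y

theorem volDensity_eq (c : M) (y : EuclideanSpace ℝ (Fin n)) :
    volDensity c y = √(metricMatrix c y).det := rfl

theorem posDef_metricMatrix {c : M} {y : EuclideanSpace ℝ (Fin n)}
    (hy : y ∈ (extChartAt (𝓡 n) c).target) : (metricMatrix c y).PosDef :=
  Matrix.posDef_gram_of_linearIndependent (linearIndependent_coordVec hy)

theorem volDensity_pos {c : M} {y : EuclideanSpace ℝ (Fin n)}
    (hy : y ∈ (extChartAt (𝓡 n) c).target) : 0 < volDensity c y :=
  Real.sqrt_pos.2 (posDef_metricMatrix hy).det_pos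

theorem inner_coordVec {c : M} {y : EuclideanSpace ℝ (Fin n)}
    (hy : y ∈ (extChartAt (𝓡 n) c).target)
    (v : TangentSpace (𝓡 n) ((extChartAt (𝓡 n) c).symm y)) (j : Fin n) :
    inner ℝ v (coordVec c j y) = ∑ i, chartCoord c _ v i * metricCoeff c i j y := by
  conv_lhs => rw [← sum_chartCoord_smul_coordVec hy v]
  rw [sum_inner]
  exact Finset.sum_congr rfl fun i _ ↦ real_inner_smul_left _ _ _

theorem inner_eq_sum {c x : M} (hx : x ∈ (extChartAt (𝓡 n) c).source)
    (v w : TangentSpace (𝓡 n) x) : inner ℝ v w = ∑ i, ∑ j, chartCoord c x v i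
      * chartCoord c x w j * metricCoeff c i j (extChartAt (𝓡 n) c x) := by
  obtain ⟨y, hy, rfl⟩ : ∃ y ∈ (extChartAt (𝓡 n) c).target, (extChartAt (𝓡 n) c).symm y = x :=
    ⟨_, (extChartAt (𝓡 n) c).map_source hx, (extChartAt (𝓡 n) c).left_inv hx⟩
  rw [(extChartAt (𝓡 n) c).right_inv hy]
  conv_lhs => rw [← sum_chartCoord_smul_coordVec hy w]
  rw [inner_sum, Finset.sum_comm]
  refine Finset.sum_congr rfl fun j _ ↦ ?_
  rw [real_inner_smul_right, inner_coordVec hy, Finset.mul_sum]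
  exact Finset.sum_congr rfl fun i _ ↦ by ring

/-- The coordinate fields are images of constant fields under the tangent map of the inverse chart,
hence smooth sections; the bundle metric is smooth on them. -/
theorem contDiffOn_metricCoeff
    [IsContMDiffRiemannianBundle (𝓡 n) ∞ (EuclideanSpace ℝ (Fin n))
      (fun x : M ↦ TangentSpace (𝓡 n) x)] (c : M) (i j : Fin n) :
    ContDiffOn ℝ ∞ (metricCoeff c i j) (extChartAt (𝓡 n) c).target := by
  have hv : ∀ i : Fin n, ContMDiffOn 𝓘(ℝ, EuclideanSpace ℝ (Fin n)) (𝓡 n).tangent ∞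
      (fun y ↦ (⟨(extChartAt (𝓡 n) c).symm y, coordVec c i y⟩ : TangentBundle (𝓡 n) M))
      (extChartAt (𝓡 n) c).target := fun i ↦ by
    have h1 := (contMDiffOn_chart_symm (n := n) c).contMDiffOn_tangentMapWithin
      (m := ∞) (by simp) (isOpen_chart_target c).uniqueMDiffOn
    have h2 : ContMDiffOn 𝓘(ℝ, EuclideanSpace ℝ (Fin n))
        𝓘(ℝ, EuclideanSpace ℝ (Fin n)).tangent ∞ (fun y : EuclideanSpace ℝ (Fin n) ↦
        (⟨y, EuclideanSpace.single i (1 : ℝ)⟩ :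
          TangentBundle 𝓘(ℝ, EuclideanSpace ℝ (Fin n)) (EuclideanSpace ℝ (Fin n))))
        (extChartAt (𝓡 n) c).target :=
      contMDiffOn_vectorSpace_iff_contDiffOn.2 contDiffOn_const
    refine (h1.comp h2 fun y hy ↦ hy).congr fun y hy ↦ ?_
    simp only [Function.comp_apply, tangentMapWithin]
    rw [mfderivWithin_of_isOpen (isOpen_chart_target c) hy]
    rfl
  exact contMDiffOn_iff_contDiffOn.1 ((hv i).inner_bundle (hv j))

/-- The components `gⁱʲ` of the inverse metric. -/
def metricInv (c : M) (i j : Fin n) (y : EuclideanSpace ℝ (Fin n)) : ℝ := (metricMatrix c y)⁻¹ i j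

/-- A bound for tangent vectors in terms of their coordinates. -/
def frameBound (n : ℕ) {M : Type*} [MetricSpace M] [ChartedSpace (EuclideanSpace ℝ (Fin n)) M]
    [RiemannianBundle (fun x : M ↦ TangentSpace (𝓡 n) x)]
    (c : M) (y : EuclideanSpace ℝ (Fin n)) : ℝ := ∑ i, √(metricCoeff c i i y)

/-- A bound for the coordinates of tangent vectors. -/
def coordBound (n : ℕ) {M : Type*} [MetricSpace M] [ChartedSpace (EuclideanSpace ℝ (Fin n)) M]
    [RiemannianBundle (fun x : M ↦ TangentSpace (𝓡 n) x)]
    (c : M) (y : EuclideanSpace ℝ (Fin n)) : ℝ :=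
  ∑ i, ∑ j, √(metricCoeff c j j y) * |metricInv c j i y|

theorem norm_coordVec (c : M) (i : Fin n) (y : EuclideanSpace ℝ (Fin n)) :
    ‖coordVec c i y‖ = √(metricCoeff c i i y) :=
  norm_eq_sqrt_real_inner _

theorem abs_inner_coordVec_le (c : M) (y : EuclideanSpace ℝ (Fin n))
    (v : TangentSpace (𝓡 n) ((extChartAt (𝓡 n) c).symm y)) (i : Fin n) :
    |inner ℝ v (coordVec c i y)| ≤ ‖v‖ * √(metricCoeff c i i y) := by
  rw [← norm_coordVec]
  exact abs_real_inner_le_norm _ _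

theorem chartCoord_eq_sum {c : M} {y : EuclideanSpace ℝ (Fin n)}
    (hy : y ∈ (extChartAt (𝓡 n) c).target)
    (v : TangentSpace (𝓡 n) ((extChartAt (𝓡 n) c).symm y)) (i : Fin n) :
    chartCoord c _ v i = ∑ j, inner ℝ v (coordVec c j y) * metricInv c j i y := by
  have h1 : (fun j ↦ inner ℝ v (coordVec c j y))
      = Matrix.vecMul (fun i ↦ chartCoord c _ v i) (metricMatrix c y) := by
    funext j
    rw [inner_coordVec hy]
    rfl
  have h2 : IsUnit (metricMatrix c y).det := (posDef_metricMatrix hy).det_pos.ne'.isUnit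
  have h3 := congrArg (fun w ↦ Matrix.vecMul w (metricMatrix c y)⁻¹ i) h1
  simp only [Matrix.vecMul_vecMul, Matrix.mul_nonsing_inv _ h2, Matrix.vecMul_one] at h3
  exact h3.symm

theorem norm_sq_eq_sum {c : M} {y : EuclideanSpace ℝ (Fin n)}
    (hy : y ∈ (extChartAt (𝓡 n) c).target)
    (v : TangentSpace (𝓡 n) ((extChartAt (𝓡 n) c).symm y)) :
    ‖v‖ ^ 2 = ∑ i, inner ℝ v (coordVec c i y) * chartCoord c _ v i := by
  rw [← real_inner_self_eq_norm_sq]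
  conv_lhs => rw [← sum_chartCoord_smul_coordVec hy v]
  rw [sum_inner]
  refine Finset.sum_congr rfl fun i _ ↦ ?_
  rw [real_inner_smul_left, sum_chartCoord_smul_coordVec hy v, mul_comm, real_inner_comm]

theorem sum_abs_chartCoord_le {c : M} {y : EuclideanSpace ℝ (Fin n)}
    (hy : y ∈ (extChartAt (𝓡 n) c).target)
    (v : TangentSpace (𝓡 n) ((extChartAt (𝓡 n) c).symm y)) :
    ∑ i, |chartCoord c _ v i| ≤ coordBound n c y * ‖v‖ := by
  rw [coordBound, Finset.sum_mul]
  refine Finset.sum_le_sum fun i _ ↦ ?_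
  rw [chartCoord_eq_sum hy, Finset.sum_mul]
  refine (Finset.abs_sum_le_sum_abs _ _).trans (Finset.sum_le_sum fun j _ ↦ ?_)
  rw [abs_mul]
  calc _ ≤ (‖v‖ * √(metricCoeff c j j y)) * |metricInv c j i y| :=
        mul_le_mul_of_nonneg_right (abs_inner_coordVec_le c y v j) (abs_nonneg _)
    _ = _ := by ring

theorem coordBound_nonneg (c : M) (y : EuclideanSpace ℝ (Fin n)) : 0 ≤ coordBound n c y := by
  unfold coordBound; positivity

theorem norm_chartCoord_le {c : M} {y : EuclideanSpace ℝ (Fin n)}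
    (hy : y ∈ (extChartAt (𝓡 n) c).target)
    (v : TangentSpace (𝓡 n) ((extChartAt (𝓡 n) c).symm y)) :
    ‖chartCoord c _ v‖ ≤ coordBound n c y * ‖v‖ := by
  refine le_trans ?_ (sum_abs_chartCoord_le hy v)
  set w := chartCoord c _ v
  have h : w = ∑ i, w i • EuclideanSpace.single i (1 : ℝ) := by
    ext j
    simp [Finset.sum_apply, Pi.single_apply]
  conv_lhs => rw [h]
  refine (norm_sum_le _ _).trans (Finset.sum_le_sum fun i _ ↦ ?_)
  rw [norm_smul, PiLp.norm_single, norm_one, mul_one, Real.norm_eq_abs]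

theorem norm_mfderiv_chart_symm_le (c : M) (y w : EuclideanSpace ℝ (Fin n)) :
    ‖mfderiv 𝓘(ℝ, EuclideanSpace ℝ (Fin n)) (𝓡 n) (extChartAt (𝓡 n) c).symm y w‖
      ≤ frameBound n c y * ‖w‖ := by
  rw [mfderiv_chart_symm_apply, frameBound, Finset.sum_mul]
  refine (norm_sum_le _ _).trans (Finset.sum_le_sum fun i _ ↦ ?_)
  rw [norm_smul, norm_coordVec, mul_comm]
  exact mul_le_mul_of_nonneg_left (PiLp.norm_apply_le w i) (Real.sqrt_nonneg _)

theorem norm_sq_mfderiv_chart_symm (c : M) (y w : EuclideanSpace ℝ (Fin n)) :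
    ‖mfderiv 𝓘(ℝ, EuclideanSpace ℝ (Fin n)) (𝓡 n) (extChartAt (𝓡 n) c).symm y w‖ ^ 2
      = ∑ i, ∑ j, w i * w j * metricCoeff c i j y := by
  rw [← real_inner_self_eq_norm_sq, mfderiv_chart_symm_apply, sum_inner]
  refine Finset.sum_congr rfl fun i _ ↦ ?_
  rw [inner_sum]
  refine Finset.sum_congr rfl fun j _ ↦ ?_
  rw [real_inner_smul_left, real_inner_smul_right, metricCoeff]
  ring

variable [IsContMDiffRiemannianBundle (𝓡 n) ∞ (EuclideanSpace ℝ (Fin n))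
      (fun x : M ↦ TangentSpace (𝓡 n) x)]

theorem continuousOn_metricCoeff (c : M) (i j : Fin n) :
    ContinuousOn (metricCoeff c i j) (extChartAt (𝓡 n) c).target :=
  (contDiffOn_metricCoeff c i j).continuousOn

theorem contDiffOn_det_metricMatrix (c : M) :
    ContDiffOn ℝ ∞ (fun y ↦ (metricMatrix (n := n) c y).det) (extChartAt (𝓡 n) c).target := by
  simp only [Matrix.det_apply']
  exact ContDiffOn.sum fun σ _ ↦ contDiffOn_const.mul
    (contDiffOn_prod fun i _ ↦ contDiffOn_metricCoeff c _ _)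

theorem contDiffOn_volDensity (c : M) :
    ContDiffOn ℝ ∞ (volDensity (n := n) c) (extChartAt (𝓡 n) c).target :=
  (contDiffOn_det_metricMatrix c).sqrt fun _ hy ↦ (posDef_metricMatrix hy).det_pos.ne'

theorem continuousOn_metricInv (c : M) (i j : Fin n) :
    ContinuousOn (metricInv c i j) (extChartAt (𝓡 n) c).target := by
  have h1 : ContinuousOn (fun y ↦ metricMatrix (n := n) c y) (extChartAt (𝓡 n) c).target :=
    continuousOn_pi.2 fun i ↦ continuousOn_pi.2 fun j ↦ continuousOn_metricCoeff c i j
  have h2 : ContinuousOn (fun y ↦ (metricMatrix (n := n) c y).adjugate i j)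
      (extChartAt (𝓡 n) c).target :=
    (((continuous_id (X := Matrix (Fin n) (Fin n) ℝ)).matrix_adjugate.matrix_elem i
      j).comp_continuousOn h1)
  have h3 : ContinuousOn (fun y ↦ ((metricMatrix (n := n) c y).det)⁻¹)
      (extChartAt (𝓡 n) c).target :=
    (contDiffOn_det_metricMatrix c).continuousOn.inv₀ fun y hy ↦
      (posDef_metricMatrix hy).det_pos.ne'
  refine (h3.mul h2).congr fun y _ ↦ ?_
  rw [metricInv, Matrix.inv_def, Ring.inverse_eq_inv', Matrix.smul_apply, smul_eq_mul]
  rfl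

theorem continuousOn_frameBound (c : M) :
    ContinuousOn (frameBound n c) (extChartAt (𝓡 n) c).target :=
  continuousOn_finsetSum _ fun i _ ↦ (continuousOn_metricCoeff c i i).sqrt

theorem continuousOn_coordBound (c : M) :
    ContinuousOn (coordBound n c) (extChartAt (𝓡 n) c).target :=
  continuousOn_finsetSum _ fun i _ ↦ continuousOn_finsetSum _ fun j _ ↦
    (continuousOn_metricCoeff c j j).sqrt.mul (continuousOn_metricInv c j i).abs

variable [IsRiemannianManifold (𝓡 n) M]

/-- The Riemannian distance is at most the length of the image of the coordinate segment. -/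
theorem dist_chart_symm_le {c : M} {y w : EuclideanSpace ℝ (Fin n)} {B : ℝ}
    (hy : ∀ s ∈ Icc (0 : ℝ) 1, y + s • w ∈ (extChartAt (𝓡 n) c).target)
    (hB : ∀ s ∈ Icc (0 : ℝ) 1, ‖mfderiv 𝓘(ℝ, EuclideanSpace ℝ (Fin n)) (𝓡 n)
      (extChartAt (𝓡 n) c).symm (y + s • w) w‖ ≤ B) :
    dist ((extChartAt (𝓡 n) c).symm y) ((extChartAt (𝓡 n) c).symm (y + w)) ≤ B := by
  have hB0 : 0 ≤ B := (norm_nonneg _).trans (hB 0 (by simp))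
  set l : ℝ → EuclideanSpace ℝ (Fin n) := fun s ↦ y + s • w with hl
  have hld : ContDiff ℝ ∞ l := by fun_prop
  have hlm : ContMDiffOn 𝓘(ℝ, ℝ) 𝓘(ℝ, EuclideanSpace ℝ (Fin n)) ∞ l (Icc 0 1) :=
    hld.contMDiff.contMDiffOn
  have hγ : ContMDiffOn 𝓘(ℝ, ℝ) (𝓡 n) 1 (fun s ↦ (extChartAt (𝓡 n) c).symm (l s)) (Icc 0 1) :=
    (((contMDiffOn_chart_symm c).comp hlm hy).of_le (by simp))
  have h1 := Manifold.riemannianEDist_le_pathELength (I := 𝓡 n) (x := (extChartAt (𝓡 n) c).symm y)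
    (y := (extChartAt (𝓡 n) c).symm (y + w)) hγ (by simp [hl]) (by simp [hl]) zero_le_one
  rw [← IsRiemannianManifold.out (I := 𝓡 n)] at h1
  have h2 : Manifold.pathELength (𝓡 n) (fun s ↦ (extChartAt (𝓡 n) c).symm (l s)) 0 1
      ≤ ENNReal.ofReal B := by
    rw [Manifold.pathELength_eq_lintegral_mfderiv_Icc]
    calc _ ≤ ∫⁻ s in Icc (0 : ℝ) 1, ENNReal.ofReal B := by
          refine setLIntegral_mono' measurableSet_Icc fun s hs ↦ ?_
          have h3 : mfderiv 𝓘(ℝ, ℝ) (𝓡 n) (fun s ↦ (extChartAt (𝓡 n) c).symm (l s)) s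
              = (mfderiv 𝓘(ℝ, EuclideanSpace ℝ (Fin n)) (𝓡 n) (extChartAt (𝓡 n) c).symm (l s)).comp
                (mfderiv 𝓘(ℝ, ℝ) 𝓘(ℝ, EuclideanSpace ℝ (Fin n)) l s) :=
            mfderiv_comp s (mdifferentiableAt_chart_symm (hy s hs))
              (hld.differentiable (by simp) s).mdifferentiableAt
          have h4 : mfderiv 𝓘(ℝ, ℝ) 𝓘(ℝ, EuclideanSpace ℝ (Fin n)) l s 1 = w := by
            rw [mfderiv_eq_fderiv]
            have h5 : HasDerivAt l w s :=
              HasDerivAt.const_add y (by simpa using (hasDerivAt_id s).smul_const w)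
            exact h5.deriv
          rw [h3, ← ofReal_norm]
          refine ENNReal.ofReal_le_ofReal ?_
          rw [ContinuousLinearMap.comp_apply]
          rw [h4]
          exact hB s hs
      _ = ENNReal.ofReal B := by simp
  have h3 := h1.trans h2
  rw [edist_dist] at h3
  exact (ENNReal.ofReal_le_ofReal_iff hB0).1 h3

end Metric

end ChartCalculus

/-! ### Charts are locally bi-Lipschitz; derivatives are bounded by Lipschitz constants. -/

section ChartLipschitz

variable {n : ℕ} {M : Type*} [MetricSpace M]
    [ChartedSpace (EuclideanSpace ℝ (Fin n)) M] [IsManifold (𝓡 n) ∞ M]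
    [RiemannianBundle (fun x : M ↦ TangentSpace (𝓡 n) x)]
    [IsContMDiffRiemannianBundle (𝓡 n) ∞ (EuclideanSpace ℝ (Fin n))
      (fun x : M ↦ TangentSpace (𝓡 n) x)]
    [IsRiemannianManifold (𝓡 n) M]

theorem locallyLipschitzOn_chart_symm (c : M) :
    LocallyLipschitzOn (extChartAt (𝓡 n) c).target (extChartAt (𝓡 n) c).symm := by
  intro y0 hy0
  obtain ⟨r, hr, hrt⟩ := Metric.isOpen_iff.1 (isOpen_chart_target c) y0 hy0
  have h1 := (continuousOn_frameBound c).continuousAt ((isOpen_chart_target c).mem_nhds hy0)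
  obtain ⟨r', hr', hB⟩ := Metric.eventually_nhds_iff_ball.1
    (h1.eventually (gt_mem_nhds (lt_add_one (frameBound n c y0))))
  set C := frameBound n c y0 + 1
  have hC : 0 ≤ C := by
    have : 0 ≤ frameBound n c y0 := by unfold frameBound; positivity
    positivity
  set ρ := min r r'
  refine ⟨C.toNNReal, Metric.ball y0 ρ,
    nhdsWithin_le_nhds (Metric.ball_mem_nhds _ (lt_min hr hr')), ?_⟩
  refine LipschitzOnWith.of_dist_le_mul fun y hy z hz ↦ ?_
  have hseg : ∀ s ∈ Icc (0 : ℝ) 1, y + s • (z - y) ∈ Metric.ball y0 ρ := fun s hs ↦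
    (convex_ball y0 ρ).add_smul_sub_mem hy hz hs
  have h2 := dist_chart_symm_le (c := c) (y := y) (w := z - y) (B := C * ‖z - y‖)
    (fun s hs ↦ hrt (Metric.ball_subset_ball (min_le_left _ _) (hseg s hs)))
    (fun s hs ↦ (norm_mfderiv_chart_symm_le c _ _).trans (mul_le_mul_of_nonneg_right
      (hB _ (Metric.ball_subset_ball (min_le_right _ _) (hseg s hs))).le (norm_nonneg _)))
  rw [add_sub_cancel] at h2
  rwa [Real.coe_toNNReal _ hC, dist_comm y z, dist_eq_norm]

/-- A curve of length below δ/2 from x stays in the ball of radius δ, where the differential of the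
chart has norm at most C; its coordinate image is at most C times longer. Letting the length r
decrease to the distance gives the bound. -/
theorem locallyLipschitzOn_chart (c : M) :
    LocallyLipschitzOn (extChartAt (𝓡 n) c).source (extChartAt (𝓡 n) c) := by
  intro x0 hx0
  set y0 := extChartAt (𝓡 n) c x0 with hy0
  have hy0t : y0 ∈ (extChartAt (𝓡 n) c).target := (extChartAt (𝓡 n) c).map_source hx0
  have h1 := (continuousOn_coordBound c).continuousAt ((isOpen_chart_target c).mem_nhds hy0t)
  have h2 : ∀ᶠ x in 𝓝 x0, x ∈ (extChartAt (𝓡 n) c).source ∧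
      coordBound n c (extChartAt (𝓡 n) c x) < coordBound n c y0 + 1 :=
    ((isOpen_extChartAt_source (I := 𝓡 n) c).eventually_mem hx0).and
      (((continuousAt_extChartAt' (I := 𝓡 n) hx0).tendsto).eventually
        (h1.eventually (gt_mem_nhds (lt_add_one _))))
  obtain ⟨δ, hδ, hδs⟩ := Metric.eventually_nhds_iff_ball.1 h2
  set C := coordBound n c y0 + 1 with hC
  have hC0 : 0 ≤ C := by have := coordBound_nonneg c y0; positivity
  refine ⟨C.toNNReal, Metric.ball x0 (δ / 4),
    nhdsWithin_le_nhds (Metric.ball_mem_nhds _ (by linarith)), ?_⟩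
  intro x hx x' hx'
  change edist _ _ ≤ ENNReal.ofReal C * edist x x'
  have hd : edist x x' < ENNReal.ofReal (δ / 2) := by
    rw [edist_dist]
    refine (ENNReal.ofReal_lt_ofReal_iff (by linarith)).2 ?_
    rw [Metric.mem_ball] at hx hx'
    have := dist_triangle_right x x' x0
    linarith
  have key : ∀ r, edist x x' < r → r < ENNReal.ofReal (δ / 2) →
      edist (extChartAt (𝓡 n) c x) (extChartAt (𝓡 n) c x') ≤ ENNReal.ofReal C * r := by
    intro r hr hrδ
    rw [IsRiemannianManifold.out (I := 𝓡 n)] at hr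
    obtain ⟨γ, h0, hγ1, hγ, hl⟩ := Manifold.exists_lt_of_riemannianEDist_lt hr
    have hin : ∀ t ∈ Icc (0 : ℝ) 1, γ t ∈ Metric.ball x0 δ := fun t ht ↦ by
      have e1 : edist x (γ t) ≤ Manifold.pathELength (𝓡 n) γ 0 t := by
        rw [IsRiemannianManifold.out (I := 𝓡 n)]
        exact Manifold.riemannianEDist_le_pathELength
          (hγ.mono (Icc_subset_Icc_right ht.2)) h0 rfl ht.1
      have e2 : edist x (γ t) < ENNReal.ofReal (δ / 2) :=
        (e1.trans (Manifold.pathELength_mono le_rfl ht.2)).trans_lt (hl.trans hrδ)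
      rw [edist_dist] at e2
      have e3 := (ENNReal.ofReal_lt_ofReal_iff'.1 e2).1
      rw [Metric.mem_ball] at hx ⊢
      have := dist_triangle_left (γ t) x0 x
      linarith
    have hs : ∀ t ∈ Icc (0 : ℝ) 1, γ t ∈ (extChartAt (𝓡 n) c).source := fun t ht ↦
      (hδs _ (hin t ht)).1
    have hg : ContMDiffOn 𝓘(ℝ, ℝ) 𝓘(ℝ, EuclideanSpace ℝ (Fin n)) 1
        (extChartAt (𝓡 n) c ∘ γ) (Icc 0 1) :=
      (contMDiffOn_extChartAt (I := 𝓡 n) (n := 1) (x := c)).comp hγ fun t ht ↦ by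
        rw [← extChartAt_source (I := 𝓡 n)]; exact hs t ht
    have h3 := enorm_sub_le_lintegral_derivWithin_Icc_of_contDiffOn_Icc
      (contMDiffOn_iff_contDiffOn.1 hg) zero_le_one
    simp only [Function.comp_apply, h0, hγ1] at h3
    rw [edist_comm, edist_eq_enorm_sub]
    refine h3.trans ?_
    calc _ ≤ ∫⁻ t in Icc (0 : ℝ) 1, ENNReal.ofReal C
            * ‖mfderivWithin 𝓘(ℝ, ℝ) (𝓡 n) γ (Icc 0 1) t 1‖ₑ := by
          refine setLIntegral_mono' measurableSet_Icc fun t ht ↦ ?_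
          have e1 : mfderivWithin 𝓘(ℝ, ℝ) 𝓘(ℝ, EuclideanSpace ℝ (Fin n))
              (extChartAt (𝓡 n) c ∘ γ) (Icc 0 1) t
              = (mfderiv (𝓡 n) 𝓘(ℝ, EuclideanSpace ℝ (Fin n)) (extChartAt (𝓡 n) c) (γ t)).comp
                (mfderivWithin 𝓘(ℝ, ℝ) (𝓡 n) γ (Icc 0 1) t) := by
            refine mfderiv_comp_mfderivWithin t (mdifferentiableAt_chart (hs t ht))
              (hγ.mdifferentiableOn one_ne_zero t ht) ?_
            rw [uniqueMDiffWithinAt_iff_uniqueDiffWithinAt]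
            exact uniqueDiffOn_Icc zero_lt_one t ht
          have e2 : derivWithin (extChartAt (𝓡 n) c ∘ γ) (Icc 0 1) t
              = chartCoord c (γ t) (mfderivWithin 𝓘(ℝ, ℝ) (𝓡 n) γ (Icc 0 1) t 1) := by
            rw [← fderivWithin_derivWithin, ← mfderivWithin_eq_fderivWithin, e1]
            rfl
          have e3 : ∀ (x : M) (hx : x ∈ (extChartAt (𝓡 n) c).source)
              (v : TangentSpace (𝓡 n) x),
              ‖chartCoord c x v‖ ≤ coordBound n c (extChartAt (𝓡 n) c x) * ‖v‖ := by
            intro x hx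
            obtain ⟨y, hy, rfl⟩ : ∃ y ∈ (extChartAt (𝓡 n) c).target,
              (extChartAt (𝓡 n) c).symm y = x :=
              ⟨_, (extChartAt (𝓡 n) c).map_source hx, (extChartAt (𝓡 n) c).left_inv hx⟩
            rw [(extChartAt (𝓡 n) c).right_inv hy]
            exact fun v ↦ norm_chartCoord_le hy v
          rw [e2, ← ofReal_norm, ← ofReal_norm, ← ENNReal.ofReal_mul hC0]
          exact ENNReal.ofReal_le_ofReal ((e3 _ (hs t ht) _).trans
            (mul_le_mul_of_nonneg_right (hδs _ (hin t ht)).2.le (norm_nonneg _)))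
      _ = ENNReal.ofReal C * Manifold.pathELength (𝓡 n) γ 0 1 := by
          rw [lintegral_const_mul' _ _ ENNReal.ofReal_ne_top,
            Manifold.pathELength_eq_lintegral_mfderivWithin_Icc]
      _ ≤ _ := by gcongr
  have : (𝓝[>] edist x x').NeBot := nhdsGT_neBot_of_exists_gt ⟨_, hd⟩
  refine ge_of_tendsto (((ENNReal.continuous_const_mul ENNReal.ofReal_ne_top).tendsto
    (edist x x')).mono_left (nhdsWithin_le_nhds (s := Ioi (edist x x')))) ?_
  filter_upwards [Ioo_mem_nhdsGT hd] with r hr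
  exact key r hr.1 hr.2

/-- The derivative is taken along the coordinate line with velocity v. By continuity of the metric,
the point at parameter s has distance at most |s| (‖v‖ + η) for small s, so the constant is measured
in the Riemannian norm without loss. -/
theorem abs_dirDeriv_chart_symm_le {c : M} {y : EuclideanSpace ℝ (Fin n)}
    (hy : y ∈ (extChartAt (𝓡 n) c).target) {g : M → ℝ} {L : ℝ} (hL : 0 ≤ L)
    (hg : ∀ᶠ x in 𝓝 ((extChartAt (𝓡 n) c).symm y),
      |g x - g ((extChartAt (𝓡 n) c).symm y)| ≤ L * dist x ((extChartAt (𝓡 n) c).symm y))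
    (v : TangentSpace (𝓡 n) ((extChartAt (𝓡 n) c).symm y)) :
    |dirDeriv g _ v| ≤ L * ‖v‖ := by
  rw [dirDeriv_eq_fderiv hy]
  by_cases hd : DifferentiableAt ℝ (fun y ↦ g ((extChartAt (𝓡 n) c).symm y)) y
  swap
  · rw [fderiv_zero_of_not_differentiableAt hd]
    simp only [zero_apply, abs_zero]
    positivity
  set w := chartCoord c _ v with hw
  have hv : mfderiv 𝓘(ℝ, EuclideanSpace ℝ (Fin n)) (𝓡 n) (extChartAt (𝓡 n) c).symm y w = v := by
    rw [mfderiv_chart_symm_apply]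
    exact sum_chartCoord_smul_coordVec hy v
  have hcurve : HasDerivAt (fun s : ℝ ↦ y + s • w) w 0 :=
    HasDerivAt.const_add y (by simpa using (hasDerivAt_id (0 : ℝ)).smul_const w)
  have hder : HasDerivAt (fun s : ℝ ↦ g ((extChartAt (𝓡 n) c).symm (y + s • w)))
      (fderiv ℝ (fun y ↦ g ((extChartAt (𝓡 n) c).symm y)) y w) 0 := by
    have h1 : HasFDerivAt (fun y ↦ g ((extChartAt (𝓡 n) c).symm y))
        (fderiv ℝ (fun y ↦ g ((extChartAt (𝓡 n) c).symm y)) y) (y + (0 : ℝ) • w) := by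
      rw [zero_smul, add_zero]; exact hd.hasFDerivAt
    exact h1.comp_hasDerivAt 0 hcurve
  have hcont : ContinuousAt (fun y' ↦ ‖mfderiv 𝓘(ℝ, EuclideanSpace ℝ (Fin n)) (𝓡 n)
      (extChartAt (𝓡 n) c).symm y' w‖) y := by
    have h1 : ∀ y', ‖mfderiv 𝓘(ℝ, EuclideanSpace ℝ (Fin n)) (𝓡 n)
      (extChartAt (𝓡 n) c).symm y' w‖ = √(∑ i, ∑ j, w i * w j * metricCoeff c i j y') :=
      fun y' ↦ by rw [← norm_sq_mfderiv_chart_symm, Real.sqrt_sq (norm_nonneg _)]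
    simp_rw [h1]
    have h2 : ContinuousOn (fun y' ↦ √(∑ i, ∑ j, w i * w j * metricCoeff c i j y'))
        (extChartAt (𝓡 n) c).target :=
      (continuousOn_finsetSum _ fun i _ ↦ continuousOn_finsetSum _ fun j _ ↦
        continuousOn_const.mul (continuousOn_metricCoeff c i j)).sqrt
    exact h2.continuousAt ((isOpen_chart_target c).mem_nhds hy)
  refine le_of_forall_pos_le_add fun ε hε ↦ ?_
  set η := ε / (L + 1) with hη
  have hη0 : 0 < η := by positivity
  have h1 : |fderiv ℝ (fun y ↦ g ((extChartAt (𝓡 n) c).symm y)) y w| ≤ L * (‖v‖ + η) := by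
    refine hder.le_of_lip' (by positivity) ?_
    have hlt : ‖mfderiv 𝓘(ℝ, EuclideanSpace ℝ (Fin n)) (𝓡 n) (extChartAt (𝓡 n) c).symm y w‖
        < ‖v‖ + η := by rw [hv]; linarith
    have h2 : ∀ᶠ y' in 𝓝 y, y' ∈ (extChartAt (𝓡 n) c).target ∧
        ‖mfderiv 𝓘(ℝ, EuclideanSpace ℝ (Fin n)) (𝓡 n) (extChartAt (𝓡 n) c).symm y' w‖
          < ‖v‖ + η :=
      ((isOpen_chart_target c).eventually_mem hy).and
        (hcont.eventually (gt_mem_nhds hlt))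
    obtain ⟨r, hr, hrs⟩ := Metric.eventually_nhds_iff_ball.1 h2
    have h3 : ∀ᶠ s : ℝ in 𝓝 0, y + s • w ∈ Metric.ball y r :=
      hcurve.continuousAt.eventually (by
        simp only [zero_smul, add_zero]; exact Metric.ball_mem_nhds y hr)
    have h4 : ∀ᶠ s : ℝ in 𝓝 0, |g ((extChartAt (𝓡 n) c).symm (y + s • w))
        - g ((extChartAt (𝓡 n) c).symm y)| ≤ L * dist ((extChartAt (𝓡 n) c).symm (y + s • w))
          ((extChartAt (𝓡 n) c).symm y) := by
      have h5 : ContinuousAt (fun s : ℝ ↦ (extChartAt (𝓡 n) c).symm (y + s • w)) 0 := by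
        refine ContinuousAt.comp (g := (extChartAt (𝓡 n) c).symm) ?_ hcurve.continuousAt
        rw [zero_smul, add_zero]
        exact (mdifferentiableAt_chart_symm hy).continuousAt
      have h6 : Tendsto (fun s : ℝ ↦ (extChartAt (𝓡 n) c).symm (y + s • w)) (𝓝 0)
          (𝓝 ((extChartAt (𝓡 n) c).symm y)) := by
        simpa using h5.tendsto
      exact h6.eventually hg
    filter_upwards [h3, h4] with s hs3 hs4
    simp only [zero_smul, add_zero, sub_zero, Real.norm_eq_abs]
    refine hs4.trans ?_
    rw [mul_assoc]
    refine mul_le_mul_of_nonneg_left ?_ hL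
    have hin : ∀ τ ∈ Icc (0 : ℝ) 1, y + τ • s • w ∈ Metric.ball y r := fun τ hτ ↦
      (convex_ball y r).add_smul_mem (Metric.mem_ball_self hr) hs3 hτ
    rw [dist_comm]
    refine dist_chart_symm_le (fun τ hτ ↦ (hrs _ (hin τ hτ)).1) fun τ hτ ↦ ?_
    have h7 := (hrs _ (hin τ hτ)).2.le
    have h8 : mfderiv 𝓘(ℝ, EuclideanSpace ℝ (Fin n)) (𝓡 n) (extChartAt (𝓡 n) c).symm
        (y + τ • s • w) (s • w) = s • mfderiv 𝓘(ℝ, EuclideanSpace ℝ (Fin n)) (𝓡 n)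
        (extChartAt (𝓡 n) c).symm (y + τ • s • w) w := ContinuousLinearMap.map_smul _ _ _
    rw [h8, norm_smul, Real.norm_eq_abs, mul_comm]
    exact mul_le_mul_of_nonneg_right h7 (abs_nonneg _)
  refine h1.trans ?_
  have h9 : L * η ≤ ε := by
    rw [hη, mul_div_assoc', div_le_iff₀ (by positivity)]
    nlinarith
  linarith [mul_add L ‖v‖ η]

/-- A function that is `L`-Lipschitz at `x` has a derivative of norm at most `L` there. -/
theorem abs_dirDeriv_le {g : M → ℝ} {x : M} {L : ℝ} (hL : 0 ≤ L)
    (hg : ∀ᶠ y in 𝓝 x, |g y - g x| ≤ L * dist y x) (v : TangentSpace (𝓡 n) x) :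
    |dirDeriv g x v| ≤ L * ‖v‖ := by
  have key : ∀ c : M, x ∈ (extChartAt (𝓡 n) c).source → |dirDeriv g x v| ≤ L * ‖v‖ := by
    intro c hx
    obtain ⟨y, hy, rfl⟩ : ∃ y ∈ (extChartAt (𝓡 n) c).target, (extChartAt (𝓡 n) c).symm y = x :=
      ⟨_, (extChartAt (𝓡 n) c).map_source hx, (extChartAt (𝓡 n) c).left_inv hx⟩
    exact abs_dirDeriv_chart_symm_le hy hL hg v
  exact key x (mem_extChartAt_source x)

end ChartLipschitz

/-! ### Change of variables for maps injective on a carrier of the measure. -/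

section InjOnMap

variable {X Y : Type*} [MeasurableSpace X] [StandardBorelSpace X] [MeasurableSpace Y]
  [MeasurableSpace.CountablySeparated Y] {f : X → Y} (hf : Measurable f) {s : Set X}
  (hs : MeasurableSet s) (hinj : InjOn f s) {ν : Measure X} (hν : ν.restrict s = ν)
include hf hs hinj

/-- Lusin-Souslin: an injective Borel map on a standard Borel space is a measurable embedding. The
integral formulas built on this hold for arbitrary integrands, with no measurability to check on the
manifold. -/
theorem measurableEmbedding_of_injOn : MeasurableEmbedding fun x : s ↦ f x := by
  have : StandardBorelSpace s := hs.standardBorel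
  exact (hf.comp measurable_subtype_coe).measurableEmbedding
    fun x y h ↦ Subtype.ext (hinj x.2 y.2 h)

include hν

theorem map_eq_map_comap_of_injOn :
    ν.map f = (ν.comap ((↑) : s → X)).map fun x : s ↦ f x := by
  conv_lhs => rw [← hν, ← map_comap_subtype_coe hs, Measure.map_map hf measurable_subtype_coe]
  rfl

theorem integral_map_of_injOn (H : Y → ℝ) : ∫ y, H y ∂(ν.map f) = ∫ x, H (f x) ∂ν := by
  rw [map_eq_map_comap_of_injOn hf hs hinj hν, (measurableEmbedding_of_injOn hf hs hinj).integral_map,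
    ← (MeasurableEmbedding.subtype_coe hs).integral_map (fun x ↦ H (f x)),
    map_comap_subtype_coe hs, hν]

theorem integrable_map_of_injOn {H : Y → ℝ} :
    Integrable H (ν.map f) ↔ Integrable (fun x ↦ H (f x)) ν := by
  rw [map_eq_map_comap_of_injOn hf hs hinj hν,
    (measurableEmbedding_of_injOn hf hs hinj).integrable_map_iff]
  conv_rhs => rw [← hν, ← map_comap_subtype_coe hs]
  rw [(MeasurableEmbedding.subtype_coe hs).integrable_map_iff]
  rfl

theorem ae_map_of_injOn {p : Y → Prop} : (∀ᵐ y ∂(ν.map f), p y) ↔ ∀ᵐ x ∂ν, p (f x) := by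
  rw [map_eq_map_comap_of_injOn hf hs hinj hν,
    (measurableEmbedding_of_injOn hf hs hinj).ae_map_iff]
  conv_rhs => rw [← hν, ← map_comap_subtype_coe hs]
  rw [(MeasurableEmbedding.subtype_coe hs).ae_map_iff]

end InjOnMap

/-! ### The Riemannian measure is consistent between charts. -/

section RiemannianMeasure

variable {n : ℕ} {M : Type*} [MetricSpace M]
    [ChartedSpace (EuclideanSpace ℝ (Fin n)) M] [IsManifold (𝓡 n) ∞ M]

open Classical in
/-- The inverse of the chart around `c`, extended to a measurable function. -/
def chartInv (n : ℕ) {M : Type*} [MetricSpace M] [ChartedSpace (EuclideanSpace ℝ (Fin n)) M]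
    (c : M) : EuclideanSpace ℝ (Fin n) → M :=
  (extChartAt (𝓡 n) c).target.piecewise (extChartAt (𝓡 n) c).symm fun _ ↦ c

theorem chartInv_of_mem {c : M} {y : EuclideanSpace ℝ (Fin n)}
    (hy : y ∈ (extChartAt (𝓡 n) c).target) : chartInv n c y = (extChartAt (𝓡 n) c).symm y :=
  if_pos hy

theorem chartInv_mem_source (c : M) (y : EuclideanSpace ℝ (Fin n)) :
    chartInv n c y ∈ (extChartAt (𝓡 n) c).source := by
  by_cases hy : y ∈ (extChartAt (𝓡 n) c).target
  · rw [chartInv_of_mem hy]; exact (extChartAt (𝓡 n) c).map_target hy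
  · have h : chartInv n c y = c := if_neg hy
    rw [h]; exact mem_extChartAt_source c

theorem measurableSet_chart_target (c : M) : MeasurableSet (extChartAt (𝓡 n) c).target :=
  (isOpen_chart_target c).measurableSet

/-- The Jacobian of a change of charts. -/
def chartJacobian (c c' : M) (y : EuclideanSpace ℝ (Fin n)) :
    EuclideanSpace ℝ (Fin n) →L[ℝ] EuclideanSpace ℝ (Fin n) :=
  (mfderiv (𝓡 n) 𝓘(ℝ, EuclideanSpace ℝ (Fin n)) (extChartAt (𝓡 n) c)
    ((extChartAt (𝓡 n) c').symm y)).comp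
    (mfderiv 𝓘(ℝ, EuclideanSpace ℝ (Fin n)) (𝓡 n) (extChartAt (𝓡 n) c').symm y)

theorem hasFDerivAt_chart_change {c c' : M} {y : EuclideanSpace ℝ (Fin n)}
    (hy : y ∈ (extChartAt (𝓡 n) c').target)
    (hyc : (extChartAt (𝓡 n) c').symm y ∈ (extChartAt (𝓡 n) c).source) :
    HasFDerivAt (fun y ↦ extChartAt (𝓡 n) c ((extChartAt (𝓡 n) c').symm y))
      (chartJacobian c c' y) y :=
  ((mdifferentiableAt_chart hyc).hasMFDerivAt.comp y
    (mdifferentiableAt_chart_symm hy).hasMFDerivAt).hasFDerivAt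

variable [RiemannianBundle (fun x : M ↦ TangentSpace (𝓡 n) x)]

/-- The Gram matrices are related by TᵀGT with T the Jacobian of the change of charts; take
determinants and square roots. -/
theorem volDensity_change {c c' : M} {y : EuclideanSpace ℝ (Fin n)}
    (hyc : (extChartAt (𝓡 n) c').symm y ∈ (extChartAt (𝓡 n) c).source) :
    volDensity c' y = |(chartJacobian c c' y).det|
      * volDensity c (extChartAt (𝓡 n) c ((extChartAt (𝓡 n) c').symm y)) := by
  set b := (EuclideanSpace.basisFun (Fin n) ℝ).toBasis with hb
  set T := LinearMap.toMatrix b b (chartJacobian c c' y : EuclideanSpace ℝ (Fin n) →ₗ[ℝ] _) with hT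
  have hTd : T.det = (chartJacobian c c' y).det := LinearMap.det_toMatrix b _
  have hTe : ∀ k i, T k i = chartCoord c _ (coordVec c' i y) k := fun k i ↦ by
    rw [hT, LinearMap.toMatrix_apply, hb]
    simp only [OrthonormalBasis.coe_toBasis, EuclideanSpace.basisFun_apply,
      OrthonormalBasis.coe_toBasis_repr_apply, EuclideanSpace.basisFun_repr]
    rfl
  have hG : metricMatrix c' y = T.transpose
      * metricMatrix c (extChartAt (𝓡 n) c ((extChartAt (𝓡 n) c').symm y)) * T := by
    ext i j
    simp only [Matrix.mul_apply, Matrix.transpose_apply, Finset.sum_mul, hTe]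
    rw [Finset.sum_comm]
    refine (inner_eq_sum hyc (coordVec c' i y) (coordVec c' j y)).trans ?_
    refine Finset.sum_congr rfl fun k _ ↦ Finset.sum_congr rfl fun l _ ↦ ?_
    rw [metricMatrix, Matrix.of_apply]
    ring
  rw [volDensity_eq, volDensity_eq, hG, Matrix.det_mul, Matrix.det_mul, Matrix.det_transpose, hTd,
    ← Real.sqrt_sq_eq_abs, ← Real.sqrt_mul (sq_nonneg _)]
  congr 1
  ring

variable [MeasurableSpace M] [BorelSpace M]
    [IsContMDiffRiemannianBundle (𝓡 n) ∞ (EuclideanSpace ℝ (Fin n))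
      (fun x : M ↦ TangentSpace (𝓡 n) x)]

theorem measurable_chartInv (c : M) : Measurable (chartInv n c) := by
  classical
  exact ContinuousOn.measurable_piecewise (continuousOn_extChartAt_symm c) continuousOn_const
    (measurableSet_chart_target c)

/-- The coordinate expression of the Riemannian measure. -/
def coordMeasure (n : ℕ) {M : Type*} [MetricSpace M] [ChartedSpace (EuclideanSpace ℝ (Fin n)) M]
    [RiemannianBundle (fun x : M ↦ TangentSpace (𝓡 n) x)] (c : M) :
    Measure (EuclideanSpace ℝ (Fin n)) :=
  (volume.restrict (extChartAt (𝓡 n) c).target).withDensity fun y ↦ ENNReal.ofReal (volDensity c y)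

theorem aemeasurable_volDensity (c : M) :
    AEMeasurable (fun y ↦ ENNReal.ofReal (volDensity (n := n) c y))
      (volume.restrict (extChartAt (𝓡 n) c).target) :=
  ((contDiffOn_volDensity c).continuousOn.aemeasurable
    (measurableSet_chart_target c)).ennreal_ofReal

theorem chartVolume_eq_map (c : M) :
    chartVolume n c = (coordMeasure n c).map (chartInv n c) := by
  refine Measure.map_congr ?_
  refine (withDensity_absolutelyContinuous _ _).ae_le ?_
  filter_upwards [ae_restrict_mem (measurableSet_chart_target c)] with y hy
  exact (chartInv_of_mem hy).symm

theorem chartVolume_apply (c : M) {A : Set M} (hA : MeasurableSet A) :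
    chartVolume n c A = ∫⁻ y in chartInv n c ⁻¹' A ∩ (extChartAt (𝓡 n) c).target,
      ENNReal.ofReal (volDensity c y) := by
  rw [chartVolume_eq_map, Measure.map_apply (measurable_chartInv c) hA, coordMeasure,
    withDensity_apply _ (measurable_chartInv c hA),
    Measure.restrict_restrict (measurable_chartInv c hA)]

theorem isOpen_chart_source (c : M) : IsOpen (extChartAt (𝓡 n) c).source :=
  isOpen_extChartAt_source c

/-- The change of variables formula for the transition map, whose Jacobian exactly accounts for the
change of density. Only the inequality is needed to identify the supremum on a chart domain. -/
theorem chartVolume_restrict_le (c c' : M) :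
    (chartVolume n c').restrict (extChartAt (𝓡 n) c).source ≤ chartVolume n c := by
  refine Measure.le_iff.2 fun A hA ↦ ?_
  have hsrc : MeasurableSet (extChartAt (𝓡 n) c).source := (isOpen_chart_source c).measurableSet
  rw [Measure.restrict_apply hA, chartVolume_apply c' (hA.inter hsrc), chartVolume_apply c hA]
  set D := chartInv n c' ⁻¹' (A ∩ (extChartAt (𝓡 n) c).source) ∩ (extChartAt (𝓡 n) c').target
  have hD : MeasurableSet D :=
    (measurable_chartInv c' (hA.inter hsrc)).inter (measurableSet_chart_target c')
  have hD1 : ∀ y ∈ D, y ∈ (extChartAt (𝓡 n) c').target ∧ (extChartAt (𝓡 n) c').symm y ∈ A ∧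
      (extChartAt (𝓡 n) c').symm y ∈ (extChartAt (𝓡 n) c).source := fun y hy ↦ by
    have h1 := hy.1
    rw [mem_preimage, chartInv_of_mem hy.2] at h1
    exact ⟨hy.2, h1⟩
  set T : EuclideanSpace ℝ (Fin n) → EuclideanSpace ℝ (Fin n) :=
    fun y ↦ extChartAt (𝓡 n) c ((extChartAt (𝓡 n) c').symm y) with hT
  have hinj : InjOn T D := fun y hy z hz h ↦
    (extChartAt (𝓡 n) c').symm.injOn (hD1 y hy).1 (hD1 z hz).1
      ((extChartAt (𝓡 n) c).injOn (hD1 y hy).2.2 (hD1 z hz).2.2 h)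
  have hcv := lintegral_image_eq_lintegral_abs_det_fderiv_mul (volume) hD
    (fun y hy ↦ (hasFDerivAt_chart_change (hD1 y hy).1 (hD1 y hy).2.2).hasFDerivWithinAt) hinj
    (fun y ↦ ENNReal.ofReal (volDensity c y))
  have h2 : ∫⁻ y in D, ENNReal.ofReal (volDensity c' y)
      = ∫⁻ y in D, ENNReal.ofReal |(chartJacobian c c' y).det| * ENNReal.ofReal
        (volDensity c (extChartAt (𝓡 n) c ((extChartAt (𝓡 n) c').symm y))) := by
    refine setLIntegral_congr_fun hD fun y hy ↦ ?_
    rw [volDensity_change (hD1 y hy).2.2, ENNReal.ofReal_mul (abs_nonneg _)]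
  rw [h2, ← hcv]
  refine lintegral_mono_set ?_
  rintro _ ⟨y, hy, rfl⟩
  obtain ⟨h3, h4, h5⟩ := hD1 y hy
  refine ⟨?_, (extChartAt (𝓡 n) c).map_source h5⟩
  rw [mem_preimage, chartInv_of_mem ((extChartAt (𝓡 n) c).map_source h5),
    (extChartAt (𝓡 n) c).left_inv h5]
  exact h4

/-- On a chart domain the Riemannian measure is given by the coordinate expression. -/
theorem riemVolume_restrict_source (c : M) :
    (riemVolume n M).restrict (extChartAt (𝓡 n) c).source = chartVolume n c := by
  have hsrc : MeasurableSet (extChartAt (𝓡 n) c).source := (isOpen_chart_source c).measurableSet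
  refine le_antisymm ?_ ?_
  -- The sum of the measure off the chart domain and the chart measure dominates every chart
  -- measure, hence their supremum; restriction to the domain kills the first summand.
  · have h1 : riemVolume n M ≤ (riemVolume n M).restrict (extChartAt (𝓡 n) c).sourceᶜ
        + chartVolume n c := by
      refine iSup_le fun c' ↦ ?_
      rw [← Measure.restrict_add_restrict_compl (μ := chartVolume n c') hsrc, add_comm]
      exact add_le_add (Measure.restrict_mono le_rfl (le_iSup (fun c : M ↦ chartVolume n c) c'))
        (chartVolume_restrict_le c c')
    have h2 := Measure.restrict_mono (s := (extChartAt (𝓡 n) c).source) le_rfl h1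
    refine h2.trans ?_
    rw [Measure.restrict_add, Measure.restrict_restrict hsrc, inter_compl_self,
      Measure.restrict_empty, zero_add]
    exact Measure.restrict_le_self
  · have h1 : (chartVolume n c).restrict (extChartAt (𝓡 n) c).source = chartVolume n c := by
      refine Measure.restrict_eq_self_of_ae_mem ?_
      rw [chartVolume_eq_map]
      exact (ae_map_iff (measurable_chartInv c).aemeasurable hsrc).2
        (Eventually.of_forall fun y ↦ chartInv_mem_source c y)
    conv_lhs => rw [← h1]
    exact Measure.restrict_mono le_rfl (le_iSup (fun c : M ↦ chartVolume n c) c)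

end RiemannianMeasure

/-! ### Transfer of integrals and integrability between space-time and coordinates. -/

section Transfer

variable {n : ℕ} {M : Type*} [MetricSpace M] [ProperSpace M]
    [ChartedSpace (EuclideanSpace ℝ (Fin n)) M] [IsManifold (𝓡 n) ∞ M]
    [RiemannianBundle (fun x : M ↦ TangentSpace (𝓡 n) x)]
    [IsContMDiffRiemannianBundle (𝓡 n) ∞ (EuclideanSpace ℝ (Fin n))
      (fun x : M ↦ TangentSpace (𝓡 n) x)]
    [MeasurableSpace M] [BorelSpace M]

instance isLocallyFiniteMeasure_riemVolume : IsLocallyFiniteMeasure (riemVolume n M) := by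
  refine ⟨fun x ↦ ?_⟩
  obtain ⟨K, hKx, hKs, hK⟩ := local_compact_nhds
    ((isOpen_chart_source (n := n) x).mem_nhds (mem_extChartAt_source x))
  refine ⟨K, hKx, ?_⟩
  have h1 : riemVolume n M K = chartVolume n x K := by
    rw [← riemVolume_restrict_source, Measure.restrict_apply hK.measurableSet,
      inter_eq_self_of_subset_left hKs]
  rw [h1, chartVolume_apply x hK.measurableSet]
  have hc : IsCompact (extChartAt (𝓡 n) x '' K) :=
    hK.image_of_continuousOn ((continuousOn_extChartAt x).mono hKs)
  have hct : extChartAt (𝓡 n) x '' K ⊆ (extChartAt (𝓡 n) x).target := by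
    rintro _ ⟨z, hz, rfl⟩; exact (extChartAt (𝓡 n) x).map_source (hKs hz)
  have hsub : chartInv n x ⁻¹' K ∩ (extChartAt (𝓡 n) x).target ⊆ extChartAt (𝓡 n) x '' K := by
    rintro y ⟨hy1, hy2⟩
    rw [mem_preimage, chartInv_of_mem hy2] at hy1
    exact ⟨_, hy1, (extChartAt (𝓡 n) x).right_inv hy2⟩
  have hint : IntegrableOn (volDensity (n := n) x) (extChartAt (𝓡 n) x '' K) volume :=
    ((contDiffOn_volDensity x).continuousOn.mono hct).integrableOn_compact hc
  exact (lintegral_mono_set hsub).trans_lt (hint.lintegral_lt_top)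

/-- The part of space-time over the domain of the chart around `c`. -/
def chartCylinder (n : ℕ) {M : Type*} [MetricSpace M] [ChartedSpace (EuclideanSpace ℝ (Fin n)) M]
    (c : M) : Set (M × ℝ) := (extChartAt (𝓡 n) c).source ×ˢ Ioi (0 : ℝ)

/-- The coordinate domain of the space-time chart around `c`. -/
def coordCylinder (n : ℕ) {M : Type*} [MetricSpace M] [ChartedSpace (EuclideanSpace ℝ (Fin n)) M]
    (c : M) : Set (EuclideanSpace ℝ (Fin n) × ℝ) := (extChartAt (𝓡 n) c).target ×ˢ Ioi (0 : ℝ)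

/-- The inverse of the space-time chart around `c`. -/
def stInv (n : ℕ) {M : Type*} [MetricSpace M] [ChartedSpace (EuclideanSpace ℝ (Fin n)) M]
    (c : M) (z : EuclideanSpace ℝ (Fin n) × ℝ) : M × ℝ := ((extChartAt (𝓡 n) c).symm z.1, z.2)

/-- The space-time chart around `c`. -/
def stChart (n : ℕ) {M : Type*} [MetricSpace M] [ChartedSpace (EuclideanSpace ℝ (Fin n)) M]
    (c : M) (z : M × ℝ) : EuclideanSpace ℝ (Fin n) × ℝ := (extChartAt (𝓡 n) c z.1, z.2)

theorem isOpen_chartCylinder (c : M) : IsOpen (chartCylinder n c) :=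
  (isOpen_chart_source c).prod isOpen_Ioi

theorem isOpen_coordCylinder (c : M) : IsOpen (coordCylinder n c) :=
  (isOpen_chart_target c).prod isOpen_Ioi

theorem stInv_mem {c : M} {z : EuclideanSpace ℝ (Fin n) × ℝ} (hz : z ∈ coordCylinder n c) :
    stInv n c z ∈ chartCylinder n c :=
  ⟨(extChartAt (𝓡 n) c).map_target hz.1, hz.2⟩

theorem stChart_mem {c : M} {z : M × ℝ} (hz : z ∈ chartCylinder n c) :
    stChart n c z ∈ coordCylinder n c :=
  ⟨(extChartAt (𝓡 n) c).map_source hz.1, hz.2⟩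

theorem stInv_stChart {c : M} {z : M × ℝ} (hz : z ∈ chartCylinder n c) :
    stInv n c (stChart n c z) = z :=
  Prod.ext ((extChartAt (𝓡 n) c).left_inv hz.1) rfl

theorem stChart_stInv {c : M} {z : EuclideanSpace ℝ (Fin n) × ℝ} (hz : z ∈ coordCylinder n c) :
    stChart n c (stInv n c z) = z :=
  Prod.ext ((extChartAt (𝓡 n) c).right_inv hz.1) rfl

theorem chartCylinder_subset (c : M) : chartCylinder n c ⊆ spaceTime M :=
  prod_mono (subset_univ _) le_rfl

theorem continuousOn_stInv (c : M) : ContinuousOn (stInv n c) (coordCylinder n c) :=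
  ((continuousOn_extChartAt_symm c).comp continuousOn_fst fun _ hz ↦ hz.1).prodMk continuousOn_snd

theorem continuousOn_stChart (c : M) : ContinuousOn (stChart n c) (chartCylinder n c) :=
  ((continuousOn_extChartAt c).comp continuousOn_fst fun _ hz ↦ hz.1).prodMk continuousOn_snd

/-- The inverse of the space-time chart, extended to a measurable function. -/
def stInvM (n : ℕ) {M : Type*} [MetricSpace M] [ChartedSpace (EuclideanSpace ℝ (Fin n)) M]
    (c : M) : EuclideanSpace ℝ (Fin n) × ℝ → M × ℝ := Prod.map (chartInv n c) id

theorem stInvM_of_mem {c : M} {z : EuclideanSpace ℝ (Fin n) × ℝ} (hz : z ∈ coordCylinder n c) :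
    stInvM n c z = stInv n c z := Prod.ext (chartInv_of_mem hz.1) rfl

theorem measurable_stInvM (c : M) : Measurable (stInvM n c) :=
  (measurable_chartInv c).prodMap measurable_id

theorem injOn_stInvM (c : M) : InjOn (stInvM n c) (coordCylinder n c) := fun z hz w hw h ↦ by
  rw [stInvM_of_mem hz, stInvM_of_mem hw] at h
  rw [← stChart_stInv hz, h, stChart_stInv hw]

/-- The coordinate expression of the product measure on space-time. -/
def stMeasure (n : ℕ) {M : Type*} [MetricSpace M] [ChartedSpace (EuclideanSpace ℝ (Fin n)) M]
    [RiemannianBundle (fun x : M ↦ TangentSpace (𝓡 n) x)] (c : M) :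
    Measure (EuclideanSpace ℝ (Fin n) × ℝ) :=
  (volume.restrict (coordCylinder n c)).withDensity fun z ↦ ENNReal.ofReal (volDensity c z.1)

theorem aemeasurable_volDensity_fst (c : M) :
    AEMeasurable (fun z : EuclideanSpace ℝ (Fin n) × ℝ ↦ ENNReal.ofReal (volDensity (n := n) c z.1))
      (volume.restrict (coordCylinder n c)) :=
  (((contDiffOn_volDensity c).continuousOn.comp continuousOn_fst
    fun _ hz ↦ hz.1).aemeasurable (isOpen_coordCylinder c).measurableSet).ennreal_ofReal

theorem prod_restrict_chartCylinder (c : M) :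
    ((riemVolume n M).prod volume).restrict (chartCylinder n c)
      = (stMeasure n c).map (stInvM n c) := by
  have : SFinite (coordMeasure n c) := by unfold coordMeasure; infer_instance
  rw [chartCylinder, ← Measure.prod_restrict, riemVolume_restrict_source, chartVolume_eq_map,
    ← Measure.map_id (μ := (volume.restrict (Ioi (0 : ℝ)))),
    Measure.map_prod_map _ _ (measurable_chartInv c) measurable_id, coordMeasure,
    prod_withDensity_left₀ (aemeasurable_volDensity c), Measure.prod_restrict]
  rfl

theorem stMeasure_restrict (c : M) : (stMeasure n c).restrict (coordCylinder n c) = stMeasure n c :=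
  Measure.restrict_eq_self_of_ae_mem ((withDensity_absolutelyContinuous _ _).ae_le
    (ae_restrict_mem (isOpen_coordCylinder c).measurableSet))

theorem ae_stMeasure {c : M} {p : EuclideanSpace ℝ (Fin n) × ℝ → Prop} :
    (∀ᵐ z ∂(stMeasure n c), p z) ↔ ∀ᵐ z ∂(volume.restrict (coordCylinder n c)), p z := by
  rw [stMeasure, ae_withDensity_iff' (aemeasurable_volDensity_fst c)]
  refine eventually_congr ?_
  filter_upwards [ae_restrict_mem (isOpen_coordCylinder c).measurableSet] with z hz
  have : ENNReal.ofReal (volDensity c z.1) ≠ 0 := by simpa using volDensity_pos hz.1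
  simp [this]

theorem ae_chart {c : M} {p : M × ℝ → Prop} :
    (∀ᵐ z ∂(((riemVolume n M).prod volume).restrict (chartCylinder n c)), p z)
      ↔ ∀ᵐ z ∂(volume.restrict (coordCylinder n c)), p (stInv n c z) := by
  rw [prod_restrict_chartCylinder, ae_map_of_injOn (measurable_stInvM c)
    (isOpen_coordCylinder c).measurableSet (injOn_stInvM c) (stMeasure_restrict c), ae_stMeasure]
  refine eventually_congr ?_
  filter_upwards [ae_restrict_mem (isOpen_coordCylinder c).measurableSet] with z hz
  rw [stInvM_of_mem hz]

theorem integral_chart (c : M) (H : M × ℝ → ℝ) :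
    ∫ z in chartCylinder n c, H z ∂((riemVolume n M).prod volume)
      = ∫ z in coordCylinder n c, volDensity c z.1 * H (stInv n c z) := by
  rw [prod_restrict_chartCylinder, integral_map_of_injOn (measurable_stInvM c)
    (isOpen_coordCylinder c).measurableSet (injOn_stInvM c) (stMeasure_restrict c), stMeasure,
    integral_withDensity_eq_integral_toReal_smul₀ (aemeasurable_volDensity_fst c)
      (Eventually.of_forall fun _ ↦ ENNReal.ofReal_lt_top)]
  refine setIntegral_congr_fun (isOpen_coordCylinder c).measurableSet fun z hz ↦ ?_
  simp only [smul_eq_mul]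
  rw [ENNReal.toReal_ofReal (volDensity_pos hz.1).le, stInvM_of_mem hz]

theorem integrableOn_chart {c : M} {H : M × ℝ → ℝ} :
    IntegrableOn H (chartCylinder n c) ((riemVolume n M).prod volume)
      ↔ IntegrableOn (fun z ↦ volDensity c z.1 * H (stInv n c z)) (coordCylinder n c) := by
  rw [IntegrableOn, prod_restrict_chartCylinder, integrable_map_of_injOn (measurable_stInvM c)
    (isOpen_coordCylinder c).measurableSet (injOn_stInvM c) (stMeasure_restrict c), stMeasure,
    integrable_withDensity_iff_integrable_smul₀' (aemeasurable_volDensity_fst c)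
      (Eventually.of_forall fun _ ↦ ENNReal.ofReal_lt_top)]
  refine integrable_congr ?_
  filter_upwards [ae_restrict_mem (isOpen_coordCylinder c).measurableSet] with z hz
  rw [smul_eq_mul, ENNReal.toReal_ofReal (volDensity_pos hz.1).le, stInvM_of_mem hz]

theorem isOpen_spaceTime : IsOpen (spaceTime M) := isOpen_univ.prod isOpen_Ioi

/-- Local integrability passes to the coordinates of a chart. -/
theorem locallyIntegrableOn_chart {H : M × ℝ → ℝ}
    (hH : LocallyIntegrableOn H (spaceTime M) ((riemVolume n M).prod volume)) (c : M) :
    LocallyIntegrableOn (fun z ↦ H (stInv n c z)) (coordCylinder n c) volume := by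
  rw [locallyIntegrableOn_iff (isOpen_coordCylinder c).isLocallyClosed]
  intro L hLO hL
  have hL' : IsCompact (stInv n c '' L) :=
    hL.image_of_continuousOn ((continuousOn_stInv c).mono hLO)
  have hLc : stInv n c '' L ⊆ chartCylinder n c := by
    rintro _ ⟨z, hz, rfl⟩; exact stInv_mem (hLO hz)
  have h1 : IntegrableOn H (stInv n c '' L) ((riemVolume n M).prod volume) :=
    hH.integrableOn_compact_subset (hLc.trans (chartCylinder_subset c)) hL'
  have h2 : IntegrableOn ((stInv n c '' L).indicator H) (chartCylinder n c)
      ((riemVolume n M).prod volume) :=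
    ((integrable_indicator_iff hL'.measurableSet).2 h1).integrableOn
  have h3 := (integrableOn_chart.1 h2).mono_set hLO
  have hinv : ContinuousOn (fun z : EuclideanSpace ℝ (Fin n) × ℝ ↦ (volDensity (n := n) c z.1)⁻¹) L :=
    (((contDiffOn_volDensity c).continuousOn.comp continuousOn_fst fun _ hz ↦ (hLO hz).1)).inv₀
      fun z hz ↦ (volDensity_pos (hLO hz).1).ne'
  have h4 := h3.continuousOn_mul hinv hL
  refine h4.congr_fun (fun z hz ↦ ?_) hL.measurableSet
  simp only
  rw [indicator_of_mem (mem_image_of_mem _ hz), ← mul_assoc,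
    inv_mul_cancel₀ (volDensity_pos (hLO hz).1).ne', one_mul]

section Weighted

variable {a : M → ℝ} (ha : Continuous a) (hpos : ∀ᵐ x ∂(riemVolume n M), 0 < a x)

include ha in
theorem weightedVolume_prod : (weightedVolume n a).prod (volume : Measure ℝ)
    = ((riemVolume n M).prod volume).withDensity fun z ↦ ENNReal.ofReal (a z.1) := by
  rw [weightedVolume, prod_withDensity_left ha.measurable.ennreal_ofReal]

include hpos in
theorem ae_prod_weight_pos : ∀ᵐ z ∂((riemVolume n M).prod (volume : Measure ℝ)), 0 < a z.1 :=
  Measure.quasiMeasurePreserving_fst.ae hpos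

include ha hpos

/-- The density of the weighted measure is the positive part of a; positivity almost everywhere
identifies it with a itself. -/
theorem setIntegral_weightedVolume {A : Set (M × ℝ)} (hA : MeasurableSet A) (H : M × ℝ → ℝ) :
    ∫ z in A, H z ∂((weightedVolume n a).prod volume)
      = ∫ z in A, a z.1 * H z ∂((riemVolume n M).prod volume) := by
  rw [weightedVolume_prod ha, restrict_withDensity hA,
    integral_withDensity_eq_integral_toReal_smul (by fun_prop)
      (Eventually.of_forall fun _ ↦ ENNReal.ofReal_lt_top)]
  refine integral_congr_ae ?_
  filter_upwards [ae_restrict_of_ae (ae_prod_weight_pos hpos)] with z hz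
  rw [ENNReal.toReal_ofReal hz.le, smul_eq_mul]

theorem integrableOn_weightedVolume {A : Set (M × ℝ)} (hA : MeasurableSet A) {H : M × ℝ → ℝ} :
    IntegrableOn H A ((weightedVolume n a).prod volume)
      ↔ IntegrableOn (fun z ↦ a z.1 * H z) A ((riemVolume n M).prod volume) := by
  rw [IntegrableOn, weightedVolume_prod ha, restrict_withDensity hA,
    integrable_withDensity_iff_integrable_smul' (by fun_prop)
      (Eventually.of_forall fun _ ↦ ENNReal.ofReal_lt_top)]
  refine integrable_congr ?_
  filter_upwards [ae_restrict_of_ae (ae_prod_weight_pos hpos)] with z hz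
  rw [ENNReal.toReal_ofReal hz.le, smul_eq_mul]

theorem locallyIntegrableOn_weightedVolume {H : M × ℝ → ℝ} :
    LocallyIntegrableOn H (spaceTime M) ((weightedVolume n a).prod volume)
      ↔ LocallyIntegrableOn (fun z ↦ a z.1 * H z) (spaceTime M)
        ((riemVolume n M).prod volume) := by
  rw [locallyIntegrableOn_iff isOpen_spaceTime.isLocallyClosed,
    locallyIntegrableOn_iff isOpen_spaceTime.isLocallyClosed]
  exact forall₃_congr fun K _ hK ↦ integrableOn_weightedVolume ha hpos hK.measurableSet

end Weighted

end Transfer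

/-! ### Pointwise inequalities for the flux and the energy. -/

section Pointwise

variable {p q m U N : ℝ}

/-- This splits the flux size into an L^q factor, the energy to the power 1/q, and the weight
U^((m-1)/p): indeed p/q = p - 1, and the exponents (m-1)/q and (m-1)/p add up to m - 1. -/
theorem rpow_flux_eq (hp : 1 < p) (hm : 1 ≤ m) (hU : 0 ≤ U) (hN : 0 ≤ N)
    (hpq : p.HolderConjugate q) :
    U ^ (m - 1) * N ^ (p - 1) = (N ^ p * U ^ (m - 1)) ^ (1 / q) * U ^ ((m - 1) / p) := by
  have hp0 : p ≠ 0 := hpq.ne_zero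
  have hq0 : 0 < q := hpq.symm.pos
  have h1 : p * (1 / q) = p - 1 := by
    have := hpq.mul_eq_add
    field_simp
    linarith
  have h2 : (m - 1) * (1 / q) + (m - 1) / p = m - 1 := by
    have := hpq.inv_add_inv_eq_one
    rw [mul_one_div, div_eq_mul_inv, div_eq_mul_inv, ← mul_add, add_comm, this, mul_one]
  rw [Real.mul_rpow (Real.rpow_nonneg hN _) (Real.rpow_nonneg hU _), ← Real.rpow_mul hN, h1,
    ← Real.rpow_mul hU, mul_assoc, ← Real.rpow_add_of_nonneg hU
      (mul_nonneg (by linarith) (by positivity)) (div_nonneg (by linarith) (by linarith)), h2,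
    mul_comm]

theorem rpow_energy_eq (hp : 1 < p) (hU : 0 ≤ U) (hN : 0 ≤ N) :
    (U ^ ((m - 1) / p) * N) ^ p = N ^ p * U ^ (m - 1) := by
  rw [Real.mul_rpow (Real.rpow_nonneg hU _) hN, ← Real.rpow_mul hU, div_mul_cancel₀ _ (by linarith),
    mul_comm]

/-- For N = 0 the bound forces Y = 0, so the value assigned to 0^(p-2) is irrelevant even when p ≤
2. -/
theorem rpow_sub_two_mul_le {Y c : ℝ} (hp : 1 < p) (hN : 0 ≤ N) (hY : |Y| ≤ c * N) :
    N ^ (p - 2) * |Y| ≤ c * N ^ (p - 1) := by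
  rcases hN.eq_or_lt with rfl | hN
  · rw [mul_zero] at hY
    rw [le_antisymm hY (abs_nonneg _), mul_zero, Real.zero_rpow (by linarith), mul_zero]
  · calc N ^ (p - 2) * |Y| ≤ N ^ (p - 2) * (c * N) := by gcongr
      _ = c * (N ^ (p - 2) * N ^ (1 : ℝ)) := by rw [Real.rpow_one]; ring
      _ = c * N ^ (p - 1) := by rw [← Real.rpow_add hN]; ring_nf

theorem rpow_sub_two_mul_sq (hp : 1 < p) (hN : 0 ≤ N) : N ^ (p - 2) * N ^ 2 = N ^ p := by
  rcases hN.eq_or_lt with rfl | hN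
  · rw [Real.zero_rpow (by linarith : p ≠ 0)]; simp
  · rw [← Real.rpow_natCast, ← Real.rpow_add hN]; norm_num

/-- This dominates the flux by a constant and the two powers assumed locally integrable. -/
theorem rpow_mul_rpow_le (hp : 1 < p) (hm : 1 ≤ m) (hU : 0 ≤ U) (hN : 0 ≤ N) :
    U ^ (m - 1) * N ^ (p - 1) ≤ 1 + U ^ (p + m - 1) + N ^ p * U ^ (m - 1) := by
  have h1 : U ^ (m - 1) ≤ 1 + U ^ (p + m - 1) := by
    rcases le_total U 1 with h | h
    · have := Real.rpow_le_one hU h (by linarith : 0 ≤ m - 1)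
      linarith [Real.rpow_nonneg hU (p + m - 1)]
    · linarith [Real.rpow_le_rpow_of_exponent_le h (by linarith : m - 1 ≤ p + m - 1)]
  have h2 : N ^ (p - 1) ≤ 1 + N ^ p := by
    rcases le_total N 1 with h | h
    · have := Real.rpow_le_one hN h (by linarith : 0 ≤ p - 1)
      linarith [Real.rpow_nonneg hN p]
    · linarith [Real.rpow_le_rpow_of_exponent_le h (by linarith : p - 1 ≤ p)]
  have h3 := mul_le_mul_of_nonneg_left h2 (Real.rpow_nonneg hU (m - 1))
  linarith [mul_add (U ^ (m - 1)) 1 (N ^ p), mul_comm (U ^ (m - 1)) (N ^ p)]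

end Pointwise

theorem _root_.LocallyLipschitzOn.mul_real {X : Type*} [PseudoEMetricSpace X] {s : Set X}
    {f g : X → ℝ} (hf : LocallyLipschitzOn s f) (hg : LocallyLipschitzOn s g) :
    LocallyLipschitzOn s fun x ↦ f x * g x :=
  locallyLipschitzOn_iff_restrict.2 (LocallyLipschitz.mul_real
    (locallyLipschitzOn_iff_restrict.1 hf) (locallyLipschitzOn_iff_restrict.1 hg))

theorem _root_.LocallyLipschitz.comp_locallyLipschitzOn {X Y Z : Type*} [PseudoEMetricSpace X]
    [PseudoEMetricSpace Y] [PseudoEMetricSpace Z] {s : Set X} {g : Y → Z} {f : X → Y}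
    (hg : LocallyLipschitz g) (hf : LocallyLipschitzOn s f) :
    LocallyLipschitzOn s fun x ↦ g (f x) :=
  locallyLipschitzOn_iff_restrict.2 (hg.comp (locallyLipschitzOn_iff_restrict.1 hf))

theorem _root_.ContDiffOn.locallyLipschitzOn_of_isOpen {E F : Type*} [NormedAddCommGroup E]
    [NormedSpace ℝ E] [NormedAddCommGroup F] [NormedSpace ℝ F] {s : Set E} {f : E → F}
    (hf : ContDiffOn ℝ 1 f s) (hs : IsOpen s) : LocallyLipschitzOn s f := fun x hx ↦ by
  obtain ⟨K, t, ht, hK⟩ := (hf.contDiffAt (hs.mem_nhds hx)).exists_lipschitzOnWith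
  exact ⟨K, t, mem_nhdsWithin_of_mem_nhds ht, hK⟩

/-- A function which is locally Lipschitz on an open set and vanishes off a closed subset of it is
locally Lipschitz. -/
theorem locallyLipschitz_of_tsupport_subset {X Y : Type*} [PseudoEMetricSpace X]
    [PseudoEMetricSpace Y] [Zero Y] {s : Set X} (hs : IsOpen s) {f : X → Y}
    (hf : LocallyLipschitzOn s f) (hfs : tsupport f ⊆ s) : LocallyLipschitz f := fun x ↦ by
  by_cases hx : x ∈ tsupport f
  · obtain ⟨K, t, ht, hK⟩ := hf (hfs hx)
    exact ⟨K, t, by rwa [hs.nhdsWithin_eq (hfs hx)] at ht, hK⟩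
  · refine ⟨0, _, notMem_tsupport_iff_eventuallyEq.1 hx, fun y hy z hz ↦ ?_⟩
    have hy' : f y = 0 := hy
    have hz' : f z = 0 := hz
    simp [hy', hz']

theorem _root_.MeasureTheory.LocallyIntegrableOn.congr_ae {X : Type*} [TopologicalSpace X]
    [LocallyCompactSpace X] [T2Space X] [MeasurableSpace X] {μ : Measure X} {s : Set X}
    (hs : IsLocallyClosed s) {f g : X → ℝ} (hf : LocallyIntegrableOn f s μ)
    (h : f =ᵐ[μ.restrict s] g) : LocallyIntegrableOn g s μ := by
  rw [locallyIntegrableOn_iff hs] at hf ⊢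
  exact fun K hK hKc ↦ (hf K hK hKc).congr (ae_mono (Measure.restrict_mono hK le_rfl) h)

/-! ### Test functions and their derivatives under the space-time charts. -/

section PushPull

variable {n : ℕ} {M : Type*} [MetricSpace M] [ProperSpace M]
    [ChartedSpace (EuclideanSpace ℝ (Fin n)) M] [IsManifold (𝓡 n) ∞ M]
    [RiemannianBundle (fun x : M ↦ TangentSpace (𝓡 n) x)]
    [IsContMDiffRiemannianBundle (𝓡 n) ∞ (EuclideanSpace ℝ (Fin n))
      (fun x : M ↦ TangentSpace (𝓡 n) x)] [IsRiemannianManifold (𝓡 n) M]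
    [MeasurableSpace M] [BorelSpace M]

theorem locallyLipschitzOn_stInv (c : M) : LocallyLipschitzOn (coordCylinder n c) (stInv n c) := by
  intro z hz
  obtain ⟨K, t, ht, hK⟩ := locallyLipschitzOn_chart_symm c hz.1
  rw [(isOpen_chart_target c).nhdsWithin_eq hz.1] at ht
  refine ⟨max K 1, Prod.fst ⁻¹' t, mem_nhdsWithin_of_mem_nhds (continuous_fst.continuousAt ht), ?_⟩
  have h1 : LipschitzOnWith K (fun z : EuclideanSpace ℝ (Fin n) × ℝ ↦
      (extChartAt (𝓡 n) c).symm z.1) (Prod.fst ⁻¹' t) := fun x hx y hy ↦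
    (hK hx hy).trans (mul_le_mul_right (le_max_left _ _) _)
  exact h1.prodMk (LipschitzWith.prod_snd.lipschitzOnWith)

theorem locallyLipschitzOn_stChart (c : M) :
    LocallyLipschitzOn (chartCylinder n c) (stChart n c) := by
  intro z hz
  obtain ⟨K, t, ht, hK⟩ := locallyLipschitzOn_chart c hz.1
  rw [(isOpen_chart_source c).nhdsWithin_eq hz.1] at ht
  refine ⟨max K 1, Prod.fst ⁻¹' t, mem_nhdsWithin_of_mem_nhds (continuous_fst.continuousAt ht), ?_⟩
  have h1 : LipschitzOnWith K (fun z : M × ℝ ↦ extChartAt (𝓡 n) c z.1) (Prod.fst ⁻¹' t) :=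
    fun x hx y hy ↦ (hK hx hy).trans (mul_le_mul_right (le_max_left _ _) _)
  exact h1.prodMk (LipschitzWith.prod_snd.lipschitzOnWith)

theorem tsupport_indicator_subset {X : Type*} [TopologicalSpace X] [T2Space X] {s K : Set X}
    {f : X → ℝ} (hK : IsCompact K) (h : ∀ x ∈ s, x ∉ K → f x = 0) :
    tsupport (s.indicator f) ⊆ K :=
  closure_minimal (fun x hx ↦ by
    by_contra hxK
    refine hx ?_
    by_cases hs : x ∈ s
    · rw [indicator_of_mem hs, h x hs hxK]
    · rw [indicator_of_notMem hs]) hK.isClosed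

/-- A test function in coordinates defines a test function on the manifold. -/
theorem isTestFunction_push (c : M) {ψ : EuclideanSpace ℝ (Fin n) × ℝ → ℝ} (h0 : ∀ z, 0 ≤ ψ z)
    (hψ : LocallyLipschitz ψ) (hc : HasCompactSupport ψ) (hs : tsupport ψ ⊆ coordCylinder n c) :
    IsTestFunction ((chartCylinder n c).indicator fun z ↦ ψ (stChart n c z)) ∧
    tsupport ((chartCylinder n c).indicator fun z ↦ ψ (stChart n c z)) ⊆ chartCylinder n c := by
  have hK : IsCompact (stInv n c '' tsupport ψ) :=
    hc.isCompact.image_of_continuousOn ((continuousOn_stInv c).mono hs)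
  have hKs : stInv n c '' tsupport ψ ⊆ chartCylinder n c := by
    rintro _ ⟨z, hz, rfl⟩; exact stInv_mem (hs hz)
  have hsub : tsupport ((chartCylinder n c).indicator fun z ↦ ψ (stChart n c z))
      ⊆ stInv n c '' tsupport ψ := by
    refine tsupport_indicator_subset hK fun z hz hzK ↦ ?_
    refine image_eq_zero_of_notMem_tsupport fun h ↦ hzK ⟨_, h, stInv_stChart hz⟩
  refine ⟨⟨fun z ↦ indicator_nonneg (fun z _ ↦ h0 _) z, ?_, hK.of_isClosed_subset
    (isClosed_tsupport _) hsub, (hsub.trans hKs).trans (chartCylinder_subset c)⟩, hsub.trans hKs⟩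
  refine locallyLipschitz_of_tsupport_subset (isOpen_chartCylinder c) ?_ (hsub.trans hKs)
  have h1 := hψ.comp_locallyLipschitzOn (locallyLipschitzOn_stChart (n := n) c)
  intro z hz
  obtain ⟨K, t, ht, hKt⟩ := h1 hz
  exact ⟨K, t ∩ chartCylinder n c, inter_mem ht self_mem_nhdsWithin, fun x hx y hy ↦ by
    rw [indicator_of_mem hx.2, indicator_of_mem hy.2]; exact hKt hx.1 hy.1⟩

/-- A test function over a chart domain defines a test function in coordinates. -/
theorem isTestFunction_pull {c : M} {Ψ : M × ℝ → ℝ} (hΨ : IsTestFunction Ψ)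
    (hs : tsupport Ψ ⊆ chartCylinder n c) :
    (∀ z, 0 ≤ (coordCylinder n c).indicator (fun z ↦ Ψ (stInv n c z)) z) ∧
    LocallyLipschitz ((coordCylinder n c).indicator fun z ↦ Ψ (stInv n c z)) ∧
    HasCompactSupport ((coordCylinder n c).indicator fun z ↦ Ψ (stInv n c z)) ∧
    tsupport ((coordCylinder n c).indicator fun z ↦ Ψ (stInv n c z)) ⊆ coordCylinder n c := by
  have hK : IsCompact (stChart n c '' tsupport Ψ) :=
    hΨ.compact.isCompact.image_of_continuousOn ((continuousOn_stChart c).mono hs)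
  have hKs : stChart n c '' tsupport Ψ ⊆ coordCylinder n c := by
    rintro _ ⟨z, hz, rfl⟩; exact stChart_mem (hs hz)
  have hsub : tsupport ((coordCylinder n c).indicator fun z ↦ Ψ (stInv n c z))
      ⊆ stChart n c '' tsupport Ψ := by
    refine tsupport_indicator_subset hK fun z hz hzK ↦ ?_
    exact image_eq_zero_of_notMem_tsupport fun h ↦ hzK ⟨_, h, stChart_stInv hz⟩
  refine ⟨fun z ↦ indicator_nonneg (fun z _ ↦ hΨ.nonneg _) z, ?_, hK.of_isClosed_subset
    (isClosed_tsupport _) hsub, hsub.trans hKs⟩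
  refine locallyLipschitz_of_tsupport_subset (isOpen_coordCylinder c) ?_ (hsub.trans hKs)
  have h1 := hΨ.lip.comp_locallyLipschitzOn (locallyLipschitzOn_stInv (n := n) c)
  intro z hz
  obtain ⟨K, t, ht, hKt⟩ := h1 hz
  exact ⟨K, t ∩ coordCylinder n c, inter_mem ht self_mem_nhdsWithin, fun x hx y hy ↦ by
    rw [indicator_of_mem hx.2, indicator_of_mem hy.2]; exact hKt hx.1 hy.1⟩

section Slices

variable {c : M} {ψ : EuclideanSpace ℝ (Fin n) × ℝ → ℝ} {Ψ : M × ℝ → ℝ}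
  (h : ∀ z ∈ coordCylinder n c, Ψ (stInv n c z) = ψ z) {z : EuclideanSpace ℝ (Fin n) × ℝ}
  (hz : z ∈ coordCylinder n c)
include h hz

theorem dirDeriv_slice_eq_sum (v : TangentSpace (𝓡 n) ((extChartAt (𝓡 n) c).symm z.1)) :
    dirDeriv (fun x ↦ Ψ (x, z.2)) ((extChartAt (𝓡 n) c).symm z.1) v
      = ∑ i, spDeriv i ψ z * chartCoord c _ v i := by
  rw [dirDeriv_eq_fderiv hz.1]
  have h1 : (fun y ↦ Ψ ((extChartAt (𝓡 n) c).symm y, z.2)) =ᶠ[𝓝 z.1] fun y ↦ ψ (y, z.2) := by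
    filter_upwards [(isOpen_chart_target (n := n) c).mem_nhds hz.1] with y hy
    exact h (y, z.2) ⟨hy, hz.2⟩
  rw [h1.fderiv_eq]
  set w := chartCoord c _ v
  have hw : w = ∑ i, w i • EuclideanSpace.single i (1 : ℝ) := by
    ext j
    simp [Finset.sum_apply, Pi.single_apply]
  conv_lhs => rw [hw]
  rw [map_sum]
  exact Finset.sum_congr rfl fun i _ ↦ by rw [map_smul, smul_eq_mul, mul_comm]; rfl

theorem deriv_slice_eq :
    deriv (fun s ↦ Ψ ((extChartAt (𝓡 n) c).symm z.1, s)) z.2 = tmDeriv ψ z := by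
  have h1 : (fun s ↦ Ψ ((extChartAt (𝓡 n) c).symm z.1, s)) =ᶠ[𝓝 z.2] fun s ↦ ψ (z.1, s) := by
    filter_upwards [isOpen_Ioi.mem_nhds hz.2] with s hs
    exact h (z.1, s) ⟨hz.1, hs⟩
  exact h1.deriv_eq

end Slices

theorem dirDeriv_eq_zero_of_notMem_tsupport {Ψ : M × ℝ → ℝ} {z : M × ℝ} (hz : z ∉ tsupport Ψ)
    (v : TangentSpace (𝓡 n) z.1) : dirDeriv (fun x ↦ Ψ (x, z.2)) z.1 v = 0 := by
  have h : (fun x ↦ Ψ (x, z.2)) =ᶠ[𝓝 z.1] fun _ ↦ (0 : ℝ) := by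
    have h1 := notMem_tsupport_iff_eventuallyEq.1 hz
    exact (Continuous.tendsto (by fun_prop : Continuous fun y : M ↦ (y, z.2)) z.1).eventually h1
  rw [dirDeriv, h.mfderiv_eq, mfderiv_const]
  rfl

theorem deriv_eq_zero_of_notMem_tsupport {Ψ : M × ℝ → ℝ} {z : M × ℝ} (hz : z ∉ tsupport Ψ) :
    deriv (fun s ↦ Ψ (z.1, s)) z.2 = 0 := by
  have h : (fun s ↦ Ψ (z.1, s)) =ᶠ[𝓝 z.2] fun _ ↦ 0 := by
    have h1 := notMem_tsupport_iff_eventuallyEq.1 hz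
    exact (Continuous.tendsto (by fun_prop : Continuous fun s : ℝ ↦ (z.1, s)) z.2).eventually h1
  rw [h.deriv_eq]
  simp

end PushPull

/-- Weak solutions with given weak derivatives `X = ∇u` and `w = ∂ₜu`. -/
structure IsWeakSolutionWith (n : ℕ) {M : Type*} [MetricSpace M]
    [ChartedSpace (EuclideanSpace ℝ (Fin n)) M]
    [RiemannianBundle (fun x : M ↦ TangentSpace (𝓡 n) x)] [MeasurableSpace M]
    (p q m : ℝ) (f : ℝ → ℝ) (a : M → ℝ) (V u : M × ℝ → ℝ)
    (X : ∀ x : M, ℝ → TangentSpace (𝓡 n) x) (w : M × ℝ → ℝ) : Prop where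
  nonneg : ∀ᵐ z ∂(((riemVolume n M).prod volume).restrict (spaceTime M)), 0 ≤ u z
  derivs : HasWeakDerivs u X w
  reaction : LocallyIntegrableOn (fun z ↦ u z ^ q * V z) (spaceTime M)
    ((weightedVolume n a).prod volume)
  power : LocallyIntegrableOn (fun z ↦ u z ^ (p + m - 1)) (spaceTime M)
    ((weightedVolume n a).prod volume)
  energy : LocallyIntegrableOn (fun z ↦ ‖X z.1 z.2‖ ^ p * u z ^ (m - 1)) (spaceTime M)
    ((riemVolume n M).prod volume)
  test : ∀ ψ : M × ℝ → ℝ, IsTestFunction ψ →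
    ∫ z in spaceTime M, ψ z * u z ^ q * V z ∂((weightedVolume n a).prod volume)
      ≤ (∫ z in spaceTime M,
          dirDeriv (fun x ↦ ψ (x, z.2)) z.1 (X z.1 z.2)
            * u z ^ (m - 1) * ‖X z.1 z.2‖ ^ (p - 2) * f ‖X z.1 z.2‖
          ∂((weightedVolume n a).prod volume))
        - ∫ z in spaceTime M, deriv (fun s ↦ ψ (z.1, s)) z.2 * u z
          ∂((weightedVolume n a).prod volume)

theorem IsWeakSolution.exists_with {n : ℕ} {M : Type*} [MetricSpace M]
    [ChartedSpace (EuclideanSpace ℝ (Fin n)) M]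
    [RiemannianBundle (fun x : M ↦ TangentSpace (𝓡 n) x)] [MeasurableSpace M]
    {p q m : ℝ} {f : ℝ → ℝ} {a : M → ℝ} {V u : M × ℝ → ℝ}
    (h : IsWeakSolution n p q m f a V u) :
    ∃ (X : ∀ x : M, ℝ → TangentSpace (𝓡 n) x) (w : M × ℝ → ℝ),
      IsWeakSolutionWith n p q m f a V u X w := by
  obtain ⟨h0, X, w, h1, h2, h3, h4, -, h5⟩ := h
  exact ⟨X, w, h0, h1, h2, h3, h4, h5⟩

/-! ### Coordinate expressions of weight, gradient and flux. -/

section Coordinates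

variable {n : ℕ} {M : Type*} [MetricSpace M] [ProperSpace M]
    [ChartedSpace (EuclideanSpace ℝ (Fin n)) M] [IsManifold (𝓡 n) ∞ M]
    [RiemannianBundle (fun x : M ↦ TangentSpace (𝓡 n) x)]
    [IsContMDiffRiemannianBundle (𝓡 n) ∞ (EuclideanSpace ℝ (Fin n))
      (fun x : M ↦ TangentSpace (𝓡 n) x)] [IsRiemannianManifold (𝓡 n) M]
    [MeasurableSpace M] [BorelSpace M]

/-- The weight `a √g` in coordinates. -/
def coordWeight (n : ℕ) {M : Type*} [MetricSpace M] [ChartedSpace (EuclideanSpace ℝ (Fin n)) M]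
    [RiemannianBundle (fun x : M ↦ TangentSpace (𝓡 n) x)] (a : M → ℝ) (c : M)
    (y : EuclideanSpace ℝ (Fin n)) : ℝ := a ((extChartAt (𝓡 n) c).symm y) * volDensity c y

theorem locallyLipschitzOn_coordWeight {a : M → ℝ} (ha : LocallyLipschitz a) (c : M) :
    LocallyLipschitzOn (extChartAt (𝓡 n) c).target (coordWeight n a c) :=
  (ha.comp_locallyLipschitzOn (locallyLipschitzOn_chart_symm c)).mul_real
    (((contDiffOn_volDensity c).of_le (by simp)).locallyLipschitzOn_of_isOpen
      (isOpen_chart_target c))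

/-- The gradient components in coordinates. -/
def gradComp (X : ∀ x : M, ℝ → TangentSpace (𝓡 n) x) (c : M) (i : Fin n)
    (z : EuclideanSpace ℝ (Fin n) × ℝ) : ℝ :=
  inner ℝ (X ((extChartAt (𝓡 n) c).symm z.1) z.2) (coordVec c i z.1)

/-- The norm of the gradient in coordinates. -/
def gradNorm (X : ∀ x : M, ℝ → TangentSpace (𝓡 n) x) (z : M × ℝ) : ℝ := ‖X z.1 z.2‖

theorem gradNorm_nonneg (X : ∀ x : M, ℝ → TangentSpace (𝓡 n) x) (z : M × ℝ) :
    0 ≤ gradNorm X z := norm_nonneg _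

/-- The components of the raised gradient in coordinates. -/
def gradCoord (X : ∀ x : M, ℝ → TangentSpace (𝓡 n) x) (c : M) (i : Fin n)
    (z : EuclideanSpace ℝ (Fin n) × ℝ) : ℝ :=
  chartCoord c _ (X ((extChartAt (𝓡 n) c).symm z.1) z.2) i

/-- The scalar factor `u^(m-1) |∇u|^(p-2) f(|∇u|)` of the flux. -/
def fluxFactor (p m : ℝ) (f : ℝ → ℝ) (u : M × ℝ → ℝ) (X : ∀ x : M, ℝ → TangentSpace (𝓡 n) x)
    (z : M × ℝ) : ℝ := u z ^ (m - 1) * gradNorm X z ^ (p - 2) * f (gradNorm X z)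

theorem gradCoord_eq (X : ∀ x : M, ℝ → TangentSpace (𝓡 n) x) {c : M} (i : Fin n)
    {z : EuclideanSpace ℝ (Fin n) × ℝ} (hz : z ∈ coordCylinder n c) :
    gradCoord X c i z = ∑ j, gradComp X c j z * metricInv c j i z.1 :=
  chartCoord_eq_sum hz.1 _ i

theorem gradNorm_sq_eq (X : ∀ x : M, ℝ → TangentSpace (𝓡 n) x) {c : M}
    {z : EuclideanSpace ℝ (Fin n) × ℝ} (hz : z ∈ coordCylinder n c) :
    gradNorm X (stInv n c z) ^ 2 = ∑ i, gradComp X c i z * gradCoord X c i z :=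
  norm_sq_eq_sum hz.1 _

theorem sum_abs_gradComp_le (X : ∀ x : M, ℝ → TangentSpace (𝓡 n) x) (c : M)
    (z : EuclideanSpace ℝ (Fin n) × ℝ) :
    ∑ i, |gradComp X c i z| ≤ frameBound n c z.1 * gradNorm X (stInv n c z) := by
  rw [frameBound, Finset.sum_mul]
  exact Finset.sum_le_sum fun i _ ↦ (abs_inner_coordVec_le c _ _ i).trans (mul_comm _ _).le

theorem abs_gradCoord_le (X : ∀ x : M, ℝ → TangentSpace (𝓡 n) x) {c : M} (i : Fin n)
    {z : EuclideanSpace ℝ (Fin n) × ℝ} (hz : z ∈ coordCylinder n c) :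
    |gradCoord X c i z| ≤ coordBound n c z.1 * gradNorm X (stInv n c z) :=
  (Finset.single_le_sum (f := fun i ↦ |gradCoord X c i z|) (fun i _ ↦ abs_nonneg _)
    (Finset.mem_univ i)).trans (sum_abs_chartCoord_le hz.1 _)

theorem continuousOn_comp_fst {c : M} {g : EuclideanSpace ℝ (Fin n) → ℝ}
    (hg : ContinuousOn g (extChartAt (𝓡 n) c).target) :
    ContinuousOn (fun z : EuclideanSpace ℝ (Fin n) × ℝ ↦ g z.1) (coordCylinder n c) :=
  hg.comp continuousOn_fst fun _ hz ↦ hz.1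

theorem aemeasurable_comp_fst {c : M} {g : EuclideanSpace ℝ (Fin n) → ℝ}
    (hg : ContinuousOn g (extChartAt (𝓡 n) c).target) :
    AEMeasurable (fun z : EuclideanSpace ℝ (Fin n) × ℝ ↦ g z.1)
      (volume.restrict (coordCylinder n c)) :=
  (continuousOn_comp_fst hg).aemeasurable (isOpen_coordCylinder c).measurableSet

end Coordinates

namespace IsWeakSolutionWith

variable {n : ℕ} {M : Type*} [MetricSpace M] [ProperSpace M]
    [ChartedSpace (EuclideanSpace ℝ (Fin n)) M] [IsManifold (𝓡 n) ∞ M]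
    [RiemannianBundle (fun x : M ↦ TangentSpace (𝓡 n) x)]
    [IsContMDiffRiemannianBundle (𝓡 n) ∞ (EuclideanSpace ℝ (Fin n))
      (fun x : M ↦ TangentSpace (𝓡 n) x)] [IsRiemannianManifold (𝓡 n) M]
    [MeasurableSpace M] [BorelSpace M]
    {p q m K : ℝ} {f : ℝ → ℝ} {a : M → ℝ} {V u : M × ℝ → ℝ}
    {X : ∀ x : M, ℝ → TangentSpace (𝓡 n) x} {w : M × ℝ → ℝ}
    (h : IsWeakSolutionWith n p q m f a V u X w)
include h

theorem locallyIntegrableOn_coord (c : M) :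
    LocallyIntegrableOn (fun z ↦ u (stInv n c z)) (coordCylinder n c) volume :=
  locallyIntegrableOn_chart h.derivs.locInt c

theorem aemeasurable_coord (c : M) :
    AEMeasurable (fun z ↦ u (stInv n c z)) (volume.restrict (coordCylinder n c)) :=
  (h.locallyIntegrableOn_coord c).aestronglyMeasurable.aemeasurable

theorem aemeasurable_gradComp (c : M) (i : Fin n) :
    AEMeasurable (gradComp X c i) (volume.restrict (coordCylinder n c)) :=
  (h.derivs.locInt_grad c i).aestronglyMeasurable.aemeasurable

theorem aemeasurable_gradCoord (c : M) (i : Fin n) :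
    AEMeasurable (gradCoord X c i) (volume.restrict (coordCylinder n c)) := by
  have h1 : AEMeasurable (fun z ↦ ∑ j, gradComp X c j z * metricInv c j i z.1)
      (volume.restrict (coordCylinder n c)) :=
    Finset.aemeasurable_fun_sum _ fun j _ ↦ (h.aemeasurable_gradComp c j).mul
      (aemeasurable_comp_fst (continuousOn_metricInv c j i))
  refine h1.congr ?_
  filter_upwards [ae_restrict_mem (isOpen_coordCylinder c).measurableSet] with z hz
  exact (gradCoord_eq X i hz).symm

theorem aemeasurable_gradNorm (c : M) :
    AEMeasurable (fun z ↦ gradNorm X (stInv n c z)) (volume.restrict (coordCylinder n c)) := by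
  have h1 : AEMeasurable (fun z ↦ √(∑ i, gradComp X c i z * gradCoord X c i z))
      (volume.restrict (coordCylinder n c)) :=
    (Finset.aemeasurable_fun_sum _ fun i _ ↦ (h.aemeasurable_gradComp c i).mul
      (h.aemeasurable_gradCoord c i)).sqrt
  refine h1.congr ?_
  filter_upwards [ae_restrict_mem (isOpen_coordCylinder c).measurableSet] with z hz
  rw [← gradNorm_sq_eq X hz, Real.sqrt_sq (gradNorm_nonneg _ _)]

theorem nonneg_coord (c : M) :
    ∀ᵐ z ∂(volume.restrict (coordCylinder n c)), 0 ≤ u (stInv n c z) :=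
  ae_chart.1 (ae_mono (Measure.restrict_mono (chartCylinder_subset c) le_rfl) h.nonneg)

theorem locallyIntegrableOn_energy_coord (c : M) :
    LocallyIntegrableOn (fun z ↦ gradNorm X (stInv n c z) ^ p * u (stInv n c z) ^ (m - 1))
      (coordCylinder n c) volume :=
  locallyIntegrableOn_chart h.energy c

theorem hasWeakDirDeriv_grad (c : M) (i : Fin n) :
    HasWeakDirDeriv volume (coordCylinder n c) (fun z ↦ u (stInv n c z)) (gradComp X c i)
      (EuclideanSpace.single i 1, 0) := by
  refine ⟨h.locallyIntegrableOn_coord c, h.derivs.locInt_grad c i, fun ζ hζ hζc hζs ↦ ?_⟩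
  have h1 := h.derivs.grad c i ζ hζ hζc hζs
  rw [setIntegral_eq_integral_of_forall_compl_eq_zero,
    setIntegral_eq_integral_of_forall_compl_eq_zero] at h1
  · exact h1
  · intro z hz
    rw [image_eq_zero_of_notMem_tsupport fun h' ↦ hz (hζs h'), mul_zero]
  · intro z hz
    have h2 : fderiv ℝ ζ z = 0 := by
      by_contra h0
      exact hz (hζs (tsupport_fderiv_subset ℝ (subset_closure h0)))
    rw [h2]
    simp

theorem hasWeakDirDeriv_time (c : M) :
    HasWeakDirDeriv volume (coordCylinder n c) (fun z ↦ u (stInv n c z))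
      (fun z ↦ w (stInv n c z)) (0, 1) := by
  refine ⟨h.locallyIntegrableOn_coord c, locallyIntegrableOn_chart h.derivs.locInt_time c,
    fun ζ hζ hζc hζs ↦ ?_⟩
  have h1 := h.derivs.time c ζ hζ hζc hζs
  rw [setIntegral_eq_integral_of_forall_compl_eq_zero,
    setIntegral_eq_integral_of_forall_compl_eq_zero] at h1
  · exact h1
  · intro z hz
    rw [image_eq_zero_of_notMem_tsupport fun h' ↦ hz (hζs h'), mul_zero]
  · intro z hz
    have h2 : fderiv ℝ ζ z = 0 := by
      by_contra h0
      exact hz (hζs (tsupport_fderiv_subset ℝ (subset_closure h0)))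
    rw [h2]
    simp

end IsWeakSolutionWith

theorem HasWeakDirDeriv.congr_ae {G : Type*} [NormedAddCommGroup G] [NormedSpace ℝ G]
    [FiniteDimensional ℝ G] [MeasurableSpace G] [BorelSpace G] {μ : Measure G}
    [μ.IsAddHaarMeasure] {O : Set G} (hO : IsOpen O) {U U' Q Q' : G → ℝ} {e : G}
    (h : HasWeakDirDeriv μ O U Q e) (hU : U =ᵐ[μ.restrict O] U') (hQ : Q =ᵐ[μ.restrict O] Q') :
    HasWeakDirDeriv μ O U' Q' e := by
  have : ProperSpace G := FiniteDimensional.proper ℝ G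
  refine ⟨h.locInt.congr_ae hO.isLocallyClosed hU, h.locInt_deriv.congr_ae hO.isLocallyClosed hQ,
    fun ζ hζ hζc hζs ↦ ?_⟩
  have key : ∀ {A B g : G → ℝ}, A =ᵐ[μ.restrict O] B → (∀ z ∉ O, g z = 0) →
      ∫ z, A z * g z ∂μ = ∫ z, B z * g z ∂μ := fun {A B g} hAB hg ↦ by
    refine integral_congr_ae ?_
    filter_upwards [(ae_restrict_iff' hO.measurableSet).1 hAB] with z hz
    by_cases hzO : z ∈ O
    · rw [hz hzO]
    · rw [hg z hzO, mul_zero, mul_zero]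
  rw [← key hU, ← key hQ]
  · exact h.integral_eq ζ hζ hζc hζs
  · exact fun z hz ↦ image_eq_zero_of_notMem_tsupport fun h' ↦ hz (hζs h')
  · intro z hz
    have h2 : fderiv ℝ ζ z = 0 := by
      by_contra h0
      exact hz (hζs (tsupport_fderiv_subset ℝ (subset_closure h0)))
    rw [h2]
    simp

/-! ### Weighted integrals over chart cylinders. -/

section CoordinateIntegrals

variable {n : ℕ} {M : Type*} [MetricSpace M] [ProperSpace M]
    [ChartedSpace (EuclideanSpace ℝ (Fin n)) M] [IsManifold (𝓡 n) ∞ M]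
    [RiemannianBundle (fun x : M ↦ TangentSpace (𝓡 n) x)]
    [IsContMDiffRiemannianBundle (𝓡 n) ∞ (EuclideanSpace ℝ (Fin n))
      (fun x : M ↦ TangentSpace (𝓡 n) x)] [IsRiemannianManifold (𝓡 n) M]
    [MeasurableSpace M] [BorelSpace M] {a : M → ℝ}

theorem continuousOn_coordWeight (ha : LocallyLipschitz a) (c : M) :
    ContinuousOn (coordWeight n a c) (extChartAt (𝓡 n) c).target :=
  (locallyLipschitzOn_coordWeight ha c).continuousOn

theorem ae_coordWeight_pos (hpos : ∀ᵐ x ∂(riemVolume n M), 0 < a x) (c : M) :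
    ∀ᵐ z ∂(volume.restrict (coordCylinder n c)), 0 < coordWeight n a c z.1 := by
  have h1 := ae_chart (c := c).1 (ae_restrict_of_ae (ae_prod_weight_pos hpos))
  filter_upwards [h1, ae_restrict_mem (isOpen_coordCylinder c).measurableSet] with z hz hzO
  exact mul_pos hz (volDensity_pos hzO.1)

theorem locallyIntegrableOn_coordWeight_mul (ha : LocallyLipschitz a)
    (hpos : ∀ᵐ x ∂(riemVolume n M), 0 < a x) {H : M × ℝ → ℝ}
    (hH : LocallyIntegrableOn H (spaceTime M) ((weightedVolume n a).prod volume)) (c : M) :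
    LocallyIntegrableOn (fun z ↦ coordWeight n a c z.1 * H (stInv n c z)) (coordCylinder n c)
      volume := by
  have h1 := locallyIntegrableOn_chart
    ((locallyIntegrableOn_weightedVolume ha.continuous hpos).1 hH) c
  refine (h1.continuousOn_mul (continuousOn_comp_fst (contDiffOn_volDensity c).continuousOn)
    (isOpen_coordCylinder c).isLocallyClosed).congr_ae
    (isOpen_coordCylinder c).isLocallyClosed (Eventually.of_forall fun z ↦ ?_)
  simp only [coordWeight, stInv]
  ring

theorem setIntegral_weighted_eq_coord (ha : LocallyLipschitz a)
    (hpos : ∀ᵐ x ∂(riemVolume n M), 0 < a x) (c : M) {H : M × ℝ → ℝ}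
    (hH : ∀ z ∉ chartCylinder n c, H z = 0) :
    ∫ z in spaceTime M, H z ∂((weightedVolume n a).prod volume)
      = ∫ z in coordCylinder n c, coordWeight n a c z.1 * H (stInv n c z) := by
  rw [setIntegral_eq_of_subset_of_forall_sdiff_eq_zero isOpen_spaceTime.measurableSet
    (chartCylinder_subset c) fun z hz ↦ hH z hz.2, setIntegral_weightedVolume ha.continuous hpos
    (isOpen_chartCylinder c).measurableSet, integral_chart]
  refine integral_congr_ae (Eventually.of_forall fun z ↦ ?_)
  simp only [coordWeight, stInv]
  ring

theorem integrableOn_weighted_of_coord (ha : LocallyLipschitz a)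
    (hpos : ∀ᵐ x ∂(riemVolume n M), 0 < a x) (c : M) {H : M × ℝ → ℝ}
    (hH : ∀ z ∉ chartCylinder n c, H z = 0)
    (hi : IntegrableOn (fun z ↦ coordWeight n a c z.1 * H (stInv n c z)) (coordCylinder n c)) :
    IntegrableOn H (spaceTime M) ((weightedVolume n a).prod volume) := by
  refine IntegrableOn.of_forall_sdiff_eq_zero (s := chartCylinder n c) ?_
    isOpen_spaceTime.measurableSet fun z hz ↦ hH z hz.2
  rw [integrableOn_weightedVolume ha.continuous hpos (isOpen_chartCylinder c).measurableSet,
    integrableOn_chart]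
  refine hi.congr (Eventually.of_forall fun z ↦ ?_)
  simp only [coordWeight, stInv]
  ring

end CoordinateIntegrals

/-- The components of the flux in coordinates. -/
def coordFlux {n : ℕ} {M : Type*} [MetricSpace M] [ChartedSpace (EuclideanSpace ℝ (Fin n)) M]
    [RiemannianBundle (fun x : M ↦ TangentSpace (𝓡 n) x)] (p m : ℝ) (f : ℝ → ℝ) (a : M → ℝ)
    (u : M × ℝ → ℝ) (X : ∀ x : M, ℝ → TangentSpace (𝓡 n) x) (c : M) (i : Fin n)
    (z : EuclideanSpace ℝ (Fin n) × ℝ) : ℝ :=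
  coordWeight n a c z.1 * (fluxFactor p m f u X (stInv n c z) * gradCoord X c i z)

/-- The size of the flux in coordinates, up to the factor `u ^ ((m - 1) / p)`. -/
def coordFluxBound {n : ℕ} {M : Type*} [MetricSpace M] [ChartedSpace (EuclideanSpace ℝ (Fin n)) M]
    [RiemannianBundle (fun x : M ↦ TangentSpace (𝓡 n) x)] (p m K : ℝ) (a : M → ℝ)
    (u : M × ℝ → ℝ) (X : ∀ x : M, ℝ → TangentSpace (𝓡 n) x) (c : M)
    (z : EuclideanSpace ℝ (Fin n) × ℝ) : ℝ :=
  (|coordWeight n a c z.1| * (K * coordBound n c z.1))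
    * (gradNorm X (stInv n c z) ^ p * u (stInv n c z) ^ (m - 1)) ^ (1 / p.conjExponent)

/-- The reaction term in coordinates. -/
def coordReaction {n : ℕ} {M : Type*} [MetricSpace M] [ChartedSpace (EuclideanSpace ℝ (Fin n)) M]
    [RiemannianBundle (fun x : M ↦ TangentSpace (𝓡 n) x)] (q : ℝ) (a : M → ℝ)
    (V u : M × ℝ → ℝ) (c : M) (z : EuclideanSpace ℝ (Fin n) × ℝ) : ℝ :=
  coordWeight n a c z.1 * (u (stInv n c z) ^ q * V (stInv n c z))

/-! ### A weak solution in a chart as a Euclidean supersolution. -/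

namespace IsWeakSolutionWith

variable {n : ℕ} {M : Type*} [MetricSpace M] [ProperSpace M]
    [ChartedSpace (EuclideanSpace ℝ (Fin n)) M] [IsManifold (𝓡 n) ∞ M]
    [RiemannianBundle (fun x : M ↦ TangentSpace (𝓡 n) x)]
    [IsContMDiffRiemannianBundle (𝓡 n) ∞ (EuclideanSpace ℝ (Fin n))
      (fun x : M ↦ TangentSpace (𝓡 n) x)] [IsRiemannianManifold (𝓡 n) M]
    [MeasurableSpace M] [BorelSpace M]
    {p q m K : ℝ} {f : ℝ → ℝ} {a : M → ℝ} {V u : M × ℝ → ℝ}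
    {X : ∀ x : M, ℝ → TangentSpace (𝓡 n) x} {w : M × ℝ → ℝ}

theorem abs_fluxFactor_mul_le (hp : 1 < p) (hf : ∀ s, 0 ≤ s → 0 ≤ f s ∧ f s ≤ K)
    {z : M × ℝ} (hu : 0 ≤ u z) {Y C : ℝ} (hY : |Y| ≤ C * gradNorm X z) (hC : 0 ≤ C) :
    |fluxFactor p m f u X z * Y| ≤ K * C * (u z ^ (m - 1) * gradNorm X z ^ (p - 1)) := by
  have hN := gradNorm_nonneg X z
  have hf' := hf _ hN
  have h1 := rpow_sub_two_mul_le hp hN hY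
  have h2 : 0 ≤ u z ^ (m - 1) := Real.rpow_nonneg hu _
  have h3 : 0 ≤ C * gradNorm X z ^ (p - 1) := mul_nonneg hC (Real.rpow_nonneg hN _)
  rw [fluxFactor, abs_mul, abs_mul, abs_mul, abs_of_nonneg h2,
    abs_of_nonneg (Real.rpow_nonneg hN _), abs_of_nonneg hf'.1]
  calc u z ^ (m - 1) * gradNorm X z ^ (p - 2) * f (gradNorm X z) * |Y|
      = u z ^ (m - 1) * (f (gradNorm X z) * (gradNorm X z ^ (p - 2) * |Y|)) := by ring
    _ ≤ u z ^ (m - 1) * (K * (C * gradNorm X z ^ (p - 1))) := by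
        refine mul_le_mul_of_nonneg_left ?_ h2
        exact mul_le_mul hf'.2 h1 (mul_nonneg (Real.rpow_nonneg hN _) (abs_nonneg _))
          (hf'.1.trans hf'.2)
    _ = _ := by ring

variable (h : IsWeakSolutionWith n p q m f a V u X w)
include h

theorem aemeasurable_fluxFactor (hf_meas : Measurable f) (c : M) :
    AEMeasurable (fun z ↦ fluxFactor p m f u X (stInv n c z))
      (volume.restrict (coordCylinder n c)) :=
  (((h.aemeasurable_coord c).pow_const _).mul ((h.aemeasurable_gradNorm c).pow_const _)).mul
    (hf_meas.comp_aemeasurable (h.aemeasurable_gradNorm c))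

theorem aemeasurable_coordFlux (hf_meas : Measurable f) (ha : LocallyLipschitz a) (c : M)
    (i : Fin n) :
    AEMeasurable (coordFlux p m f a u X c i) (volume.restrict (coordCylinder n c)) :=
  (aemeasurable_comp_fst (continuousOn_coordWeight ha c)).mul
    ((h.aemeasurable_fluxFactor hf_meas c).mul (h.aemeasurable_gradCoord c i))

theorem abs_coordFlux_le (hp : 1 < p) (hf : ∀ s, 0 ≤ s → 0 ≤ f s ∧ f s ≤ K) (c : M) (i : Fin n) :
    ∀ᵐ z ∂(volume.restrict (coordCylinder n c)), |coordFlux p m f a u X c i z|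
      ≤ (|coordWeight n a c z.1| * (K * coordBound n c z.1))
        * (u (stInv n c z) ^ (m - 1) * gradNorm X (stInv n c z) ^ (p - 1)) := by
  filter_upwards [h.nonneg_coord c, ae_restrict_mem (isOpen_coordCylinder c).measurableSet]
    with z hz hzO
  rw [coordFlux, abs_mul, mul_assoc |_|]
  exact mul_le_mul_of_nonneg_left (abs_fluxFactor_mul_le hp hf hz (abs_gradCoord_le X i hzO)
    (coordBound_nonneg c _)) (abs_nonneg _)

theorem abs_coordFlux_le_bound (hp : 1 < p) (hm : 1 ≤ m)
    (hf : ∀ s, 0 ≤ s → 0 ≤ f s ∧ f s ≤ K) (c : M) (i : Fin n) :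
    ∀ᵐ z ∂(volume.restrict (coordCylinder n c)), |coordFlux p m f a u X c i z|
      ≤ coordFluxBound p m K a u X c z * u (stInv n c z) ^ ((m - 1) / p) := by
  filter_upwards [h.nonneg_coord c, h.abs_coordFlux_le hp hf c i] with z hz hzA
  rw [rpow_flux_eq hp hm hz (gradNorm_nonneg _ _) (Real.HolderConjugate.conjExponent hp),
    ← mul_assoc] at hzA
  exact hzA

theorem locallyIntegrableOn_coordFlux (hp : 1 < p) (hm : 1 ≤ m) (hf_meas : Measurable f)
    (hf : ∀ s, 0 ≤ s → 0 ≤ f s ∧ f s ≤ K) (ha : LocallyLipschitz a)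
    (hpos : ∀ᵐ x ∂(riemVolume n M), 0 < a x) (c : M) (i : Fin n) :
    LocallyIntegrableOn (coordFlux p m f a u X c i) (coordCylinder n c) volume := by
  have hO := (isOpen_coordCylinder (n := n) c).isLocallyClosed
  have hK : 0 ≤ K := (hf 0 le_rfl).1.trans (hf 0 le_rfl).2
  have hw := continuousOn_comp_fst (continuousOn_coordWeight (n := n) ha c)
  have hb := continuousOn_comp_fst (continuousOn_coordBound (n := n) c)
  have h1 := locallyIntegrableOn_coordWeight_mul ha hpos h.power c
  have h2 := (h.locallyIntegrableOn_energy_coord c).continuousOn_mul hw hO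
  have h3 : LocallyIntegrableOn (fun z ↦ coordWeight n a c z.1) (coordCylinder n c) volume :=
    hw.locallyIntegrableOn (isOpen_coordCylinder c).measurableSet
  have h4 := ((h3.add h1).add h2).continuousOn_mul (hb.const_smul K) hO
  rw [locallyIntegrableOn_iff hO] at h4 ⊢
  intro L hLO hL
  refine (h4 L hLO hL).mono' ?_ ?_
  · exact ((h.aemeasurable_coordFlux hf_meas ha c i).mono_measure
      (Measure.restrict_mono hLO le_rfl)).aestronglyMeasurable
  · have h5 : ∀ {P : EuclideanSpace ℝ (Fin n) × ℝ → Prop},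
      (∀ᵐ z ∂(volume.restrict (coordCylinder n c)), P z) → ∀ᵐ z ∂(volume.restrict L), P z :=
      fun hP ↦ ae_mono (Measure.restrict_mono hLO le_rfl) hP
    filter_upwards [h5 (h.nonneg_coord c), h5 (h.abs_coordFlux_le hp hf c i),
      h5 (ae_coordWeight_pos hpos c)] with z hz hzA hzw
    rw [Real.norm_eq_abs]
    refine hzA.trans ?_
    rw [abs_of_pos hzw]
    have h6 := rpow_mul_rpow_le hp hm hz (gradNorm_nonneg X (stInv n c z))
    calc _ ≤ coordWeight n a c z.1 * (K * coordBound n c z.1) * _ :=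
          mul_le_mul_of_nonneg_left h6
            (mul_nonneg hzw.le (mul_nonneg hK (coordBound_nonneg c _)))
      _ = _ := by
        simp only [smul_eq_mul, Pi.smul_apply, Pi.add_apply]
        ring

theorem lintegral_coordFluxBound_lt_top (hp : 1 < p) (ha : LocallyLipschitz a) (hK : 0 ≤ K) (c : M)
    {L : Set (EuclideanSpace ℝ (Fin n) × ℝ)} (hLO : L ⊆ coordCylinder n c) (hL : IsCompact L) :
    ∫⁻ z in L, ENNReal.ofReal (coordFluxBound p m K a u X c z) ^ p.conjExponent < ⊤ := by
  have hq := (Real.HolderConjugate.conjExponent hp).symm.pos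
  have hw := continuousOn_comp_fst (continuousOn_coordWeight (n := n) ha c)
  have hb := continuousOn_comp_fst (continuousOn_coordBound (n := n) c)
  obtain ⟨C, hC⟩ := hL.exists_bound_of_continuousOn
    ((hw.abs.mul (hb.const_smul K)).mono hLO)
  have h1 : IntegrableOn _ L volume :=
    (h.locallyIntegrableOn_energy_coord c).integrableOn_compact_subset hLO hL
  refine lt_of_le_of_lt (b := ∫⁻ z in L, ENNReal.ofReal C ^ p.conjExponent *
    ‖gradNorm X (stInv n c z) ^ p * u (stInv n c z) ^ (m - 1)‖ₑ) ?_ ?_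
  · refine setLIntegral_mono_ae' hL.measurableSet ?_
    have h5 := (ae_restrict_iff' (isOpen_coordCylinder c).measurableSet).1 (h.nonneg_coord c)
    filter_upwards [h5] with z hz hzL
    have h6 : 0 ≤ gradNorm X (stInv n c z) ^ p * u (stInv n c z) ^ (m - 1) :=
      mul_nonneg (Real.rpow_nonneg (gradNorm_nonneg _ _) _) (Real.rpow_nonneg (hz (hLO hzL)) _)
    have h7 := (le_abs_self _).trans (hC z hzL)
    rw [Real.enorm_of_nonneg h6, coordFluxBound, ENNReal.ofReal_mul (mul_nonneg (abs_nonneg _)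
      (mul_nonneg hK (coordBound_nonneg c _))), ENNReal.mul_rpow_of_nonneg _ _ hq.le,
      ← ENNReal.ofReal_rpow_of_nonneg h6 (by positivity), ← ENNReal.rpow_mul,
      one_div_mul_cancel hq.ne', ENNReal.rpow_one]
    gcongr
    exact h7
  · rw [lintegral_const_mul' _ _ (ENNReal.rpow_ne_top_of_nonneg hq.le ENNReal.ofReal_ne_top)]
    exact ENNReal.mul_lt_top (ENNReal.rpow_lt_top_of_nonneg hq.le ENNReal.ofReal_ne_top) h1.2

theorem coord_test (ha : LocallyLipschitz a) (hpos : ∀ᵐ x ∂(riemVolume n M), 0 < a x) (c : M)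
    {ψ : EuclideanSpace ℝ (Fin n) × ℝ → ℝ} (h0 : ∀ z, 0 ≤ ψ z) (hψ : LocallyLipschitz ψ)
    (hc : HasCompactSupport ψ) (hs : tsupport ψ ⊆ coordCylinder n c) :
    ∫ z in coordCylinder n c, ψ z * coordReaction q a V u c z
      ≤ (∫ z in coordCylinder n c, ∑ i, spDeriv i ψ z * coordFlux p m f a u X c i z)
        - ∫ z in coordCylinder n c, tmDeriv ψ z * (u (stInv n c z) * coordWeight n a c z.1) := by
  obtain ⟨hΨ, hΨs⟩ := isTestFunction_push c h0 hψ hc hs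
  set Ψ := (chartCylinder n c).indicator fun z ↦ ψ (stChart n c z) with hΨdef
  have hval : ∀ z ∈ coordCylinder n c, Ψ (stInv n c z) = ψ z := fun z hz ↦ by
    rw [hΨdef, indicator_of_mem (stInv_mem hz), stChart_stInv hz]
  have hO := (isOpen_coordCylinder (n := n) c).measurableSet
  have h1 := h.test Ψ hΨ
  rw [setIntegral_weighted_eq_coord ha hpos c, setIntegral_weighted_eq_coord ha hpos c,
    setIntegral_weighted_eq_coord ha hpos c] at h1
  · refine (le_of_eq ?_).trans (h1.trans (le_of_eq ?_))
    · refine setIntegral_congr_fun hO fun z hz ↦ ?_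
      simp only [hval z hz, coordReaction]
      ring
    · congr 1
      · refine setIntegral_congr_fun hO fun z hz ↦ ?_
        have h2 := dirDeriv_slice_eq_sum hval hz (X ((extChartAt (𝓡 n) c).symm z.1) z.2)
        simp only [stInv] at h2 ⊢
        rw [h2]
        simp only [coordFlux, fluxFactor, Finset.sum_mul, Finset.mul_sum]
        refine Finset.sum_congr rfl fun i _ ↦ ?_
        simp only [gradCoord, gradNorm, stInv]
        ring
      · refine setIntegral_congr_fun hO fun z hz ↦ ?_
        have h2 := deriv_slice_eq hval hz
        simp only [stInv] at h2 ⊢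
        rw [h2]
        ring
  · intro z hz
    rw [deriv_eq_zero_of_notMem_tsupport fun h' ↦ hz (hΨs h'), zero_mul]
  · intro z hz
    have h2 : dirDeriv (fun x ↦ Ψ (x, z.2)) z.1 (X z.1 z.2) = 0 :=
      dirDeriv_eq_zero_of_notMem_tsupport (fun h' ↦ hz (hΨs h')) _
    rw [h2]
    ring
  · intro z hz
    rw [image_eq_zero_of_notMem_tsupport fun h' ↦ hz (hΨs h'), zero_mul, zero_mul]

/-- In coordinates a weak solution is a supersolution of a Euclidean inequality. -/
theorem exists_isEuclideanSupersolution (hp : 1 < p) (hm : 1 ≤ m) (hf_meas : Measurable f)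
    (hf : ∀ s, 0 ≤ s → 0 ≤ f s ∧ f s ≤ K) (ha : LocallyLipschitz a)
    (hpos : ∀ᵐ x ∂(riemVolume n M), 0 < a x) (c : M) :
    ∃ (U : EuclideanSpace ℝ (Fin n) × ℝ → ℝ) (P : Fin n → EuclideanSpace ℝ (Fin n) × ℝ → ℝ),
      (U =ᵐ[volume.restrict (coordCylinder n c)] fun z ↦ u (stInv n c z)) ∧
      (∀ i, P i =ᵐ[volume.restrict (coordCylinder n c)] gradComp X c i) ∧
      IsEuclideanSupersolution (extChartAt (𝓡 n) c).target (coordWeight n a c) ((m - 1) / p) p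
        p.conjExponent U (fun z ↦ w (stInv n c z)) P (coordFlux p m f a u X c)
        (coordFluxBound p m K a u X c) (coordReaction q a V u c) := by
  have hOo := isOpen_coordCylinder (n := n) c
  have hK : 0 ≤ K := (hf 0 le_rfl).1.trans (hf 0 le_rfl).2
  -- Mollification and composition are carried out with everywhere nonnegative Borel
  -- representatives; the identities for u hold only almost everywhere.
  have hU : (fun z ↦ max ((h.aemeasurable_coord c).mk _ z) 0)
      =ᵐ[volume.restrict (coordCylinder n c)] fun z ↦ u (stInv n c z) := by
    filter_upwards [(h.aemeasurable_coord c).ae_eq_mk, h.nonneg_coord c] with z h1 h2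
    rw [← h1, max_eq_left h2]
  have hP : ∀ i, (h.aemeasurable_gradComp c i).mk _
      =ᵐ[volume.restrict (coordCylinder n c)] gradComp X c i :=
    fun i ↦ (h.aemeasurable_gradComp c i).ae_eq_mk.symm
  refine ⟨_, _, hU, hP, ?_⟩
  constructor
  case isOpen => exact isOpen_chart_target c
  case weight => exact locallyLipschitzOn_coordWeight ha c
  case conj => exact Real.HolderConjugate.conjExponent hp
  case exponent => exact div_nonneg (by linarith) (by linarith)
  case meas => exact (h.aemeasurable_coord c).measurable_mk.max measurable_const
  case nonneg => exact fun z ↦ le_max_right _ _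
  case meas_grad => exact fun i ↦ (h.aemeasurable_gradComp c i).measurable_mk
  case grad => exact fun i ↦ (h.hasWeakDirDeriv_grad c i).congr_ae hOo hU.symm (hP i).symm
  case time => exact (h.hasWeakDirDeriv_time c).congr_ae hOo hU.symm (ae_eq_refl _)
  case grad_int =>
    intro L hLO hL
    obtain ⟨C, hC⟩ := hL.exists_bound_of_continuousOn
      ((continuousOn_comp_fst (continuousOn_frameBound (n := n) c)).mono hLO)
    have hp0 : 0 ≤ p := by linarith
    have h1 : IntegrableOn _ L volume :=
      (h.locallyIntegrableOn_energy_coord c).integrableOn_compact_subset hLO hL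
    refine lt_of_le_of_lt (b := ∫⁻ z in L, ENNReal.ofReal C ^ p *
      ‖gradNorm X (stInv n c z) ^ p * u (stInv n c z) ^ (m - 1)‖ₑ) ?_ ?_
    · have h5 : ∀ {Q : EuclideanSpace ℝ (Fin n) × ℝ → Prop},
        (∀ᵐ z ∂(volume.restrict (coordCylinder n c)), Q z) → ∀ᵐ z ∂(volume.restrict L), Q z :=
        fun hP ↦ ae_mono (Measure.restrict_mono hLO le_rfl) hP
      refine lintegral_mono_ae ?_
      filter_upwards [h5 hU, h5 (ae_all_iff.2 hP), h5 (h.nonneg_coord c),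
        ae_restrict_mem hL.measurableSet] with z h6 h7 h8 hzL
      have hN := gradNorm_nonneg X (stInv n c z)
      have h9 : 0 ≤ u (stInv n c z) ^ ((m - 1) / p) := Real.rpow_nonneg h8 _
      have hC0 : 0 ≤ C := (norm_nonneg _).trans (hC z hzL)
      rw [h6]
      simp only [h7]
      rw [← rpow_energy_eq (by linarith) h8 hN, Real.enorm_of_nonneg
        (Real.rpow_nonneg (mul_nonneg h9 hN) _),
        ← ENNReal.ofReal_rpow_of_nonneg (mul_nonneg h9 hN) hp0,
        ← ENNReal.mul_rpow_of_nonneg _ _ hp0, ← ENNReal.ofReal_mul hC0]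
      refine ENNReal.rpow_le_rpow (ENNReal.ofReal_le_ofReal ?_) hp0
      calc _ ≤ u (stInv n c z) ^ ((m - 1) / p)
            * (frameBound n c z.1 * gradNorm X (stInv n c z)) :=
            mul_le_mul_of_nonneg_left (sum_abs_gradComp_le X c z) h9
        _ ≤ u (stInv n c z) ^ ((m - 1) / p) * (C * gradNorm X (stInv n c z)) := by
            gcongr
            exact (le_abs_self _).trans (hC z hzL)
        _ = _ := by ring
    · rw [lintegral_const_mul' _ _ (ENNReal.rpow_ne_top_of_nonneg hp0 ENNReal.ofReal_ne_top)]
      exact ENNReal.mul_lt_top (ENNReal.rpow_lt_top_of_nonneg hp0 ENNReal.ofReal_ne_top) h1.2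
  case reaction_locInt => exact locallyIntegrableOn_coordWeight_mul ha hpos h.reaction c
  case flux_locInt => exact h.locallyIntegrableOn_coordFlux hp hm hf_meas hf ha hpos c
  case flux_le =>
    intro i
    filter_upwards [hU, h.abs_coordFlux_le_bound hp hm hf c i] with z h1 h2
    rw [h1]
    exact h2
  case flux_meas =>
    exact ((aemeasurable_comp_fst (continuousOn_coordWeight ha c).abs).mul
      ((aemeasurable_comp_fst (continuousOn_coordBound c)).const_mul K)).mul
      ((((h.aemeasurable_gradNorm c).pow_const _).mul
        ((h.aemeasurable_coord c).pow_const _)).pow_const _)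
  case flux_int => exact fun L hLO hL ↦ h.lintegral_coordFluxBound_lt_top hp ha hK c hLO hL
  case test =>
    intro ψ h0 hψ hc hs
    have h1 := h.coord_test ha hpos c h0 hψ hc hs
    have h2 : ∀ z ∉ coordCylinder n c, z ∉ tsupport ψ := fun z hz h' ↦ hz (hs h')
    have h3 : ∫ z in coordCylinder n c, tmDeriv ψ z
        * (u (stInv n c z) * coordWeight n a c z.1)
        = ∫ z in coordCylinder n c, tmDeriv ψ z
          * (max ((h.aemeasurable_coord c).mk _ z) 0 * coordWeight n a c z.1) := by
      refine integral_congr_ae ?_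
      filter_upwards [hU] with z hz
      rw [hz]
    rw [h3, setIntegral_eq_integral_of_forall_compl_eq_zero,
      setIntegral_eq_integral_of_forall_compl_eq_zero,
      setIntegral_eq_integral_of_forall_compl_eq_zero] at h1
    · exact h1
    · exact fun z hz ↦ by rw [tmDeriv_eq_zero (h2 z hz), zero_mul]
    · exact fun z hz ↦ Finset.sum_eq_zero fun i _ ↦ by rw [spDeriv_eq_zero (h2 z hz), zero_mul]
    · exact fun z hz ↦ by rw [image_eq_zero_of_notMem_tsupport (h2 z hz), zero_mul]

end IsWeakSolutionWith

/-! ### Returning coordinate integrals and slice differentiability to the manifold. -/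

section CoordinateIntegrals

variable {n : ℕ} {M : Type*} [MetricSpace M] [ProperSpace M]
    [ChartedSpace (EuclideanSpace ℝ (Fin n)) M] [IsManifold (𝓡 n) ∞ M]
    [RiemannianBundle (fun x : M ↦ TangentSpace (𝓡 n) x)]
    [IsContMDiffRiemannianBundle (𝓡 n) ∞ (EuclideanSpace ℝ (Fin n))
      (fun x : M ↦ TangentSpace (𝓡 n) x)] [IsRiemannianManifold (𝓡 n) M]
    [MeasurableSpace M] [BorelSpace M] {a : M → ℝ}

theorem integrableOn_and_integral_eq_of_coord (ha : LocallyLipschitz a)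
    (hpos : ∀ᵐ x ∂(riemVolume n M), 0 < a x) {c : M} {H : M × ℝ → ℝ}
    {G : EuclideanSpace ℝ (Fin n) × ℝ → ℝ} (hG : Integrable G)
    (hG0 : ∀ z ∉ coordCylinder n c, G z = 0) (hH : ∀ z ∉ chartCylinder n c, H z = 0)
    (hHG : ∀ᵐ z ∂(volume.restrict (coordCylinder n c)),
      G z = coordWeight n a c z.1 * H (stInv n c z)) :
    IntegrableOn H (spaceTime M) ((weightedVolume n a).prod volume) ∧
    ∫ z in spaceTime M, H z ∂((weightedVolume n a).prod volume) = ∫ z, G z := by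
  refine ⟨integrableOn_weighted_of_coord ha hpos c hH (hG.integrableOn.congr hHG), ?_⟩
  rw [setIntegral_weighted_eq_coord ha hpos c hH, ← integral_congr_ae hHG,
    setIntegral_eq_integral_of_forall_compl_eq_zero hG0]

/-- Slices of locally Lipschitz functions supported in a chart domain are differentiable almost
everywhere. -/
theorem ae_mdifferentiableAt_slice {c : M} {ζ : M × ℝ → ℝ} (hζ : IsTestFunction ζ)
    (hζs : tsupport ζ ⊆ chartCylinder n c) :
    ∀ᵐ z ∂(((riemVolume n M).prod volume).restrict (spaceTime M)),
      MDifferentiableAt (𝓡 n) 𝓘(ℝ, ℝ) (fun x ↦ ζ (x, z.2)) z.1 ∧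
      DifferentiableAt ℝ (fun s ↦ ζ (z.1, s)) z.2 := by
  obtain ⟨-, hψ, hψc, hψs⟩ := isTestFunction_pull hζ hζs
  set ψ := (coordCylinder n c).indicator fun z ↦ ζ (stInv n c z) with hψdef
  have hval : ∀ z ∈ coordCylinder n c, ζ (stInv n c z) = ψ z := fun z hz ↦ by
    rw [hψdef, indicator_of_mem hz]
  obtain ⟨C, hC⟩ := exists_lipschitzWith_of_hasCompactSupport hψ hψc
  have h1 : ∀ᵐ z ∂(((riemVolume n M).prod volume).restrict (chartCylinder n c)),
      MDifferentiableAt (𝓡 n) 𝓘(ℝ, ℝ) (fun x ↦ ζ (x, z.2)) z.1 ∧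
      DifferentiableAt ℝ (fun s ↦ ζ (z.1, s)) z.2 := by
    rw [ae_chart]
    filter_upwards [ae_restrict_of_ae (hC.ae_differentiableAt (μ := volume)),
      ae_restrict_mem (isOpen_coordCylinder c).measurableSet] with z hz hzO
    have hx := (extChartAt (𝓡 n) c).map_target hzO.1
    have hzz : extChartAt (𝓡 n) c ((extChartAt (𝓡 n) c).symm z.1) = z.1 :=
      (extChartAt (𝓡 n) c).right_inv hzO.1
    constructor
    · have h2 : DifferentiableAt ℝ (fun y ↦ ψ (y, z.2)) z.1 :=
        DifferentiableAt.comp (g := ψ) z.1 hz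
          (hasFDerivAt_prodMk_left z.1 z.2).differentiableAt
      have h3 : MDifferentiableAt (𝓡 n) 𝓘(ℝ, ℝ)
          (fun x ↦ ψ (extChartAt (𝓡 n) c x, z.2)) ((extChartAt (𝓡 n) c).symm z.1) := by
        refine MDifferentiableAt.comp (I' := 𝓘(ℝ, EuclideanSpace ℝ (Fin n)))
          (g := fun y ↦ ψ (y, z.2)) _ ?_ (mdifferentiableAt_chart hx)
        rw [hzz]
        exact h2.mdifferentiableAt
      refine h3.congr_of_eventuallyEq ?_
      filter_upwards [(isOpen_chart_source (n := n) c).mem_nhds hx] with x hx'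
      have h4 := hval (extChartAt (𝓡 n) c x, z.2) ⟨(extChartAt (𝓡 n) c).map_source hx', hzO.2⟩
      rw [← h4]
      simp only [stInv]
      rw [(extChartAt (𝓡 n) c).left_inv hx']
    · have h2 : DifferentiableAt ℝ (fun s ↦ ψ (z.1, s)) z.2 :=
        DifferentiableAt.comp (g := ψ) z.2 hz
          (hasFDerivAt_prodMk_right z.1 z.2).differentiableAt
      refine h2.congr_of_eventuallyEq ?_
      filter_upwards [isOpen_Ioi.mem_nhds hzO.2] with s hs
      exact hval (z.1, s) ⟨hzO.1, hs⟩
  rw [ae_restrict_iff' (isOpen_chartCylinder c).measurableSet] at h1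
  refine ae_restrict_of_ae ?_
  filter_upwards [h1] with z hz
  by_cases hzs : z ∈ tsupport ζ
  · exact hz (hζs hzs)
  · have h1 := notMem_tsupport_iff_eventuallyEq.1 hzs
    constructor
    · have h2 : (fun x ↦ ζ (x, z.2)) =ᶠ[𝓝 z.1] fun _ ↦ (0 : ℝ) :=
        (Continuous.tendsto (by fun_prop : Continuous fun y : M ↦ (y, z.2)) z.1).eventually h1
      exact mdifferentiableAt_const.congr_of_eventuallyEq h2
    · have h2 : (fun s ↦ ζ (z.1, s)) =ᶠ[𝓝 z.2] fun _ ↦ (0 : ℝ) :=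
        (Continuous.tendsto (by fun_prop : Continuous fun s : ℝ ↦ (z.1, s)) z.2).eventually h1
      exact (differentiableAt_const _).congr_of_eventuallyEq h2

end CoordinateIntegrals

/-- The integrand of the gradient terms when a weak solution is tested with `ζ F(u)`. -/
def testedGradient {n : ℕ} {M : Type*} [MetricSpace M] [ChartedSpace (EuclideanSpace ℝ (Fin n)) M]
    [RiemannianBundle (fun x : M ↦ TangentSpace (𝓡 n) x)] (p m : ℝ) (f : ℝ → ℝ)
    (u : M × ℝ → ℝ) (X : ∀ x : M, ℝ → TangentSpace (𝓡 n) x) (F F' : ℝ → ℝ) (ζ : M × ℝ → ℝ)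
    (z : M × ℝ) : ℝ :=
  fluxFactor p m f u X z * (dirDeriv (fun x ↦ ζ (x, z.2)) z.1 (X z.1 z.2) * F (u z)
    + ζ z * (F' (u z) * gradNorm X z ^ 2))

/-- The inequality obtained by testing a weak solution with `ζ F(u)`, where `Φ' = F`. -/
structure TestedInequality {n : ℕ} {M : Type*} [MetricSpace M]
    [ChartedSpace (EuclideanSpace ℝ (Fin n)) M]
    [RiemannianBundle (fun x : M ↦ TangentSpace (𝓡 n) x)] [MeasurableSpace M]
    (p q m : ℝ) (f : ℝ → ℝ) (a : M → ℝ) (V u : M × ℝ → ℝ)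
    (X : ∀ x : M, ℝ → TangentSpace (𝓡 n) x) (F F' Φ : ℝ → ℝ) (ζ : M × ℝ → ℝ) : Prop where
  reaction : IntegrableOn (fun z ↦ ζ z * (u z ^ q * V z) * F (u z)) (spaceTime M)
    ((weightedVolume n a).prod volume)
  gradient : IntegrableOn (testedGradient p m f u X F F' ζ) (spaceTime M)
    ((weightedVolume n a).prod volume)
  time : IntegrableOn (fun z ↦ Φ (u z) * deriv (fun s ↦ ζ (z.1, s)) z.2) (spaceTime M)
    ((weightedVolume n a).prod volume)
  le : ∫ z in spaceTime M, ζ z * (u z ^ q * V z) * F (u z) ∂((weightedVolume n a).prod volume)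
    ≤ ∫ z in spaceTime M, testedGradient p m f u X F F' ζ z ∂((weightedVolume n a).prod volume)
      - ∫ z in spaceTime M, Φ (u z) * deriv (fun s ↦ ζ (z.1, s)) z.2
        ∂((weightedVolume n a).prod volume)

/-! ### The tested inequality over a chart domain and its additivity in the cutoff. -/

section Tested

variable {n : ℕ} {M : Type*} [MetricSpace M] [ProperSpace M]
    [ChartedSpace (EuclideanSpace ℝ (Fin n)) M] [IsManifold (𝓡 n) ∞ M]
    [RiemannianBundle (fun x : M ↦ TangentSpace (𝓡 n) x)]
    [IsContMDiffRiemannianBundle (𝓡 n) ∞ (EuclideanSpace ℝ (Fin n))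
      (fun x : M ↦ TangentSpace (𝓡 n) x)] [IsRiemannianManifold (𝓡 n) M]
    [MeasurableSpace M] [BorelSpace M]
    {p q m K : ℝ} {f : ℝ → ℝ} {a : M → ℝ} {V u : M × ℝ → ℝ}
    {X : ∀ x : M, ℝ → TangentSpace (𝓡 n) x} {w : M × ℝ → ℝ}
    (h : IsWeakSolutionWith n p q m f a V u X w)
    {F F' Φ : ℝ → ℝ} {B B' : ℝ}

-- The Euclidean inequality `test_comp`, rewritten invariantly: contracting covariant and raised
-- components of the gradient yields |∇u|², and the coordinate weight becomes the weighted measure.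
include h in
theorem IsWeakSolutionWith.testedInequality_of_chart (hp : 1 < p) (hm : 1 ≤ m)
    (hf_meas : Measurable f) (hf : ∀ s, 0 ≤ s → 0 ≤ f s ∧ f s ≤ K) (ha : LocallyLipschitz a)
    (hpos : ∀ᵐ x ∂(riemVolume n M), 0 < a x)
    (hF : ∀ s, HasDerivAt F (F' s) s) (hF' : Continuous F') (hB : ∀ s, |F' s| ≤ B)
    (hF0 : ∀ s, 0 ≤ F s) (hFB : ∀ s, F s ≤ B') (hΦ : ∀ s, HasDerivAt Φ (F s) s)
    {c : M} {ζ : M × ℝ → ℝ} (hζ : IsTestFunction ζ) (hζs : tsupport ζ ⊆ chartCylinder n c) :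
    TestedInequality p q m f a V u X F F' Φ ζ := by
  obtain ⟨hψ0, hψ, hψc, hψs⟩ := isTestFunction_pull hζ hζs
  set ψ := (coordCylinder n c).indicator fun z ↦ ζ (stInv n c z) with hψdef
  have hval : ∀ z ∈ coordCylinder n c, ζ (stInv n c z) = ψ z := fun z hz ↦ by
    rw [hψdef, indicator_of_mem hz]
  obtain ⟨C, hC⟩ := exists_lipschitzWith_of_hasCompactSupport hψ hψc
  obtain ⟨U, P, hU, hP, hE⟩ := h.exists_isEuclideanSupersolution hp hm hf_meas hf ha hpos c
  obtain ⟨hint, hle⟩ := hE.test_comp hF hF' hB hF0 hFB hΦ hψ0 hψ hψc hψs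
  have hO := (isOpen_coordCylinder (n := n) c).measurableSet
  have hFc : Continuous F := continuous_iff_continuousAt.2 fun s ↦ (hF s).continuousAt
  have hFabs : ∀ s, |F s| ≤ B' := fun s ↦ by rw [abs_of_nonneg (hF0 s)]; exact hFB s
  have hFm : Measurable fun z ↦ F (U z) := hFc.measurable.comp hE.meas
  have hzC : ∀ z ∉ coordCylinder n c, z ∉ tsupport ψ := fun z hz h' ↦ hz (hψs h')
  have hzM : ∀ z ∉ chartCylinder n c, z ∉ tsupport ζ := fun z hz h' ↦ hz (hζs h')
  have i0 : Integrable fun z ↦ (ψ z * coordReaction q a V u c z) * F (U z) :=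
    (hE.integrable_mul hψ.continuous hψc hψs hE.reaction_locInt).mul_bdd (c := B')
      hFm.aestronglyMeasurable (Eventually.of_forall fun z ↦ hFabs _)
  have i1 : ∀ i, Integrable fun z ↦ (spDeriv i ψ z * coordFlux p m f a u X c i z) * F (U z) :=
    fun i ↦ (hE.integrable_spDeriv_mul_flux hψ hψc hψs i).mul_bdd (c := B')
      hFm.aestronglyMeasurable (Eventually.of_forall fun z ↦ hFabs _)
  have i3 : Integrable fun z ↦ Φ (U z) * (tmDeriv ψ z * coordWeight n a c z.1) := by
    have h1 : LocallyIntegrableOn (fun z ↦ Φ (U z)) (coordCylinder n c) volume :=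
      hE.time.locInt.comp_of_hasDerivAt_bounded hE.meas hΦ hFabs
    have h2 := h1.continuousOn_mul (continuousOn_comp_fst (continuousOn_coordWeight ha c))
      (isOpen_coordCylinder c).isLocallyClosed
    refine (integrable_mul_of_tsupport h2
      (measurable_tmDeriv hψ.continuous).aestronglyMeasurable (fun z ↦ abs_tmDeriv_le hC z)
      hψc hψs (fun z hz ↦ tmDeriv_eq_zero hz)).congr (Eventually.of_forall fun z ↦ ?_)
    simp only
    ring
  have i2 : ∀ i, Integrable fun z ↦ (spDeriv i ψ z * coordFlux p m f a u X c i z) * F (U z)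
      + (ψ z * coordFlux p m f a u X c i z) * (F' (U z) * P i z) := fun i ↦ (i1 i).add (hint i)
  have i12 : Integrable fun z ↦ ∑ i, ((spDeriv i ψ z * coordFlux p m f a u X c i z) * F (U z)
      + (ψ z * coordFlux p m f a u X c i z) * (F' (U z) * P i z)) :=
    integrable_finsetSum _ fun i _ ↦ i2 i
  obtain ⟨j0, e0⟩ := integrableOn_and_integral_eq_of_coord ha hpos (c := c)
    (H := fun z ↦ ζ z * (u z ^ q * V z) * F (u z)) i0
    (fun z hz ↦ by rw [image_eq_zero_of_notMem_tsupport (hzC z hz), zero_mul, zero_mul])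
    (fun z hz ↦ by rw [image_eq_zero_of_notMem_tsupport (hzM z hz), zero_mul, zero_mul]) (by
      filter_upwards [hU, ae_restrict_mem hO] with z hz hzO
      rw [hz, hval z hzO, coordReaction]
      ring)
  obtain ⟨j3, e3⟩ := integrableOn_and_integral_eq_of_coord ha hpos (c := c)
    (H := fun z ↦ Φ (u z) * deriv (fun s ↦ ζ (z.1, s)) z.2) i3
    (fun z hz ↦ by rw [tmDeriv_eq_zero (hzC z hz), zero_mul, mul_zero])
    (fun z hz ↦ by rw [deriv_eq_zero_of_notMem_tsupport (hzM z hz), mul_zero]) (by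
      filter_upwards [hU, ae_restrict_mem hO] with z hz hzO
      have h2 := deriv_slice_eq hval hzO
      rw [hz, ← h2]
      simp only [stInv]
      ring)
  obtain ⟨j1, e1⟩ := integrableOn_and_integral_eq_of_coord ha hpos (c := c)
    (H := testedGradient p m f u X F F' ζ) i12
    (fun z hz ↦ Finset.sum_eq_zero fun i _ ↦ by
      rw [image_eq_zero_of_notMem_tsupport (hzC z hz), spDeriv_eq_zero (hzC z hz)]; ring)
    (fun z hz ↦ by
      have h2 : dirDeriv (fun x ↦ ζ (x, z.2)) z.1 (X z.1 z.2) = 0 :=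
        dirDeriv_eq_zero_of_notMem_tsupport (hzM z hz) _
      rw [testedGradient, image_eq_zero_of_notMem_tsupport (hzM z hz), h2]; ring) (by
      filter_upwards [hU, ae_all_iff.2 hP, ae_restrict_mem hO] with z hz hzP hzO
      have h2 := dirDeriv_slice_eq_sum hval hzO (X ((extChartAt (𝓡 n) c).symm z.1) z.2)
      have h3 := gradNorm_sq_eq X hzO
      have h4 : testedGradient p m f u X F F' ζ (stInv n c z)
          = fluxFactor p m f u X (stInv n c z)
            * ((∑ i, spDeriv i ψ z * gradCoord X c i z) * F (u (stInv n c z))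
            + ψ z * (F' (u (stInv n c z)) * ∑ i, gradComp X c i z * gradCoord X c i z)) := by
        rw [testedGradient, h3, hval z hzO]
        simp only [stInv] at h2 ⊢
        rw [h2]
        rfl
      rw [h4]
      simp only [hz, hzP, Finset.sum_mul, Finset.mul_sum, ← Finset.sum_add_distrib, coordFlux]
      refine Finset.sum_congr rfl fun i _ ↦ ?_
      ring)
  refine ⟨j0, j1, j3, ?_⟩
  rw [e0, e1, e3, integral_finsetSum _ fun i _ ↦ i2 i]
  refine hle.trans (le_of_eq ?_)
  congr 1
  exact Finset.sum_congr rfl fun i _ ↦ (integral_add (i1 i) (hint i)).symm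

theorem absolutelyContinuous_weightedVolume (n : ℕ) {M : Type*} [MetricSpace M] [ProperSpace M]
    [ChartedSpace (EuclideanSpace ℝ (Fin n)) M] [IsManifold (𝓡 n) ∞ M]
    [RiemannianBundle (fun x : M ↦ TangentSpace (𝓡 n) x)]
    [IsContMDiffRiemannianBundle (𝓡 n) ∞ (EuclideanSpace ℝ (Fin n))
      (fun x : M ↦ TangentSpace (𝓡 n) x)] [IsRiemannianManifold (𝓡 n) M]
    [MeasurableSpace M] [BorelSpace M] {a : M → ℝ} (ha : Continuous a) :
    ((weightedVolume n a).prod (volume : Measure ℝ)).restrict (spaceTime M)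
      ≪ ((riemVolume n M).prod volume).restrict (spaceTime M) := by
  rw [weightedVolume_prod ha]
  exact (withDensity_absolutelyContinuous _ _).restrict _

theorem mdifferentiableAt_and_dirDeriv_sum {ι : Type*} {t : Finset ι} {g : ι → M → ℝ} {x : M}
    (hg : ∀ i ∈ t, MDifferentiableAt (𝓡 n) 𝓘(ℝ, ℝ) (g i) x) :
    MDifferentiableAt (𝓡 n) 𝓘(ℝ, ℝ) (fun y ↦ ∑ i ∈ t, g i y) x ∧
    ∀ v : TangentSpace (𝓡 n) x,
      dirDeriv (fun y ↦ ∑ i ∈ t, g i y) x v = ∑ i ∈ t, dirDeriv (g i) x v := by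
  classical
  induction t using Finset.induction_on with
  | empty =>
    simp only [Finset.sum_empty]
    refine ⟨mdifferentiableAt_const, fun v ↦ ?_⟩
    rw [dirDeriv, mfderiv_const]
    rfl
  | insert i s hi IH =>
    obtain ⟨h1, h2⟩ := IH fun j hj ↦ hg j (Finset.mem_insert_of_mem hj)
    have h3 := hg i (Finset.mem_insert_self i s)
    have h4 : (fun y ↦ ∑ j ∈ insert i s, g j y) = g i + fun y ↦ ∑ j ∈ s, g j y := by
      ext y
      rw [Finset.sum_insert hi]
      rfl
    rw [h4]
    refine ⟨h3.add h1, fun v ↦ ?_⟩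
    rw [Finset.sum_insert hi, ← h2 v]
    have h5 := congrArg (fun L ↦ L v) (mfderiv_add h3 h1)
    exact h5

/-- Every term is linear in ζ, and derivatives of sums split wherever all pieces are differentiable,
which is almost everywhere. The integrability fields are what make the integrals additive. -/
theorem TestedInequality.sum {ι : Type*} {t : Finset ι} {c : ι → M} {ζ : ι → M × ℝ → ℝ}
    (ha : LocallyLipschitz a) (hζ : ∀ i ∈ t, IsTestFunction (ζ i))
    (hζs : ∀ i ∈ t, tsupport (ζ i) ⊆ chartCylinder n (c i))
    (hT : ∀ i ∈ t, TestedInequality p q m f a V u X F F' Φ (ζ i)) :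
    TestedInequality p q m f a V u X F F' Φ fun z ↦ ∑ i ∈ t, ζ i z := by
  have hd : ∀ᵐ z ∂(((weightedVolume n a).prod volume).restrict (spaceTime M)), ∀ i ∈ t,
      MDifferentiableAt (𝓡 n) 𝓘(ℝ, ℝ) (fun x ↦ ζ i (x, z.2)) z.1 ∧
      DifferentiableAt ℝ (fun s ↦ ζ i (z.1, s)) z.2 :=
    (absolutelyContinuous_weightedVolume n ha.continuous).ae_le <| (Finset.eventually_all t).2
      fun i hi ↦ ae_mdifferentiableAt_slice (hζ i hi) (hζs i hi)
  have e0 : (fun z ↦ ∑ i ∈ t, ζ i z * (u z ^ q * V z) * F (u z))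
      = fun z ↦ (∑ i ∈ t, ζ i z) * (u z ^ q * V z) * F (u z) := by
    funext z
    rw [Finset.sum_mul, Finset.sum_mul]
  have e3 : (fun z ↦ ∑ i ∈ t, Φ (u z) * deriv (fun s ↦ ζ i (z.1, s)) z.2)
      =ᵐ[((weightedVolume n a).prod volume).restrict (spaceTime M)]
      fun z ↦ Φ (u z) * deriv (fun s ↦ ∑ i ∈ t, ζ i (z.1, s)) z.2 := by
    filter_upwards [hd] with z hz
    rw [deriv_fun_sum fun i hi ↦ (hz i hi).2, Finset.mul_sum]
  have e1 : (fun z ↦ ∑ i ∈ t, testedGradient p m f u X F F' (ζ i) z)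
      =ᵐ[((weightedVolume n a).prod volume).restrict (spaceTime M)]
      testedGradient p m f u X F F' fun z ↦ ∑ i ∈ t, ζ i z := by
    filter_upwards [hd] with z hz
    have h1 : dirDeriv (fun x ↦ ∑ i ∈ t, ζ i (x, z.2)) z.1 (X z.1 z.2)
        = ∑ i ∈ t, dirDeriv (fun x ↦ ζ i (x, z.2)) z.1 (X z.1 z.2) :=
      (mdifferentiableAt_and_dirDeriv_sum fun i hi ↦ (hz i hi).1).2 _
    simp only [testedGradient]
    rw [h1, ← Finset.mul_sum, Finset.sum_add_distrib, Finset.sum_mul, Finset.sum_mul]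
  have i0 := integrable_finsetSum t fun i hi ↦ (hT i hi).reaction
  have i1 := integrable_finsetSum t fun i hi ↦ (hT i hi).gradient
  have i3 := integrable_finsetSum t fun i hi ↦ (hT i hi).time
  refine ⟨?_, i1.congr e1, i3.congr e3, ?_⟩
  · rw [← e0]; exact i0
  · rw [← e0, ← integral_congr_ae e1, ← integral_congr_ae e3,
      integral_finsetSum t fun i hi ↦ (hT i hi).reaction,
      integral_finsetSum t fun i hi ↦ (hT i hi).gradient,
      integral_finsetSum t fun i hi ↦ (hT i hi).time, ← Finset.sum_sub_distrib]
    exact Finset.sum_le_sum fun i hi ↦ (hT i hi).le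

end Tested

theorem _root_.LocallyLipschitz.inv_on_pos {X : Type*} [PseudoEMetricSpace X] {σ : X → ℝ}
    (hσ : LocallyLipschitz σ) : LocallyLipschitzOn {x | 0 < σ x} fun x ↦ (σ x)⁻¹ := fun x hx ↦ by
  have hx0 : 0 < σ x := hx
  obtain ⟨K, t, ht, hK⟩ := (contDiffAt_inv ℝ hx0.ne' (n := 1)).exists_lipschitzOnWith
  obtain ⟨K', s, hs, hK'⟩ := hσ x
  refine ⟨K * K', s ∩ σ ⁻¹' t, mem_nhdsWithin_of_mem_nhds
    (inter_mem hs (hσ.continuous.continuousAt ht)), ?_⟩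
  exact hK.comp (hK'.mono inter_subset_left) fun y hy ↦ hy.2

theorem _root_.LocallyLipschitz.finsetSum {X ι : Type*} [PseudoEMetricSpace X] {t : Finset ι}
    {g : ι → X → ℝ} (hg : ∀ i ∈ t, LocallyLipschitz (g i)) :
    LocallyLipschitz fun x ↦ ∑ i ∈ t, g i x := by
  classical
  induction t using Finset.induction_on with
  | empty => simpa using LocallyLipschitz.const (0 : ℝ)
  | insert i s hi IH =>
    simp only [Finset.sum_insert hi]
    exact (hg i (Finset.mem_insert_self i s)).add
      (IH fun j hj ↦ hg j (Finset.mem_insert_of_mem hj))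

/-! ### Lipschitz partition of unity and the tested inequality for all cutoffs. -/

section Partition

variable {n : ℕ} {M : Type*} [MetricSpace M] [ProperSpace M]
    [ChartedSpace (EuclideanSpace ℝ (Fin n)) M] [IsManifold (𝓡 n) ∞ M]
    [RiemannianBundle (fun x : M ↦ TangentSpace (𝓡 n) x)]
    [IsContMDiffRiemannianBundle (𝓡 n) ∞ (EuclideanSpace ℝ (Fin n))
      (fun x : M ↦ TangentSpace (𝓡 n) x)] [IsRiemannianManifold (𝓡 n) M]
    [MeasurableSpace M] [BorelSpace M]

/-- A test function is a finite sum of test functions supported in chart domains. -/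
theorem IsTestFunction.exists_partition (n : ℕ) {M : Type*} [MetricSpace M] [ProperSpace M]
    [ChartedSpace (EuclideanSpace ℝ (Fin n)) M] {ζ : M × ℝ → ℝ} (hζ : IsTestFunction ζ) :
    ∃ (t : Finset M) (η : M → M × ℝ → ℝ), (∀ i ∈ t, IsTestFunction (η i)) ∧
      (∀ i ∈ t, tsupport (η i) ⊆ chartCylinder n i) ∧ ζ = fun z ↦ ∑ i ∈ t, η i z := by
  have hr : ∀ x : M, ∃ r > 0, Metric.closedBall x r ⊆ (extChartAt (𝓡 n) x).source := fun x ↦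
    Metric.nhds_basis_closedBall.mem_iff.1 (extChartAt_source_mem_nhds x)
  choose r hr0 hrs using hr
  have hK : IsCompact (Prod.fst '' tsupport ζ) := hζ.compact.isCompact.image continuous_fst
  obtain ⟨t, -, ht⟩ := hK.elim_nhds_subcover (fun x ↦ Metric.ball x (r x))
    fun x _ ↦ Metric.ball_mem_nhds x (hr0 x)
  -- Tent functions of the space variable on balls inside chart domains; their sum is positive on
  -- the support of ζ, so dividing by it there preserves local Lipschitz continuity.
  set b : M → M × ℝ → ℝ := fun i z ↦ max (r i - dist z.1 i) 0 with hb
  have hb0 : ∀ i z, 0 ≤ b i z := fun i z ↦ le_max_right _ _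
  have hbl : ∀ i, LocallyLipschitz (b i) := fun i ↦ by
    have h1 : LipschitzWith 1 fun z : M × ℝ ↦ dist z.1 i :=
      ((LipschitzWith.dist_left i).comp LipschitzWith.prod_fst).weaken (by simp)
    exact (((LipschitzWith.const (r i)).sub h1).max_const 0).locallyLipschitz
  set σ : M × ℝ → ℝ := fun z ↦ ∑ i ∈ t, b i z with hσ
  have hσl : LocallyLipschitz σ := LocallyLipschitz.finsetSum fun i _ ↦ hbl i
  have hσpos : tsupport ζ ⊆ {z | 0 < σ z} := fun z hz ↦ by
    obtain ⟨i, hi, hzi⟩ := mem_iUnion₂.1 (ht (mem_image_of_mem _ hz))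
    refine Finset.sum_pos' (fun j _ ↦ hb0 j z) ⟨i, hi, ?_⟩
    exact lt_max_of_lt_left (sub_pos.2 hzi)
  refine ⟨t, fun i z ↦ ζ z * (b i z * (σ z)⁻¹), fun i _ ↦ ?_, fun i _ ↦ ?_, ?_⟩
  · have hsub : tsupport (fun z ↦ ζ z * (b i z * (σ z)⁻¹)) ⊆ tsupport ζ :=
      tsupport_mul_subset_left
    refine ⟨fun z ↦ mul_nonneg (hζ.nonneg z) (mul_nonneg (hb0 i z)
      (inv_nonneg.2 (Finset.sum_nonneg fun j _ ↦ hb0 j z))), ?_, ?_, hsub.trans hζ.supp⟩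
    · refine locallyLipschitz_of_tsupport_subset
        (isOpen_lt continuous_const hσl.continuous) ?_ (hsub.trans hσpos)
      exact (hζ.lip.locallyLipschitzOn).mul_real
        (((hbl i).locallyLipschitzOn).mul_real hσl.inv_on_pos)
    · exact hζ.compact.isCompact.of_isClosed_subset (isClosed_tsupport _) hsub
  · intro z hz
    have h1 : tsupport (fun z ↦ ζ z * (b i z * (σ z)⁻¹)) ⊆ Prod.fst ⁻¹' Metric.closedBall i (r i) :=
      closure_minimal (fun y hy ↦ by
        by_contra h'
        refine hy ?_
        have h2 : b i y = 0 := by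
          simp only [mem_preimage, Metric.mem_closedBall, not_le] at h'
          exact max_eq_right (by linarith)
        simp only [h2, zero_mul, mul_zero]) (Metric.isClosed_closedBall.preimage continuous_fst)
    exact ⟨hrs i (h1 hz), (hζ.supp (tsupport_mul_subset_left hz)).2⟩
  · funext z
    by_cases hz : z ∈ tsupport ζ
    · have h1 : 0 < σ z := hσpos hz
      rw [← Finset.mul_sum, ← Finset.sum_mul, mul_inv_cancel₀ h1.ne', mul_one]
    · simp [image_eq_zero_of_notMem_tsupport hz]

variable {p q m K : ℝ} {f : ℝ → ℝ} {a : M → ℝ} {V u : M × ℝ → ℝ}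
    {X : ∀ x : M, ℝ → TangentSpace (𝓡 n) x} {w : M × ℝ → ℝ}
    (h : IsWeakSolutionWith n p q m f a V u X w)
    {F F' Φ : ℝ → ℝ} {B B' : ℝ}
include h

/-- A weak solution `u` may be tested with `ζ F(u)` for every test function `ζ`. -/
theorem IsWeakSolutionWith.testedInequality (hp : 1 < p) (hm : 1 ≤ m)
    (hf_meas : Measurable f) (hf : ∀ s, 0 ≤ s → 0 ≤ f s ∧ f s ≤ K) (ha : LocallyLipschitz a)
    (hpos : ∀ᵐ x ∂(riemVolume n M), 0 < a x)
    (hF : ∀ s, HasDerivAt F (F' s) s) (hF' : Continuous F') (hB : ∀ s, |F' s| ≤ B)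
    (hF0 : ∀ s, 0 ≤ F s) (hFB : ∀ s, F s ≤ B') (hΦ : ∀ s, HasDerivAt Φ (F s) s)
    {ζ : M × ℝ → ℝ} (hζ : IsTestFunction ζ) :
    TestedInequality p q m f a V u X F F' Φ ζ := by
  obtain ⟨t, η, h1, h2, rfl⟩ := hζ.exists_partition n
  exact TestedInequality.sum (c := fun i ↦ i) ha h1 h2 fun i hi ↦
    h.testedInequality_of_chart hp hm hf_meas hf ha hpos hF hF' hB hF0 hFB hΦ (h1 i hi) (h2 i hi)

end Partition

/-! ### Absorption of the gradient terms by Young's inequality. -/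

section Absorption

variable {p m δ ε U N Y D G ζ g K : ℝ}

/-- A crude Young inequality: whichever of D and A·N is larger decides which term on the right
dominates. -/
theorem mul_rpow_sub_one_le {A : ℝ} (hp : 1 < p) (hA : 0 < A) (hN : 0 ≤ N) (hD : 0 ≤ D) :
    D * N ^ (p - 1) ≤ A * N ^ p + D ^ p * A ^ (1 - p) := by
  have h1 : ∀ x : ℝ, 0 ≤ x → x * x ^ (p - 1) = x ^ p := fun x hx ↦ by
    conv_rhs => rw [show p = 1 + (p - 1) by ring,
      Real.rpow_add_of_nonneg hx (by norm_num) (by linarith), Real.rpow_one]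
  rcases le_total D (A * N) with h | h
  · have h2 : D * N ^ (p - 1) ≤ A * N * N ^ (p - 1) :=
      mul_le_mul_of_nonneg_right h (Real.rpow_nonneg hN _)
    rw [mul_assoc, h1 N hN] at h2
    have h3 : 0 ≤ D ^ p * A ^ (1 - p) := by positivity
    linarith
  · have h2 : N ≤ D / A := by rw [le_div_iff₀ hA]; linarith
    have h3 : D * N ^ (p - 1) ≤ D * (D / A) ^ (p - 1) := by
      gcongr
    rw [Real.div_rpow hD hA.le, ← mul_div_assoc, h1 D hD, div_eq_mul_inv, ← Real.rpow_neg hA.le,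
      neg_sub] at h3
    have h4 : 0 ≤ A * N ^ p := by positivity
    linarith

/-- The gradient terms of a weak solution tested with `ζ (u + ε) ^ (-δ)` are controlled by a power
of `u + ε`. -/
theorem tested_gradient_le (hp : 1 < p) (hm : 1 ≤ m) (hδ : 0 < δ) (hε : 0 < ε) (hU : 0 ≤ U)
    (hN : 0 ≤ N) (hg0 : 0 ≤ g) (hgK : g ≤ K) (hζ : 0 ≤ ζ) (hD : 0 ≤ D) (hG : 0 ≤ G)
    (hY : |Y| ≤ D * N) (hDG : D ^ p ≤ ζ ^ (p - 1) * G) :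
    U ^ (m - 1) * N ^ (p - 2) * g * (Y * (U + ε) ^ (-δ)
      + ζ * (-δ * (U + ε) ^ (-δ - 1) * N ^ 2)) ≤ K * δ ^ (1 - p) * (G * (U + ε) ^ (p + m - 2 - δ)) := by
  have hv : 0 < U + ε := by linarith
  set v := U + ε with hvdef
  have hK : 0 ≤ K := hg0.trans hgK
  have h1 : N ^ (p - 2) * Y ≤ D * N ^ (p - 1) :=
    (mul_le_mul_of_nonneg_left (le_abs_self Y) (Real.rpow_nonneg hN _)).trans
      (rpow_sub_two_mul_le hp hN hY)
  -- Young with A = δζ/v, the coefficient of the good gradient term; the powers ζ^(p-1) and ζ^(1-p)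
  -- cancel and δ^(1-p) remains. Where ζ = 0 the slope D vanishes as well.
  have h2 : D * N ^ (p - 1) - δ * ζ / v * N ^ p ≤ δ ^ (1 - p) * G * v ^ (p - 1) := by
    rcases hζ.eq_or_lt with rfl | hζ
    · rw [Real.zero_rpow (by linarith), zero_mul] at hDG
      have hD0 : D = 0 := by
        have := le_antisymm hDG (Real.rpow_nonneg hD p)
        exact ((Real.rpow_eq_zero hD (by linarith)).1 this)
      rw [hD0]
      simp only [zero_mul, mul_zero, zero_div, sub_zero]
      positivity
    · have hA : 0 < δ * ζ / v := by positivity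
      have h3 := mul_rpow_sub_one_le hp hA hN hD
      have h4 : D ^ p * (δ * ζ / v) ^ (1 - p) ≤ ζ ^ (p - 1) * G * (δ * ζ / v) ^ (1 - p) :=
        mul_le_mul_of_nonneg_right hDG (by positivity)
      have h5 : ζ ^ (p - 1) * G * (δ * ζ / v) ^ (1 - p) = δ ^ (1 - p) * G * v ^ (p - 1) := by
        rw [Real.div_rpow (by positivity) hv.le, Real.mul_rpow hδ.le hζ.le, div_eq_mul_inv,
          ← Real.rpow_neg hv.le, neg_sub]
        have h6 : ζ ^ (p - 1) * ζ ^ (1 - p) = 1 := by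
          rw [← Real.rpow_add hζ]; norm_num
        calc _ = (ζ ^ (p - 1) * ζ ^ (1 - p)) * (δ ^ (1 - p) * G * v ^ (p - 1)) := by ring
          _ = _ := by rw [h6, one_mul]
      linarith
  have h3 : v ^ (-δ - 1) = v ^ (-δ) / v := by rw [Real.rpow_sub hv, Real.rpow_one]
  have h4 : N ^ (p - 2) * (Y * v ^ (-δ) + ζ * (-δ * v ^ (-δ - 1) * N ^ 2))
      ≤ v ^ (-δ) * (δ ^ (1 - p) * G * v ^ (p - 1)) := by
    have h5 : N ^ (p - 2) * (Y * v ^ (-δ) + ζ * (-δ * v ^ (-δ - 1) * N ^ 2))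
        = v ^ (-δ) * (N ^ (p - 2) * Y - δ * ζ / v * (N ^ (p - 2) * N ^ 2)) := by
      rw [h3]; field_simp; ring
    rw [h5, rpow_sub_two_mul_sq hp hN]
    refine mul_le_mul_of_nonneg_left ?_ (by positivity)
    linarith
  calc _ = U ^ (m - 1) * g * (N ^ (p - 2) * (Y * v ^ (-δ) + ζ * (-δ * v ^ (-δ - 1) * N ^ 2))) := by
        ring
    _ ≤ U ^ (m - 1) * g * (v ^ (-δ) * (δ ^ (1 - p) * G * v ^ (p - 1))) :=
        mul_le_mul_of_nonneg_left h4 (by positivity)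
    _ ≤ v ^ (m - 1) * K * (v ^ (-δ) * (δ ^ (1 - p) * G * v ^ (p - 1))) := by
        gcongr
        · linarith
    _ = K * δ ^ (1 - p) * (G * (v ^ (m - 1) * v ^ (-δ) * v ^ (p - 1))) := by ring
    _ = _ := by
        rw [← Real.rpow_add hv, ← Real.rpow_add hv]
        ring_nf

end Absorption

/-! ### The test nonlinearity (s + ε)^(-δ). -/

section NegativePower

variable {δ ε : ℝ}

/-- The derivative of `s ↦ (s + ε) ^ (-δ)`, extended to an even function. -/
def negPowDeriv (δ ε s : ℝ) : ℝ := -δ * (|s| + ε) ^ (-δ - 1)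

/-- The function `s ↦ (s + ε) ^ (-δ)` on `[0, ∞)`, extended to a `C¹` function. -/
def negPow (δ ε s : ℝ) : ℝ := ε ^ (-δ) + ∫ t in (0 : ℝ)..s, negPowDeriv δ ε t

/-- The primitive of `negPow` vanishing at `0`. -/
def negPowPrim (δ ε s : ℝ) : ℝ := ∫ t in (0 : ℝ)..s, negPow δ ε t

variable (hδ : 0 < δ) (hε : 0 < ε)
include hδ hε

theorem continuous_negPowDeriv : Continuous (negPowDeriv δ ε) :=
  continuous_const.mul ((by fun_prop : Continuous fun s : ℝ ↦ |s| + ε).rpow_const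
    fun s ↦ Or.inl (by positivity))

theorem abs_negPowDeriv_le (s : ℝ) : |negPowDeriv δ ε s| ≤ δ * ε ^ (-δ - 1) := by
  rw [negPowDeriv, abs_mul, abs_neg, abs_of_pos hδ, abs_of_nonneg (by positivity)]
  refine mul_le_mul_of_nonneg_left ?_ hδ.le
  exact Real.rpow_le_rpow_of_nonpos hε (by linarith [abs_nonneg s]) (by linarith)

theorem hasDerivAt_negPow (s : ℝ) : HasDerivAt (negPow δ ε) (negPowDeriv δ ε s) s :=
  (hasDerivAt_primitive (continuous_negPowDeriv hδ hε) s).const_add _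

theorem continuous_negPow : Continuous (negPow δ ε) :=
  continuous_iff_continuousAt.2 fun s ↦ (hasDerivAt_negPow hδ hε s).continuousAt

theorem hasDerivAt_negPowPrim (s : ℝ) : HasDerivAt (negPowPrim δ ε) (negPow δ ε s) s :=
  hasDerivAt_primitive (continuous_negPow hδ hε) s

theorem negPow_of_nonneg {s : ℝ} (hs : 0 ≤ s) : negPow δ ε s = (s + ε) ^ (-δ) := by
  have h1 : ∫ t in (0 : ℝ)..s, negPowDeriv δ ε t = (s + ε) ^ (-δ) - (0 + ε) ^ (-δ) := by
    refine intervalIntegral.integral_eq_sub_of_hasDerivAt (f := fun t ↦ (t + ε) ^ (-δ))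
      (fun t ht ↦ ?_) ((continuous_negPowDeriv hδ hε).intervalIntegrable _ _)
    rw [uIcc_of_le hs] at ht
    have h2 : t + ε ≠ 0 := by linarith [ht.1]
    have h3 := ((hasDerivAt_id t).add_const ε).rpow_const (p := -δ) (Or.inl h2)
    rw [negPowDeriv, abs_of_nonneg ht.1]
    simpa using h3
  rw [negPow, h1, zero_add]
  ring

/-- The derivative is even, so the graph is symmetric about its point at 0. This gives nonnegativity
and boundedness for negative arguments too, as required when testing with functions defined on all
of ℝ. -/
theorem negPow_neg (s : ℝ) : negPow δ ε (-s) = 2 * ε ^ (-δ) - negPow δ ε s := by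
  have h1 : ∫ t in (0 : ℝ)..s, negPowDeriv δ ε (-t) = ∫ t in (-s)..(-0), negPowDeriv δ ε t :=
    intervalIntegral.integral_comp_neg _
  have h2 : ∀ t, negPowDeriv δ ε (-t) = negPowDeriv δ ε t := fun t ↦ by
    rw [negPowDeriv, negPowDeriv, abs_neg]
  simp only [h2, neg_zero] at h1
  rw [negPow, negPow, h1, intervalIntegral.integral_symm (-s) 0]
  ring

theorem negPow_mem_Icc {s : ℝ} (hs : 0 ≤ s) : negPow δ ε s ∈ Icc 0 (ε ^ (-δ)) := by
  rw [negPow_of_nonneg hδ hε hs]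
  exact ⟨by positivity, Real.rpow_le_rpow_of_nonpos hε (by linarith) (by linarith)⟩

theorem negPow_nonneg (s : ℝ) : 0 ≤ negPow δ ε s := by
  rcases le_total 0 s with hs | hs
  · exact (negPow_mem_Icc hδ hε hs).1
  · have h1 := negPow_neg hδ hε (-s)
    rw [neg_neg] at h1
    have h2 := (negPow_mem_Icc hδ hε (neg_nonneg.2 hs)).2
    have h3 : 0 < ε ^ (-δ) := by positivity
    linarith

theorem negPow_le (s : ℝ) : negPow δ ε s ≤ 2 * ε ^ (-δ) := by
  have h1 := negPow_neg hδ hε (-s)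
  rw [neg_neg] at h1
  linarith [negPow_nonneg hδ hε (-s)]

theorem negPowPrim_nonneg {s : ℝ} (hs : 0 ≤ s) : 0 ≤ negPowPrim δ ε s :=
  intervalIntegral.integral_nonneg hs fun _ _ ↦ negPow_nonneg hδ hε _

/-- Subadditivity of s^(1-δ) removes ε, and 1/(1-δ) ≤ 2; the bound is uniform as ε → 0. -/
theorem negPowPrim_le (hδ2 : δ ≤ 1 / 2) {s : ℝ} (hs : 0 ≤ s) :
    negPowPrim δ ε s ≤ 2 * s ^ (1 - δ) := by
  have h1 : negPowPrim δ ε s = (s + ε) ^ (1 - δ) / (1 - δ) - (0 + ε) ^ (1 - δ) / (1 - δ) := by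
    refine intervalIntegral.integral_eq_sub_of_hasDerivAt
      (f := fun t ↦ (t + ε) ^ (1 - δ) / (1 - δ))
      (fun t ht ↦ ?_) ((continuous_negPow hδ hε).intervalIntegrable _ _)
    rw [uIcc_of_le hs] at ht
    have h2 : t + ε ≠ 0 := by linarith [ht.1]
    have h3 := (((hasDerivAt_id t).add_const ε).rpow_const (p := 1 - δ)
      (Or.inl h2)).div_const (1 - δ)
    rw [negPow_of_nonneg hδ hε ht.1]
    refine h3.congr_deriv ?_
    have h4 : (1 - δ) ≠ 0 := by linarith
    simp only [id]
    field_simp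
    ring_nf
  have h2 : (s + ε) ^ (1 - δ) ≤ s ^ (1 - δ) + ε ^ (1 - δ) :=
    Real.rpow_add_le_add_rpow hs hε.le (by linarith) (by linarith)
  rw [h1, zero_add, ← sub_div, div_le_iff₀ (by linarith)]
  have h3 : 0 ≤ s ^ (1 - δ) := Real.rpow_nonneg hs _
  nlinarith

end NegativePower

theorem add_rpow_le_two_rpow_mul {x y r : ℝ} (hx : 0 ≤ x) (hy : 0 ≤ y) (hr : 0 ≤ r) :
    (x + y) ^ r ≤ 2 ^ r * (x ^ r + y ^ r) := by
  have h1 : (x + y) ^ r ≤ (2 * max x y) ^ r :=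
    Real.rpow_le_rpow (by positivity) (by linarith [le_max_left x y, le_max_right x y]) hr
  rw [Real.mul_rpow (by norm_num) (le_max_of_le_left hx)] at h1
  refine h1.trans (mul_le_mul_of_nonneg_left ?_ (by positivity))
  have hx' := Real.rpow_nonneg hx r
  have hy' := Real.rpow_nonneg hy r
  rcases max_choice x y with h | h <;> rw [h] <;> linarith

/-! ### Perturbation of the Hölder exponents. -/

section Exponents

/-- Small perturbations of the exponents only cost a constant factor. -/
theorem rpow_mul_rpow_neg_le {β Γ N j g H : ℝ} (hβ : 0 ≤ β) (hj : 0 < j) (hN : 0 ≤ N)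
    (hΓ : Γ ≤ β / (1 + β)) (hΓ' : β / (1 + β) ≤ Γ + 1 / j)
    (hg : Real.exp (-(N * j)) ≤ g) (hH : 0 < H) (hH' : H ≤ Real.exp (N * j)) :
    g ^ (1 / (1 - Γ)) * H ^ (-(Γ / (1 - Γ)))
      ≤ Real.exp (2 * N * (1 + β) ^ 2) * (g ^ (1 + β) * H ^ (-β)) := by
  have hg0 : 0 < g := (Real.exp_pos _).trans_le hg
  have hβ1 : 0 < 1 + β := by linarith
  have h1 : Γ * (1 + β) ≤ β := by rwa [le_div_iff₀ hβ1] at hΓ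
  have h2 : 0 < 1 - Γ := by
    by_contra h
    nlinarith
  have h3 : (1 + β) * (1 - Γ) ≥ 1 := by nlinarith
  have h4 : 1 / (1 - Γ) = 1 + Γ / (1 - Γ) := by field_simp; ring
  have h5 : β - Γ / (1 - Γ) = (β / (1 + β) - Γ) * ((1 + β) / (1 - Γ)) := by field_simp; ring
  have h6 : 0 ≤ β - Γ / (1 - Γ) := by
    rw [h5]
    exact mul_nonneg (by linarith) (by positivity)
  have h7 : (β - Γ / (1 - Γ)) * j ≤ (1 + β) ^ 2 := by
    have h8 : (1 + β) / (1 - Γ) ≤ (1 + β) ^ 2 := by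
      rw [div_le_iff₀ h2]
      nlinarith
    have h9 : (β / (1 + β) - Γ) * j ≤ 1 := by
      have : β / (1 + β) - Γ ≤ 1 / j := by linarith
      calc _ ≤ 1 / j * j := mul_le_mul_of_nonneg_right this hj.le
        _ = 1 := by field_simp
    rw [h5, mul_right_comm]
    calc _ ≤ 1 * (1 + β) ^ 2 := mul_le_mul h9 h8 (by positivity) zero_le_one
      _ = _ := one_mul _
  have h10 : (H / g) ^ (β - Γ / (1 - Γ)) ≤ Real.exp (2 * N * (1 + β) ^ 2) := by
    have h11 : H / g ≤ Real.exp (2 * N * j) := by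
      rw [div_le_iff₀ hg0]
      calc H ≤ Real.exp (2 * N * j) * Real.exp (-(N * j)) := by
            rw [← Real.exp_add]; convert hH' using 2; ring
        _ ≤ _ := by gcongr
    calc _ ≤ (Real.exp (2 * N * j)) ^ (β - Γ / (1 - Γ)) :=
          Real.rpow_le_rpow (by positivity) h11 h6
      _ = Real.exp (2 * N * ((β - Γ / (1 - Γ)) * j)) := by rw [← Real.exp_mul]; ring_nf
      _ ≤ _ := by gcongr
  calc _ = (H / g) ^ (β - Γ / (1 - Γ)) * (g ^ (1 + β) * H ^ (-β)) := by
        rw [h4, Real.div_rpow hH.le hg0.le, div_eq_mul_inv (H ^ _), ← Real.rpow_neg hg0.le]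
        calc _ = g ^ (-(β - Γ / (1 - Γ)) + (1 + β)) * H ^ ((β - Γ / (1 - Γ)) + (-β)) := by
              ring_nf
          _ = _ := by rw [Real.rpow_add hg0, Real.rpow_add hH]; ring
    _ ≤ _ := mul_le_mul_of_nonneg_right h10 (by positivity)

end Exponents

/-- The pointwise Lipschitz constant of `g` at `x` is at most `ℓ`. -/
def LipConstAtLE {X : Type*} [PseudoMetricSpace X] (g : X → ℝ) (x : X) (ℓ : ℝ) : Prop :=
  ∀ L > ℓ, ∀ᶠ y in 𝓝 x, |g y - g x| ≤ L * dist y x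

theorem ofReal_integral_le_lintegral_ofReal {X : Type*} [MeasurableSpace X] {μ : Measure X}
    {g : X → ℝ} (hg : Integrable g μ) :
    ENNReal.ofReal (∫ x, g x ∂μ) ≤ ∫⁻ x, ENNReal.ofReal (g x) ∂μ := by
  calc ENNReal.ofReal (∫ x, g x ∂μ) ≤ ENNReal.ofReal (∫ x, max (g x) 0 ∂μ) :=
        ENNReal.ofReal_le_ofReal (integral_mono hg hg.pos_part fun x ↦ le_max_left _ _)
    _ = ∫⁻ x, ENNReal.ofReal (max (g x) 0) ∂μ :=
        ofReal_integral_eq_lintegral_ofReal hg.pos_part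
          (Eventually.of_forall fun x ↦ le_max_right _ _)
    _ = _ := by
        refine lintegral_congr fun x ↦ ?_
        rw [ENNReal.ofReal_max, ENNReal.ofReal_zero, max_eq_left zero_le]

theorem tendsto_mul_rpow_neg {U q δ : ℝ} (hU : 0 ≤ U) (hδ : 0 < δ) (hδq : δ < q) :
    Tendsto (fun j : ℕ ↦ U ^ q * (U + 1 / ((j : ℝ) + 1)) ^ (-δ)) atTop (𝓝 (U ^ (q - δ))) := by
  rcases hU.eq_or_lt with rfl | hU
  · rw [Real.zero_rpow (by linarith : q ≠ 0), Real.zero_rpow (by linarith : q - δ ≠ 0)]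
    simp
  · have h1 : Tendsto (fun j : ℕ ↦ U + 1 / ((j : ℝ) + 1)) atTop (𝓝 (U + 0)) :=
      tendsto_one_div_add_atTop_nhds_zero_nat.const_add U
    rw [add_zero] at h1
    have h2 := (h1.rpow_const (p := -δ) (Or.inl hU.ne')).const_mul (U ^ q)
    rwa [← Real.rpow_add hU, ← sub_eq_add_neg] at h2

/-! ### The basic integral estimate with negative powers of the solution. -/

section Estimate

variable {n : ℕ} {M : Type*} [MetricSpace M] [ProperSpace M]
    [ChartedSpace (EuclideanSpace ℝ (Fin n)) M] [IsManifold (𝓡 n) ∞ M]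
    [RiemannianBundle (fun x : M ↦ TangentSpace (𝓡 n) x)]
    [IsContMDiffRiemannianBundle (𝓡 n) ∞ (EuclideanSpace ℝ (Fin n))
      (fun x : M ↦ TangentSpace (𝓡 n) x)] [IsRiemannianManifold (𝓡 n) M]
    [MeasurableSpace M] [BorelSpace M]

theorem abs_dirDeriv_le_of_lipConst {g : M → ℝ} {x : M} {ℓ : ℝ} (hℓ : 0 ≤ ℓ)
    (hg : LipConstAtLE g x ℓ) (v : TangentSpace (𝓡 n) x) : |dirDeriv g x v| ≤ ℓ * ‖v‖ := by
  have h1 : ∀ᶠ L in 𝓝[>] ℓ, |dirDeriv g x v| ≤ L * ‖v‖ := by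
    filter_upwards [self_mem_nhdsWithin] with L hL
    exact abs_dirDeriv_le (hℓ.trans (le_of_lt hL)) (hg L hL) v
  have h2 : Tendsto (fun L ↦ L * ‖v‖) (𝓝[>] ℓ) (𝓝 (ℓ * ‖v‖)) :=
    ((continuous_id.mul continuous_const).tendsto ℓ).mono_left nhdsWithin_le_nhds
  exact ge_of_tendsto h2 h1

/-- The weighted measure on space-time. -/
def spaceTimeMeasure (n : ℕ) {M : Type*} [MetricSpace M]
    [ChartedSpace (EuclideanSpace ℝ (Fin n)) M]
    [RiemannianBundle (fun x : M ↦ TangentSpace (𝓡 n) x)] [MeasurableSpace M] (a : M → ℝ) :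
    Measure (M × ℝ) := ((weightedVolume n a).prod volume).restrict (spaceTime M)

variable {p q m K : ℝ} {f : ℝ → ℝ} {a : M → ℝ} {V u : M × ℝ → ℝ}
    {X : ∀ x : M, ℝ → TangentSpace (𝓡 n) x} {w : M × ℝ → ℝ}
    (h : IsWeakSolutionWith n p q m f a V u X w)
include h

theorem IsWeakSolutionWith.aemeasurable (ha : LocallyLipschitz a) :
    AEMeasurable u (spaceTimeMeasure n a) :=
  h.derivs.locInt.aestronglyMeasurable.aemeasurable.mono_ac
    (absolutelyContinuous_weightedVolume n ha.continuous)

theorem IsWeakSolutionWith.ae_nonneg (ha : LocallyLipschitz a) :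
    ∀ᵐ z ∂(spaceTimeMeasure n a), 0 ≤ u z :=
  (absolutelyContinuous_weightedVolume n ha.continuous).ae_le h.nonneg

section

variable (hp : 1 < p) (hm : 1 ≤ m)
    (hf_meas : Measurable f) (hf : ∀ s, 0 ≤ s → 0 ≤ f s ∧ f s ≤ K) (ha : LocallyLipschitz a)
    (hpos : ∀ᵐ x ∂(riemVolume n M), 0 < a x) {H : M → ℝ}
    (hVH : ∀ᵐ z ∂(spaceTimeMeasure n a), H z.1 ≤ V z)
    (hH : ∀ᵐ z ∂(spaceTimeMeasure n a), 0 < H z.1)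
    {δ : ℝ} (hδ : 0 < δ) (hδ2 : δ ≤ 1 / 2) (hδk : δ < p + m - 2)
    {ζ D G T : M × ℝ → ℝ} (hζ : IsTestFunction ζ) (hD0 : ∀ z, 0 ≤ D z) (hG0 : ∀ z, 0 ≤ G z)
    (hT0 : ∀ z, 0 ≤ T z)
    (hD : ∀ z ∈ spaceTime M, LipConstAtLE (fun x ↦ ζ (x, z.2)) z.1 (D z))
    (hDG : ∀ z ∈ spaceTime M, D z ^ p ≤ ζ z ^ (p - 1) * G z)
    (hT : ∀ z ∈ spaceTime M, -deriv (fun s ↦ ζ (z.1, s)) z.2 ≤ T z)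
    (hGm : Measurable G) (hTm : Measurable T)
include hp hm hf_meas hf ha hpos hVH hH hδ hδ2 hδk hζ hD0 hG0 hT0 hD hDG hT hGm hTm

/-- The tested inequality for (u + ε)^(-δ): the reaction is bounded below through V ≥ h, the
gradient terms are absorbed, and only the decrease of ζ in time counts because the primitive is
nonnegative. Lower Lebesgue integrals permit an infinite right-hand side. -/
theorem IsWeakSolutionWith.lintegral_regularized_le {ε : ℝ} (hε : 0 < ε) :
    ∫⁻ z, ENNReal.ofReal (ζ z * (H z.1 * (u z ^ q * (u z + ε) ^ (-δ)))) ∂(spaceTimeMeasure n a)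
      ≤ ENNReal.ofReal (K * δ ^ (1 - p) * 2 ^ (p + m - 2))
          * (∫⁻ z, ENNReal.ofReal (G z * u z ^ (p + m - 2 - δ)) ∂(spaceTimeMeasure n a)
            + ENNReal.ofReal (ε ^ (p + m - 2 - δ))
              * ∫⁻ z, ENNReal.ofReal (G z) ∂(spaceTimeMeasure n a))
        + 2 * ∫⁻ z, ENNReal.ofReal (T z * u z ^ (1 - δ)) ∂(spaceTimeMeasure n a) := by
  have hK : 0 ≤ K := (hf 0 le_rfl).1.trans (hf 0 le_rfl).2
  have hI := h.testedInequality hp hm hf_meas hf ha hpos (hasDerivAt_negPow hδ hε)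
    (continuous_negPowDeriv hδ hε) (abs_negPowDeriv_le hδ hε) (negPow_nonneg hδ hε)
    (negPow_le hδ hε) (hasDerivAt_negPowPrim hδ hε) hζ
  have hu := h.ae_nonneg ha
  have hum := h.aemeasurable ha
  have hS : ∀ᵐ z ∂(spaceTimeMeasure n a), z ∈ spaceTime M :=
    ae_restrict_mem isOpen_spaceTime.measurableSet
  set ρ := spaceTimeMeasure (M := M) n a with hρ
  have i0 : Integrable (fun z ↦ ζ z * (u z ^ q * V z) * negPow δ ε (u z)) ρ := hI.reaction
  have i1 : Integrable (testedGradient p m f u X (negPow δ ε) (negPowDeriv δ ε) ζ) ρ :=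
    hI.gradient
  have i3 : Integrable (fun z ↦ negPowPrim δ ε (u z) * deriv (fun s ↦ ζ (z.1, s)) z.2) ρ :=
    hI.time
  have hle : ∫ z, ζ z * (u z ^ q * V z) * negPow δ ε (u z) ∂ρ
      ≤ ∫ z, testedGradient p m f u X (negPow δ ε) (negPowDeriv δ ε) ζ z ∂ρ
      - ∫ z, negPowPrim δ ε (u z) * deriv (fun s ↦ ζ (z.1, s)) z.2 ∂ρ := hI.le
  rw [← integral_sub i1 i3] at hle
  have hGu : AEMeasurable (fun z ↦ ENNReal.ofReal (G z * u z ^ (p + m - 2 - δ))) ρ :=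
    (hGm.aemeasurable.mul (hum.pow_const _)).ennreal_ofReal
  have hTu : AEMeasurable (fun z ↦ ENNReal.ofReal (T z * u z ^ (1 - δ))) ρ :=
    (hTm.aemeasurable.mul (hum.pow_const _)).ennreal_ofReal
  calc ∫⁻ z, ENNReal.ofReal (ζ z * (H z.1 * (u z ^ q * (u z + ε) ^ (-δ)))) ∂ρ
      ≤ ∫⁻ z, ENNReal.ofReal (ζ z * (u z ^ q * V z) * negPow δ ε (u z)) ∂ρ := by
        refine lintegral_mono_ae ?_
        filter_upwards [hu, hVH] with z hz hzV
        refine ENNReal.ofReal_le_ofReal ?_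
        rw [negPow_of_nonneg hδ hε hz]
        have h1 : 0 ≤ ζ z * (u z ^ q * (u z + ε) ^ (-δ)) :=
          mul_nonneg (hζ.nonneg z) (mul_nonneg (Real.rpow_nonneg hz _)
            (Real.rpow_nonneg (by linarith) _))
        nlinarith [mul_le_mul_of_nonneg_left hzV h1]
    _ = ENNReal.ofReal (∫ z, ζ z * (u z ^ q * V z) * negPow δ ε (u z) ∂ρ) := by
        refine (ofReal_integral_eq_lintegral_ofReal i0 ?_).symm
        filter_upwards [hu, hVH, hH] with z hz hzV hzH
        exact mul_nonneg (mul_nonneg (hζ.nonneg z) (mul_nonneg (Real.rpow_nonneg hz _)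
          (hzH.le.trans hzV))) (negPow_nonneg hδ hε _)
    _ ≤ _ := ENNReal.ofReal_le_ofReal hle
    _ ≤ _ := ofReal_integral_le_lintegral_ofReal (i1.sub i3)
    _ ≤ ∫⁻ z, (ENNReal.ofReal (K * δ ^ (1 - p) * 2 ^ (p + m - 2))
          * (ENNReal.ofReal (G z * u z ^ (p + m - 2 - δ))
            + ENNReal.ofReal (ε ^ (p + m - 2 - δ)) * ENNReal.ofReal (G z))
        + 2 * ENNReal.ofReal (T z * u z ^ (1 - δ))) ∂ρ := by
        refine lintegral_mono_ae ?_
        filter_upwards [hu, hS] with z hz hzS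
        have hN := gradNorm_nonneg X z
        have hY := abs_dirDeriv_le_of_lipConst (hD0 z) (hD z hzS) (X z.1 z.2)
        have h1 := tested_gradient_le (g := f (gradNorm X z)) (K := K) hp hm hδ hε hz hN (hf _ hN).1
          (hf _ hN).2 (hζ.nonneg z) (hD0 z) (hG0 z) hY (hDG z hzS)
        have h2 : testedGradient p m f u X (negPow δ ε) (negPowDeriv δ ε) ζ z
            ≤ K * δ ^ (1 - p) * (G z * (u z + ε) ^ (p + m - 2 - δ)) := by
          rw [testedGradient, fluxFactor, negPow_of_nonneg hδ hε hz, negPowDeriv,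
            abs_of_nonneg hz]
          exact h1
        have h3 : -(negPowPrim δ ε (u z) * deriv (fun s ↦ ζ (z.1, s)) z.2)
            ≤ 2 * (T z * u z ^ (1 - δ)) := by
          have h4 := negPowPrim_nonneg hδ hε hz
          calc _ = negPowPrim δ ε (u z) * -deriv (fun s ↦ ζ (z.1, s)) z.2 := by ring
            _ ≤ negPowPrim δ ε (u z) * T z := mul_le_mul_of_nonneg_left (hT z hzS) h4
            _ ≤ 2 * u z ^ (1 - δ) * T z :=
                mul_le_mul_of_nonneg_right (negPowPrim_le hδ hε hδ2 hz) (hT0 z)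
            _ = _ := by ring
        have h5 : (u z + ε) ^ (p + m - 2 - δ)
            ≤ 2 ^ (p + m - 2) * (u z ^ (p + m - 2 - δ) + ε ^ (p + m - 2 - δ)) := by
          refine (add_rpow_le_two_rpow_mul hz hε.le (by linarith)).trans ?_
          refine mul_le_mul_of_nonneg_right ?_
            (add_nonneg (Real.rpow_nonneg hz _) (Real.rpow_nonneg hε.le _))
          exact Real.rpow_le_rpow_of_exponent_le (by norm_num) (by linarith)
        have h6 : K * δ ^ (1 - p) * (G z * (u z + ε) ^ (p + m - 2 - δ))
            ≤ K * δ ^ (1 - p) * 2 ^ (p + m - 2) * (G z * u z ^ (p + m - 2 - δ)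
              + ε ^ (p + m - 2 - δ) * G z) := by
          have h7 : 0 ≤ K * δ ^ (1 - p) := mul_nonneg hK (Real.rpow_nonneg hδ.le _)
          calc _ ≤ K * δ ^ (1 - p) * (G z * (2 ^ (p + m - 2) * (u z ^ (p + m - 2 - δ)
                + ε ^ (p + m - 2 - δ)))) :=
                mul_le_mul_of_nonneg_left (mul_le_mul_of_nonneg_left h5 (hG0 z)) h7
            _ = _ := by ring
        have h8 : 0 ≤ G z * u z ^ (p + m - 2 - δ) := mul_nonneg (hG0 z) (Real.rpow_nonneg hz _)
        have h9 : 0 ≤ ε ^ (p + m - 2 - δ) * G z := mul_nonneg (Real.rpow_nonneg hε.le _) (hG0 z)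
        have h10 : 0 ≤ K * δ ^ (1 - p) * 2 ^ (p + m - 2) :=
          mul_nonneg (mul_nonneg hK (Real.rpow_nonneg hδ.le _)) (by positivity)
        have h11 : 0 ≤ T z * u z ^ (1 - δ) := mul_nonneg (hT0 z) (Real.rpow_nonneg hz _)
        rw [← ENNReal.ofReal_mul (Real.rpow_nonneg hε.le _), ← ENNReal.ofReal_add h8 h9,
          ← ENNReal.ofReal_mul h10, show (2 : ℝ≥0∞) = ENNReal.ofReal 2 by simp,
          ← ENNReal.ofReal_mul (by norm_num), ← ENNReal.ofReal_add
            (mul_nonneg h10 (add_nonneg h8 h9)) (by positivity)]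
        refine ENNReal.ofReal_le_ofReal ?_
        linarith
    _ = _ := by
        rw [lintegral_add_right' _ (hTu.const_mul 2), lintegral_const_mul'' _ hTu,
          lintegral_const_mul' _ _ ENNReal.ofReal_ne_top, lintegral_add_left' hGu,
          lintegral_const_mul' _ _ ENNReal.ofReal_ne_top]

/-- The reaction term is controlled by lower powers of `u` on the support of the derivatives of
the test function. -/
theorem IsWeakSolutionWith.lintegral_reaction_le (hδq : δ < q)
    (hHm : AEMeasurable (fun z : M × ℝ ↦ H z.1) (spaceTimeMeasure n a))
    (hGfin : ∫⁻ z, ENNReal.ofReal (G z) ∂(spaceTimeMeasure n a) ≠ ⊤) :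
    ∫⁻ z, ENNReal.ofReal (ζ z * (H z.1 * u z ^ (q - δ))) ∂(spaceTimeMeasure n a)
      ≤ ENNReal.ofReal (K * δ ^ (1 - p) * 2 ^ (p + m - 2))
          * ∫⁻ z, ENNReal.ofReal (G z * u z ^ (p + m - 2 - δ)) ∂(spaceTimeMeasure n a)
        + 2 * ∫⁻ z, ENNReal.ofReal (T z * u z ^ (1 - δ)) ∂(spaceTimeMeasure n a) := by
  have hu := h.ae_nonneg ha
  have hum := h.aemeasurable ha
  have key := fun j : ℕ ↦ h.lintegral_regularized_le hp hm hf_meas hf ha hpos hVH hH hδ hδ2 hδk hζ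
    hD0 hG0 hT0 hD hDG hT hGm hTm (Nat.one_div_pos_of_nat (α := ℝ) (n := j))
  set ρ := spaceTimeMeasure (M := M) n a with hρ
  -- Along ε = 1/(j+1) the remainder vanishes, since k - δ > 0 and G is integrable; Fatou handles
  -- the left-hand side.
  have hlim : Tendsto (fun j : ℕ ↦ ENNReal.ofReal (K * δ ^ (1 - p) * 2 ^ (p + m - 2))
      * (∫⁻ z, ENNReal.ofReal (G z * u z ^ (p + m - 2 - δ)) ∂ρ
        + ENNReal.ofReal ((1 / ((j : ℝ) + 1)) ^ (p + m - 2 - δ)) * ∫⁻ z, ENNReal.ofReal (G z) ∂ρ)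
      + 2 * ∫⁻ z, ENNReal.ofReal (T z * u z ^ (1 - δ)) ∂ρ) atTop
      (𝓝 (ENNReal.ofReal (K * δ ^ (1 - p) * 2 ^ (p + m - 2))
      * (∫⁻ z, ENNReal.ofReal (G z * u z ^ (p + m - 2 - δ)) ∂ρ
        + ENNReal.ofReal (0 ^ (p + m - 2 - δ)) * ∫⁻ z, ENNReal.ofReal (G z) ∂ρ)
      + 2 * ∫⁻ z, ENNReal.ofReal (T z * u z ^ (1 - δ)) ∂ρ)) := by
    refine Tendsto.add_const _ (ENNReal.Tendsto.const_mul (Tendsto.const_add _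
      (ENNReal.Tendsto.mul_const (ENNReal.tendsto_ofReal ?_) (Or.inr hGfin)))
      (Or.inr ENNReal.ofReal_ne_top))
    exact tendsto_one_div_add_atTop_nhds_zero_nat.rpow_const (Or.inr (by linarith))
  rw [Real.zero_rpow (by linarith), ENNReal.ofReal_zero, zero_mul, add_zero] at hlim
  calc ∫⁻ z, ENNReal.ofReal (ζ z * (H z.1 * u z ^ (q - δ))) ∂ρ
      = ∫⁻ z, liminf (fun j : ℕ ↦ ENNReal.ofReal (ζ z * (H z.1 * (u z ^ q
          * (u z + 1 / ((j : ℝ) + 1)) ^ (-δ))))) atTop ∂ρ := by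
        refine lintegral_congr_ae ?_
        filter_upwards [hu] with z hz
        refine (Tendsto.liminf_eq ?_).symm
        exact ENNReal.tendsto_ofReal (((tendsto_mul_rpow_neg hz hδ hδq).const_mul _).const_mul _)
    _ ≤ liminf (fun j : ℕ ↦ ∫⁻ z, ENNReal.ofReal (ζ z * (H z.1 * (u z ^ q
          * (u z + 1 / ((j : ℝ) + 1)) ^ (-δ)))) ∂ρ) atTop := by
        refine lintegral_liminf_le' fun j ↦ ?_
        exact (hζ.lip.continuous.measurable.aemeasurable.mul (hHm.mul ((hum.pow_const _).mul
          ((hum.add_const _).pow_const _)))).ennreal_ofReal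
    _ ≤ _ := liminf_le_liminf (Eventually.of_forall key)
    _ = _ := hlim.liminf_eq

end

end Estimate

/-! ### Pointwise Lipschitz constants. -/

section LipConst

variable {X : Type*} [PseudoMetricSpace X]

theorem eventually_abs_sub_le_of_hasDerivAt {g : ℝ → ℝ} {g' v L : ℝ} (hg : HasDerivAt g g' v)
    (hL : |g'| < L) : ∀ᶠ y in 𝓝 v, |g y - g v| ≤ L * |y - v| := by
  have h1 := hg.isLittleO.bound (sub_pos.2 hL)
  filter_upwards [h1] with y hy
  rw [Real.norm_eq_abs, Real.norm_eq_abs, smul_eq_mul] at hy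
  calc |g y - g v| = |(g y - g v - (y - v) * g') + (y - v) * g'| := by ring_nf
    _ ≤ (L - |g'|) * |y - v| + |y - v| * |g'| := by
        refine (abs_add_le _ _).trans ?_
        rw [abs_mul (y - v)]
        gcongr
    _ = _ := by ring

theorem LipConstAtLE.comp_hasDerivAt {g : X → ℝ} {x : X} {ℓ : ℝ} (hg : LipConstAtLE g x ℓ)
    (hgc : ContinuousAt g x) {Θ : ℝ → ℝ} {Θ' : ℝ} (hΘ : HasDerivAt Θ Θ' (g x)) :
    LipConstAtLE (fun y ↦ Θ (g y)) x (|Θ'| * ℓ) := fun L hL ↦ by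
  have h1 : Tendsto (fun η ↦ (|Θ'| + η) * (ℓ + η)) (𝓝[>] 0) (𝓝 ((|Θ'| + 0) * (ℓ + 0))) :=
    ((by fun_prop : Continuous fun η ↦ (|Θ'| + η) * (ℓ + η)).tendsto 0).mono_left
      nhdsWithin_le_nhds
  rw [add_zero, add_zero] at h1
  obtain ⟨η, hη, hη0⟩ := ((h1.eventually (gt_mem_nhds hL)).and self_mem_nhdsWithin).exists
  have hη0 : 0 < η := hη0
  have h2 := eventually_abs_sub_le_of_hasDerivAt hΘ (lt_add_of_pos_right |Θ'| hη0)
  filter_upwards [hg (ℓ + η) (lt_add_of_pos_right ℓ hη0), hgc.eventually h2] with y h3 h4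
  calc |Θ (g y) - Θ (g x)| ≤ (|Θ'| + η) * |g y - g x| := h4
    _ ≤ (|Θ'| + η) * ((ℓ + η) * dist y x) := by gcongr
    _ = ((|Θ'| + η) * (ℓ + η)) * dist y x := by ring
    _ ≤ L * dist y x := by gcongr

/-- For s > t monotonicity gives χ(s)Θ(s) ≥ χ(t)Θ(s), so the growth of χ contributes with the
favourable sign; no initial values of the solution enter. Where the product is not differentiable
its derivative is zero by convention. -/
theorem neg_deriv_mul_le {χ Θ : ℝ → ℝ} {t ℓ : ℝ} (hχ : Monotone χ) (hχ0 : 0 ≤ χ t)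
    (hΘ0 : ∀ s, 0 ≤ Θ s) (hℓ : 0 ≤ ℓ) (hΘ : LipConstAtLE Θ t ℓ) :
    -deriv (fun s ↦ χ s * Θ s) t ≤ χ t * ℓ := by
  by_cases hd : DifferentiableAt ℝ (fun s ↦ χ s * Θ s) t
  · have h1 : ∀ L > ℓ, -(χ t * L) ≤ deriv (fun s ↦ χ s * Θ s) t := fun L hL ↦ by
      have h2 := (hasDerivAt_iff_tendsto_slope.1 hd.hasDerivAt).mono_left
        (nhdsWithin_mono t (show Ioi t ⊆ {t}ᶜ from fun s hs ↦ ne_of_gt hs))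
      refine ge_of_tendsto h2 ?_
      filter_upwards [self_mem_nhdsWithin, nhdsWithin_le_nhds (hΘ L hL)] with s hs h3
      have hs : t < s := hs
      rw [slope_def_field, le_div_iff₀ (sub_pos.2 hs)]
      rw [Real.dist_eq, abs_of_pos (sub_pos.2 hs)] at h3
      have h4 := mul_le_mul_of_nonneg_left (neg_le_of_abs_le h3) hχ0
      have h5 := mul_le_mul_of_nonneg_right (hχ hs.le) (hΘ0 s)
      linarith
    have h2 : Tendsto (fun L ↦ -(χ t * L)) (𝓝[>] ℓ) (𝓝 (-(χ t * ℓ))) :=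
      ((by fun_prop : Continuous fun L ↦ -(χ t * L)).tendsto ℓ).mono_left nhdsWithin_le_nhds
    have h3 := le_of_tendsto h2 (by filter_upwards [self_mem_nhdsWithin] with L hL using h1 L hL)
    linarith
  · rw [deriv_zero_of_not_differentiableAt hd, neg_zero]
    exact mul_nonneg hχ0 hℓ

theorem _root_.LocallyLipschitz.comp_contDiffAt {X : Type*} [PseudoEMetricSpace X] {σ : X → ℝ}
    (hσ : LocallyLipschitz σ) {Θ : ℝ → ℝ} (hΘ : ∀ x, ContDiffAt ℝ 1 Θ (σ x)) :
    LocallyLipschitz fun x ↦ Θ (σ x) := fun x ↦ by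
  obtain ⟨K, t, ht, hK⟩ := (hΘ x).exists_lipschitzOnWith
  obtain ⟨K', s, hs, hK'⟩ := hσ x
  exact ⟨K * K', s ∩ σ ⁻¹' t, inter_mem hs (hσ.continuous.continuousAt ht),
    hK.comp (hK'.mono inter_subset_left) fun y hy ↦ hy.2⟩

end LipConst

/-! ### Logarithmic space-time cutoffs. -/

section Cutoff

/-- A logarithmic height. -/
def logHeight (c v : ℝ) : ℝ := Real.log (max v 1) / c

/-- The cutoff which is `1` below height `1` and `0` above height `2`. -/
def heightCutoff (y : ℝ) : ℝ := max 0 (2 - max 1 y)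

/-- The slope of the cutoff of the logarithmic height, where the height exceeds `b`. -/
def cutoffSlope (c b v : ℝ) : ℝ :=
  if 1 ≤ logHeight c v ∧ b ≤ logHeight c v ∧ logHeight c v ≤ 2 then 1 / (c * v) else 0

/-- The cutoff near the initial time. -/
def initialCutoff (j t : ℝ) : ℝ := max 0 (min 1 (j * t - 1))

theorem continuous_logHeight (c : ℝ) : Continuous (logHeight c) :=
  ((continuous_id.max continuous_const).log fun v ↦ by
    have := le_max_right v 1; exact ne_of_gt (by simp only [id]; linarith)).div_const c

theorem continuous_heightCutoff : Continuous heightCutoff := by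
  unfold heightCutoff; fun_prop

theorem heightCutoff_nonneg (y : ℝ) : 0 ≤ heightCutoff y := le_max_left _ _

theorem heightCutoff_le_one (y : ℝ) : heightCutoff y ≤ 1 :=
  max_le zero_le_one (by linarith [le_max_left 1 y])

theorem heightCutoff_of_le_one {y : ℝ} (hy : y ≤ 1) : heightCutoff y = 1 := by
  rw [heightCutoff, max_eq_left hy]; norm_num

theorem heightCutoff_of_two_le {y : ℝ} (hy : 2 ≤ y) : heightCutoff y = 0 := by
  rw [heightCutoff, max_eq_right (by linarith : (1 : ℝ) ≤ y), max_eq_left (by linarith)]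

theorem abs_heightCutoff_sub_le (y y' : ℝ) : |heightCutoff y - heightCutoff y'| ≤ |y - y'| := by
  have h1 := abs_max_sub_max_le_abs (2 - max 1 y) (2 - max 1 y') 0
  have h2 := abs_max_sub_max_le_abs y y' 1
  rw [heightCutoff, heightCutoff, max_comm 0, max_comm 0]
  refine h1.trans ?_
  rw [max_comm 1 y, max_comm 1 y']
  calc _ = |max y 1 - max y' 1| := by rw [← abs_neg]; ring_nf
    _ ≤ _ := h2

theorem one_lt_of_one_le_logHeight {c v : ℝ} (hc : 0 < c) (h : 1 ≤ logHeight c v) :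
    Real.exp c ≤ v ∧ 1 < v ∧ logHeight c v = Real.log v / c := by
  have h0 : (0 : ℝ) < max v 1 := lt_max_of_lt_right one_pos
  rw [logHeight, le_div_iff₀ hc, one_mul, Real.le_log_iff_exp_le h0] at h
  have h1 : 1 < Real.exp c := Real.one_lt_exp_iff.2 hc
  have h2 : 1 < v := by
    by_contra h'
    rw [max_eq_right (not_lt.1 h')] at h
    linarith
  rw [max_eq_left h2.le] at h
  exact ⟨h, h2, by rw [logHeight, max_eq_left h2.le]⟩

theorem cutoffSlope_nonneg {c : ℝ} (hc : 0 < c) (b v : ℝ) : 0 ≤ cutoffSlope c b v := by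
  rw [cutoffSlope]
  split_ifs with h
  · have := (one_lt_of_one_le_logHeight hc h.1).2.1
    positivity
  · exact le_rfl

/-- Below max(1, b) and above 2 the cutoff is locally constant; in between, and at the ends of the
range, the logarithm has slope 1/(cv) and all truncations are contractions. -/
theorem lipConstAtLE_heightCutoff {X : Type*} [PseudoMetricSpace X] {ρ : X → ℝ}
    (hρ : LipschitzWith 1 ρ) {c : ℝ} (hc : 0 < c) (b : ℝ) (x : X) :
    LipConstAtLE (fun x ↦ heightCutoff (max (logHeight c (ρ x)) b)) x
      (cutoffSlope c b (ρ x)) := by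
  intro L hL
  have hL0 : 0 < L := (cutoffSlope_nonneg hc b (ρ x)).trans_lt hL
  have hcont : ContinuousAt (fun x ↦ logHeight c (ρ x)) x :=
    ((continuous_logHeight c).comp hρ.continuous).continuousAt
  rcases lt_or_ge (logHeight c (ρ x)) (max 1 b) with h1 | h1
  · filter_upwards [hcont.eventually (gt_mem_nhds h1)] with y hy
    have h2 : ∀ {Y : ℝ}, Y < max 1 b → heightCutoff (max Y b) = max 0 (2 - max 1 b) :=
      fun {Y} hY ↦ by
        rw [heightCutoff, max_left_comm, max_eq_right hY.le]
    rw [h2 hy, h2 h1, sub_self, abs_zero]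
    positivity
  rcases lt_or_ge 2 (logHeight c (ρ x)) with h2 | h2
  · filter_upwards [hcont.eventually (lt_mem_nhds h2)] with y hy
    rw [heightCutoff_of_two_le (le_max_of_le_left (le_of_lt hy)),
      heightCutoff_of_two_le (le_max_of_le_left h2.le), sub_self, abs_zero]
    positivity
  · have h3 : 1 ≤ logHeight c (ρ x) := (le_max_left _ _).trans h1
    have h4 : b ≤ logHeight c (ρ x) := (le_max_right _ _).trans h1
    obtain ⟨-, hv, h5⟩ := one_lt_of_one_le_logHeight hc h3
    rw [cutoffSlope, if_pos ⟨h3, h4, h2⟩] at hL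
    have hv0 : 0 < ρ x := by linarith
    have h6 : |(ρ x)⁻¹ / c| < L := by
      rw [abs_of_pos (by positivity)]
      refine lt_of_eq_of_lt ?_ hL
      field_simp
    have h7 := eventually_abs_sub_le_of_hasDerivAt ((Real.hasDerivAt_log hv0.ne').div_const c) h6
    filter_upwards [hρ.continuous.continuousAt.eventually h7,
      hρ.continuous.continuousAt.eventually (lt_mem_nhds hv)] with y hy hy1
    refine (abs_heightCutoff_sub_le _ _).trans ((abs_max_sub_max_le_abs _ _ _).trans ?_)
    rw [h5, logHeight, max_eq_left hy1.le]
    refine hy.trans (mul_le_mul_of_nonneg_left ?_ hL0.le)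
    have := hρ.dist_le_mul y x
    rwa [Real.dist_eq, NNReal.coe_one, one_mul] at this

theorem monotone_initialCutoff {j : ℝ} (hj : 0 ≤ j) : Monotone (initialCutoff j) := fun s t h ↦ by
  unfold initialCutoff
  gcongr

theorem initialCutoff_nonneg (j t : ℝ) : 0 ≤ initialCutoff j t := le_max_left _ _

theorem initialCutoff_le_one (j t : ℝ) : initialCutoff j t ≤ 1 :=
  max_le zero_le_one (min_le_left _ _)

variable {M : Type*} [MetricSpace M]

/-- The height function of the space-time cutoff. -/
def stHeight (x₀ : M) (θ j : ℝ) (z : M × ℝ) : ℝ :=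
  max (logHeight j (dist x₀ z.1)) (logHeight (θ * j) z.2)

/-- The space-time cutoff. -/
def stCutoff (x₀ : M) (θ j : ℝ) (s : ℕ) (z : M × ℝ) : ℝ :=
  initialCutoff j z.2 * heightCutoff (stHeight x₀ θ j z) ^ s

/-- The size of the spatial derivative of the height cutoff. -/
def spSlope (x₀ : M) (θ j : ℝ) (z : M × ℝ) : ℝ :=
  cutoffSlope j (logHeight (θ * j) z.2) (dist x₀ z.1)

/-- The size of the time derivative of the height cutoff. -/
def tmSlope (x₀ : M) (θ j : ℝ) (z : M × ℝ) : ℝ :=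
  cutoffSlope (θ * j) (logHeight j (dist x₀ z.1)) z.2

theorem continuous_stHeight (x₀ : M) (θ j : ℝ) : Continuous (stHeight x₀ θ j) :=
  ((continuous_logHeight _).comp (by fun_prop)).max ((continuous_logHeight _).comp continuous_snd)

theorem measurable_cutoffSlope {X : Type*} [MeasurableSpace X] {c : ℝ} {b v : X → ℝ}
    (hb : Measurable b) (hv : Measurable v) : Measurable fun x ↦ cutoffSlope c (b x) (v x) := by
  have h1 : Measurable fun x ↦ logHeight c (v x) := (continuous_logHeight c).measurable.comp hv
  refine Measurable.ite ?_ ((hv.const_mul c).const_div 1) measurable_const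
  exact (measurableSet_le measurable_const h1).inter
    ((measurableSet_le hb h1).inter (measurableSet_le h1 measurable_const))

theorem stCutoff_nonneg (x₀ : M) (θ j : ℝ) (s : ℕ) (z : M × ℝ) : 0 ≤ stCutoff x₀ θ j s z :=
  mul_nonneg (initialCutoff_nonneg _ _) (pow_nonneg (heightCutoff_nonneg _) _)

theorem stCutoff_le_one (x₀ : M) (θ j : ℝ) (s : ℕ) (z : M × ℝ) : stCutoff x₀ θ j s z ≤ 1 :=
  mul_le_one₀ (initialCutoff_le_one _ _) (pow_nonneg (heightCutoff_nonneg _) _)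
    (pow_le_one₀ (heightCutoff_nonneg _) (heightCutoff_le_one _))

theorem locallyLipschitz_logHeight {X : Type*} [PseudoEMetricSpace X] {v : X → ℝ}
    (hv : LocallyLipschitz v) (c : ℝ) : LocallyLipschitz fun x ↦ logHeight c (v x) :=
  (hv.max_const 1).comp_contDiffAt (Θ := fun y ↦ Real.log y / c) fun x ↦
    (contDiffAt_id.log (by
      have := le_max_right (v x) 1; exact ne_of_gt (by simp only [id]; linarith))).div_const c

theorem locallyLipschitz_stCutoff (x₀ : M) (θ j : ℝ) (s : ℕ) :
    LocallyLipschitz (stCutoff x₀ θ j s) := by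
  have h1 : LocallyLipschitz fun z : M × ℝ ↦ dist x₀ z.1 :=
    ((LipschitzWith.dist_right x₀).comp LipschitzWith.prod_fst).locallyLipschitz
  have h2 : LocallyLipschitz fun z : M × ℝ ↦ z.2 := LipschitzWith.prod_snd.locallyLipschitz
  have h3 : LocallyLipschitz (stHeight x₀ θ j) :=
    (locallyLipschitz_logHeight h1 j).max (locallyLipschitz_logHeight h2 (θ * j))
  have h4 : LocallyLipschitz fun z ↦ heightCutoff (stHeight x₀ θ j z) := by
    have h5 : LipschitzWith 1 heightCutoff := LipschitzWith.of_dist_le_mul fun y y' ↦ by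
      rw [NNReal.coe_one, one_mul]; exact abs_heightCutoff_sub_le y y'
    exact h5.locallyLipschitz.comp h3
  have h6 : LocallyLipschitz fun z : M × ℝ ↦ initialCutoff j z.2 := by
    have h7 : LocallyLipschitz fun z : M × ℝ ↦ j * z.2 - 1 :=
      h2.comp_contDiffAt (Θ := fun t ↦ j * t - 1) fun _ ↦ by fun_prop
    exact (h7.const_min 1).const_max 0
  exact LocallyLipschitz.mul_real h6 (h4.comp_contDiffAt (Θ := fun y ↦ y ^ s) fun _ ↦ by fun_prop)

theorem two_le_logHeight {c v : ℝ} (hc : 0 < c) (hv : Real.exp (2 * c) ≤ v) :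
    2 ≤ logHeight c v := by
  rw [logHeight, le_div_iff₀ hc, Real.le_log_iff_exp_le (lt_max_of_lt_right one_pos)]
  exact le_max_of_le_left hv

/-- The support lies in a closed ball times the interval [1/j, e^(2θj)], compact because the space
is proper. -/
theorem isTestFunction_stCutoff [ProperSpace M] (x₀ : M) {θ j : ℝ} (hθ : 0 < θ) (hj : 0 < j) {s : ℕ}
    (hs : s ≠ 0) : IsTestFunction (stCutoff x₀ θ j s) := by
  have hsub : tsupport (stCutoff x₀ θ j s)
      ⊆ Metric.closedBall x₀ (Real.exp (2 * j)) ×ˢ Icc (1 / j) (Real.exp (2 * (θ * j))) := by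
    refine closure_minimal (fun z hz ↦ ?_) (Metric.isClosed_closedBall.prod isClosed_Icc)
    have h1 : ¬ 2 ≤ stHeight x₀ θ j z := fun h ↦ hz (by
      rw [stCutoff, heightCutoff_of_two_le h, zero_pow hs, mul_zero])
    refine ⟨?_, ?_, ?_⟩
    · rw [Metric.mem_closedBall, dist_comm]
      by_contra h
      exact h1 (le_max_of_le_left (two_le_logHeight hj (not_le.1 h).le))
    · by_contra h
      refine hz ?_
      have h2 : j * z.2 - 1 ≤ 0 := by
        have := (not_le.1 h).le
        rw [le_div_iff₀ hj] at this
        linarith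
      rw [stCutoff, initialCutoff, max_eq_left ((min_le_right _ _).trans h2), zero_mul]
    · by_contra h
      exact h1 (le_max_of_le_right (two_le_logHeight (by positivity) (not_le.1 h).le))
  refine ⟨stCutoff_nonneg _ _ _ _, locallyLipschitz_stCutoff _ _ _ _,
    ((isCompact_closedBall _ _).prod isCompact_Icc).of_isClosed_subset (isClosed_tsupport _) hsub,
    fun z hz ↦ ⟨mem_univ _, ?_⟩⟩
  exact lt_of_lt_of_le (by positivity) (hsub hz).2.1

/-- The size of the spatial derivative of the space-time cutoff. -/
theorem lipConstAtLE_stCutoff (x₀ : M) {θ j : ℝ} (hj : 0 < j) (s : ℕ) (z : M × ℝ) :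
    LipConstAtLE (fun x ↦ stCutoff x₀ θ j s (x, z.2)) z.1
      (initialCutoff j z.2 * heightCutoff (stHeight x₀ θ j z) ^ (s - 1)
        * (s * spSlope x₀ θ j z)) := by
  have h1 := lipConstAtLE_heightCutoff (LipschitzWith.dist_right x₀) hj
    (logHeight (θ * j) z.2) z.1
  have h2 := h1.comp_hasDerivAt ((continuous_heightCutoff.comp
    (((continuous_logHeight j).comp (by fun_prop)).max continuous_const)).continuousAt)
    (((hasDerivAt_pow s _).const_mul (initialCutoff j z.2)))
  refine fun L hL ↦ h2 L (lt_of_eq_of_lt ?_ hL)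
  rw [abs_of_nonneg (mul_nonneg (initialCutoff_nonneg _ _) (mul_nonneg (Nat.cast_nonneg _)
    (pow_nonneg (heightCutoff_nonneg _) _))), spSlope, stHeight]
  ring

/-- The size of the time derivative of the space-time cutoff, where it decreases. -/
theorem neg_deriv_stCutoff_le (x₀ : M) {θ j : ℝ} (hθ : 0 < θ) (hj : 0 < j) (s : ℕ) (z : M × ℝ) :
    -deriv (fun t ↦ stCutoff x₀ θ j s (z.1, t)) z.2
      ≤ initialCutoff j z.2 * heightCutoff (stHeight x₀ θ j z) ^ (s - 1)
        * (s * tmSlope x₀ θ j z) := by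
  have h1 := lipConstAtLE_heightCutoff (ρ := fun t : ℝ ↦ t) LipschitzWith.id (mul_pos hθ hj)
    (logHeight j (dist x₀ z.1)) z.2
  have h2 := h1.comp_hasDerivAt ((continuous_heightCutoff.comp
    ((continuous_logHeight _).max continuous_const)).continuousAt)
    (hasDerivAt_pow s _)
  have h3 := neg_deriv_mul_le (monotone_initialCutoff hj.le) (initialCutoff_nonneg j z.2)
    (fun t ↦ pow_nonneg (heightCutoff_nonneg _) s) (mul_nonneg (abs_nonneg _)
    (cutoffSlope_nonneg (mul_pos hθ hj) _ _)) h2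
  simp only [stCutoff, stHeight, max_comm (logHeight j _)]
  refine h3.trans (le_of_eq ?_)
  rw [abs_of_nonneg (mul_nonneg (Nat.cast_nonneg _) (pow_nonneg (heightCutoff_nonneg _) _)),
    tmSlope]
  ring

/-- Comparing powers of ψ, the inequality (s-1)r ≥ s(r-1+Γ) is exactly r ≤ s(1-Γ). A high power s of
the cutoff thus leaves the spare factor ζ^Γ needed for Hölder. -/
theorem mul_pow_rpow_le {χ ψ r Γ : ℝ} {s : ℕ} (hχ : 0 ≤ χ) (hχ1 : χ ≤ 1) (hψ : 0 ≤ ψ)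
    (hψ1 : ψ ≤ 1) (hr : 1 ≤ r) (hΓ : 0 ≤ Γ) (hΓ1 : Γ ≤ 1) (hs : 2 ≤ s) (hsr : r ≤ s * (1 - Γ)) :
    (χ * ψ ^ (s - 1)) ^ r ≤ (χ * ψ ^ s) ^ (r - 1) * (χ * ψ ^ s) ^ Γ := by
  have hz : 0 ≤ χ * ψ ^ s := by positivity
  rw [← Real.rpow_add_of_nonneg hz (by linarith) hΓ]
  rcases (mul_nonneg hχ hψ).eq_or_lt with h | h
  · have h1 : χ * ψ ^ (s - 1) = 0 := by
      rcases mul_eq_zero.1 h.symm with h | h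
      · rw [h, zero_mul]
      · rw [h, zero_pow (by omega), mul_zero]
    rw [h1, Real.zero_rpow (by linarith)]
    positivity
  · have hχ0 : 0 < χ := hχ.lt_of_ne fun h' ↦ by rw [← h', zero_mul] at h; exact lt_irrefl _ h
    have hψ0 : 0 < ψ := hψ.lt_of_ne fun h' ↦ by rw [← h', mul_zero] at h; exact lt_irrefl _ h
    rw [Real.mul_rpow hχ (by positivity), Real.mul_rpow hχ (by positivity),
      ← Real.rpow_natCast_mul hψ, ← Real.rpow_natCast_mul hψ]
    refine mul_le_mul (Real.rpow_le_rpow_of_exponent_ge hχ0 hχ1 (by linarith))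
      (Real.rpow_le_rpow_of_exponent_ge hψ0 hψ1 ?_) (by positivity) (by positivity)
    rw [Nat.cast_sub (by omega), Nat.cast_one]
    nlinarith

end Cutoff

/-! ### Integrals over logarithmic shells. -/

section Shells

/-- The condition `hr` makes the decay of the slope beat the growth of the shell's measure in i, so
a bound in j alone remains; (i+1)^β costs only 3^β j^β. -/
theorem shell_term_le {β σ θ τ r A C E : ℝ} {i j : ℕ} (hβ : 0 ≤ β) (hA : 0 ≤ A) (hC : 0 ≤ C)
    (hE : 0 ≤ E) (hj : 1 ≤ j) (hi : i ≤ 2 * j) (hr : σ + θ ≤ τ * (r * (1 + β))) :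
    E * (A * (Real.exp (-(τ * i)) / j) ^ r) ^ (1 + β)
        * (C * Real.exp (σ * (i + 1)) * ((i : ℝ) + 1) ^ β) * Real.exp (θ * (i + 1))
      ≤ E * A ^ (1 + β) * C * Real.exp (σ + θ) * 3 ^ β * (j : ℝ) ^ (β - r * (1 + β)) := by
  have hj0 : (0 : ℝ) < j := by exact_mod_cast hj
  have h1 : (A * (Real.exp (-(τ * i)) / j) ^ r) ^ (1 + β)
      = A ^ (1 + β) * (Real.exp (-(τ * (r * (1 + β)) * i)) * (j : ℝ) ^ (-(r * (1 + β)))) := by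
    rw [Real.mul_rpow hA (by positivity), ← Real.rpow_mul (by positivity),
      Real.div_rpow (Real.exp_pos _).le hj0.le, ← Real.exp_mul, div_eq_mul_inv,
      ← Real.rpow_neg hj0.le]
    ring_nf
  have h2 : ((i : ℝ) + 1) ^ β ≤ 3 ^ β * (j : ℝ) ^ β := by
    rw [← Real.mul_rpow (by norm_num) hj0.le]
    refine Real.rpow_le_rpow (by positivity) ?_ hβ
    have : (i : ℝ) ≤ 2 * j := by exact_mod_cast hi
    have : (1 : ℝ) ≤ j := by exact_mod_cast hj
    linarith
  have h3 : Real.exp (-(τ * (r * (1 + β)) * i)) * Real.exp (σ * (i + 1)) * Real.exp (θ * (i + 1))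
      ≤ Real.exp (σ + θ) := by
    rw [← Real.exp_add, ← Real.exp_add]
    refine Real.exp_le_exp.2 ?_
    have := mul_le_mul_of_nonneg_right hr (Nat.cast_nonneg (α := ℝ) i)
    nlinarith
  have h4 : (j : ℝ) ^ (β - r * (1 + β)) = (j : ℝ) ^ β * (j : ℝ) ^ (-(r * (1 + β))) := by
    rw [← Real.rpow_add hj0]; ring_nf
  rw [h1, h4]
  calc _ = E * A ^ (1 + β) * C * (Real.exp (-(τ * (r * (1 + β)) * i)) * Real.exp (σ * (i + 1))
        * Real.exp (θ * (i + 1))) * ((i : ℝ) + 1) ^ β * (j : ℝ) ^ (-(r * (1 + β))) := by ring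
    _ ≤ E * A ^ (1 + β) * C * Real.exp (σ + θ) * (3 ^ β * (j : ℝ) ^ β)
        * (j : ℝ) ^ (-(r * (1 + β))) := by gcongr
    _ = _ := by ring

variable {M : Type*} [MetricSpace M] [MeasurableSpace M] [BorelSpace M] {μ : Measure M} [SFinite μ]
  {H : M → ℝ} (x₀ : M)

/-- The integral of a weight concentrated on the logarithmic shells. -/
theorem lintegral_shell_weight_le (hHm : AEMeasurable H μ) (hH : ∀ᵐ x ∂μ, 0 < H x)
    {β σ θ τ r A C N Γ : ℝ} {j : ℕ} (hβ : 0 ≤ β) (hA : 0 ≤ A) (hC : 0 ≤ C) (hj : 1 ≤ j)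
    (hN : 0 ≤ N) (hr : σ + θ ≤ τ * (r * (1 + β)))
    (hΓ : Γ ≤ β / (1 + β)) (hΓ' : β / (1 + β) ≤ Γ + 1 / j)
    (hHle : ∀ᵐ x ∂μ, dist x₀ x < Real.exp (2 * j + 1) → H x ≤ Real.exp (N * j))
    (hball : ∀ i : ℕ, j ≤ i → ∫⁻ x in Metric.ball x₀ (Real.exp (i + 1)),
      ENNReal.ofReal (H x ^ (-β)) ∂μ
        ≤ ENNReal.ofReal (C * Real.exp (σ * (i + 1)) * ((i : ℝ) + 1) ^ β))
    {g : M × ℝ → ℝ} (hg : ∀ z, 0 < z.2 → g z = 0 ∨ ∃ i : ℕ, j ≤ i ∧ i ≤ 2 * j ∧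
      dist x₀ z.1 < Real.exp (i + 1) ∧ z.2 ≤ Real.exp (θ * (i + 1)) ∧
      Real.exp (-(N * j)) ≤ g z ∧ g z ≤ A * (Real.exp (-(τ * i)) / j) ^ r) :
    ∫⁻ z in spaceTime M, ENNReal.ofReal (g z ^ (1 / (1 - Γ)) * H z.1 ^ (-(Γ / (1 - Γ))))
        ∂(μ.prod volume)
      ≤ ENNReal.ofReal (2 * (Real.exp (2 * N * (1 + β) ^ 2) * A ^ (1 + β) * C * Real.exp (σ + θ)
        * 3 ^ β) * (j : ℝ) ^ (1 + β - r * (1 + β))) := by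
  have hj0 : (0 : ℝ) < j := by exact_mod_cast hj
  have hΓ1 : 0 < 1 - Γ := by
    have : β / (1 + β) < 1 := by rw [div_lt_one (by linarith)]; linarith
    linarith
  set E := Real.exp (2 * N * (1 + β) ^ 2) with hE
  have hE0 : 0 ≤ E := (Real.exp_pos _).le
  set c : ℕ → ℝ := fun i ↦ E * (A * (Real.exp (-(τ * i)) / j) ^ r) ^ (1 + β) with hc
  set F : M → ℝ≥0∞ := fun x ↦ ENNReal.ofReal (H x ^ (-β)) with hF
  have hFm : AEMeasurable F μ := (hHm.pow_const _).ennreal_ofReal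
  set B : ℕ → Set M := fun i ↦ Metric.ball x₀ (Real.exp (i + 1)) with hB
  set J : ℕ → Set ℝ := fun i ↦ Ioc 0 (Real.exp (θ * (i + 1))) with hJ
  have hFi : ∀ i, AEMeasurable ((B i).indicator F) μ := fun i ↦
    hFm.indicator Metric.isOpen_ball.measurableSet
  have hJi : ∀ i, Measurable ((J i).indicator (1 : ℝ → ℝ≥0∞)) := fun i ↦
    measurable_one.indicator measurableSet_Ioc
  have hcm : ∀ i, AEMeasurable (fun z : M × ℝ ↦ ENNReal.ofReal (c i)
      * ((B i).indicator F z.1 * (J i).indicator 1 z.2)) (μ.prod volume) := fun i ↦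
    (((hFi i).comp_quasiMeasurePreserving Measure.quasiMeasurePreserving_fst).mul
      ((hJi i).comp measurable_snd).aemeasurable).const_mul _
  -- Each point with nonzero weight satisfies the bounds of some index i; summing over all indices
  -- avoids choosing i measurably.
  calc _ ≤ ∫⁻ z in spaceTime M, ∑ i ∈ Finset.Icc j (2 * j), ENNReal.ofReal (c i)
          * ((B i).indicator F z.1 * (J i).indicator 1 z.2) ∂(μ.prod volume) := by
        refine lintegral_mono_ae ?_
        have hS : MeasurableSet (spaceTime M) := MeasurableSet.univ.prod measurableSet_Ioi
        filter_upwards [ae_restrict_of_ae (Measure.quasiMeasurePreserving_fst.ae hH),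
          ae_restrict_of_ae (Measure.quasiMeasurePreserving_fst.ae hHle),
          ae_restrict_mem hS] with z hz1 hz2 hzS
        rcases hg z hzS.2 with h0 | ⟨i, hi1, hi2, h1, h2, h3, h4⟩
        · rw [h0, Real.zero_rpow (by positivity), zero_mul, ENNReal.ofReal_zero]
          exact zero_le
        · have h5 : dist x₀ z.1 < Real.exp (2 * j + 1) := by
            refine h1.trans_le (Real.exp_le_exp.2 ?_)
            have : (i : ℝ) ≤ 2 * j := by exact_mod_cast hi2
            linarith
          have h6 := rpow_mul_rpow_neg_le hβ hj0 hN hΓ hΓ' h3 hz1 (hz2 h5)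
          have hg0 : 0 ≤ g z := (Real.exp_pos _).le.trans h3
          have h7 : g z ^ (1 / (1 - Γ)) * H z.1 ^ (-(Γ / (1 - Γ))) ≤ c i * H z.1 ^ (-β) := by
            refine h6.trans ?_
            simp only [hc]
            rw [mul_assoc E]
            refine mul_le_mul_of_nonneg_left ?_ hE0
            refine mul_le_mul_of_nonneg_right ?_ (Real.rpow_nonneg hz1.le _)
            exact Real.rpow_le_rpow hg0 h4 (by linarith)
          refine (ENNReal.ofReal_le_ofReal h7).trans ?_
          have h8 : 0 ≤ c i := by simp only [hc]; positivity
          have h9 : z.1 ∈ B i := by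
            rw [hB, Metric.mem_ball, dist_comm]; exact h1
          have h10 : z.2 ∈ J i := ⟨hzS.2, h2⟩
          refine le_trans (le_of_eq ?_) (Finset.single_le_sum (f := fun i ↦ ENNReal.ofReal (c i)
            * ((B i).indicator F z.1 * (J i).indicator 1 z.2)) (fun _ _ ↦ zero_le)
            (Finset.mem_Icc.2 ⟨hi1, hi2⟩))
          rw [indicator_of_mem h9, indicator_of_mem h10, Pi.one_apply, mul_one,
            ENNReal.ofReal_mul h8]
    _ ≤ ∫⁻ z, ∑ i ∈ Finset.Icc j (2 * j), ENNReal.ofReal (c i)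
          * ((B i).indicator F z.1 * (J i).indicator 1 z.2) ∂(μ.prod volume) :=
        setLIntegral_le_lintegral _ _
    _ = ∑ i ∈ Finset.Icc j (2 * j), ENNReal.ofReal (c i)
          * ((∫⁻ x in B i, F x ∂μ) * ENNReal.ofReal (Real.exp (θ * (i + 1)))) := by
        rw [lintegral_finsetSum' _ fun i _ ↦ hcm i]
        refine Finset.sum_congr rfl fun i _ ↦ ?_
        rw [lintegral_const_mul' _ _ ENNReal.ofReal_ne_top,
          lintegral_prod_mul (hFi i) (hJi i).aemeasurable,
          lintegral_indicator Metric.isOpen_ball.measurableSet,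
          lintegral_indicator_one measurableSet_Ioc, Real.volume_Ioc, sub_zero]
    _ ≤ ∑ _i ∈ Finset.Icc j (2 * j), ENNReal.ofReal (E * A ^ (1 + β) * C * Real.exp (σ + θ)
          * 3 ^ β * (j : ℝ) ^ (β - r * (1 + β))) := by
        refine Finset.sum_le_sum fun i hi ↦ ?_
        rw [Finset.mem_Icc] at hi
        have h8 : 0 ≤ c i := by simp only [hc]; positivity
        calc _ ≤ ENNReal.ofReal (c i) * (ENNReal.ofReal (C * Real.exp (σ * (i + 1))
              * ((i : ℝ) + 1) ^ β) * ENNReal.ofReal (Real.exp (θ * (i + 1)))) := by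
              gcongr
              exact hball i hi.1
          _ = ENNReal.ofReal (c i * (C * Real.exp (σ * (i + 1)) * ((i : ℝ) + 1) ^ β)
              * Real.exp (θ * (i + 1))) := by
              rw [← ENNReal.ofReal_mul (by positivity), ← ENNReal.ofReal_mul h8, mul_assoc (c i)]
          _ ≤ _ := ENNReal.ofReal_le_ofReal (shell_term_le hβ hA hC hE0 hj hi.2 hr)
    _ ≤ _ := by
        rw [Finset.sum_const, Nat.card_Icc, nsmul_eq_mul, ← ENNReal.ofReal_natCast,
          ← ENNReal.ofReal_mul (Nat.cast_nonneg _)]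
        refine ENNReal.ofReal_le_ofReal ?_
        -- There are j + 1 shells, at most 2j.
        have h1 : ((2 * j + 1 - j : ℕ) : ℝ) ≤ 2 * j := by
          exact_mod_cast (by omega : 2 * j + 1 - j ≤ 2 * j)
        have h2 : (j : ℝ) ^ (1 + β - r * (1 + β)) = j * (j : ℝ) ^ (β - r * (1 + β)) := by
          rw [add_sub_assoc, Real.rpow_add hj0, Real.rpow_one]
        rw [h2]
        calc _ ≤ 2 * j * (E * A ^ (1 + β) * C * Real.exp (σ + θ) * 3 ^ β
              * (j : ℝ) ^ (β - r * (1 + β))) :=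
              mul_le_mul_of_nonneg_right h1 (by positivity)
          _ = _ := by ring

end Shells

/-! ### The weighted Hölder inequality. -/

section Holder

variable {Y : Type*} [MeasurableSpace Y] {ρ : Measure Y} {ζ g H u : Y → ℝ}

/-- The integrand is (ζ H u^Q)^Γ times g H^(-Γ), and Hölder is used with exponents 1/Γ and 1/(1-Γ).
Since g vanishes off E, the factor containing u is integrated over E only. -/
theorem lintegral_weighted_power_le (hζm : AEMeasurable ζ ρ) (hgm : AEMeasurable g ρ)
    (hHm : AEMeasurable H ρ) (hum : AEMeasurable u ρ) (hζ : ∀ z, 0 ≤ ζ z) (hg : ∀ z, 0 ≤ g z)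
    (hH : ∀ᵐ z ∂ρ, 0 < H z) (hu : ∀ᵐ z ∂ρ, 0 ≤ u z) {Γ Q e : ℝ} (hΓ : 0 ≤ Γ) (hΓ1 : Γ < 1)
    (he : Q * Γ = e) {E : Set Y} (hgE : ∀ z ∉ E, g z = 0) :
    ∫⁻ z, ENNReal.ofReal (ζ z ^ Γ * g z * u z ^ e) ∂ρ
      ≤ (∫⁻ z in E, ENNReal.ofReal (ζ z * (H z * u z ^ Q)) ∂ρ) ^ Γ
        * (∫⁻ z, ENNReal.ofReal (g z ^ (1 / (1 - Γ)) * H z ^ (-(Γ / (1 - Γ)))) ∂ρ) ^ (1 - Γ) := by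
  have h1Γ : 0 < 1 - Γ := by linarith
  calc _ = ∫⁻ z in E, ENNReal.ofReal (ζ z ^ Γ * g z * u z ^ e) ∂ρ := by
        refine (setLIntegral_eq_of_support_subset ?_).symm
        intro z hz
        by_contra hzE
        refine hz ?_
        simp only [hgE z hzE, mul_zero, zero_mul, ENNReal.ofReal_zero]
    _ = ∫⁻ z in E, ENNReal.ofReal (ζ z * (H z * u z ^ Q)) ^ Γ
        * ENNReal.ofReal (g z ^ (1 / (1 - Γ)) * H z ^ (-(Γ / (1 - Γ)))) ^ (1 - Γ) ∂ρ := by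
        refine lintegral_congr_ae ?_
        filter_upwards [ae_restrict_of_ae hH, ae_restrict_of_ae hu] with z hz hzu
        have h2 : 0 ≤ ζ z * (H z * u z ^ Q) :=
          mul_nonneg (hζ z) (mul_nonneg hz.le (Real.rpow_nonneg hzu _))
        have h3 : 0 ≤ g z ^ (1 / (1 - Γ)) * H z ^ (-(Γ / (1 - Γ))) :=
          mul_nonneg (Real.rpow_nonneg (hg z) _) (Real.rpow_nonneg hz.le _)
        rw [ENNReal.ofReal_rpow_of_nonneg h2 hΓ, ENNReal.ofReal_rpow_of_nonneg h3 h1Γ.le,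
          ← ENNReal.ofReal_mul (Real.rpow_nonneg h2 _)]
        congr 1
        rw [Real.mul_rpow (hζ z) (mul_nonneg hz.le (Real.rpow_nonneg hzu _)),
          Real.mul_rpow hz.le (Real.rpow_nonneg hzu _),
          Real.mul_rpow (Real.rpow_nonneg (hg z) _) (Real.rpow_nonneg hz.le _),
          ← Real.rpow_mul hzu, he, ← Real.rpow_mul (hg z), ← Real.rpow_mul hz.le,
          one_div_mul_cancel h1Γ.ne', Real.rpow_one, neg_mul, div_mul_cancel₀ _ h1Γ.ne',
          Real.rpow_neg hz.le]
        have := (Real.rpow_pos_of_pos hz Γ).ne'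
        field_simp
    _ ≤ _ := ENNReal.lintegral_mul_norm_pow_le
        (hζm.mul (hHm.mul (hum.pow_const _))).ennreal_ofReal.restrict
        ((hgm.pow_const _).mul (hHm.pow_const _)).ennreal_ofReal.restrict hΓ h1Γ.le (by ring)
    _ ≤ _ := mul_le_mul' le_rfl (ENNReal.rpow_le_rpow
        (lintegral_mono' Measure.restrict_le_self le_rfl) h1Γ.le)

end Holder

/-! ### Location and size of the slopes of the cutoffs. -/

section Slopes

theorem cutoffSlope_ne_zero {c b v : ℝ} (hc : 0 < c) (h : cutoffSlope c b v ≠ 0) :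
    1 < v ∧ c ≤ Real.log v ∧ Real.log v ≤ 2 * c ∧ b * c ≤ Real.log v ∧
      cutoffSlope c b v = 1 / (c * v) := by
  rw [cutoffSlope] at h ⊢
  split_ifs at h ⊢ with h1
  · obtain ⟨h2, h3, h4⟩ := h1
    obtain ⟨-, hv, h5⟩ := one_lt_of_one_le_logHeight hc h2
    rw [h5] at h2 h3 h4
    rw [le_div_iff₀ hc] at h2 h3
    rw [div_le_iff₀ hc] at h4
    exact ⟨hv, by linarith, h4, h3, rfl⟩
  · exact absurd rfl h

theorem cutoffSlope_le_one {c b v : ℝ} (hc : 1 ≤ c) : cutoffSlope c b v ≤ 1 := by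
  by_cases h : cutoffSlope c b v = 0
  · rw [h]; exact zero_le_one
  · obtain ⟨hv, -, -, -, h1⟩ := cutoffSlope_ne_zero (by linarith) h
    rw [h1, div_le_one (by nlinarith)]
    nlinarith

theorem le_exp_of_logHeight_mul_le {c d v L : ℝ} (hc : 0 < c)
    (h : logHeight c v * d ≤ L) : d * Real.log (max v 1) ≤ c * L ∧
      ∀ L', Real.log (max v 1) ≤ L' → v ≤ Real.exp L' := by
  have h0 : (0 : ℝ) < max v 1 := lt_max_of_lt_right one_pos
  refine ⟨?_, fun L' hL' ↦ ?_⟩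
  · rw [logHeight, div_mul_eq_mul_div, div_le_iff₀ hc] at h
    linarith
  · rw [Real.log_le_iff_le_exp h0] at hL'
    exact (le_max_left _ _).trans hL'

variable {M : Type*} [MetricSpace M] {x₀ : M} {θ : ℝ} {j : ℕ}

theorem one_le_stHeight_of_spSlope_ne_zero {z : M × ℝ}
    (h : spSlope x₀ θ j z ≠ 0) : 1 ≤ stHeight x₀ θ j z := by
  rw [spSlope, cutoffSlope] at h
  split_ifs at h with h1
  · exact le_max_of_le_left h1.1
  · exact absurd rfl h

theorem one_le_stHeight_of_tmSlope_ne_zero {z : M × ℝ}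
    (h : tmSlope x₀ θ j z ≠ 0) : 1 ≤ stHeight x₀ θ j z := by
  rw [tmSlope, cutoffSlope] at h
  split_ifs at h with h1
  · exact le_max_of_le_right h1.1
  · exact absurd rfl h

theorem natCast_le_exp (j : ℕ) : (j : ℝ) ≤ Real.exp j := by
  have := Real.add_one_le_exp (j : ℝ)
  linarith

/-- The spatial slope is concentrated on logarithmic shells. -/
theorem spSlope_shell (hθ : 0 < θ) (hj : 1 ≤ j) (z : M × ℝ) :
    spSlope x₀ θ j z = 0 ∨ ∃ i : ℕ, j ≤ i ∧ i ≤ 2 * j ∧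
      dist x₀ z.1 < Real.exp (i + 1) ∧ z.2 ≤ Real.exp (θ * (i + 1)) ∧
      Real.exp (-(3 * j)) ≤ spSlope x₀ θ j z ∧ spSlope x₀ θ j z ≤ Real.exp (-(1 * i)) / j := by
  refine or_iff_not_imp_left.2 fun h ↦ ?_
  have hj0 : (0 : ℝ) < j := by exact_mod_cast hj
  obtain ⟨hv, h1, h2, h3, h4⟩ := cutoffSlope_ne_zero hj0 h
  set r := dist x₀ z.1 with hr
  have hr0 : 0 < r := by linarith
  set L := Real.log r with hL
  have hL0 : 0 ≤ L := hj0.le.trans h1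
  have hrL : r = Real.exp L := (Real.exp_log hr0).symm
  have hiL := Nat.floor_le hL0
  have hLi := Nat.lt_floor_add_one L
  -- The shell index is ⌊log r⌋. A nonzero spatial slope forces log t ≤ θ log r, which bounds the
  -- time; r ≤ e^(2j) and j ≤ e^j give the lower bound.
  refine ⟨⌊L⌋₊, Nat.le_floor h1, ?_, ?_, ?_, ?_, ?_⟩
  · have : (⌊L⌋₊ : ℝ) ≤ (2 * j : ℕ) := by push_cast; linarith
    exact_mod_cast this
  · rw [hrL]; exact Real.exp_lt_exp.2 hLi
  · obtain ⟨h5, h6⟩ := le_exp_of_logHeight_mul_le (by positivity) h3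
    refine h6 _ ?_
    have h7 : j * Real.log (max z.2 1) ≤ j * (θ * L) := by linarith
    have h8 := le_of_mul_le_mul_left h7 hj0
    nlinarith
  · rw [spSlope, h4, hrL, Real.exp_neg, ← one_div]
    refine one_div_le_one_div_of_le (by positivity) ?_
    calc (j : ℝ) * Real.exp L ≤ Real.exp j * Real.exp (2 * j) := by
          gcongr
          exact natCast_le_exp j
      _ = _ := by rw [← Real.exp_add]; ring_nf
  · rw [spSlope, h4, hrL, one_mul, Real.exp_neg, div_eq_mul_inv, div_eq_mul_inv, one_mul, mul_inv,
      mul_comm]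
    gcongr

/-- The time slope is concentrated on logarithmic shells. -/
theorem tmSlope_shell (hθ : 0 < θ) (hj : 1 ≤ j) (z : M × ℝ) :
    tmSlope x₀ θ j z = 0 ∨ ∃ i : ℕ, j ≤ i ∧ i ≤ 2 * j ∧
      dist x₀ z.1 < Real.exp (i + 1) ∧ z.2 ≤ Real.exp (θ * (i + 1)) ∧
      Real.exp (-((1 + 3 * θ) * j)) ≤ tmSlope x₀ θ j z ∧
      tmSlope x₀ θ j z ≤ θ⁻¹ * (Real.exp (-(θ * i)) / j) := by
  refine or_iff_not_imp_left.2 fun h ↦ ?_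
  have hj0 : (0 : ℝ) < j := by exact_mod_cast hj
  have hj1 : (1 : ℝ) ≤ j := by exact_mod_cast hj
  obtain ⟨hv, h1, h2, h3, h4⟩ := cutoffSlope_ne_zero (mul_pos hθ hj0) h
  set t := z.2 with ht
  have ht0 : 0 < t := by linarith
  set L := Real.log t with hL
  have htL : t = Real.exp L := (Real.exp_log ht0).symm
  have hLθ : (j : ℝ) ≤ L / θ := by rw [le_div_iff₀ hθ]; linarith
  have hiL := Nat.floor_le (hj0.le.trans hLθ)
  have hLi := Nat.lt_floor_add_one (L / θ)
  have h9 : L = θ * (L / θ) := by field_simp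
  -- Here time decides the shell: i = ⌊log t / θ⌋, and log r ≤ log t / θ bounds the distance.
  refine ⟨⌊L / θ⌋₊, Nat.le_floor hLθ, ?_, ?_, ?_, ?_, ?_⟩
  · have h5 : L / θ ≤ 2 * j := by rw [div_le_iff₀ hθ]; linarith
    have : (⌊L / θ⌋₊ : ℝ) ≤ (2 * j : ℕ) := by push_cast; linarith
    exact_mod_cast this
  · obtain ⟨h5, h6⟩ := le_exp_of_logHeight_mul_le hj0 h3
    have h7 : j * (θ * Real.log (max (dist x₀ z.1) 1)) ≤ j * L := by linarith
    have h8 := le_of_mul_le_mul_left h7 hj0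
    have h10 : Real.log (max (dist x₀ z.1) 1) ≤ L / θ := by
      rw [le_div_iff₀ hθ]; linarith
    exact (h6 _ h10).trans_lt (Real.exp_lt_exp.2 hLi)
  · rw [htL]
    have h12 := mul_le_mul_of_nonneg_left hLi.le hθ.le
    exact Real.exp_le_exp.2 (by linarith)
  · rw [tmSlope, h4, htL, Real.exp_neg, ← one_div]
    refine one_div_le_one_div_of_le (by positivity) ?_
    have h11 : θ ≤ Real.exp (θ * j) := by
      have := Real.add_one_le_exp (θ * j)
      nlinarith
    calc θ * j * Real.exp L ≤ Real.exp (θ * j) * Real.exp j * Real.exp (2 * (θ * j)) := by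
          gcongr
          exact natCast_le_exp j
      _ = _ := by rw [← Real.exp_add, ← Real.exp_add]; ring_nf
  · have h12 : Real.exp (θ * ⌊L / θ⌋₊) ≤ Real.exp L := by
      conv_rhs => rw [h9]
      gcongr
    rw [tmSlope, h4, htL, Real.exp_neg, one_div, mul_inv, mul_inv, div_eq_mul_inv, mul_assoc,
      mul_comm (j : ℝ)⁻¹]
    gcongr

end Slopes

/-! ### Interpolation exponents and the resulting powers of j. -/

section Exponents

/-- The interpolation exponents of the Hölder inequality. -/
theorem interpolation_exponent {k q δ Q : ℝ} (hq : 1 < q) (hkq : k < q) (hδ : 0 < δ)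
    (hδk : δ < k) (hQ : q - δ ≤ Q) (hQ' : Q ≤ q) :
    0 < (k - δ) / Q ∧ (k - δ) / Q < 1 ∧ Q * ((k - δ) / Q) = k - δ ∧
    (k - δ) / Q ≤ k / (q - k) / (1 + k / (q - k)) ∧
    k / (q - k) / (1 + k / (q - k)) ≤ (k - δ) / Q + δ ∧
    1 ≤ (1 + k / (q - k)) * (1 - (k - δ) / Q) := by
  have hQ0 : 0 < Q := by linarith
  have hqk : 0 < q - k := by linarith
  have hq0 : 0 < q := by linarith
  have e1 : 1 + k / (q - k) = q / (q - k) := by field_simp; ring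
  have e2 : k / (q - k) / (1 + k / (q - k)) = k / q := by rw [e1]; field_simp
  have h1 : (k - δ) / Q ≤ k / q := by
    rw [div_le_div_iff₀ hQ0 hq0]
    nlinarith
  have h2 : k / q ≤ (k - δ) / Q + δ := by
    have h3 : (k - δ) / q ≤ (k - δ) / Q :=
      div_le_div_of_nonneg_left (by linarith) hQ0 hQ'
    have h4 : δ / q ≤ δ := div_le_self hδ.le hq.le
    have h5 : k / q = (k - δ) / q + δ / q := by rw [← add_div]; ring_nf
    linarith
  have h3 : k / q < 1 := (div_lt_one hq0).2 hkq
  refine ⟨div_pos (by linarith) hQ0, h1.trans_lt h3, by field_simp, e2 ▸ h1, e2 ▸ h2, ?_⟩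
  rw [e1]
  calc (1 : ℝ) = q / (q - k) * (1 - k / q) := by field_simp
    _ ≤ _ := by gcongr

/-- The exponent is (1+β)(1-r) ≤ 0, and multiplying by 1-Γ leaves at most 1-r because (1+β)(1-Γ) ≥
1. The maximum with 1 frees the constant from Γ. -/
theorem rpow_one_sub_le_of_le {I : ℝ≥0∞} {D β r Γ : ℝ} {j : ℕ} (hj : 1 ≤ j) (hD : 0 ≤ D)
    (hr : 1 ≤ r) (hΓ0 : 0 ≤ Γ) (hΓ1 : Γ < 1) (hβΓ : 1 ≤ (1 + β) * (1 - Γ))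
    (hI : I ≤ ENNReal.ofReal (D * (j : ℝ) ^ (1 + β - r * (1 + β)))) :
    I ^ (1 - Γ) ≤ ENNReal.ofReal (max D 1 * (j : ℝ) ^ (1 - r)) := by
  have hj0 : (0 : ℝ) < j := by exact_mod_cast hj
  have hj1 : (1 : ℝ) ≤ j := by exact_mod_cast hj
  have h1 : 0 ≤ 1 - Γ := by linarith
  refine (ENNReal.rpow_le_rpow hI h1).trans ?_
  rw [ENNReal.ofReal_rpow_of_nonneg (by positivity) h1]
  refine ENNReal.ofReal_le_ofReal ?_
  rw [Real.mul_rpow hD (by positivity), ← Real.rpow_mul hj0.le]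
  refine mul_le_mul ?_ (Real.rpow_le_rpow_of_exponent_le hj1 (by nlinarith)) (by positivity)
    (by positivity)
  calc D ^ (1 - Γ) ≤ (max D 1) ^ (1 - Γ) := Real.rpow_le_rpow hD (le_max_left _ _) h1
    _ ≤ (max D 1) ^ (1 : ℝ) :=
        Real.rpow_le_rpow_of_exponent_le (le_max_right _ _) (by linarith)
    _ = _ := Real.rpow_one _

end Exponents

/-! ### The basic estimate for the logarithmic cutoffs. -/

section KeyEstimate

variable {n : ℕ} {M : Type*} [MetricSpace M] [ProperSpace M]
    [ChartedSpace (EuclideanSpace ℝ (Fin n)) M] [IsManifold (𝓡 n) ∞ M]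
    [RiemannianBundle (fun x : M ↦ TangentSpace (𝓡 n) x)]
    [IsContMDiffRiemannianBundle (𝓡 n) ∞ (EuclideanSpace ℝ (Fin n))
      (fun x : M ↦ TangentSpace (𝓡 n) x)] [IsRiemannianManifold (𝓡 n) M]
    [MeasurableSpace M] [BorelSpace M]

instance sFinite_weightedVolume (a : M → ℝ) : SFinite (weightedVolume n a) := by
  unfold weightedVolume; infer_instance

theorem isLocallyFiniteMeasure_weightedVolume {a : M → ℝ} (ha : Continuous a) :
    IsLocallyFiniteMeasure (weightedVolume n a) :=
  IsLocallyFiniteMeasure.withDensity_ofReal ha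

theorem spaceTimeMeasure_lt_top {a : M → ℝ} (ha : Continuous a) {L : Set (M × ℝ)}
    (hL : IsCompact L) : spaceTimeMeasure n a L < ⊤ := by
  have := isLocallyFiniteMeasure_weightedVolume (n := n) ha
  exact (Measure.restrict_apply_le _ _).trans_lt hL.measure_lt_top

/-- The level set where the height of the cutoff is at least one. -/
def outerRegion (x₀ : M) (θ j : ℝ) : Set (M × ℝ) := {z | 1 ≤ stHeight x₀ θ j z}

theorem measurableSet_outerRegion (x₀ : M) (θ j : ℝ) : MeasurableSet (outerRegion x₀ θ j) :=
  (isClosed_le continuous_const (continuous_stHeight x₀ θ j)).measurableSet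

variable {p q m K : ℝ} {f : ℝ → ℝ} {a : M → ℝ} {V u : M × ℝ → ℝ}
    {X : ∀ x : M, ℝ → TangentSpace (𝓡 n) x} {w : M × ℝ → ℝ}

/-- The testing inequality for the logarithmic cutoffs, in terms of their slopes. -/
theorem IsWeakSolutionWith.lintegral_cutoff_le (h : IsWeakSolutionWith n p q m f a V u X w)
    (hp : 1 < p) (hm : 1 ≤ m)
    (hf_meas : Measurable f) (hf : ∀ s, 0 ≤ s → 0 ≤ f s ∧ f s ≤ K) (ha : LocallyLipschitz a)
    (hpos : ∀ᵐ x ∂(riemVolume n M), 0 < a x) {H : M → ℝ}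
    (hVH : ∀ᵐ z ∂(spaceTimeMeasure n a), H z.1 ≤ V z)
    (hH : ∀ᵐ z ∂(spaceTimeMeasure n a), 0 < H z.1)
    (hHm : AEMeasurable (fun z : M × ℝ ↦ H z.1) (spaceTimeMeasure n a))
    (x₀ : M) {θ : ℝ} (hθ : 0 < θ) {j : ℕ} (hj : 1 ≤ j) (hj2 : (1 : ℝ) / j ≤ 1 / 2)
    (hjk : (1 : ℝ) / j < p + m - 2) (hjq : (1 : ℝ) / j < q) {s : ℕ} (hs : 2 ≤ s)
    {Γ₁ Γ₂ : ℝ} (hΓ₁ : 0 < Γ₁) (hΓ₁' : Γ₁ < 1) (hs₁ : p ≤ s * (1 - Γ₁)) (hΓ₂ : 0 < Γ₂)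
    (hΓ₂' : Γ₂ < 1) (hs₂ : 1 ≤ s * (1 - Γ₂)) :
    ∫⁻ z, ENNReal.ofReal (stCutoff x₀ θ j s z * (H z.1 * u z ^ (q - 1 / j))) ∂(spaceTimeMeasure n a)
      ≤ ENNReal.ofReal (K * (1 / j : ℝ) ^ (1 - p) * 2 ^ (p + m - 2))
          * ∫⁻ z, ENNReal.ofReal (stCutoff x₀ θ j s z ^ Γ₁ * (s * spSlope x₀ θ j z) ^ p
            * u z ^ (p + m - 2 - 1 / j)) ∂(spaceTimeMeasure n a)
        + 2 * ∫⁻ z, ENNReal.ofReal (stCutoff x₀ θ j s z ^ Γ₂ * (s * tmSlope x₀ θ j z)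
            * u z ^ (1 - 1 / (j : ℝ))) ∂(spaceTimeMeasure n a) := by
  have hj0 : (0 : ℝ) < j := by exact_mod_cast hj
  have hj1 : (1 : ℝ) ≤ j := by exact_mod_cast hj
  have hζ : IsTestFunction (stCutoff x₀ θ j s) := isTestFunction_stCutoff x₀ hθ hj0 (by omega)
  have hζ0 := stCutoff_nonneg x₀ θ j s
  have hsp : ∀ z, 0 ≤ spSlope x₀ θ j z := fun z ↦ cutoffSlope_nonneg hj0 _ _
  have htm : ∀ z, 0 ≤ tmSlope x₀ θ j z := fun z ↦ cutoffSlope_nonneg (by positivity) _ _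
  have hζm := hζ.lip.continuous.measurable
  have hspm : Measurable (spSlope x₀ θ j) := measurable_cutoffSlope
    ((continuous_logHeight _).measurable.comp measurable_snd)
    (by fun_prop : Continuous fun z : M × ℝ ↦ dist x₀ z.1).measurable
  have htmm : Measurable (tmSlope x₀ θ j) := measurable_cutoffSlope
    ((continuous_logHeight _).measurable.comp
      (by fun_prop : Continuous fun z : M × ℝ ↦ dist x₀ z.1).measurable) measurable_snd
  have hχψ : ∀ z, 0 ≤ initialCutoff j z.2 * heightCutoff (stHeight x₀ θ j z) ^ (s - 1) := fun z ↦
    mul_nonneg (initialCutoff_nonneg _ _) (pow_nonneg (heightCutoff_nonneg _) _)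
  -- With δ = 1/j, D is the size of ∇ζ; G and T replace the excess powers of the cutoff by ζ^Γ₁ and
  -- ζ^Γ₂, the factors that Hölder will pair with u.
  refine h.lintegral_reaction_le hp hm hf_meas hf ha hpos hVH hH (by positivity) hj2 hjk hζ
    (D := fun z ↦ initialCutoff j z.2 * heightCutoff (stHeight x₀ θ j z) ^ (s - 1)
        * (s * spSlope x₀ θ j z)) (G := fun z ↦ stCutoff x₀ θ j s z ^ Γ₁
        * (s * spSlope x₀ θ j z) ^ p) (T := fun z ↦ stCutoff x₀ θ j s z ^ Γ₂
        * (s * tmSlope x₀ θ j z)) ?_ ?_ ?_ ?_ ?_ ?_ ?_ ?_ hjq hHm ?_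
  · exact fun z ↦ mul_nonneg (hχψ z) (mul_nonneg (Nat.cast_nonneg _) (hsp z))
  · exact fun z ↦ mul_nonneg (Real.rpow_nonneg (hζ0 z) _) (Real.rpow_nonneg
      (mul_nonneg (Nat.cast_nonneg _) (hsp z)) _)
  · exact fun z ↦ mul_nonneg (Real.rpow_nonneg (hζ0 z) _)
      (mul_nonneg (Nat.cast_nonneg _) (htm z))
  · exact fun z _ ↦ lipConstAtLE_stCutoff x₀ hj0 s z
  · intro z _
    rw [Real.mul_rpow (hχψ z) (mul_nonneg (Nat.cast_nonneg _) (hsp z)), ← mul_assoc]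
    exact mul_le_mul_of_nonneg_right (mul_pow_rpow_le (initialCutoff_nonneg _ _)
      (initialCutoff_le_one _ _) (heightCutoff_nonneg _) (heightCutoff_le_one _) hp.le hΓ₁.le
      hΓ₁'.le hs hs₁) (Real.rpow_nonneg (mul_nonneg (Nat.cast_nonneg _) (hsp z)) _)
  · intro z _
    refine (neg_deriv_stCutoff_le x₀ hθ hj0 s z).trans ?_
    refine mul_le_mul_of_nonneg_right ?_ (mul_nonneg (Nat.cast_nonneg _) (htm z))
    have h1 := mul_pow_rpow_le (r := 1) (initialCutoff_nonneg j z.2) (initialCutoff_le_one _ _)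
      (heightCutoff_nonneg (stHeight x₀ θ j z)) (heightCutoff_le_one _) le_rfl hΓ₂.le hΓ₂'.le hs hs₂
    rwa [Real.rpow_one, sub_self, Real.rpow_zero, one_mul] at h1
  · exact (hζm.pow_const _).mul ((hspm.const_mul _).pow_const _)
  · exact (hζm.pow_const _).mul (htmm.const_mul _)
  -- G is integrable: slopes are at most one for j ≥ 1, and Γ₁ > 0 makes G vanish off the compact
  -- support of the cutoff.
  · have h1 : ∫⁻ z, ENNReal.ofReal (stCutoff x₀ θ j s z ^ Γ₁ * (s * spSlope x₀ θ j z) ^ p)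
        ∂(spaceTimeMeasure n a) ≤ ∫⁻ z, (tsupport (stCutoff x₀ θ j s)).indicator
          (fun _ ↦ ENNReal.ofReal ((s : ℝ) ^ p)) z ∂(spaceTimeMeasure n a) := by
      refine lintegral_mono fun z ↦ ?_
      by_cases hz : z ∈ tsupport (stCutoff x₀ θ j s)
      · rw [indicator_of_mem hz]
        refine ENNReal.ofReal_le_ofReal ?_
        have h2 : stCutoff x₀ θ j s z ^ Γ₁ ≤ 1 :=
          Real.rpow_le_one (hζ0 z) (stCutoff_le_one _ _ _ _ z) hΓ₁.le
        have h3 : (s * spSlope x₀ θ j z) ^ p ≤ (s : ℝ) ^ p := by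
          refine Real.rpow_le_rpow (mul_nonneg (Nat.cast_nonneg _) (hsp z)) ?_ (by linarith)
          exact mul_le_of_le_one_right (Nat.cast_nonneg _) (cutoffSlope_le_one hj1)
        calc _ ≤ 1 * (s : ℝ) ^ p := mul_le_mul h2 h3 (Real.rpow_nonneg
              (mul_nonneg (Nat.cast_nonneg _) (hsp z)) _) zero_le_one
          _ = _ := one_mul _
      · rw [indicator_of_notMem hz, image_eq_zero_of_notMem_tsupport hz, Real.zero_rpow hΓ₁.ne',
          zero_mul, ENNReal.ofReal_zero]
    refine (h1.trans_lt ?_).ne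
    rw [lintegral_indicator (isClosed_tsupport _).measurableSet, setLIntegral_const]
    exact ENNReal.mul_lt_top ENNReal.ofReal_lt_top
      (spaceTimeMeasure_lt_top ha.continuous hζ.compact)

end KeyEstimate

/-! ### Hölder's inequality combined with the shell integrals. -/

section ShellFlux

variable {M : Type*} [MetricSpace M] [MeasurableSpace M] [BorelSpace M]
    {μ : Measure M} [SFinite μ] {H : M → ℝ} {x₀ : M}

/-- Hölder's inequality for a weight concentrated on logarithmic shells. -/
theorem lintegral_shell_flux_le {q k σ θ τ r A C N Q : ℝ} {j : ℕ} {ζ g u : M × ℝ → ℝ}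
    {E : Set (M × ℝ)}
    (hHm : AEMeasurable H μ) (hH : ∀ᵐ x ∂μ, 0 < H x)
    (hHm' : AEMeasurable (fun z : M × ℝ ↦ H z.1) ((μ.prod volume).restrict (spaceTime M)))
    (hH' : ∀ᵐ z ∂((μ.prod volume).restrict (spaceTime M)), 0 < H z.1)
    (hζm : AEMeasurable ζ ((μ.prod volume).restrict (spaceTime M)))
    (hgm : AEMeasurable g ((μ.prod volume).restrict (spaceTime M)))
    (hum : AEMeasurable u ((μ.prod volume).restrict (spaceTime M)))
    (hu : ∀ᵐ z ∂((μ.prod volume).restrict (spaceTime M)), 0 ≤ u z)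
    (hζ : ∀ z, 0 ≤ ζ z) (hg : ∀ z, 0 ≤ g z) (hgE : ∀ z ∉ E, g z = 0)
    (hq : 1 < q) (hkq : k < q) (hjk : 1 / (j : ℝ) < k) (hQ : q - 1 / (j : ℝ) ≤ Q) (hQ' : Q ≤ q)
    (hA : 0 ≤ A) (hC : 0 ≤ C) (hj : 1 ≤ j) (hN : 0 ≤ N) (hr1 : 1 ≤ r)
    (hr : σ + θ ≤ τ * (r * (1 + k / (q - k))))
    (hHle : ∀ᵐ x ∂μ, dist x₀ x < Real.exp (2 * j + 1) → H x ≤ Real.exp (N * j))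
    (hball : ∀ i : ℕ, j ≤ i → ∫⁻ x in Metric.ball x₀ (Real.exp (i + 1)),
      ENNReal.ofReal (H x ^ (-(k / (q - k)))) ∂μ
        ≤ ENNReal.ofReal (C * Real.exp (σ * (i + 1)) * ((i : ℝ) + 1) ^ (k / (q - k))))
    (hgs : ∀ z, 0 < z.2 → g z = 0 ∨ ∃ i : ℕ, j ≤ i ∧ i ≤ 2 * j ∧
      dist x₀ z.1 < Real.exp (i + 1) ∧ z.2 ≤ Real.exp (θ * (i + 1)) ∧
      Real.exp (-(N * j)) ≤ g z ∧ g z ≤ A * (Real.exp (-(τ * i)) / j) ^ r) :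
    ∫⁻ z, ENNReal.ofReal (ζ z ^ ((k - 1 / (j : ℝ)) / Q) * g z * u z ^ (k - 1 / (j : ℝ)))
        ∂((μ.prod volume).restrict (spaceTime M))
      ≤ ENNReal.ofReal (max (2 * (Real.exp (2 * N * (1 + k / (q - k)) ^ 2) * A ^ (1 + k / (q - k))
          * C * Real.exp (σ + θ) * 3 ^ (k / (q - k)))) 1 * (j : ℝ) ^ (1 - r))
        * (∫⁻ z in E, ENNReal.ofReal (ζ z * (H z.1 * u z ^ Q))
          ∂((μ.prod volume).restrict (spaceTime M))) ^ ((k - 1 / (j : ℝ)) / Q) := by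
  have hj0 : (0 : ℝ) < j := by exact_mod_cast hj
  have hδ : 0 < 1 / (j : ℝ) := by positivity
  obtain ⟨h1, h2, h3, h4, h5, h6⟩ := interpolation_exponent hq hkq hδ hjk hQ hQ'
  have hβ : 0 ≤ k / (q - k) := div_nonneg (hδ.trans hjk).le (by linarith)
  refine (lintegral_weighted_power_le hζm hgm hHm' hum hζ hg hH' hu h1.le h2 h3 hgE).trans ?_
  rw [mul_comm]
  refine mul_le_mul_left ?_ _
  exact rpow_one_sub_le_of_le hj (by positivity) hr1 h1.le h2 h6
    (lintegral_shell_weight_le x₀ hHm hH hβ hA hC hj hN hr h4 h5 hHle hball hgs)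

/-- Radii are sampled at R = e^(i+1), where log R = i + 1; the growth condition holds there for all
i ≥ j once j is large. -/
theorem eventually_ball_le_of_eventually {F : M → ℝ≥0∞} {C σ β : ℝ}
    (h : ∀ᶠ R : ℝ in atTop, ∫⁻ x in Metric.ball x₀ R, F x ∂μ
      ≤ ENNReal.ofReal (C * R ^ σ * Real.log R ^ β)) :
    ∀ᶠ j : ℕ in atTop, ∀ i : ℕ, j ≤ i → ∫⁻ x in Metric.ball x₀ (Real.exp (i + 1)), F x ∂μ
      ≤ ENNReal.ofReal (C * Real.exp (σ * (i + 1)) * ((i : ℝ) + 1) ^ β) := by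
  have h1 : Tendsto (fun i : ℕ ↦ Real.exp ((i : ℝ) + 1)) atTop atTop :=
    Real.tendsto_exp_atTop.comp (tendsto_atTop_add_const_right _ _ tendsto_natCast_atTop_atTop)
  obtain ⟨j₀, hj₀⟩ := eventually_atTop.1 (h1.eventually h)
  filter_upwards [eventually_ge_atTop j₀] with j hj i hi
  have h2 := hj₀ i (hj.trans hi)
  rwa [Real.log_exp, ← Real.exp_mul, mul_comm ((i : ℝ) + 1)] at h2

theorem mul_one_add_rpow_le_exp {C α N r : ℝ} {j : ℕ} (hC : 0 ≤ C) (hα : 0 ≤ α) (hj : 1 ≤ j)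
    (hN : C + 4 * α ≤ N) (hr : 0 ≤ r) (hrj : r < Real.exp (2 * j + 1)) :
    C * (1 + r) ^ α ≤ Real.exp (N * j) := by
  have hj1 : (1 : ℝ) ≤ j := by exact_mod_cast hj
  have h1 : 1 + r ≤ Real.exp (4 * j) := by
    have h2 : Real.exp (2 * j + 1) ≤ Real.exp (3 * j) := Real.exp_le_exp.2 (by linarith)
    have h3 : 2 ≤ Real.exp j := by linarith [Real.add_one_le_exp (j : ℝ)]
    have h4 : Real.exp (4 * j) = Real.exp j * Real.exp (3 * j) := by rw [← Real.exp_add]; ring_nf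
    have h5 : 1 ≤ Real.exp (3 * j) := Real.one_le_exp (by positivity)
    nlinarith
  have h2 : C ≤ Real.exp (C * j) := by
    refine (by nlinarith : C ≤ C * j).trans ?_
    linarith [Real.add_one_le_exp (C * j)]
  calc C * (1 + r) ^ α ≤ Real.exp (C * j) * Real.exp (4 * j) ^ α := by gcongr
    _ = Real.exp ((C + 4 * α) * j) := by rw [← Real.exp_mul, ← Real.exp_add]; ring_nf
    _ ≤ _ := Real.exp_le_exp.2 (by gcongr)

end ShellFlux

/-! ### The sublinear estimate with constants independent of j. -/

section KeyEstimate

variable {n : ℕ} {M : Type*} [MetricSpace M] [ProperSpace M]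
    [ChartedSpace (EuclideanSpace ℝ (Fin n)) M] [IsManifold (𝓡 n) ∞ M]
    [RiemannianBundle (fun x : M ↦ TangentSpace (𝓡 n) x)]
    [IsContMDiffRiemannianBundle (𝓡 n) ∞ (EuclideanSpace ℝ (Fin n))
      (fun x : M ↦ TangentSpace (𝓡 n) x)] [IsRiemannianManifold (𝓡 n) M]
    [MeasurableSpace M] [BorelSpace M]

variable {p q m K : ℝ} {f : ℝ → ℝ} {a : M → ℝ} {V u : M × ℝ → ℝ}
    {X : ∀ x : M, ℝ → TangentSpace (𝓡 n) x} {w : M × ℝ → ℝ}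

theorem measurable_spSlope (x₀ : M) (θ j : ℝ) : Measurable (spSlope x₀ θ j) :=
  measurable_cutoffSlope ((continuous_logHeight _).measurable.comp measurable_snd)
    (by fun_prop : Continuous fun z : M × ℝ ↦ dist x₀ z.1).measurable

theorem measurable_tmSlope (x₀ : M) (θ j : ℝ) : Measurable (tmSlope x₀ θ j) :=
  measurable_cutoffSlope ((continuous_logHeight _).measurable.comp
    (by fun_prop : Continuous fun z : M × ℝ ↦ dist x₀ z.1).measurable) measurable_snd

/-- The integrals of `ζ h u^(q - 1/j)`, for the logarithmic cutoffs `ζ`, are controlled by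
sublinear powers of integrals over the region where the cutoff is not constant. -/
theorem IsWeakSolutionWith.exists_lintegral_cutoff_le (h : IsWeakSolutionWith n p q m f a V u X w)
    (hp : 1 < p) (hm : 1 ≤ m) (hq : 1 < q) (hkq : p + m - 2 < q) (hK : 0 < K)
    (hf_meas : Measurable f) (hf : ∀ s, 0 ≤ s → 0 ≤ f s ∧ f s ≤ K) (ha : LocallyLipschitz a)
    (hpos : ∀ᵐ x ∂(riemVolume n M), 0 < a x) {H : M → ℝ}
    (hVH : ∀ᵐ z ∂(spaceTimeMeasure n a), H z.1 ≤ V z)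
    (hHm : AEMeasurable H (weightedVolume n a)) (hH : ∀ᵐ x ∂(weightedVolume n a), 0 < H x)
    (hHm' : AEMeasurable (fun z : M × ℝ ↦ H z.1) (spaceTimeMeasure n a))
    (hH' : ∀ᵐ z ∂(spaceTimeMeasure n a), 0 < H z.1)
    (x₀ : M) {C α σ₁ σ₂ θ : ℝ} (hC : 0 < C) (hα : 0 ≤ α)
    (hHle : ∀ᵐ x ∂(weightedVolume n a), H x ≤ C * (1 + dist x₀ x) ^ α)
    (hint₁ : ∀ᶠ R : ℝ in atTop,
      ∫⁻ x in Metric.ball x₀ R, ENNReal.ofReal (H x ^ (-(1 / (q - 1)))) ∂(weightedVolume n a)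
        ≤ ENNReal.ofReal (C * R ^ σ₁ * Real.log R ^ (1 / (q - 1))))
    (hint₂ : ∀ᶠ R : ℝ in atTop,
      ∫⁻ x in Metric.ball x₀ R, ENNReal.ofReal (H x ^ (-((p + m - 2) / (q - (p + m - 2)))))
          ∂(weightedVolume n a)
        ≤ ENNReal.ofReal (C * R ^ σ₂ * Real.log R ^ ((p + m - 2) / (q - (p + m - 2)))))
    (hθ : 0 < θ) (hσ₂ : σ₂ + θ ≤ 1 * (p * (1 + (p + m - 2) / (q - (p + m - 2)))))
    (hσ₁ : σ₁ + θ ≤ θ * (1 * (1 + 1 / (q - 1)))) :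
    ∃ (s : ℕ) (D : ℝ), 2 ≤ s ∧ 0 ≤ D ∧ ∀ᶠ j : ℕ in atTop, ∀ Q : ℝ, q - 1 / (j : ℝ) ≤ Q → Q ≤ q →
      ∫⁻ z, ENNReal.ofReal (stCutoff x₀ θ j s z * (H z.1 * u z ^ (q - 1 / (j : ℝ))))
          ∂(spaceTimeMeasure n a)
        ≤ ENNReal.ofReal D
          * ((∫⁻ z in outerRegion x₀ θ j, ENNReal.ofReal (stCutoff x₀ θ j s z
              * (H z.1 * u z ^ Q)) ∂(spaceTimeMeasure n a)) ^ ((p + m - 2 - 1 / (j : ℝ)) / Q)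
            + (∫⁻ z in outerRegion x₀ θ j, ENNReal.ofReal (stCutoff x₀ θ j s z
              * (H z.1 * u z ^ Q)) ∂(spaceTimeMeasure n a)) ^ ((1 - 1 / (j : ℝ)) / Q)) := by
  have hk : 0 < p + m - 2 := by linarith
  generalize hkdef : p + m - 2 = k at *
  set β₁ := k / (q - k) with hβ₁
  set β₂ := 1 / (q - 1) with hβ₂
  have hβ₁0 : 0 ≤ β₁ := div_nonneg hk.le (by linarith)
  have hβ₂0 : 0 ≤ β₂ := div_nonneg zero_le_one (by linarith)
  -- One power s serves all j, because (1+β)(1-Γ) ≥ 1 for every exponent Γ that occurs.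
  obtain ⟨s, hs⟩ := exists_nat_ge (max (p * (1 + β₁)) (max (1 + β₂) 2))
  have hs1 : p * (1 + β₁) ≤ s := (le_max_left _ _).trans hs
  have hs2 : 1 + β₂ ≤ s := (le_max_left _ _).trans ((le_max_right _ _).trans hs)
  have hs3 : 2 ≤ s := by
    exact_mod_cast (le_max_right (1 + β₂) (2 : ℝ)).trans ((le_max_right _ _).trans hs)
  have hs0 : (1 : ℝ) ≤ s := by exact_mod_cast (by omega : 1 ≤ s)
  -- A single rate for all exponential bounds: 3p for the p-th power of the spatial slope, 1 + 3θ
  -- for the time slope, C + 4α for the upper bound on h.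
  set N := 3 * p + 1 + 3 * θ + C + 4 * α with hN
  have hN0 : 0 ≤ N := by positivity
  set D₁ := max (2 * (Real.exp (2 * N * (1 + β₁) ^ 2) * ((s : ℝ) ^ p) ^ (1 + β₁)
          * C * Real.exp (σ₂ + θ) * 3 ^ β₁)) 1 with hD₁
  set D₂ := max (2 * (Real.exp (2 * N * (1 + β₂) ^ 2) * (s * θ⁻¹) ^ (1 + β₂)
          * C * Real.exp (σ₁ + θ) * 3 ^ β₂)) 1 with hD₂
  have hD₁0 : 0 ≤ D₁ := zero_le_one.trans (le_max_right _ _)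
  have hD₂0 : 0 ≤ D₂ := zero_le_one.trans (le_max_right _ _)
  refine ⟨s, max (K * 2 ^ k * D₁) (2 * D₂), hs3, le_max_of_le_left (by positivity), ?_⟩
  have hsmall : ∀ {c : ℝ}, 0 < c → ∀ᶠ j : ℕ in atTop, 1 / (j : ℝ) < c := fun hc ↦
    tendsto_one_div_atTop_nhds_zero_nat.eventually (gt_mem_nhds hc)
  filter_upwards [eventually_ball_le_of_eventually hint₁, eventually_ball_le_of_eventually hint₂,
    hsmall hk, hsmall (by norm_num : (0 : ℝ) < 1 / 2), eventually_ge_atTop 1]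
    with j hb₁ hb₂ hjk hj2 hj Q hQ hQ'
  have hj0 : (0 : ℝ) < j := by exact_mod_cast hj
  have hj1 : (1 : ℝ) ≤ j := by exact_mod_cast hj
  have hδ : 0 < 1 / (j : ℝ) := by positivity
  have hj11 : 1 / (j : ℝ) < 1 := by linarith
  obtain ⟨g1, g2, -, -, -, g6⟩ := interpolation_exponent hq hkq hδ hjk hQ hQ'
  obtain ⟨g1', g2', -, -, -, g6'⟩ := interpolation_exponent hq hq hδ hj11 hQ hQ'
  have hHe : ∀ᵐ x ∂(weightedVolume n a), dist x₀ x < Real.exp (2 * j + 1)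
      → H x ≤ Real.exp (N * j) := by
    filter_upwards [hHle] with x hx hxj
    exact hx.trans (mul_one_add_rpow_le_exp hC.le hα hj (by linarith) dist_nonneg hxj)
  have hsp0 : ∀ z, 0 ≤ spSlope x₀ θ j z := fun z ↦ cutoffSlope_nonneg hj0 _ _
  have htm0 : ∀ z, 0 ≤ tmSlope x₀ θ j z := fun z ↦ cutoffSlope_nonneg (by positivity) _ _
  have hζ : IsTestFunction (stCutoff x₀ θ j s) := isTestFunction_stCutoff x₀ hθ hj0 (by omega)
  have hζm := hζ.lip.continuous.measurable
  have hum := h.aemeasurable ha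
  have hu0 := h.ae_nonneg ha
  -- The gradient term: decay rate 1 in i and r = p, giving the factor j^(1-p).
  have t1 := lintegral_shell_flux_le (x₀ := x₀) (θ := θ) (τ := 1) (r := p) (A := (s : ℝ) ^ p)
    (g := fun z ↦ (s * spSlope x₀ θ j z) ^ p) (E := outerRegion x₀ θ j) hHm hH hHm' hH'
    hζm.aemeasurable (((measurable_spSlope x₀ θ j).const_mul _).pow_const p).aemeasurable hum hu0
    (stCutoff_nonneg x₀ θ j s)
    (fun z ↦ Real.rpow_nonneg (mul_nonneg (Nat.cast_nonneg _) (hsp0 z)) _)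
    (fun z hz ↦ by
      have : spSlope x₀ θ j z = 0 := by
        by_contra h'
        exact hz (one_le_stHeight_of_spSlope_ne_zero h')
      rw [this, mul_zero, Real.zero_rpow (by linarith)]) hq hkq hjk hQ hQ' (by positivity) hC.le hj
    hN0 hp.le hσ₂ hHe hb₂ (fun z _ ↦ by
      rcases spSlope_shell hθ hj z with h1 | ⟨i, h1, h2, h3, h4, h5, h6⟩
      · left
        rw [h1, mul_zero, Real.zero_rpow (by linarith)]
      · refine Or.inr ⟨i, h1, h2, h3, h4, ?_, ?_⟩
        · calc Real.exp (-(N * j)) ≤ Real.exp (-(3 * j)) ^ p := by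
                rw [← Real.exp_mul]
                refine Real.exp_le_exp.2 ?_
                have : 3 * p * j ≤ N * j := by gcongr; linarith
                linarith
            _ ≤ spSlope x₀ θ j z ^ p := by gcongr
            _ ≤ _ := Real.rpow_le_rpow (hsp0 z) (le_mul_of_one_le_left (hsp0 z) hs0) (by linarith)
        · rw [Real.mul_rpow (Nat.cast_nonneg _) (hsp0 z)]
          gcongr
          exact hsp0 z)
  -- The time term: decay rate θ, r = 1 and k replaced by 1, so that no power of j remains.
  have t2 := lintegral_shell_flux_le (x₀ := x₀) (θ := θ) (τ := θ) (r := 1) (A := (s : ℝ) * θ⁻¹)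
    (g := fun z ↦ s * tmSlope x₀ θ j z) (E := outerRegion x₀ θ j) hHm hH hHm' hH'
    hζm.aemeasurable ((measurable_tmSlope x₀ θ j).const_mul _).aemeasurable hum hu0
    (stCutoff_nonneg x₀ θ j s)
    (fun z ↦ mul_nonneg (Nat.cast_nonneg _) (htm0 z))
    (fun z hz ↦ by
      have : tmSlope x₀ θ j z = 0 := by
        by_contra h'
        exact hz (one_le_stHeight_of_tmSlope_ne_zero h')
      rw [this, mul_zero]) hq hq hj11 hQ hQ' (by positivity) hC.le hj
    hN0 le_rfl hσ₁ hHe hb₁ (fun z _ ↦ by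
      rcases tmSlope_shell hθ hj z with h1 | ⟨i, h1, h2, h3, h4, h5, h6⟩
      · left
        rw [h1, mul_zero]
      · refine Or.inr ⟨i, h1, h2, h3, h4, ?_, ?_⟩
        · calc Real.exp (-(N * j)) ≤ Real.exp (-((1 + 3 * θ) * j)) := by
                refine Real.exp_le_exp.2 (neg_le_neg ?_)
                gcongr
                linarith
            _ ≤ tmSlope x₀ θ j z := h5
            _ ≤ _ := le_mul_of_one_le_left (htm0 z) hs0
        · rw [Real.rpow_one, mul_assoc]
          gcongr)
  rw [sub_self, Real.rpow_zero, mul_one] at t2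
  have hmain := h.lintegral_cutoff_le hp hm hf_meas hf ha hpos hVH hH' hHm' x₀ hθ hj hj2.le
    (by rwa [hkdef]) (by linarith) hs3 g1 g2 ?_ g1' g2' ?_
  · rw [hkdef] at hmain
    refine hmain.trans ?_
    rw [mul_add]
    refine add_le_add ?_ ?_
    · refine (mul_le_mul_right t1 _).trans ?_
      rw [← mul_assoc, ← ENNReal.ofReal_mul (by positivity)]
      -- Here δ^(1-p) = j^(p-1) cancels the gain j^(1-p) of the logarithmic cutoff exactly.
      refine mul_le_mul_left (ENNReal.ofReal_le_ofReal (le_max_of_le_left (le_of_eq ?_))) _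
      rw [one_div, Real.inv_rpow hj0.le, ← hD₁]
      have : (j : ℝ) ^ (1 - p) ≠ 0 := (Real.rpow_pos_of_pos hj0 _).ne'
      field_simp
    · refine (mul_le_mul_right t2 _).trans ?_
      rw [← mul_assoc, ← ENNReal.ofReal_ofNat 2, ← ENNReal.ofReal_mul (by positivity)]
      exact mul_le_mul_left (ENNReal.ofReal_le_ofReal (le_max_right _ _)) _
  · calc p = p * 1 := (mul_one p).symm
      _ ≤ p * ((1 + β₁) * (1 - (k - 1 / (j : ℝ)) / Q)) := by gcongr
      _ = (p * (1 + β₁)) * (1 - (k - 1 / (j : ℝ)) / Q) := by ring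
      _ ≤ _ := mul_le_mul_of_nonneg_right hs1 (by linarith)
  · exact g6'.trans (mul_le_mul_of_nonneg_right hs2 (by linarith))

end KeyEstimate

/-! ### From the sublinear estimate to vanishing. -/

section Absorption

/-- If Z > 1, both powers are at most Z^g, whence Z^(1-g) ≤ 2D. Finiteness must be known beforehand
to divide by Z^g. -/
theorem le_of_le_mul_rpow_add_rpow {Z : ℝ≥0∞} {D Γ₁ Γ₂ g : ℝ} (hZ : Z < ⊤) (hD : 0 ≤ D)
    (h1 : Γ₁ ≤ g) (h2 : Γ₂ ≤ g) (hg : g < 1)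
    (h : Z ≤ ENNReal.ofReal D * (Z ^ Γ₁ + Z ^ Γ₂)) :
    Z ≤ ENNReal.ofReal (max 1 ((2 * D) ^ (1 / (1 - g)))) := by
  rcases le_or_gt Z 1 with hZ1 | hZ1
  · refine hZ1.trans ?_
    rw [← ENNReal.ofReal_one]
    exact ENNReal.ofReal_le_ofReal (le_max_left _ _)
  lift Z to NNReal using hZ.ne
  have hz1 : (1 : ℝ) < Z := by exact_mod_cast hZ1
  have hz0 : (0 : ℝ) < Z := zero_lt_one.trans hz1
  rw [← ENNReal.ofReal_coe_nnreal, ENNReal.ofReal_rpow_of_pos hz0, ENNReal.ofReal_rpow_of_pos hz0,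
    ← ENNReal.ofReal_add (by positivity) (by positivity), ← ENNReal.ofReal_mul hD,
    ENNReal.ofReal_le_ofReal_iff (by positivity)] at h
  rw [← ENNReal.ofReal_coe_nnreal]
  refine ENNReal.ofReal_le_ofReal (le_max_of_le_right ?_)
  have h3 : (Z : ℝ) ≤ (2 * D) * (Z : ℝ) ^ g := by
    refine h.trans ?_
    have e1 := Real.rpow_le_rpow_of_exponent_le hz1.le h1
    have e2 := Real.rpow_le_rpow_of_exponent_le hz1.le h2
    nlinarith
  have h4 : (Z : ℝ) ^ (1 - g) ≤ 2 * D := by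
    rw [Real.rpow_sub hz0, Real.rpow_one, div_le_iff₀ (Real.rpow_pos_of_pos hz0 _)]
    exact h3
  calc (Z : ℝ) = ((Z : ℝ) ^ (1 - g)) ^ (1 / (1 - g)) := by
        rw [← Real.rpow_mul hz0.le, mul_one_div_cancel (by linarith), Real.rpow_one]
    _ ≤ _ := Real.rpow_le_rpow (by positivity) h4 (one_div_nonneg.2 (by linarith))

variable {Y : Type*} [MeasurableSpace Y] {ρ : Measure Y} {H u : Y → ℝ} {ζ : ℕ → Y → ℝ}

theorem lintegral_le_liminf_cutoff (hHm : AEMeasurable H ρ) (hum : AEMeasurable u ρ)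
    (hζm : ∀ j, AEMeasurable (ζ j) ρ) (hζ : ∀ᵐ z ∂ρ, Tendsto (fun j ↦ ζ j z) atTop (𝓝 1))
    {q : ℝ} (hq : q ≠ 0) :
    ∫⁻ z, ENNReal.ofReal (H z * u z ^ q) ∂ρ
      ≤ liminf (fun j : ℕ ↦ ∫⁻ z, ENNReal.ofReal (ζ j z * (H z * u z ^ (q - 1 / (j : ℝ)))) ∂ρ)
        atTop := by
  refine le_trans (le_of_eq ?_) (lintegral_liminf_le' fun j ↦
    ((hζm j).mul (hHm.mul (hum.pow_const _))).ennreal_ofReal)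
  refine lintegral_congr_ae ?_
  filter_upwards [hζ] with z hz
  refine (Tendsto.liminf_eq ?_).symm
  refine ENNReal.tendsto_ofReal ?_
  have h1 : Tendsto (fun j : ℕ ↦ q - 1 / (j : ℝ)) atTop (𝓝 q) := by
    simpa using tendsto_const_nhds.sub (tendsto_one_div_atTop_nhds_zero_nat (𝕜 := ℝ))
  have h2 : Tendsto (fun j : ℕ ↦ u z ^ (q - 1 / (j : ℝ))) atTop (𝓝 (u z ^ q)) :=
    (Real.continuousAt_const_rpow' hq).tendsto.comp h1
  simpa using hz.mul (h2.const_mul (H z))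

/-- If the integrals of `ζⱼ h u^(q - 1/j)` are controlled by sublinear powers of integrals over
sets which shrink to the empty set, then `u` vanishes. -/
theorem ae_eq_zero_of_sublinear_bound (hHm : AEMeasurable H ρ) (hum : AEMeasurable u ρ)
    (hH : ∀ᵐ z ∂ρ, 0 < H z) (hu : ∀ᵐ z ∂ρ, 0 ≤ u z)
    (hζm : ∀ j, AEMeasurable (ζ j) ρ) (hζ : ∀ᵐ z ∂ρ, Tendsto (fun j ↦ ζ j z) atTop (𝓝 1))
    (hζ1 : ∀ j z, ζ j z ≤ 1) {E : ℕ → Set Y} (hEm : ∀ j, MeasurableSet (E j))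
    (hE : ∀ z, ∀ᶠ j in atTop, z ∉ E j) {q k D : ℝ} (hq : 1 < q) (hk : 0 < k) (hkq : k < q)
    (hD : 0 ≤ D)
    (hfin : ∀ᶠ j : ℕ in atTop,
      ∫⁻ z, ENNReal.ofReal (ζ j z * (H z * u z ^ (q - 1 / (j : ℝ)))) ∂ρ < ⊤)
    (hkey : ∀ᶠ j : ℕ in atTop, ∀ Q : ℝ, q - 1 / (j : ℝ) ≤ Q → Q ≤ q →
      ∫⁻ z, ENNReal.ofReal (ζ j z * (H z * u z ^ (q - 1 / (j : ℝ)))) ∂ρ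
        ≤ ENNReal.ofReal D
          * ((∫⁻ z in E j, ENNReal.ofReal (ζ j z * (H z * u z ^ Q)) ∂ρ) ^ ((k - 1 / (j : ℝ)) / Q)
          + (∫⁻ z in E j, ENNReal.ofReal (ζ j z * (H z * u z ^ Q)) ∂ρ) ^ ((1 - 1 / (j : ℝ)) / Q))) :
    ∀ᵐ z ∂ρ, u z = 0 := by
  have hq0 : 0 < q := by linarith
  have hFatou := lintegral_le_liminf_cutoff hHm hum hζm hζ hq0.ne'
  have hsmall : ∀ {c : ℝ}, 0 < c → ∀ᶠ j : ℕ in atTop, 1 / (j : ℝ) < c := fun hc ↦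
    tendsto_one_div_atTop_nhds_zero_nat.eventually (gt_mem_nhds hc)
  have hmk : 0 < min k 1 := lt_min hk one_pos
  have hexp : ∀ {k' δ : ℝ}, 0 ≤ δ → δ < k' → k' < q → (k' - δ) / (q - δ) ≤ k' / q := by
    intro k' δ h1 h2 h3
    rw [div_le_div_iff₀ (by linarith) hq0]
    nlinarith
  -- First pass, Q = q - 1/j: enlarging the outer region to the whole space puts the same integral
  -- on both sides, so it is bounded uniformly in j and Fatou applies.
  have hfinite : ∫⁻ z, ENNReal.ofReal (H z * u z ^ q) ∂ρ < ⊤ := by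
    refine hFatou.trans_lt (lt_of_le_of_lt (liminf_le_of_frequently_le' (Eventually.frequently ?_))
      (ENNReal.ofReal_lt_top (r := max 1 ((2 * D) ^ (1 / (1 - max k 1 / q))))))
    filter_upwards [hfin, hkey, hsmall hmk, eventually_ge_atTop 1] with j h1 h2 h3 h4
    have hj0 : (0 : ℝ) < j := by exact_mod_cast h4
    have hδ : 0 < 1 / (j : ℝ) := by positivity
    have hδk := h3.trans_le (min_le_left _ _)
    have hδ1 := h3.trans_le (min_le_right _ _)
    have e1 : 0 ≤ (k - 1 / (j : ℝ)) / (q - 1 / j) := div_nonneg (by linarith) (by linarith)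
    have e2 : 0 ≤ (1 - 1 / (j : ℝ)) / (q - 1 / j) := div_nonneg (by linarith) (by linarith)
    refine le_of_le_mul_rpow_add_rpow h1 hD (Γ₁ := (k - 1 / (j : ℝ)) / (q - 1 / j))
      (Γ₂ := (1 - 1 / (j : ℝ)) / (q - 1 / j)) ?_ ?_ ?_ ?_
    · refine (hexp hδ.le hδk hkq).trans ?_
      gcongr
      exact le_max_left _ _
    · refine (hexp hδ.le hδ1 hq).trans ?_
      gcongr
      exact le_max_right _ _
    · rw [div_lt_one hq0]
      exact max_lt hkq hq
    · refine (h2 _ le_rfl (by linarith)).trans ?_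
      gcongr <;> exact Measure.restrict_le_self
  have hfm : AEMeasurable (fun z ↦ ENNReal.ofReal (H z * u z ^ q)) ρ :=
    (hHm.mul (hum.pow_const _)).ennreal_ofReal
  have hW : Tendsto (fun j ↦ ∫⁻ z in E j, ENNReal.ofReal (H z * u z ^ q) ∂ρ) atTop (𝓝 0) := by
    have h1 := tendsto_lintegral_of_dominated_convergence'
      (F := fun (j : ℕ) z ↦ (E j).indicator (fun z ↦ ENNReal.ofReal (H z * u z ^ q)) z)
      (f := fun _ ↦ 0) (μ := ρ) (fun z ↦ ENNReal.ofReal (H z * u z ^ q))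
      (fun j ↦ hfm.indicator (hEm j))
      (fun j ↦ Eventually.of_forall fun z ↦ indicator_le_self' (fun _ _ ↦ zero_le) z) hfinite.ne
      (Eventually.of_forall fun z ↦ tendsto_nhds_of_eventually_eq (by
        filter_upwards [hE z] with j hj
        exact indicator_of_notMem hj _))
    rw [lintegral_zero] at h1
    refine h1.congr fun j ↦ ?_
    rw [lintegral_indicator (hEm j)]
  -- A common lower bound for the exponents (k - 1/j)/q and (1 - 1/j)/q at large j. Once the tail
  -- integral is below one, its c-th power dominates both.
  set c := min k 1 / (2 * q) with hc
  have hc0 : 0 < c := by positivity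
  -- Second pass, Q = q: the right-hand side involves only tails of the integral just shown to be
  -- finite, so the left-hand side tends to zero.
  have hZ : Tendsto (fun j : ℕ ↦ ∫⁻ z, ENNReal.ofReal (ζ j z * (H z * u z ^ (q - 1 / (j : ℝ)))) ∂ρ)
      atTop (𝓝 0) := by
    have h1 : Tendsto (fun j ↦ ENNReal.ofReal D
        * ((∫⁻ z in E j, ENNReal.ofReal (H z * u z ^ q) ∂ρ) ^ c
          + (∫⁻ z in E j, ENNReal.ofReal (H z * u z ^ q) ∂ρ) ^ c)) atTop (𝓝 0) := by
      have h2 := (ENNReal.continuous_rpow_const (y := c)).tendsto 0 |>.comp hW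
      rw [ENNReal.zero_rpow_of_pos hc0] at h2
      simpa using ENNReal.Tendsto.const_mul (h2.add h2) (Or.inr ENNReal.ofReal_ne_top)
        (a := ENNReal.ofReal D)
    refine tendsto_of_tendsto_of_tendsto_of_le_of_le' tendsto_const_nhds h1
      (Eventually.of_forall fun _ ↦ zero_le) ?_
    filter_upwards [hkey, hsmall (half_pos hmk), eventually_ge_atTop 1,
      hW.eventually (gt_mem_nhds one_pos)] with j h2 h3 h4 h5
    have hj0 : (0 : ℝ) < j := by exact_mod_cast h4
    have hδ : 0 < 1 / (j : ℝ) := by positivity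
    have hmin1 := min_le_left k 1
    have hmin2 := min_le_right k 1
    have hle : ∫⁻ z in E j, ENNReal.ofReal (ζ j z * (H z * u z ^ q)) ∂ρ
        ≤ ∫⁻ z in E j, ENNReal.ofReal (H z * u z ^ q) ∂ρ := by
      refine lintegral_mono_ae (ae_restrict_of_ae ?_)
      filter_upwards [hH, hu] with z hz1 hz2
      exact ENNReal.ofReal_le_ofReal (mul_le_of_le_one_left (by positivity) (hζ1 j z))
    have hpow : ∀ {Γ : ℝ}, c ≤ Γ → (∫⁻ z in E j, ENNReal.ofReal (ζ j z * (H z * u z ^ q)) ∂ρ) ^ Γ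
        ≤ (∫⁻ z in E j, ENNReal.ofReal (H z * u z ^ q) ∂ρ) ^ c := fun {Γ} hΓ ↦
      (ENNReal.rpow_le_rpow hle (hc0.le.trans hΓ)).trans
        (ENNReal.rpow_le_rpow_of_exponent_ge h5.le hΓ)
    refine (h2 q (by linarith) le_rfl).trans (mul_le_mul_right (add_le_add (hpow ?_) (hpow ?_)) _)
    · rw [hc, div_le_div_iff₀ (by positivity) hq0]; nlinarith
    · rw [hc, div_le_div_iff₀ (by positivity) hq0]; nlinarith
  rw [hZ.liminf_eq, nonpos_iff_eq_zero, lintegral_eq_zero_iff' hfm] at hFatou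
  filter_upwards [hFatou, hH, hu] with z h1 h2 h3
  by_contra h4
  have h5 : 0 < u z := h3.lt_of_ne (Ne.symm h4)
  have h6 : 0 < H z * u z ^ q := by positivity
  exact absurd (ENNReal.ofReal_eq_zero.1 h1) (not_le.2 h6)

end Absorption

/-! ### Exhaustion by the cutoffs, a priori finiteness and the conclusion. -/

section Conclusion

theorem tendsto_logHeight {v : ℝ} : Tendsto (fun c ↦ logHeight c v) atTop (𝓝 0) :=
  tendsto_const_nhds.div_atTop tendsto_id

theorem tendsto_stHeight {M : Type*} [MetricSpace M] (x₀ : M) {θ : ℝ} (hθ : 0 < θ) (z : M × ℝ) :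
    Tendsto (fun j : ℕ ↦ stHeight x₀ θ j z) atTop (𝓝 0) := by
  have h1 := (tendsto_logHeight (v := dist x₀ z.1)).comp (tendsto_natCast_atTop_atTop (R := ℝ))
  have h2 := (tendsto_logHeight (v := z.2)).comp
    ((tendsto_natCast_atTop_atTop (R := ℝ)).const_mul_atTop hθ)
  simpa [stHeight, Function.comp_def] using h1.max h2

theorem eventually_notMem_outerRegion {M : Type*} [MetricSpace M] (x₀ : M) {θ : ℝ} (hθ : 0 < θ)
    (z : M × ℝ) : ∀ᶠ j : ℕ in atTop, z ∉ outerRegion x₀ θ j := by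
  filter_upwards [(tendsto_stHeight x₀ hθ z).eventually (gt_mem_nhds one_pos)] with j hj
  exact not_le.2 hj

theorem tendsto_stCutoff {M : Type*} [MetricSpace M] (x₀ : M) {θ : ℝ} (hθ : 0 < θ) (s : ℕ)
    {z : M × ℝ} (hz : 0 < z.2) : Tendsto (fun j : ℕ ↦ stCutoff x₀ θ j s z) atTop (𝓝 1) := by
  refine tendsto_nhds_of_eventually_eq ?_
  filter_upwards [(tendsto_stHeight x₀ hθ z).eventually (gt_mem_nhds one_pos),
    ((tendsto_natCast_atTop_atTop (R := ℝ)).atTop_mul_const hz).eventually_ge_atTop 2]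
    with j h1 h2
  rw [stCutoff, heightCutoff_of_le_one h1.le, one_pow, mul_one, initialCutoff,
    min_eq_left (by linarith), max_eq_right zero_le_one]

variable {n : ℕ} {M : Type*} [MetricSpace M] [ProperSpace M]
    [ChartedSpace (EuclideanSpace ℝ (Fin n)) M] [IsManifold (𝓡 n) ∞ M]
    [RiemannianBundle (fun x : M ↦ TangentSpace (𝓡 n) x)]
    [IsContMDiffRiemannianBundle (𝓡 n) ∞ (EuclideanSpace ℝ (Fin n))
      (fun x : M ↦ TangentSpace (𝓡 n) x)] [IsRiemannianManifold (𝓡 n) M]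
    [MeasurableSpace M] [BorelSpace M]

variable {p q m K : ℝ} {f : ℝ → ℝ} {a : M → ℝ} {V u : M × ℝ → ℝ}
    {X : ∀ x : M, ℝ → TangentSpace (𝓡 n) x} {w : M × ℝ → ℝ}

/-- By u^(q-δ) ≤ 1 + u^q: the constant part is controlled by the continuous bound for h, the other
by the local integrability of V u^q. This supplies the finiteness needed for absorption. -/
theorem IsWeakSolutionWith.lintegral_cutoff_lt_top (h : IsWeakSolutionWith n p q m f a V u X w)
    (ha : LocallyLipschitz a) {H : M → ℝ}
    (hVH : ∀ᵐ z ∂(spaceTimeMeasure n a), H z.1 ≤ V z)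
    (hH : ∀ᵐ z ∂(spaceTimeMeasure n a), 0 < H z.1) {B : M → ℝ} (hB : Continuous B)
    (hHB : ∀ᵐ z ∂(spaceTimeMeasure n a), H z.1 ≤ B z.1)
    {ζ : M × ℝ → ℝ} (hζ : IsTestFunction ζ) (hζ1 : ∀ z, ζ z ≤ 1) {δ : ℝ} (hδ : 0 ≤ δ)
    (hδq : δ ≤ q) :
    ∫⁻ z, ENNReal.ofReal (ζ z * (H z.1 * u z ^ (q - δ))) ∂(spaceTimeMeasure n a) < ⊤ := by
  have := isLocallyFiniteMeasure_weightedVolume (n := n) ha.continuous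
  have : IsLocallyFiniteMeasure (spaceTimeMeasure n a) := by
    unfold spaceTimeMeasure; infer_instance
  have h1 : Integrable (fun z : M × ℝ ↦ ζ z * B z.1) (spaceTimeMeasure n a) :=
    (hζ.lip.continuous.mul (hB.comp continuous_fst)).integrable_of_hasCompactSupport
      hζ.compact.mul_right
  have h2 : IntegrableOn (fun z ↦ u z ^ q * V z) (tsupport ζ) (spaceTimeMeasure n a) :=
    (h.reaction.integrableOn_compact_subset hζ.supp hζ.compact).mono_measure
      Measure.restrict_le_self
  calc _ ≤ ∫⁻ z, ENNReal.ofReal (ζ z * B z.1)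
        + (tsupport ζ).indicator (fun z ↦ ‖u z ^ q * V z‖ₑ) z ∂(spaceTimeMeasure n a) := by
        refine lintegral_mono_ae ?_
        filter_upwards [hVH, hH, hHB, h.ae_nonneg ha] with z e1 e2 e3 e4
        have e5 : u z ^ (q - δ) ≤ 1 + u z ^ q := by
          rcases le_total (u z) 1 with e | e
          · linarith [Real.rpow_le_one e4 e (by linarith : 0 ≤ q - δ), Real.rpow_nonneg e4 q]
          · linarith [Real.rpow_le_rpow_of_exponent_le e (by linarith : q - δ ≤ q)]
        by_cases hz : z ∈ tsupport ζ
        · rw [indicator_of_mem hz, Real.enorm_eq_ofReal_abs]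
          refine (ENNReal.ofReal_le_ofReal ?_).trans ENNReal.ofReal_add_le
          have e6 : ζ z * (H z.1 * u z ^ (q - δ)) ≤ ζ z * (H z.1 * (1 + u z ^ q)) := by
            have := hζ.nonneg z
            gcongr
          have e7 : ζ z * (H z.1 * u z ^ q) ≤ u z ^ q * V z := by
            calc _ ≤ H z.1 * u z ^ q := mul_le_of_le_one_left (by positivity) (hζ1 z)
              _ ≤ V z * u z ^ q := by gcongr
              _ = _ := mul_comm _ _
          have e8 := mul_le_mul_of_nonneg_left e3 (hζ.nonneg z)
          linarith [le_abs_self (u z ^ q * V z)]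
        · rw [image_eq_zero_of_notMem_tsupport hz, zero_mul, ENNReal.ofReal_zero]
          exact zero_le
    _ = ∫⁻ z, ENNReal.ofReal (ζ z * B z.1) ∂(spaceTimeMeasure n a)
        + ∫⁻ z in tsupport ζ, ‖u z ^ q * V z‖ₑ ∂(spaceTimeMeasure n a) := by
        rw [lintegral_add_left (show Measurable fun z : M × ℝ ↦ ENNReal.ofReal (ζ z * B z.1) from
          (hζ.lip.continuous.mul (hB.comp continuous_fst)).measurable.ennreal_ofReal),
          lintegral_indicator (isClosed_tsupport _).measurableSet]
    _ < ⊤ := ENNReal.add_lt_top.2 ⟨h1.lintegral_lt_top, h2.2⟩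

theorem ae_of_ae_spaceTimeMeasure {a : M → ℝ} (ha : Continuous a)
    (hpos : ∀ᵐ x ∂(riemVolume n M), 0 < a x) {P : M × ℝ → Prop}
    (h : ∀ᵐ z ∂(spaceTimeMeasure n a), P z) :
    ∀ᵐ z ∂(((riemVolume n M).prod volume).restrict (spaceTime M)), P z := by
  have hS : MeasurableSet (spaceTime M) := isOpen_spaceTime.measurableSet
  rw [spaceTimeMeasure, weightedVolume_prod ha, restrict_withDensity hS,
    ae_withDensity_iff (by fun_prop)] at h
  filter_upwards [h, ae_restrict_of_ae (ae_prod_weight_pos hpos)] with z h1 h2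
  exact h1 (ENNReal.ofReal_pos.2 h2).ne'

/-- Weak solutions vanish under the critical volume growth. -/
theorem IsWeakSolutionWith.ae_eq_zero (h : IsWeakSolutionWith n p q m f a V u X w)
    (hp : 1 < p) (hm : 1 ≤ m) (hq : 1 < q) (hkq : p + m - 2 < q) (hK : 0 < K)
    (hf_meas : Measurable f) (hf : ∀ s, 0 ≤ s → 0 ≤ f s ∧ f s ≤ K) (ha : LocallyLipschitz a)
    (hpos : ∀ᵐ x ∂(riemVolume n M), 0 < a x) {H : M → ℝ}
    (hHm : AEMeasurable H (riemVolume n M))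
    (hVH : ∀ᵐ z ∂(((riemVolume n M).prod volume).restrict (spaceTime M)), H z.1 ≤ V z)
    (x₀ : M) {C α σ₁ σ₂ θ : ℝ} (hC : 0 < C) (hα : 0 ≤ α)
    (hH : ∀ᵐ x ∂(riemVolume n M), 0 < H x)
    (hHle : ∀ᵐ x ∂(riemVolume n M), H x ≤ C * (1 + dist x₀ x) ^ α)
    (hint₁ : ∀ᶠ R : ℝ in atTop,
      ∫⁻ x in Metric.ball x₀ R, ENNReal.ofReal (H x ^ (-(1 / (q - 1)))) ∂(weightedVolume n a)
        ≤ ENNReal.ofReal (C * R ^ σ₁ * Real.log R ^ (1 / (q - 1))))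
    (hint₂ : ∀ᶠ R : ℝ in atTop,
      ∫⁻ x in Metric.ball x₀ R, ENNReal.ofReal (H x ^ (-((p + m - 2) / (q - (p + m - 2)))))
          ∂(weightedVolume n a)
        ≤ ENNReal.ofReal (C * R ^ σ₂ * Real.log R ^ ((p + m - 2) / (q - (p + m - 2)))))
    (hθ : 0 < θ) (hσ₂ : σ₂ + θ ≤ 1 * (p * (1 + (p + m - 2) / (q - (p + m - 2)))))
    (hσ₁ : σ₁ + θ ≤ θ * (1 * (1 + 1 / (q - 1)))) :
    ∀ᵐ z ∂(((riemVolume n M).prod volume).restrict (spaceTime M)), u z = 0 := by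
  have hac : weightedVolume n a ≪ riemVolume n M := withDensity_absolutelyContinuous _ _
  have hfst : ∀ {P : M → Prop}, (∀ᵐ x ∂(weightedVolume n a), P x) →
      ∀ᵐ z ∂(spaceTimeMeasure n a), P z.1 := fun hP ↦
    ae_restrict_of_ae (Measure.quasiMeasurePreserving_fst.ae hP)
  have hVH' : ∀ᵐ z ∂(spaceTimeMeasure n a), H z.1 ≤ V z :=
    (absolutelyContinuous_weightedVolume n ha.continuous).ae_le hVH
  have hHm₁ : AEMeasurable H (weightedVolume n a) := hHm.mono_ac hac
  have hH₁ := hac.ae_le hH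
  have hHle₁ := hac.ae_le hHle
  have hHm₂ : AEMeasurable (fun z : M × ℝ ↦ H z.1) (spaceTimeMeasure n a) :=
    (hHm₁.comp_quasiMeasurePreserving Measure.quasiMeasurePreserving_fst).mono_measure
      Measure.restrict_le_self
  obtain ⟨s, D, hs, hD, hkey⟩ := h.exists_lintegral_cutoff_le hp hm hq hkq hK hf_meas hf ha hpos
    hVH' hHm₁ hH₁ hHm₂ (hfst hH₁) x₀ hC hα hHle₁ hint₁ hint₂ hθ hσ₂ hσ₁
  refine ae_of_ae_spaceTimeMeasure ha.continuous hpos ?_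
  refine ae_eq_zero_of_sublinear_bound (ζ := fun j ↦ stCutoff x₀ θ j s)
    (E := fun j ↦ outerRegion x₀ θ j) hHm₂ (h.aemeasurable ha) (hfst hH₁) (h.ae_nonneg ha)
    (fun j ↦ (locallyLipschitz_stCutoff x₀ θ j s).continuous.measurable.aemeasurable) ?_
    (fun j z ↦ stCutoff_le_one x₀ θ j s z) (fun j ↦ measurableSet_outerRegion x₀ θ j)
    (eventually_notMem_outerRegion x₀ hθ) hq (by linarith : 0 < p + m - 2) hkq hD ?_ hkey
  · filter_upwards [ae_restrict_mem (isOpen_spaceTime (M := M)).measurableSet] with z hz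
    exact tendsto_stCutoff x₀ hθ s hz.2
  · filter_upwards [eventually_ge_atTop 1] with j hj
    have hj1 : (1 : ℝ) ≤ j := by exact_mod_cast hj
    have hj0 : (0 : ℝ) < j := zero_lt_one.trans_le hj1
    have hB : Continuous fun x : M ↦ C * (1 + dist x₀ x) ^ α :=
      continuous_const.mul ((by fun_prop : Continuous fun x : M ↦ 1 + dist x₀ x).rpow_const
        fun x ↦ Or.inr hα)
    exact h.lintegral_cutoff_lt_top ha hVH' (hfst hH₁) hB (hfst hHle₁)
      (isTestFunction_stCutoff x₀ hθ hj0 (by omega)) (stCutoff_le_one x₀ θ j s)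
      (by positivity) (by have : 1 / (j : ℝ) ≤ 1 := (div_le_one hj0).2 hj1
                          linarith)

end Conclusion

end RiemParabolic

end

theorem mainTheorem7 {n : ℕ} {M : Type*} [MetricSpace M]
    [ChartedSpace (EuclideanSpace ℝ (Fin n)) M] [IsManifold (𝓡 n) ∞ M]
    [RiemannianBundle (fun x : M ↦ TangentSpace (𝓡 n) x)]
    [IsContMDiffRiemannianBundle (𝓡 n) ∞ (EuclideanSpace ℝ (Fin n))
      (fun x : M ↦ TangentSpace (𝓡 n) x)]
    [IsRiemannianManifold (𝓡 n) M] [CompleteSpace M] [NoncompactSpace M]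
    [MeasurableSpace M] [BorelSpace M]
    (x₀ : M) (p q m K : ℝ) (hp : 1 < p) (hm : 1 ≤ m) (hq : max (p + m - 2) 1 < q) (hK : 0 < K)
    (f : ℝ → ℝ) (hf_meas : Measurable f) (hf : ∀ s, 0 ≤ s → 0 ≤ f s ∧ f s ≤ K)
    (a : M → ℝ) (ha_lip : LocallyLipschitz a)
    (ha_pos : ∀ᵐ x ∂(RiemParabolic.riemVolume n M), 0 < a x)
    (V : M × ℝ → ℝ)
    (hV_int : LocallyIntegrableOn V (RiemParabolic.spaceTime M)
      ((RiemParabolic.riemVolume n M).prod volume))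
    (h : M → ℝ) (hh_meas : AEMeasurable h (RiemParabolic.riemVolume n M))
    (hVh : ∀ᵐ z ∂(((RiemParabolic.riemVolume n M).prod volume).restrict
      (RiemParabolic.spaceTime M)), h z.1 ≤ V z)
    (C α σ₁ σ₂ : ℝ) (hC : 0 < C) (hα : 0 ≤ α) (hσ₁ : 0 ≤ σ₁) (hσ₂ : 0 ≤ σ₂)
    (hh : ∀ᵐ x ∂(RiemParabolic.riemVolume n M),
      C⁻¹ * (1 + dist x₀ x) ^ (-α) ≤ h x ∧ h x ≤ C * (1 + dist x₀ x) ^ α)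
    (hint₁ : ∀ᶠ R : ℝ in atTop,
      ∫⁻ x in Metric.ball x₀ R, ENNReal.ofReal (h x ^ (-(1 / (q - 1))))
          ∂(RiemParabolic.weightedVolume n a)
        ≤ ENNReal.ofReal (C * R ^ σ₁ * Real.log R ^ (1 / (q - 1))))
    (hint₂ : ∀ᶠ R : ℝ in atTop,
      ∫⁻ x in Metric.ball x₀ R, ENNReal.ofReal (h x ^ (-((p + m - 2) / (q - p - m + 2))))
          ∂(RiemParabolic.weightedVolume n a)
        ≤ ENNReal.ofReal (C * R ^ σ₂ * Real.log R ^ ((p + m - 2) / (q - p - m + 2))))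
    (hσ₂_lt : σ₂ < p * q / (q - p - m + 2))
    (hσ₁_le : σ₁ ≤ 1 / (q - 1) * (p * q / (q - p - m + 2) - σ₂)) :
    ∀ u : M × ℝ → ℝ, RiemParabolic.IsWeakSolution n p q m f a V u →
      ∀ᵐ z ∂(((RiemParabolic.riemVolume n M).prod volume).restrict
        (RiemParabolic.spaceTime M)), u z = 0 := by
  have : ProperSpace M := RiemParabolic.properSpace_of_completeSpace n M
  intro u hu
  obtain ⟨X, w, hw⟩ := hu.exists_with
  have hq1 : 1 < q := (le_max_right _ _).trans_lt hq
  have hkq : p + m - 2 < q := (le_max_left _ _).trans_lt hq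
  have e : q - p - m + 2 = q - (p + m - 2) := by ring
  rw [e] at hσ₂_lt hσ₁_le
  simp only [e] at hint₂
  have hqk : 0 < q - (p + m - 2) := by linarith
  have e2 : p * (1 + (p + m - 2) / (q - (p + m - 2))) = p * q / (q - (p + m - 2)) := by
    field_simp
    ring
  -- The positivity proof fixes θ = pq/(q - k) - σ₂, the scaling t ≈ r^θ. The condition on σ₂ then
  -- holds with equality, and the one on σ₁ becomes σ₁ ≤ θ/(q - 1).
  refine hw.ae_eq_zero hp hm hq1 hkq hK hf_meas hf ha_lip ha_pos hh_meas hVh x₀ hC hα ?_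
    (hh.mono fun x hx ↦ hx.2) hint₁ hint₂ (sub_pos.2 hσ₂_lt) ?_ ?_
  · filter_upwards [hh] with x hx
    have : 0 < 1 + dist x₀ x := by positivity
    exact lt_of_lt_of_le (by positivity) hx.1
  · rw [e2]
    linarith
  · linarith
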